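/- Let $d\ge 2$ and $0<\theta<1$. \emph{Lipschitz domains.} A Lipschitz graph domain in $\mathbb{R}^d$ with constant at most $M$ is a set $\{(x',t):x'\in\mathbb{R}^{d-1},\ t>\psi(x')\}$, in some orthonormal coordinate system, with $\psi$ Lipschitz with constant at most $M$. A connected open set $\Omega\subset\mathbb{R}^d$ is a Lipschitz domain of character $(M,N,c_0)$ if either it is a Lipschitz graph domain with constant at most $M$ (then $N=c_0=1$), or $M>0$, $c_0\ge1$ and there are $r>0$, points $x_1,\dots,x_N\in\partial\Omega$ and radii $r_j$ with $r/c_0<r_j<c_0r$ such that $\partial\Omega\subset\bigcup_j B(x_j,r_j)$ and, for each $j$, there is a Lipschitz graph domain $V_j$ with constant at most $M$, with $x_j\in\partial V_j$ and $Z_j\cap\Omega=Z_j\cap V_j$, where $Z_j$ is the open cylinder centred at $x_j$, of radius $2r_j$ and height $(8+8M)r_j$, with axis parallel to the $t$-axis of $V_j$. Let $\sigma$ be surface measure on $\partial\Omega$. \emph{Norms.} All functions are complex valued and all norms take values in $[0,\infty]$. For $f\in L^1_{loc}(\partial\Omega)$ put $$\|f\|_{S}=\int_{\partial\Omega}\int_{\partial\Omega}\frac{|f(x)-f(y)|}{|x-y|^{d-1+\theta}}\,d\sigma(x)\,d\sigma(y),\qquad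 \|f\|_{A}=\inf\Bigl\{\sum_{j=1}^\infty|\lambda_j| : f=c+\sum_{j=1}^\infty\lambda_ja_j\Bigr\},$$ where $c,\lambda_j\in\mathbb{C}$, the series converges in $L^{(d-1)/(d-1-\theta)}(\partial\Omega)$, and each $a_j$ is an atom: a Lipschitz function on $\partial\Omega$ for which there are $x_0\in\partial\Omega$ and $r>0$ with $\operatorname{supp}a_j\subseteq B(x_0,r)\cap\partial\Omega$, $\|a_j\|_{L^\infty(\partial\Omega)}\le r^{\theta-(d-1)}$ and $\|\nabla_\tau a_j\|_{L^\infty(\partial\Omega)}\le r^{\theta-1-(d-1)}$, with $\nabla_\tau$ the tangential gradient. Thus $\|\cdot\|_A$ is the atomic norm of $\dot B^{1,1}_\theta(\partial\Omega)$. For $1\le q\le\infty$ and $\Phi\in L^1_{loc}(\Omega)$ with locally integrable weak gradient put $$\|\Phi\|_{\dot W^{1,\theta,q}_{1,av}(\Omega)}=\int_\Omega\Bigl(\frac{1}{|B_x|}\int_{B_x}|\nabla\Phi|^q\Bigr)^{1/q}\operatorname{dist}(x,\partial\Omega)^{-\theta}\,dx,\qquad B_x=B\bigl(x,\tfrac12\operatorname{dist}(x,\partial\Omega)\bigr),$$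 with the essential supremum over $B_x$ in place of the average if $q=\infty$; $\dot W^{1,\theta,q}_{1,av}(\Omega)$ is the set of $\Phi$ for which this is finite. We say that $f=\operatorname{Tr}\Phi$ if $f\in L^1_{loc}(\partial\Omega)$ and there are $\varphi_k\in C^\infty(\mathbb{R}^d)$ such that, for every $R>0$, $\varphi_k\to\Phi$ in $W^{1,1}(\Omega\cap B(0,R))$ and $\varphi_k|_{\partial\Omega}\to f$ in $L^1(\partial\Omega\cap B(0,R))$. \emph{Statement.} For all $M,N,c_0$ there is a constant $C$, depending only on $d,\theta,M,N,c_0$, such that for every Lipschitz domain $\Omega\subset\mathbb{R}^d$ of character $(M,N,c_0)$ with connected boundary and every $q\in[1,\infty]$ the following hold. (i) If $f\in L^1_{loc}(\partial\Omega)$ and $\|f\|_A<\infty$ or $\|f\|_S<\infty$, then $f=\operatorname{Tr}\Phi$ for some $\Phi$ that satisfies both $\|\Phi\|_{\dot W^{1,\theta,q}_{1,av}(\Omega)}\le C\|f\|_S$ and $\|\Phi\|_{\dot W^{1,\theta,q}_{1,av}(\Omega)}\le C\|f\|_A$. (ii) Every $\Phi\in\dot W^{1,\theta,q}_{1,av}(\Omega)$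 has a trace, and $f=\operatorname{Tr}\Phi$ satisfies both $\|f\|_S\le C\|\Phi\|_{\dot W^{1,\theta,q}_{1,av}(\Omega)}$ and $\|f\|_A\le C\|\Phi\|_{\dot W^{1,\theta,q}_{1,av}(\Omega)}$. (iii) For every $f\in L^1_{loc}(\partial\Omega)$, any two of the three quantities $\|f\|_A$, $\|f\|_S$ and $\inf\{\|\Phi\|_{\dot W^{1,\theta,q}_{1,av}(\Omega)}:\operatorname{Tr}\Phi=f\}$ (with $\inf\emptyset=\infty$) are comparable, that is, each is at most $C$ times the other; in particular, if one of them is finite then all are. -/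

import Mathlib

open MeasureTheory Filter Topology Set Metric
open scoped NNReal ENNReal ContDiff

noncomputable section

namespace AvTrace

/-- The ambient Euclidean space of dimension `n + 1`; boundaries have dimension `n`. -/
abbrev Amb (n : ℕ) : Type := EuclideanSpace ℝ (Fin (n + 1))

/-- Orthonormal coordinates `(x', t)`, with `x' ∈ ℝⁿ` and `t ∈ ℝ`, on the ambient space.
(Translations of the coordinates can be absorbed into the graph function.) -/
abbrev Coord (n : ℕ) : Type := Amb n ≃ₗᵢ[ℝ] WithLp 2 (EuclideanSpace ℝ (Fin n) × ℝ)

/-- The region `{(x', t) : t > ψ x'}` in the coordinates `A`. -/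
def epigraph {n : ℕ} (A : Coord n) (ψ : EuclideanSpace ℝ (Fin n) → ℝ) : Set (Amb n) :=
  {x | ψ (A x).fst < (A x).snd}

/-- `V` is a Lipschitz graph domain with Lipschitz constant at most `M`. -/
def IsLipschitzGraphDomain {n : ℕ} (M : ℝ≥0) (V : Set (Amb n)) : Prop :=
  ∃ (A : Coord n) (ψ : EuclideanSpace ℝ (Fin n) → ℝ), LipschitzWith M ψ ∧ V = epigraph A ψ

/-- The open cylinder centred at `z`, with the given radius and height, whose axis is parallel to
the `t`-axis of the coordinates `A`. -/
def cylinder {n : ℕ} (A : Coord n) (z : Amb n) (radius height : ℝ) : Set (Amb n) :=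
  {x | dist (A x).fst (A z).fst < radius ∧ |(A x).snd - (A z).snd| < height / 2}

/-- `Ω` is a Lipschitz domain with Lipschitz character `(M, N, c₀)`. -/
def IsLipschitzDomain {n : ℕ} (M : ℝ≥0) (N : ℕ) (c₀ : ℝ) (Ω : Set (Amb n)) : Prop :=
  IsOpen Ω ∧ IsConnected Ω ∧
    ((IsLipschitzGraphDomain M Ω ∧ N = 1 ∧ c₀ = 1) ∨
      (0 < M ∧ 1 ≤ c₀ ∧ ∃ r : ℝ, 0 < r ∧ ∃ (z : Fin N → Amb n) (ρ : Fin N → ℝ),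
        (∀ j, z j ∈ frontier Ω ∧ 1 / c₀ * r < ρ j ∧ ρ j < c₀ * r) ∧
        frontier Ω ⊆ ⋃ j, ball (z j) (ρ j) ∧
        ∀ j, ∃ (A : Coord n) (ψ : EuclideanSpace ℝ (Fin n) → ℝ),
          LipschitzWith M ψ ∧ z j ∈ frontier (epigraph A ψ) ∧
          cylinder A (z j) (2 * ρ j) ((8 + 8 * M) * ρ j) ∩ Ω =
            cylinder A (z j) (2 * ρ j) ((8 + 8 * M) * ρ j) ∩ epigraph A ψ))

/-- Surface measure `σ` on `∂Ω`: the `n`-dimensional Hausdorff measure, normalized so as to agree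
with Lebesgue measure on `n`-planes, restricted to `∂Ω`. Functions on `∂Ω` are represented by
functions on the ambient space, of which only the values on `∂Ω` up to `σ`-null sets matter. -/
def surfaceMeasure {n : ℕ} (Ω : Set (Amb n)) : Measure (Amb n) :=
  (Measure.euclideanHausdorffMeasure n).restrict (frontier Ω)

/-- The real-linear map `v ↦ v · g = ∑ i, vᵢ gᵢ` determined by a complex vector `g`. -/
def gradMap {n : ℕ} (g : EuclideanSpace ℂ (Fin (n + 1))) : Amb n →L[ℝ] ℂ :=
  ∑ i, (EuclideanSpace.proj i : Amb n →L[ℝ] ℝ).smulRight (g i)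

/-- `a` is a `Ḃ^{1,1}_θ(∂Ω)`-atom: a Lipschitz function on `∂Ω` (extended by zero off `∂Ω`)
supported in `B(x₀, r) ∩ ∂Ω`, with `‖a‖_{L^∞} ≤ r^{θ-n}` and tangential gradient bounded by
`r^{θ-1-n}`.

At `σ`-almost every point `∂Ω` has a tangent plane. The vectors `g` that represent the derivative
of `a` within `∂Ω` at such a point have one and the same tangential part, the tangential gradient,
which is itself such a vector and the shortest one. Hence the bound below says precisely that the tangential gradient exists and
has length at most `r^{θ-1-n}` almost everywhere. -/
def IsAtom {n : ℕ} (θ : ℝ) (Ω : Set (Amb n)) (a : Amb n → ℂ) : Prop :=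
  ∃ x₀ ∈ frontier Ω, ∃ r : ℝ, 0 < r ∧
    tsupport a ⊆ ball x₀ r ∩ frontier Ω ∧
    (∃ K : ℝ≥0, LipschitzOnWith K a (frontier Ω)) ∧
    (∀ᵐ x ∂(surfaceMeasure Ω), ‖a x‖ ≤ r ^ (θ - n)) ∧
    (∀ᵐ x ∂(surfaceMeasure Ω), ∃ g : EuclideanSpace ℂ (Fin (n + 1)),
      HasFDerivWithinAt a (gradMap g) (frontier Ω) x ∧ ‖g‖ ≤ r ^ (θ - 1 - n))

/-- `f = c + ∑ⱼ lamⱼ aⱼ` on `∂Ω` with atoms `aⱼ`; the series converges in `L^{n/(n-θ)}(∂Ω)`. -/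
def IsAtomicDecomposition {n : ℕ} (θ : ℝ) (Ω : Set (Amb n)) (f : Amb n → ℂ)
    (c : ℂ) (lam : ℕ → ℂ) (a : ℕ → Amb n → ℂ) : Prop :=
  (∀ j, IsAtom θ Ω (a j)) ∧
    Tendsto (fun k : ℕ =>
        eLpNorm (fun x => f x - (c + ∑ j ∈ Finset.range k, lam j * a j x))
          (ENNReal.ofReal (n / (n - θ))) (surfaceMeasure Ω))
      atTop (𝓝 0)

/-- The atomic norm of `Ḃ^{1,1}_θ(∂Ω)`; it is `∞` for functions outside the space. -/
def atomicNorm {n : ℕ} (θ : ℝ) (Ω : Set (Amb n)) (f : Amb n → ℂ) : ℝ≥0∞ :=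
  ⨅ (c : ℂ) (lam : ℕ → ℂ) (a : ℕ → Amb n → ℂ) (_ : IsAtomicDecomposition θ Ω f c lam a),
    ∑' j, ‖lam j‖ₑ

/-- The Slobodeckij double integral over `∂Ω × ∂Ω` of `|f(x) - f(y)| / |x - y|^{n+θ}`. -/
def slobodeckijNorm {n : ℕ} (θ : ℝ) (Ω : Set (Amb n)) (f : Amb n → ℂ) : ℝ≥0∞ :=
  ∫⁻ y, ∫⁻ x, ‖f x - f y‖ₑ / edist x y ^ (n + θ : ℝ) ∂(surfaceMeasure Ω) ∂(surfaceMeasure Ω)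

/-- `u` and `G` are locally integrable in `Ω` and `G` is the weak gradient of `u` in `Ω`. -/
def HasWeakGradient {n : ℕ} (Ω : Set (Amb n)) (u : Amb n → ℂ)
    (G : Amb n → EuclideanSpace ℂ (Fin (n + 1))) : Prop :=
  LocallyIntegrableOn u Ω ∧ LocallyIntegrableOn G Ω ∧
    ∀ η : Amb n → ℝ, ContDiff ℝ ∞ η → HasCompactSupport η → tsupport η ⊆ Ω →
      ∀ i, ∫ x in Ω, fderiv ℝ η x (EuclideanSpace.single i 1) • u x = -∫ x in Ω, η x • G x i

/-- The norm of `L_av^{1,θ,q}(Ω)`: the integral over `Ω` of the averaged `L^q` norm over the ball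
`B(x, dist(x, ∂Ω)/2)` (an essential supremum if `q = ∞`), against the weight `dist(x, ∂Ω)^{-θ}`. -/
def avNorm {n : ℕ} (θ : ℝ) (q : ℝ≥0∞) (Ω : Set (Amb n))
    (G : Amb n → EuclideanSpace ℂ (Fin (n + 1))) : ℝ≥0∞ :=
  ∫⁻ x in Ω,
    eLpNorm G q (ProbabilityTheory.cond volume (ball x (infDist x (frontier Ω) / 2))) *
      ENNReal.ofReal (infDist x (frontier Ω) ^ (-θ))

/-- The norm of `Ẇ_{1,av}^{1,θ,q}(Ω)`, that is, the `L_av^{1,θ,q}(Ω)`-norm of the weak gradient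
(which is unique up to null sets); it is `∞` for functions outside the space. -/
def sobolevNorm {n : ℕ} (θ : ℝ) (q : ℝ≥0∞) (Ω : Set (Amb n)) (u : Amb n → ℂ) : ℝ≥0∞ :=
  ⨅ (G : Amb n → EuclideanSpace ℂ (Fin (n + 1))) (_ : HasWeakGradient Ω u G), avNorm θ q Ω G

/-- The pointwise gradient of a differentiable complex-valued function. -/
def gradVec {n : ℕ} (φ : Amb n → ℂ) (x : Amb n) : EuclideanSpace ℂ (Fin (n + 1)) :=
  WithLp.toLp 2 fun i => fderiv ℝ φ x (EuclideanSpace.single i 1)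

/-- `f` is the boundary trace of `u`. The trace operator is the extension by continuity of
`φ ↦ φ|_{∂Ω}` from smooth functions: there are functions `φₖ`, smooth in the whole space, that
converge to `u` in `W^{1,1}(Ω ∩ B(0,R))` and to `f` in `L¹(∂Ω ∩ B(0,R))` for every `R`. -/
def HasTrace {n : ℕ} (Ω : Set (Amb n)) (u f : Amb n → ℂ) : Prop :=
  LocallyIntegrable f (surfaceMeasure Ω) ∧
    ∃ G : Amb n → EuclideanSpace ℂ (Fin (n + 1)), HasWeakGradient Ω u G ∧
      ∃ φ : ℕ → Amb n → ℂ, (∀ k, ContDiff ℝ ∞ (φ k)) ∧ ∀ R : ℝ,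
        Tendsto (fun k => ∫⁻ x in Ω ∩ ball 0 R, ‖φ k x - u x‖ₑ) atTop (𝓝 0) ∧
        Tendsto (fun k => ∫⁻ x in Ω ∩ ball 0 R, ‖gradVec (φ k) x - G x‖ₑ) atTop (𝓝 0) ∧
        Tendsto (fun k => ∫⁻ x in ball 0 R, ‖φ k x - f x‖ₑ ∂(surfaceMeasure Ω)) atTop (𝓝 0)

/-- The minimal (infimal) `Ẇ_{1,av}^{1,θ,q}(Ω)`-norm of an extension of `f` to `Ω`. -/
def minExtensionNorm {n : ℕ} (θ : ℝ) (q : ℝ≥0∞) (Ω : Set (Amb n)) (f : Amb n → ℂ) : ℝ≥0∞ :=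
  ⨅ (u : Amb n → ℂ) (_ : HasTrace Ω u f), sobolevNorm θ q Ω u

end AvTrace

end

noncomputable section

namespace AvTrace

variable {n : ℕ}

/-! ### Gradients as vectors and as linear maps -/

/-! Write `δ` for the distance to the boundary. The quantity that links the three norms is the
weighted integral `wInt`, that is `∫ |∇Φ| δ^(-θ)`. Fubini over Whitney balls bounds it by the
averaged norm with `q = 1` (`wInt_le_avNorm_one`). The averages are taken against probability
measures, so the averaged norm increases with `q` (`avNorm_mono_exponent`). It therefore suffices to
bound traces by the weakest norm, `q = 1`, and to build extensions in the strongest, `q = ∞`. No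
constant then depends on `q`, and three one-sided estimates close the circle (`TraceEstimates`).

From functions to atoms. A smooth field `e` transversal to the boundary gives averages `tr` of `Φ`
over balls of radius comparable to `s` about `x + s e(x)`. These are smooth on the whole space, and
the fundamental theorem of calculus along the moving balls bounds the difference of two of them by
an integral of `|∇Φ|`. Integrated over the boundary, this costs only the integral of `|∇Φ|` over a
collar of height `s` (`lintegral_surface_le`), hence at most `s^θ` times `wInt`. So the averages
converge on the boundary, and they are themselves the smooth functions that witness the trace. The
trace is the sum of the differences between consecutive dyadic scales, up to a constant. Cut by a
partition of unity on a grid of the same scale, each difference becomes a multiple of an atom whose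
coefficient is `t^(-θ)` times the integral of `|∇Φ|` over a Whitney region at height `t`. These
regions overlap boundedly, so the coefficients sum to at most a multiple of `wInt`. The largest
scales are treated apart: when every scale is available the averages tend to a constant at infinity,
and when the boundary is bounded the coarsest average minus a constant is one more dyadic piece.

From atoms to the double integral. An atom is estimated by its Lipschitz bound at distances below
its radius and by its supremum beyond (`slobodeckijNorm_atom_le`); the series is then summed
pointwise along an almost everywhere convergent subsequence.

From the double integral to an extension. `potExt` averages `f` against `|x - y|^(-2n-2)`,
normalized to total mass one. Subtracting the value `potExt Ω f x` under the integral bounds the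
gradient by `δ^θ` times `diffPot`, a double integral of differences of `f`. That quantity is almost
constant on Whitney balls, so it serves `q = ∞`, and its integral over the whole space is at most a
multiple of the Slobodeckij norm. A pointwise estimate near almost every boundary point identifies
the trace. If the boundary is bounded, the extension is cut off to a constant at distances beyond
the diameter.

Four geometric facts are used: upper and lower `n`-regularity of the surface measure, the
transversal field, and `GradControls`, by which the tangential gradient bounds the Lipschitz
constant. On a graph domain they hold at every scale. Otherwise they come from the charts, and
connectedness of the boundary is what chains local estimates into global ones. -/

lemma gradMap_apply (g : EuclideanSpace ℂ (Fin (n + 1))) (v : Amb n) :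
    gradMap g v = ∑ i, (v i) • g i := by
  simp [gradMap]

lemma gradMap_single (g : EuclideanSpace ℂ (Fin (n + 1))) (i : Fin (n + 1)) :
    gradMap g (EuclideanSpace.single i 1) = g i := by
  rw [gradMap_apply, Finset.sum_eq_single i]
  · simp
  · intro j _ hj
    simp [hj]
  · simp

lemma clm_ext_single {T T' : Amb n →L[ℝ] ℂ}
    (h : ∀ i, T (EuclideanSpace.single i 1) = T' (EuclideanSpace.single i 1)) : T = T' := by
  apply ContinuousLinearMap.coe_injective
  refine (EuclideanSpace.basisFun (Fin (n + 1)) ℝ).toBasis.ext fun i => ?_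
  simpa using h i

lemma gradMap_gradVec (φ : Amb n → ℂ) (x : Amb n) : gradMap (gradVec φ x) = fderiv ℝ φ x :=
  clm_ext_single fun i => by rw [gradMap_single]; rfl

lemma gradMap_add (g h : EuclideanSpace ℂ (Fin (n + 1))) :
    gradMap (g + h) = gradMap g + gradMap h :=
  clm_ext_single fun i => by simp [gradMap_single]

lemma gradMap_smul (c : ℝ) (g : EuclideanSpace ℂ (Fin (n + 1))) :
    gradMap (c • g) = c • gradMap g :=
  clm_ext_single fun i => by simp [gradMap_single]

/-- The linear map `g ↦ gradMap g`. -/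
def gradMapL (n : ℕ) : EuclideanSpace ℂ (Fin (n + 1)) →ₗ[ℝ] (Amb n →L[ℝ] ℂ) where
  toFun := gradMap
  map_add' := gradMap_add
  map_smul' := gradMap_smul

lemma continuous_gradMap : Continuous (gradMap : EuclideanSpace ℂ (Fin (n + 1)) → _) :=
  (gradMapL n).continuous_of_finiteDimensional

lemma gradMap_sub (g h : EuclideanSpace ℂ (Fin (n + 1))) :
    gradMap (g - h) = gradMap g - gradMap h := (gradMapL n).map_sub g h

lemma norm_gradMap_le (g : EuclideanSpace ℂ (Fin (n + 1))) : ‖gradMap g‖ ≤ ‖g‖ := by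
  refine ContinuousLinearMap.opNorm_le_bound _ (norm_nonneg _) fun v => ?_
  rw [gradMap_apply]
  calc ‖∑ i, (v i) • g i‖ ≤ ∑ i, ‖g i‖ * ‖v i‖ :=
        (norm_sum_le _ _).trans (Finset.sum_le_sum fun i _ => by rw [norm_smul, mul_comm])
    _ ≤ √(∑ i, ‖g i‖ ^ 2) * √(∑ i, ‖v i‖ ^ 2) := Real.sum_mul_le_sqrt_mul_sqrt _ _ _
    _ = ‖g‖ * ‖v‖ := by rw [EuclideanSpace.norm_eq, EuclideanSpace.norm_eq]

/-- Each component of `g` is a value of `gradMap g` on a unit vector. The dimensional loss is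
harmless and allows gradients to be estimated as operators throughout. -/
lemma norm_le_of_norm_gradMap_le {g : EuclideanSpace ℂ (Fin (n + 1))} :
    ‖g‖ ≤ (n + 1 : ℝ) * ‖gradMap g‖ := by
  have h : ∀ i, ‖g i‖ ≤ ‖gradMap g‖ := fun i => by
    have := (gradMap g).le_opNorm (EuclideanSpace.single i 1)
    rw [gradMap_single] at this
    simpa using this
  rw [EuclideanSpace.norm_eq]
  refine (Real.sqrt_le_sqrt (Finset.sum_le_sum fun i _ =>
    pow_le_pow_left₀ (norm_nonneg _) (h i) 2)).trans ?_
  rw [Finset.sum_const, Finset.card_univ, Fintype.card_fin, nsmul_eq_mul,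
    Real.sqrt_mul (by positivity), Real.sqrt_sq (norm_nonneg _)]
  gcongr
  rw [Real.sqrt_le_left (by positivity)]
  push_cast
  nlinarith

lemma enorm_gradMap_le (g : EuclideanSpace ℂ (Fin (n + 1))) : ‖gradMap g‖ₑ ≤ ‖g‖ₑ :=
  enorm_le_iff_norm_le.2 (norm_gradMap_le g)

lemma enorm_le_enorm_gradMap (g : EuclideanSpace ℂ (Fin (n + 1))) :
    ‖g‖ₑ ≤ ENNReal.ofReal (n + 1) * ‖gradMap g‖ₑ := by
  rw [← ofReal_norm, ← ofReal_norm, ← ENNReal.ofReal_mul (by positivity)]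
  exact ENNReal.ofReal_le_ofReal norm_le_of_norm_gradMap_le

/-! ### Changes of variables -/

lemma finrank_amb : Module.finrank ℝ (Amb n) = n + 1 := by simp

/-- Replaces the Jacobian formula: an antilipschitz map controls the Hausdorff measure of preimages,
and Lebesgue measure is normalized Hausdorff measure of full dimension. No derivative of `Φ` enters.
-/
lemma lintegral_comp_le_of_antilipschitz {Φ : Amb n → Amb n} {K : ℝ≥0}
    (hΦ : AntilipschitzWith K Φ) (hm : Measurable Φ) {g : Amb n → ℝ≥0∞} (hg : Measurable g) :
    ∫⁻ x, g (Φ x) ≤ (K : ℝ≥0∞) ^ (n + 1) * ∫⁻ x, g x := by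
  have h : Measure.map Φ volume ≤ ((K : ℝ≥0∞) ^ (n + 1)) • (volume : Measure (Amb n)) := by
    refine Measure.le_iff.2 fun s hs => ?_
    rw [Measure.map_apply hm hs, Measure.smul_apply, smul_eq_mul,
      ← EuclideanSpace.euclideanHausdorffMeasure_eq_volume, Measure.euclideanHausdorffMeasure_def,
      Measure.smul_apply, Measure.smul_apply]
    have := hΦ.hausdorffMeasure_preimage_le (d := ((n + 1 : ℕ) : ℝ)) (by positivity) s
    rw [ENNReal.rpow_natCast] at this
    rw [mul_smul_comm]
    gcongr
  rw [← lintegral_map hg hm, ← smul_eq_mul, ← lintegral_smul_measure]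
  exact lintegral_mono' h le_rfl

lemma lintegral_comp_add_smul (p : Amb n) {t : ℝ} (ht : 0 < t) (h : Amb n → ℝ≥0∞) :
    ∫⁻ v, h (p + t • v) = ENNReal.ofReal ((t ^ (n + 1))⁻¹) * ∫⁻ w, h w := by
  have h1 : ∫⁻ v, h (p + t • v) = ∫⁻ v, (fun v => h (p + v)) v ∂(Measure.map (t • ·) volume) := by
    have hme : MeasurableEmbedding (fun v : Amb n => t • v) :=
      (Homeomorph.smulOfNeZero t ht.ne').measurableEmbedding
    rw [hme.lintegral_map]
  rw [h1, Measure.map_addHaar_smul _ ht.ne', lintegral_smul_measure, finrank_amb,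
    abs_of_pos (by positivity), smul_eq_mul, lintegral_add_left_eq_self]

/-! ### The mollifying kernel -/

/-- The bump function underlying the mollifying kernel. -/
def kapBump (n : ℕ) : ContDiffBump (0 : Amb n) := ⟨1 / 4, 1 / 2, by norm_num, by norm_num⟩

/-- A smooth even probability density supported in the ball of radius `1 / 2`. -/
def kap (n : ℕ) : Amb n → ℝ := (kapBump n).normed volume

/-- A bound for the mollifying kernel. -/
def kapSup (n : ℕ) : ℝ≥0 := ⟨1 / (volume : Measure (Amb n)).real (closedBall 0 (1 / 4)), by
  positivity⟩

lemma kap_nonneg (v : Amb n) : 0 ≤ kap n v := (kapBump n).nonneg_normed v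
lemma kap_neg (v : Amb n) : kap n (-v) = kap n v := (kapBump n).normed_neg v
lemma kap_le (v : Amb n) : kap n v ≤ kapSup n :=
  (kapBump n).normed_le_div_measure_closedBall_rIn volume v
lemma contDiff_kap : ContDiff ℝ ∞ (kap n) := (kapBump n).contDiff_normed (n := ⊤)
lemma continuous_kap : Continuous (kap n) := (kapBump n).continuous_normed
lemma integral_kap : ∫ v, kap n v = 1 := (kapBump n).integral_normed
lemma integrable_kap : Integrable (kap n) := (kapBump n).integrable_normed
lemma support_kap : Function.support (kap n) = ball 0 (1 / 2) := (kapBump n).support_normed_eq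

lemma kap_eq_zero {v : Amb n} (hv : 1 / 2 ≤ ‖v‖) : kap n v = 0 := by
  by_contra h
  have : v ∈ Function.support (kap n) := h
  rw [support_kap, mem_ball_zero_iff] at this
  linarith

lemma norm_lt_of_kap_ne {v : Amb n} (hv : kap n v ≠ 0) : ‖v‖ < 1 / 2 := by
  by_contra h
  exact hv (kap_eq_zero (not_lt.1 h))

lemma enorm_kap_le (v : Amb n) : ‖kap n v‖ₑ ≤ kapSup n := by
  rw [Real.enorm_of_nonneg (kap_nonneg v)]
  exact ENNReal.ofReal_le_of_le_toReal (kap_le v)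

lemma lintegral_enorm_kap : ∫⁻ v, ‖kap n v‖ₑ = 1 := by
  have := ofReal_integral_eq_lintegral_ofReal (integrable_kap (n := n))
    (Eventually.of_forall kap_nonneg)
  rw [integral_kap] at this
  simp_rw [Real.enorm_of_nonneg (kap_nonneg _)]
  simpa using this.symm

variable {E : Type*} [NormedAddCommGroup E] [NormedSpace ℝ E]

/-- Averages of `g` near `p` at scale `t`. -/
def mol (t : ℝ) (g : Amb n → E) (p : Amb n) : E := ∫ v, kap n v • g (p + t • v)

/-- The kernel of `mol t`. -/
def kapAt (t : ℝ) (w : Amb n) : ℝ := (t ^ (n + 1))⁻¹ * kap n (t⁻¹ • w)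

lemma contDiff_kapAt (t : ℝ) : ContDiff ℝ ∞ (kapAt t : Amb n → ℝ) :=
  contDiff_const.mul (contDiff_kap.comp (contDiff_const_smul _))

lemma kapAt_neg (t : ℝ) (w : Amb n) : kapAt t (-w) = kapAt t w := by
  simp [kapAt, smul_neg, kap_neg]

lemma kapAt_eq_zero {t : ℝ} (ht : 0 < t) {w : Amb n} (hw : t / 2 ≤ ‖w‖) : kapAt t w = 0 := by
  rw [kapAt, kap_eq_zero, mul_zero]
  rw [norm_smul, norm_inv, Real.norm_of_nonneg ht.le, inv_mul_eq_div, le_div_iff₀ ht]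
  linarith

lemma hasCompactSupport_kapAt {t : ℝ} (ht : 0 < t) : HasCompactSupport (kapAt t : Amb n → ℝ) := by
  refine HasCompactSupport.of_support_subset_isCompact (isCompact_closedBall (0 : Amb n) (t / 2))
    fun w hw => ?_
  rw [mem_closedBall_zero_iff]
  by_contra h
  exact hw (kapAt_eq_zero ht (not_le.1 h).le)

lemma mol_eq {t : ℝ} (ht : 0 < t) (g : Amb n → E) (p : Amb n) :
    mol t g p = ∫ w, kapAt t (w - p) • g w := by
  have h1 : ∫ w, kapAt t (w - p) • g w = ∫ w, kapAt t w • g (p + w) := by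
    rw [← integral_add_left_eq_self _ p]
    simp
  have h2 := Measure.integral_comp_smul volume (fun w : Amb n => kapAt t w • g (p + w)) t
  rw [h1, mol]
  simp only [finrank_amb] at h2
  rw [abs_of_pos (by positivity)] at h2
  have h3 : ∀ v : Amb n, kapAt t (t • v) • g (p + t • v) =
      (t ^ (n + 1))⁻¹ • (kap n v • g (p + t • v)) := fun v => by
    rw [kapAt, smul_smul t⁻¹, inv_mul_cancel₀ ht.ne', one_smul, mul_smul]
  simp_rw [h3] at h2
  rw [integral_smul] at h2
  exact smul_right_injective E (by positivity : (t ^ (n + 1))⁻¹ ≠ 0) h2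

/-- The kernel is even, so the average around `p` is a convolution, and smoothness is inherited from
the kernel. -/
lemma mol_eq_convolution {t : ℝ} (ht : 0 < t) (g : Amb n → E) :
    mol t g = MeasureTheory.convolution g (kapAt t) (ContinuousLinearMap.lsmul ℝ ℝ).flip volume := by
  ext p
  rw [mol_eq ht, convolution_def]
  refine integral_congr_ae (Eventually.of_forall fun w => ?_)
  simp [← kapAt_neg t (w - p)]

lemma contDiff_mol {t : ℝ} (ht : 0 < t) {g : Amb n → E} (hg : LocallyIntegrable g) :
    ContDiff ℝ ∞ (mol t g) := by
  rw [mol_eq_convolution ht]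
  exact (hasCompactSupport_kapAt ht).contDiff_convolution_right (n := ⊤) _ hg (contDiff_kapAt t)

lemma enorm_mol_le (t : ℝ) (g : Amb n → E) (p : Amb n) :
    ‖mol t g p‖ₑ ≤ ∫⁻ v, ‖kap n v‖ₑ * ‖g (p + t • v)‖ₑ := by
  refine (enorm_integral_le_lintegral_enorm _).trans (lintegral_mono fun v => ?_)
  rw [enorm_smul]

lemma lintegral_kap_mul_le {t : ℝ} (ht : 0 < t) (h : Amb n → ℝ≥0∞) (p : Amb n) :
    ∫⁻ v, ‖kap n v‖ₑ * h (p + t • v) ≤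
      kapSup n * ENNReal.ofReal ((t ^ (n + 1))⁻¹) * ∫⁻ w in ball p (t / 2), h w := by
  rw [mul_assoc, ← lintegral_indicator measurableSet_ball, ← lintegral_comp_add_smul p ht,
    ← lintegral_const_mul' _ _ ENNReal.coe_ne_top]
  refine lintegral_mono fun v => ?_
  by_cases hv : kap n v = 0
  · simp [hv]
  · have : p + t • v ∈ ball p (t / 2) := by
      rw [mem_ball, dist_eq_norm, add_sub_cancel_left, norm_smul, Real.norm_of_nonneg ht.le]
      have := norm_lt_of_kap_ne hv
      nlinarith
    rw [indicator_of_mem this]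
    gcongr
    exact enorm_kap_le v

lemma enorm_mol_le_ball {t : ℝ} (ht : 0 < t) (g : Amb n → E) (p : Amb n) :
    ‖mol t g p‖ₑ ≤ kapSup n * ENNReal.ofReal ((t ^ (n + 1))⁻¹) * ∫⁻ w in ball p (t / 2), ‖g w‖ₑ :=
  (enorm_mol_le t g p).trans (lintegral_kap_mul_le ht _ p)

lemma mol_congr {t : ℝ} (ht : 0 < t) {g h : Amb n → E} {p : Amb n}
    (hgh : ∀ w ∈ ball p (t / 2), g w = h w) : mol t g p = mol t h p := by
  refine integral_congr_ae (Eventually.of_forall fun v => ?_)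
  by_cases hv : kap n v = 0
  · simp [hv]
  · have : p + t • v ∈ ball p (t / 2) := by
      rw [mem_ball, dist_eq_norm, add_sub_cancel_left, norm_smul, Real.norm_of_nonneg ht.le]
      have := norm_lt_of_kap_ne hv
      nlinarith
    simp [hgh _ this]

variable {n : ℕ} {E : Type*} [NormedAddCommGroup E] [NormedSpace ℝ E]

/-! ### Convergence of averages -/

lemma integrable_kap_smul {g : Amb n → E} (hg : StronglyMeasurable g) {t : ℝ} (ht : 0 < t)
    {p : Amb n} (hi : ∫⁻ w in ball p (t / 2), ‖g w‖ₑ ≠ ⊤) :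
    Integrable (fun v => kap n v • g (p + t • v)) := by
  refine ⟨(continuous_kap.stronglyMeasurable.smul
    (hg.comp_measurable (by fun_prop))).aestronglyMeasurable, ?_⟩
  rw [hasFiniteIntegral_iff_enorm]
  simp_rw [enorm_smul]
  refine (lintegral_kap_mul_le ht (fun w => ‖g w‖ₑ) p).trans_lt ?_
  exact ENNReal.mul_lt_top (ENNReal.mul_lt_top ENNReal.coe_lt_top ENNReal.ofReal_lt_top)
    hi.lt_top

lemma mol_sub {g h : Amb n → E} (hg : StronglyMeasurable g) (hh : StronglyMeasurable h) {t : ℝ}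
    (ht : 0 < t) {p : Amb n} (hgi : ∫⁻ w in ball p (t / 2), ‖g w‖ₑ ≠ ⊤)
    (hhi : ∫⁻ w in ball p (t / 2), ‖h w‖ₑ ≠ ⊤) :
    mol t (fun w => g w - h w) p = mol t g p - mol t h p := by
  rw [mol, mol, mol, ← integral_sub (integrable_kap_smul hg ht hgi) (integrable_kap_smul hh ht hhi)]
  simp_rw [smul_sub]

lemma norm_mol_sub_le {h : Amb n → E} (hh : StronglyMeasurable h) {t : ℝ} (a : E) (p : Amb n)
    {r : ℝ} (hr : ∀ v, ‖v‖ < 1 / 2 → ‖h (p + t • v) - a‖ ≤ r) [CompleteSpace E] :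
    ‖mol t h p - a‖ ≤ r := by
  have hi : Integrable (fun v => kap n v • h (p + t • v)) := by
    refine (integrable_kap.mul_const (‖a‖ + r)).mono' (continuous_kap.stronglyMeasurable.smul
      (hh.comp_measurable (by fun_prop))).aestronglyMeasurable (Eventually.of_forall fun v => ?_)
    rw [norm_smul, Real.norm_of_nonneg (kap_nonneg v)]
    by_cases hv : kap n v = 0
    · simp [hv]
    · have h1 := hr v (norm_lt_of_kap_ne hv)
      have h2 := norm_le_norm_add_norm_sub' (h (p + t • v)) a
      exact mul_le_mul_of_nonneg_left (by linarith) (kap_nonneg v)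
  have h1 : a = ∫ v, kap n v • a := by rw [integral_smul_const, integral_kap, one_smul]
  have h2 : mol t h p - a = ∫ v, kap n v • (h (p + t • v) - a) := by
    conv_lhs => rw [h1, mol]
    rw [← integral_sub hi (integrable_kap.smul_const a)]
    simp_rw [smul_sub]
  rw [h2]
  calc ‖∫ v, kap n v • (h (p + t • v) - a)‖ ≤ ∫ v, kap n v * r := by
        refine norm_integral_le_of_norm_le (integrable_kap.mul_const r)
          (Eventually.of_forall fun v => ?_)
        rw [norm_smul, Real.norm_of_nonneg (kap_nonneg v)]
        by_cases hv : kap n v = 0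
        · simp [hv]
        · exact mul_le_mul_of_nonneg_left (hr v (norm_lt_of_kap_ne hv)) (kap_nonneg v)
    _ = r := by rw [integral_mul_const, integral_kap, one_mul]

/-- A perturbation of the identity with Lipschitz constant `1/2` shrinks distances at most by the
factor `2`. -/
lemma antilipschitz_add_smul {e : Amb n → Amb n} {s : ℝ}
    (he : ∀ x y, ‖s • e x - s • e y‖ ≤ ‖x - y‖ / 2) (a : Amb n) :
    AntilipschitzWith 2 fun x => x + s • e x + a := by
  refine AntilipschitzWith.of_le_mul_dist fun x y => ?_
  rw [dist_eq_norm, dist_eq_norm]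
  have h := norm_sub_norm_le (x - y) (-(s • e x - s • e y))
  rw [norm_neg] at h
  have h2 : x + s • e x + a - (y + s • e y + a) = x - y - -(s • e x - s • e y) := by abel
  rw [h2]
  have := he x y
  push_cast
  linarith

/-- For each fixed `v` the inner map is antilipschitz in `x` with constant `2`; integrate in `x`
first, then use that the kernel has mass one. -/
lemma lintegral_kap_comp_le {e : Amb n → Amb n} (hem : Continuous e) {s t : ℝ}
    (he : ∀ x y, ‖s • e x - s • e y‖ ≤ ‖x - y‖ / 2) {g : Amb n → ℝ≥0∞} (hg : Measurable g) :
    ∫⁻ x, ∫⁻ v, ‖kap n v‖ₑ * g (x + s • e x + t • v) ≤ 2 ^ (n + 1) * ∫⁻ x, g x := by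
  have hk : Measurable fun v : Amb n => ‖kap n v‖ₑ := continuous_kap.enorm.measurable
  have hm : Measurable fun q : Amb n × Amb n => q.1 + s • e q.1 + t • q.2 :=
    Continuous.measurable (by fun_prop)
  rw [lintegral_lintegral_swap ((hk.comp measurable_snd).mul (hg.comp hm)).aemeasurable]
  calc ∫⁻ v, ∫⁻ x, ‖kap n v‖ₑ * g (x + s • e x + t • v)
      ≤ ∫⁻ v, ‖kap n v‖ₑ * (2 ^ (n + 1) * ∫⁻ x, g x) := by
        refine lintegral_mono fun v => ?_
        dsimp only
        rw [lintegral_const_mul' _ _ (by simp)]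
        gcongr
        exact lintegral_comp_le_of_antilipschitz (antilipschitz_add_smul he (t • v))
          (Continuous.measurable (by fun_prop)) hg
    _ = 2 ^ (n + 1) * ∫⁻ x, g x := by
        rw [lintegral_mul_const _ hk, lintegral_enorm_kap, one_mul]

/-- Averages over small balls with slightly displaced centres converge in `L¹`. -/
lemma tendsto_lintegral_mol_sub [CompleteSpace E] {e : Amb n → Amb n} {L Λ c : ℝ} (hc : 0 < c)
    (hec : Continuous e) (heL : ∀ x, ‖e x‖ ≤ L) (heΛ : ∀ x y, ‖e x - e y‖ ≤ Λ * ‖x - y‖)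
    {g : Amb n → E} (hgm : StronglyMeasurable g) (hg : Integrable g) :
    Tendsto (fun s : ℝ => ∫⁻ x, ‖mol (c * s) g (x + s • e x) - g x‖ₑ) (𝓝[>] 0) (𝓝 0) := by
  have hL : 0 ≤ L := (norm_nonneg _).trans (heL 0)
  rw [ENNReal.tendsto_nhds_zero]
  intro ε hε
  rcases eq_or_ne ε ⊤ with rfl | hεt
  · simp
  obtain ⟨ε₁, hε₁, hε₁'⟩ : ∃ ε₁ : ℝ≥0∞, ε₁ ≠ 0 ∧ 2 ^ (n + 1) * ε₁ + ε₁ ≤ ε / 2 := by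
    refine ⟨ε / 2 / (2 ^ (n + 1) + 1), ?_, ?_⟩
    · simp [hε.ne', ENNReal.div_eq_zero_iff]
    · rw [← add_one_mul]
      exact ENNReal.mul_div_le
  -- Density argument: the error from replacing `g` by a compactly supported continuous `h` is
  -- bounded uniformly in `s` by `lintegral_kap_comp_le`, and `h` itself is handled by uniform
  -- continuity inside one fixed ball.
  obtain ⟨h, hhc, hgh, hcont, hhi⟩ := hg.exists_hasCompactSupport_lintegral_sub_le hε₁
  obtain ⟨R, hR0, hR⟩ := hhc.isCompact.isBounded.subset_closedBall_lt 0 0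
  have hV : (volume (closedBall (0 : Amb n) (R + L + c))) ≠ ⊤ := measure_closedBall_lt_top.ne
  obtain ⟨ϖ, hϖ, hϖV⟩ : ∃ ϖ : ℝ, 0 < ϖ ∧
      ENNReal.ofReal ϖ * volume (closedBall (0 : Amb n) (R + L + c)) ≤ ε / 2 := by
    obtain ⟨m, hm, hm'⟩ := ENNReal.exists_nnreal_pos_mul_lt hV
      (ENNReal.half_pos hε.ne').ne'
    exact ⟨m, hm, by rw [ENNReal.ofReal_coe_nnreal]; exact hm'.le⟩
  obtain ⟨δ, hδ, hδ'⟩ := Metric.uniformContinuous_iff.1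
    (hcont.uniformContinuous_of_tendsto_cocompact hhc.is_zero_at_infty) ϖ hϖ
  have hsm : ∀ᶠ s : ℝ in 𝓝[>] 0, 0 < s ∧ s < 1 ∧ s * |Λ| < 1 / 2 ∧ s * (L + c) < δ := by
    have c1 : Tendsto (fun s : ℝ => s * |Λ|) (𝓝[>] 0) (𝓝 0) := by
      simpa using ((continuous_mul_const |Λ|).tendsto 0).mono_left nhdsWithin_le_nhds
    have c2 : Tendsto (fun s : ℝ => s * (L + c)) (𝓝[>] 0) (𝓝 0) := by
      simpa using ((continuous_mul_const (L + c)).tendsto 0).mono_left nhdsWithin_le_nhds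
    have c3 : Tendsto (fun s : ℝ => s) (𝓝[>] 0) (𝓝 0) := nhdsWithin_le_nhds
    filter_upwards [self_mem_nhdsWithin, c3.eventually_lt_const one_pos,
      c1.eventually_lt_const (by norm_num : (0 : ℝ) < 1 / 2), c2.eventually_lt_const hδ]
      with s h1 h2 h3 h4 using ⟨h1, h2, h3, h4⟩
  filter_upwards [hsm] with s ⟨hs0, hs1, hsΛ, hsδ⟩
  have he : ∀ x y, ‖s • e x - s • e y‖ ≤ ‖x - y‖ / 2 := fun x y => by
    rw [← smul_sub, norm_smul, Real.norm_of_nonneg hs0.le]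
    have h1 := heΛ x y
    have h2 : Λ * ‖x - y‖ ≤ |Λ| * ‖x - y‖ := by gcongr; exact le_abs_self _
    have h3 : s * |Λ| * ‖x - y‖ ≤ 1 / 2 * ‖x - y‖ := by gcongr
    nlinarith
  have hcs : 0 < c * s := mul_pos hc hs0
  have hhm : StronglyMeasurable h := hcont.stronglyMeasurable
  have hfin : ∀ {k : Amb n → E}, Integrable k → ∀ A : Set (Amb n), ∫⁻ w in A, ‖k w‖ₑ ≠ ⊤ :=
    fun hk A => ((setLIntegral_le_lintegral _ _).trans_lt hk.2).ne
  have hpt : ∀ x, ‖mol (c * s) g (x + s • e x) - g x‖ₑ ≤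
      ((∫⁻ v, ‖kap n v‖ₑ * ‖g (x + s • e x + (c * s) • v) - h (x + s • e x + (c * s) • v)‖ₑ)
        + ‖g x - h x‖ₑ) + (closedBall 0 (R + L + c)).indicator (fun _ => ENNReal.ofReal ϖ) x := by
    intro x
    have h1 := mol_sub hgm hhm hcs (p := x + s • e x) (hfin hg _) (hfin hhi _)
    have h2 : mol (c * s) g (x + s • e x) - g x = (mol (c * s) (fun w => g w - h w) (x + s • e x)
        - (g x - h x)) + (mol (c * s) h (x + s • e x) - h x) := by rw [h1]; abel
    rw [h2]
    refine (enorm_add_le _ _).trans (add_le_add ((enorm_sub_le).trans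
      (add_le_add (enorm_mol_le _ _ _) le_rfl)) ?_)
    have hmove : ∀ v : Amb n, ‖v‖ < 1 / 2 → ‖s • e x + (c * s) • v‖ ≤ s * (L + c) := fun v hv => by
      refine (norm_add_le _ _).trans ?_
      rw [norm_smul, norm_smul, Real.norm_of_nonneg hs0.le, Real.norm_of_nonneg hcs.le]
      have := heL x
      have : s * ‖e x‖ ≤ s * L := by gcongr
      have : c * s * ‖v‖ ≤ c * s * 1 := by gcongr; linarith
      nlinarith
    by_cases hx : x ∈ closedBall (0 : Amb n) (R + L + c)
    · rw [indicator_of_mem hx, ← ofReal_norm]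
      refine ENNReal.ofReal_le_ofReal (norm_mol_sub_le hcont.stronglyMeasurable _ _ fun v hv => ?_)
      rw [← dist_eq_norm]
      refine (hδ' ?_).le
      rw [dist_eq_norm, add_assoc, add_sub_cancel_left]
      exact (hmove v hv).trans_lt hsδ
    · have hz : ∀ y, R < ‖y‖ → h y = 0 := fun y hy => by
        by_contra hne
        have := hR (subset_tsupport _ hne)
        rw [mem_closedBall_zero_iff] at this
        linarith
      rw [mem_closedBall_zero_iff, not_le] at hx
      rw [indicator_of_notMem (by simpa using hx)]
      have hx0 : h x = 0 := hz x (by linarith)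
      have : ‖mol (c * s) h (x + s • e x) - h x‖ ≤ 0 := norm_mol_sub_le hcont.stronglyMeasurable _ _ fun v hv => by
        rw [hx0, hz, sub_zero, norm_zero]
        have h3 := hmove v hv
        have h4 := norm_sub_norm_le x (-(s • e x + (c * s) • v))
        rw [norm_neg, sub_neg_eq_add, ← add_assoc] at h4
        have : s * (L + c) ≤ 1 * (L + c) := by gcongr
        linarith
      rw [norm_le_zero_iff.1 this]
      simp
  have hkm : Measurable fun x => ‖g x - h x‖ₑ := (hgm.sub hhm).enorm
  calc ∫⁻ x, ‖mol (c * s) g (x + s • e x) - g x‖ₑ ≤ _ := lintegral_mono hpt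
    _ = ((∫⁻ x, ∫⁻ v, ‖kap n v‖ₑ *
        ‖g (x + s • e x + (c * s) • v) - h (x + s • e x + (c * s) • v)‖ₑ) + ∫⁻ x, ‖g x - h x‖ₑ)
        + ENNReal.ofReal ϖ * volume (closedBall (0 : Amb n) (R + L + c)) := by
      rw [lintegral_add_right _ (measurable_const.indicator measurableSet_closedBall),
        lintegral_add_right _ hkm, lintegral_indicator measurableSet_closedBall, setLIntegral_const]
    _ ≤ (2 ^ (n + 1) * ε₁ + ε₁) + ε / 2 := by
      gcongr
      exact (lintegral_kap_comp_le hec he hkm).trans (by gcongr)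
    _ ≤ ε / 2 + ε / 2 := by gcongr
    _ = ε := ENNReal.add_halves ε

/-! ### Weak gradients and averages -/

/-- The kernel centred at `p` is itself an admissible test function for the weak gradient. Only the
values of `ut` on the averaging ball matter, so `ut` may be a cut-off of `u` that is locally
integrable on the whole space. -/
lemma fderiv_mol {Ω : Set (Amb n)} {u ut : Amb n → ℂ}
    {G : Amb n → EuclideanSpace ℂ (Fin (n + 1))} (hu : HasWeakGradient Ω u G)
    (hΩ : MeasurableSet Ω)
    (hut : LocallyIntegrable ut) {t : ℝ} (ht : 0 < t) {p : Amb n}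
    (hball : closedBall p (t / 2) ⊆ Ω) (heq : ∀ w ∈ closedBall p (t / 2), ut w = u w) :
    fderiv ℝ (mol t ut) p = mol t (fun w => gradMap (G w)) p := by
  have hk := hasCompactSupport_kapAt (n := n) ht
  have hk1 : ContDiff ℝ 1 (kapAt t : Amb n → ℝ) := (contDiff_kapAt t).of_le (by norm_cast)
  have h1 := (hk.hasFDerivAt_convolution_right (ContinuousLinearMap.lsmul ℝ ℝ).flip hut hk1 p).fderiv
  rw [mol_eq_convolution ht, h1]
  set η : Amb n → ℝ := fun w => kapAt t (w - p) with hη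
  have hηs : ContDiff ℝ ∞ η := (contDiff_kapAt t).comp (contDiff_id.sub contDiff_const)
  have hηsupp : Function.support η ⊆ closedBall p (t / 2) := fun w hw => by
    rw [mem_closedBall, dist_eq_norm]
    by_contra h
    exact hw (kapAt_eq_zero ht (not_le.1 h).le)
  have hηt : tsupport η ⊆ closedBall p (t / 2) :=
    closure_minimal hηsupp isClosed_closedBall
  have hηc : HasCompactSupport η :=
    HasCompactSupport.of_support_subset_isCompact (isCompact_closedBall _ _) hηsupp
  refine clm_ext_single fun i => ?_
  have hInt : Integrable (fun w => η w • gradMap (G w)) := by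
    have hG : IntegrableOn (fun w => gradMap (G w)) (closedBall p (t / 2)) := by
      have := hu.2.1.integrableOn_compact_subset hball (isCompact_closedBall _ _)
      exact Integrable.mono' this.norm
        (continuous_gradMap.comp_aestronglyMeasurable this.aestronglyMeasurable)
        (Eventually.of_forall fun w => norm_gradMap_le _)
    refine (integrableOn_iff_integrable_of_support_subset (s := closedBall p (t / 2)) ?_).1
      (hG.continuousOn_smul hηs.continuous.continuousOn (isCompact_closedBall _ _))
    exact fun w hw => hηsupp fun h0 => hw (by simp [h0])
  rw [mol_eq ht, ContinuousLinearMap.integral_apply hInt,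
    convolution_precompR_apply _ hut (hk.fderiv ℝ) (hk1.continuous_fderiv one_ne_zero),
    convolution_def]
  have key := hu.2.2 η hηs hηc (hηt.trans hball) i
  have hfd : ∀ w, fderiv ℝ η w = -fderiv ℝ (kapAt t) (p - w) := fun w => by
    have e1 : η = fun w => kapAt t (p - w) := by
      ext w
      rw [hη, ← kapAt_neg, neg_sub]
    rw [e1]
    have e3 := (((contDiff_kapAt (n := n) t).differentiable (by simp)) (p - w)).hasFDerivAt.comp w
      ((hasFDerivAt_id w).const_sub p)
    rw [show (fun w => kapAt t (p - w)) = kapAt t ∘ HSub.hSub p from rfl, e3.fderiv]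
    ext v
    simp
  have hz : ∀ w ∉ closedBall p (t / 2), fderiv ℝ η w = 0 := fun w hw =>
    image_eq_zero_of_notMem_tsupport fun h => hw (hηt (tsupport_fderiv_subset ℝ h))
  have l1 : ∫ w, ((ContinuousLinearMap.lsmul ℝ ℝ).flip (ut w))
      (fderiv ℝ (kapAt t) (p - w) (EuclideanSpace.single i 1)) =
      -∫ w in Ω, fderiv ℝ η w (EuclideanSpace.single i 1) • u w := by
    rw [← integral_indicator hΩ, ← integral_neg]
    refine integral_congr_ae (Eventually.of_forall fun w => ?_)
    have e2 : fderiv ℝ (kapAt t) (p - w) = -fderiv ℝ η w := by rw [hfd, neg_neg]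
    by_cases hw : w ∈ closedBall p (t / 2)
    · simp [e2, indicator_of_mem (hball hw), heq w hw]
    · simp [e2, hz w hw, indicator]
  have l2 : ∫ w, (kapAt t (w - p) • gradMap (G w)) (EuclideanSpace.single i 1) =
      ∫ w in Ω, η w • G w i := by
    rw [← integral_indicator hΩ]
    refine integral_congr_ae (Eventually.of_forall fun w => ?_)
    by_cases hw : w ∈ closedBall p (t / 2)
    · simp [indicator_of_mem (hball hw), gradMap_single, hη]
    · have h0 : η w = 0 := by
        by_contra h
        exact hw (hηsupp h)
      have h0' : kapAt t (w - p) = 0 := h0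
      simp [h0', indicator, h0]
  rw [l1, l2, key, neg_neg]

/-- Mollify `u` cut off to a thickening of `K`. At points of `K` the small averages do not see the
cut-off, so their gradients are averages of `G`. -/
lemma exists_smooth_approx {Ω : Set (Amb n)} (hΩ : IsOpen Ω) {u : Amb n → ℂ}
    {G : Amb n → EuclideanSpace ℂ (Fin (n + 1))} (hu : HasWeakGradient Ω u G)
    (hum : Measurable u) (hGm : Measurable G) {K : Set (Amb n)} (hK : IsCompact K) (hKΩ : K ⊆ Ω) :
    ∃ w : ℕ → Amb n → ℂ, (∀ j, ContDiff ℝ ∞ (w j)) ∧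
      Tendsto (fun j => ∫⁻ x in K, ‖w j x - u x‖ₑ) atTop (𝓝 0) ∧
      Tendsto (fun j => ∫⁻ x in K, ‖fderiv ℝ (w j) x - gradMap (G x)‖ₑ) atTop (𝓝 0) := by
  obtain ⟨δ, hδ, hδK⟩ := hK.exists_cthickening_subset_open hΩ hKΩ
  have hK' : IsCompact (cthickening δ K) := hK.cthickening
  set ut := (cthickening δ K).indicator u
  set Gt := (cthickening δ K).indicator fun w => gradMap (G w)
  have hutm : StronglyMeasurable ut := (hum.indicator hK'.measurableSet).stronglyMeasurable
  have hGtm : StronglyMeasurable Gt :=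
    ((continuous_gradMap.measurable.comp hGm).indicator hK'.measurableSet).stronglyMeasurable
  have hut : Integrable ut :=
    (hu.1.integrableOn_compact_subset hδK hK').integrable_indicator hK'.measurableSet
  have hGt : Integrable Gt := by
    have := hu.2.1.integrableOn_compact_subset hδK hK'
    have h' : IntegrableOn (fun w => gradMap (G w)) (cthickening δ K) := Integrable.mono' this.norm
      (continuous_gradMap.comp_aestronglyMeasurable this.aestronglyMeasurable)
      (Eventually.of_forall fun w => norm_gradMap_le _)
    exact (integrable_indicator_iff (f := fun w => gradMap (G w)) (μ := volume)
      hK'.measurableSet).2 h'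
  have htend : Tendsto (fun j : ℕ => δ / ((j : ℝ) + 1)) atTop (𝓝[>] 0) := by
    refine tendsto_nhdsWithin_iff.2 ⟨?_, Eventually.of_forall fun j => ?_⟩
    · exact tendsto_const_div_atTop_nhds_zero_nat δ |>.comp (tendsto_add_atTop_nat 1) |>.congr
        fun j => by simp
    · exact div_pos hδ (by positivity)
  have htpos : ∀ j : ℕ, 0 < δ / ((j : ℝ) + 1) := fun j => div_pos hδ (by positivity)
  have htle : ∀ j : ℕ, δ / ((j : ℝ) + 1) / 2 ≤ δ := fun j => by
    rw [div_div, div_le_iff₀ (by positivity)]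
    nlinarith [(Nat.cast_nonneg j : (0 : ℝ) ≤ j)]
  have hcb : ∀ (j : ℕ), ∀ x ∈ K, closedBall x (δ / ((j : ℝ) + 1) / 2) ⊆ cthickening δ K :=
    fun j x hx => (closedBall_subset_closedBall (htle j)).trans (closedBall_subset_cthickening hx δ)
  refine ⟨fun j => mol (δ / (j + 1)) ut, fun j => contDiff_mol (htpos j) hut.locallyIntegrable,
    ?_, ?_⟩
  · have h := (tendsto_lintegral_mol_sub (e := fun _ => 0) (L := 0) (Λ := 0) one_pos
      continuous_const (by simp) (by simp) hutm hut).comp htend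
    refine tendsto_of_tendsto_of_tendsto_of_le_of_le tendsto_const_nhds h (fun _ => zero_le)
      fun j => ?_
    refine (setLIntegral_mono' hK.measurableSet fun x hx => ?_).trans (setLIntegral_le_lintegral K _)
    have : ut x = u x := indicator_of_mem (self_subset_cthickening K hx) _
    simp [this]
  · have h := (tendsto_lintegral_mol_sub (e := fun _ => 0) (L := 0) (Λ := 0) one_pos
      continuous_const (by simp) (by simp) hGtm hGt).comp htend
    refine tendsto_of_tendsto_of_tendsto_of_le_of_le tendsto_const_nhds h (fun _ => zero_le)
      fun j => ?_
    refine (setLIntegral_mono' hK.measurableSet fun x hx => ?_).trans (setLIntegral_le_lintegral K _)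
    have h1 : Gt x = gradMap (G x) := indicator_of_mem (self_subset_cthickening K hx) _
    rw [fderiv_mol hu hΩ.measurableSet hut.locallyIntegrable (htpos j) ((hcb j x hx).trans hδK)
      fun w hw => indicator_of_mem (hcb j x hx hw) _]
    have h2 : mol (δ / ((j : ℝ) + 1)) (fun w => gradMap (G w)) x = mol (δ / ((j : ℝ) + 1)) Gt x :=
      mol_congr (htpos j) fun w hw =>
        (indicator_of_mem (hcb j x hx (ball_subset_closedBall hw)) fun w => gradMap (G w)).symm
    rw [h2]
    simp [h1]


/-! ### Comparison of averages at different scales -/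

lemma enorm_sub_le_lintegral_fderiv {w : Amb n → ℂ} (hw : ContDiff ℝ ∞ w) (x d : Amb n)
    {a b : ℝ} (hab : a ≤ b) :
    ‖w (x + b • d) - w (x + a • d)‖ₑ ≤
      ENNReal.ofReal ‖d‖ * ∫⁻ τ in Ioc a b, ‖fderiv ℝ w (x + τ • d)‖ₑ := by
  have hline : ∀ τ : ℝ, HasDerivAt (fun τ : ℝ => x + τ • d) d τ := fun τ => by
    simpa using ((hasDerivAt_id τ).smul_const d).const_add x
  have hd : ∀ τ : ℝ, HasDerivAt (fun τ : ℝ => w (x + τ • d)) (fderiv ℝ w (x + τ • d) d) τ :=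
    fun τ => ((hw.differentiable (by simp)) _).hasFDerivAt.comp_hasDerivAt τ (hline τ)
  have hcont : Continuous fun τ : ℝ => fderiv ℝ w (x + τ • d) :=
    (hw.continuous_fderiv (by simp)).comp (by fun_prop)
  have hftc := intervalIntegral.integral_eq_sub_of_hasDerivAt (a := a) (b := b)
    (fun τ _ => hd τ) ((hcont.clm_apply continuous_const).intervalIntegrable _ _)
  rw [← hftc, intervalIntegral.integral_of_le hab]
  refine (enorm_integral_le_lintegral_enorm _).trans ?_
  rw [← lintegral_const_mul' _ _ ENNReal.ofReal_ne_top]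
  refine lintegral_mono fun τ => ?_
  rw [ofReal_norm, mul_comm]
  exact (fderiv ℝ w (x + τ • d)).le_opENorm d

set_option maxHeartbeats 800000 in
-- For smooth `u` the `τ`-derivative of the average at scale `c τ` about `x + τ d` is the average of
-- `∇u · (d + c v)`, and `|d + c v| ≤ ‖d‖ + c` where the kernel lives. The weakly differentiable
-- case follows by approximation.
lemma enorm_mol_sub_mol_le {Ω : Set (Amb n)} (hΩ : IsOpen Ω) {u : Amb n → ℂ}
    {G : Amb n → EuclideanSpace ℂ (Fin (n + 1))} (hu : HasWeakGradient Ω u G)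
    (hum : Measurable u) (hGm : Measurable G) {x d : Amb n} {c a b : ℝ} (hc : 0 < c) (ha : 0 < a)
    (hab : a ≤ b) (hmem : ∀ τ ∈ Icc a b, ∀ v : Amb n, ‖v‖ ≤ 1 / 2 → x + τ • d + (c * τ) • v ∈ Ω) :
    ‖mol (c * b) u (x + b • d) - mol (c * a) u (x + a • d)‖ₑ ≤
      ENNReal.ofReal (‖d‖ + c) *
        ∫⁻ τ in Ioc a b, ∫⁻ v, ‖kap n v‖ₑ * ‖G (x + τ • d + (c * τ) • v)‖ₑ := by
  -- The compact set swept by the averaging balls, on which smooth approximation is available.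
  set K : Set (Amb n) := (fun q : ℝ × Amb n => x + q.1 • d + (c * q.1) • q.2) ''
    (Icc a b ×ˢ closedBall 0 (1 / 2)) with hKdef
  have hK : IsCompact K :=
    (isCompact_Icc.prod (isCompact_closedBall _ _)).image (by fun_prop)
  have hKΩ : K ⊆ Ω := by
    rintro _ ⟨⟨τ, v⟩, ⟨h1, h2⟩, rfl⟩
    exact hmem τ h1 v (by simpa using h2)
  have hballK : ∀ τ ∈ Icc a b, ball (x + τ • d) (c * τ / 2) ⊆ K := fun τ hτ y hy => by
    have hcτ : 0 < c * τ := mul_pos hc (ha.trans_le hτ.1)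
    refine ⟨(τ, (c * τ)⁻¹ • (y - (x + τ • d))), ⟨hτ, ?_⟩, ?_⟩
    · rw [mem_ball, dist_eq_norm] at hy
      rw [mem_closedBall_zero_iff, norm_smul, norm_inv, Real.norm_of_nonneg hcτ.le,
        inv_mul_le_iff₀ hcτ]
      linarith
    · dsimp only
      rw [smul_smul, mul_inv_cancel₀ hcτ.ne', one_smul, add_sub_cancel]
  obtain ⟨w, hws, hw1, hw2⟩ := exists_smooth_approx hΩ hu hum hGm hK hKΩ
  have hafin : ∀ τ ∈ Icc a b, ∀ {k : Amb n → ℂ}, IntegrableOn k K →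
      ∫⁻ y in ball (x + τ • d) (c * τ / 2), ‖k y‖ₑ ≠ ⊤ := fun τ hτ k hk =>
    ((lintegral_mono_set (hballK τ hτ)).trans_lt hk.2).ne
  have huK : IntegrableOn u K := hu.1.integrableOn_compact_subset hKΩ hK
  have hwK : ∀ j, IntegrableOn (w j) K := fun j => (hws j).continuous.continuousOn.integrableOn_compact hK
  set P : ℝ≥0∞ := kapSup n * ENNReal.ofReal (((c * a) ^ (n + 1))⁻¹)
  have hPb : ∀ τ ∈ Icc a b, ∀ h : Amb n → ℝ≥0∞,
      ∫⁻ v, ‖kap n v‖ₑ * h (x + τ • d + (c * τ) • v) ≤ P * ∫⁻ y in K, h y := fun τ hτ h => by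
    have hcτ : 0 < c * τ := mul_pos hc (ha.trans_le hτ.1)
    refine (lintegral_kap_mul_le hcτ h _).trans ?_
    have h1 : 0 < c * a := mul_pos hc ha
    have h2 := hτ.1
    refine mul_le_mul' (mul_le_mul' le_rfl (ENNReal.ofReal_le_ofReal ?_))
      (lintegral_mono_set (hballK τ hτ))
    gcongr
  have hmolu : ∀ τ ∈ Icc a b, ∀ j, ‖mol (c * τ) u (x + τ • d) - mol (c * τ) (w j) (x + τ • d)‖ₑ ≤
      P * ∫⁻ y in K, ‖w j y - u y‖ₑ := fun τ hτ j => by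
    have hcτ : 0 < c * τ := mul_pos hc (ha.trans_le hτ.1)
    rw [← mol_sub hum.stronglyMeasurable (hws j).continuous.stronglyMeasurable hcτ
      (hafin τ hτ huK) (hafin τ hτ (hwK j))]
    refine (enorm_mol_le _ _ _).trans ((hPb τ hτ fun y => ‖u y - w j y‖ₑ).trans_eq ?_)
    simp_rw [← enorm_neg (u _ - _), neg_sub]
  have hsmooth : ∀ j, ‖mol (c * b) (w j) (x + b • d) - mol (c * a) (w j) (x + a • d)‖ₑ ≤
      ENNReal.ofReal (‖d‖ + c) *
        ∫⁻ τ in Ioc a b, ∫⁻ v, ‖kap n v‖ₑ * ‖fderiv ℝ (w j) (x + τ • d + (c * τ) • v)‖ₑ := by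
    intro j
    have hbI : b ∈ Icc a b := ⟨hab, le_rfl⟩
    have haI : a ∈ Icc a b := ⟨le_rfl, hab⟩
    have hcfd : Continuous (fderiv ℝ (w j)) := (hws j).continuous_fderiv (by simp)
    rw [mol, mol, ← integral_sub
      (integrable_kap_smul (hws j).continuous.stronglyMeasurable (mul_pos hc (ha.trans_le hab))
        (hafin b hbI (hwK j)))
      (integrable_kap_smul (hws j).continuous.stronglyMeasurable (mul_pos hc ha)
        (hafin a haI (hwK j)))]
    refine (enorm_integral_le_lintegral_enorm _).trans ?_
    rw [lintegral_lintegral_swap, ← lintegral_const_mul' _ _ ENNReal.ofReal_ne_top]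
    · refine lintegral_mono fun v => ?_
      dsimp only
      rw [← smul_sub, enorm_smul, lintegral_const_mul' _ _ (by simp)]
      by_cases hv : kap n v = 0
      · simp [hv]
      have hv' := norm_lt_of_kap_ne hv
      rw [mul_left_comm]
      gcongr
      have h1 : ∀ τ : ℝ, x + τ • d + (c * τ) • v = x + τ • (d + c • v) := fun τ => by
        rw [smul_add, smul_smul, mul_comm c, add_assoc]
      simp_rw [h1]
      refine (enorm_sub_le_lintegral_fderiv (hws j) x (d + c • v) hab).trans ?_
      gcongr
      refine (norm_add_le _ _).trans ?_
      rw [norm_smul, Real.norm_of_nonneg hc.le]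
      nlinarith
    · exact ((continuous_kap.comp continuous_snd).enorm.measurable.mul
        (hcfd.comp (by fun_prop : Continuous fun q : ℝ × Amb n =>
          x + q.1 • d + (c * q.1) • q.2)).enorm.measurable).aemeasurable
  have hGcm : Measurable fun q : ℝ × Amb n => ‖kap n q.2‖ₑ * ‖G (x + q.1 • d + (c * q.1) • q.2)‖ₑ :=
    (continuous_kap.comp continuous_snd).enorm.measurable.mul
      (hGm.comp (Continuous.measurable (by fun_prop))).enorm
  -- The estimate for the smooth `w j`, with the cost of replacing `w j` by `u` and its derivative
  -- by `G`. The extra terms vanish as `j → ∞` because `a > 0` keeps the factor `P` finite.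
  have hmain : ∀ j, ‖mol (c * b) u (x + b • d) - mol (c * a) u (x + a • d)‖ₑ ≤
      ENNReal.ofReal (‖d‖ + c) *
        (∫⁻ τ in Ioc a b, ∫⁻ v, ‖kap n v‖ₑ * ‖G (x + τ • d + (c * τ) • v)‖ₑ) +
      (ENNReal.ofReal (‖d‖ + c) * (P * ENNReal.ofReal (b - a)) *
          (∫⁻ y in K, ‖fderiv ℝ (w j) y - gradMap (G y)‖ₑ) +
        (2 * P) * ∫⁻ y in K, ‖w j y - u y‖ₑ) := by
    intro j
    have t1 := hmolu b ⟨hab, le_rfl⟩ j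
    have t2 := hmolu a ⟨le_rfl, hab⟩ j
    have t3 : ∫⁻ τ in Ioc a b, ∫⁻ v, ‖kap n v‖ₑ * ‖fderiv ℝ (w j) (x + τ • d + (c * τ) • v)‖ₑ ≤
        (∫⁻ τ in Ioc a b, ∫⁻ v, ‖kap n v‖ₑ * ‖G (x + τ • d + (c * τ) • v)‖ₑ) +
        P * ENNReal.ofReal (b - a) * ∫⁻ y in K, ‖fderiv ℝ (w j) y - gradMap (G y)‖ₑ := by
      have e1 : P * ENNReal.ofReal (b - a) * ∫⁻ y in K, ‖fderiv ℝ (w j) y - gradMap (G y)‖ₑ =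
          ∫⁻ τ in Ioc a b, P * ∫⁻ y in K, ‖fderiv ℝ (w j) y - gradMap (G y)‖ₑ := by
        rw [setLIntegral_const, Real.volume_Ioc]
        ring
      rw [e1, ← lintegral_add_left (hGcm.lintegral_prod_right')]
      refine setLIntegral_mono' measurableSet_Ioc fun τ hτ => ?_
      refine le_trans ?_ (add_le_add le_rfl
        (hPb τ ⟨hτ.1.le, hτ.2⟩ fun y => ‖fderiv ℝ (w j) y - gradMap (G y)‖ₑ))
      dsimp only
      have hGτ : Measurable fun v => ‖kap n v‖ₑ * ‖G (x + τ • d + (c * τ) • v)‖ₑ :=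
        continuous_kap.enorm.measurable.mul
          (hGm.comp (Continuous.measurable (by fun_prop))).enorm
      rw [← lintegral_add_left hGτ]
      refine lintegral_mono fun v => ?_
      dsimp only
      rw [← mul_add]
      gcongr
      set y := x + τ • d + (c * τ) • v
      calc ‖fderiv ℝ (w j) y‖ₑ = ‖gradMap (G y) + (fderiv ℝ (w j) y - gradMap (G y))‖ₑ := by
            congr 1; abel
        _ ≤ _ := (enorm_add_le (gradMap (G y)) (fderiv ℝ (w j) y - gradMap (G y))).trans
            (add_le_add (enorm_gradMap_le _) le_rfl)
    set p := mol (c * b) u (x + b • d)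
    set p' := mol (c * b) (w j) (x + b • d)
    set q := mol (c * a) u (x + a • d)
    set q' := mol (c * a) (w j) (x + a • d)
    have e2 : p - q = (p' - q') + ((p - p') - (q - q')) := by abel
    calc ‖p - q‖ₑ ≤ ‖p' - q'‖ₑ + (‖p - p'‖ₑ + ‖q - q'‖ₑ) := by
          rw [e2]
          exact (enorm_add_le _ _).trans (add_le_add le_rfl enorm_sub_le)
      _ ≤ _ := add_le_add ((hsmooth j).trans (mul_le_mul' le_rfl t3)) (add_le_add t1 t2)
      _ = _ := by ring
  have hPt : P ≠ ⊤ := ENNReal.mul_ne_top ENNReal.coe_ne_top ENNReal.ofReal_ne_top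
  have hlim := (tendsto_const_nhds (x := ENNReal.ofReal (‖d‖ + c) *
        (∫⁻ τ in Ioc a b, ∫⁻ v, ‖kap n v‖ₑ * ‖G (x + τ • d + (c * τ) • v)‖ₑ)) (f := atTop)).add
    ((ENNReal.Tendsto.const_mul (a := ENNReal.ofReal (‖d‖ + c) *
      (P * ENNReal.ofReal (b - a))) hw2 (Or.inr (ENNReal.mul_ne_top ENNReal.ofReal_ne_top
        (ENNReal.mul_ne_top hPt ENNReal.ofReal_ne_top)))).add
    (ENNReal.Tendsto.const_mul (a := 2 * P) hw1
      (Or.inr (ENNReal.mul_ne_top ENNReal.ofNat_ne_top hPt))))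
  simp only [mul_zero, add_zero] at hlim
  exact ge_of_tendsto' hlim hmain


/-! ### Transversal vector fields -/

/-- The points of `Ω` at distance at least `η` from the boundary. -/
def innerSet (Ω : Set (Amb n)) (η : ℝ) : Set (Amb n) := {x ∈ Ω | η ≤ infDist x (frontier Ω)}

/-- A point of the closure outside `Ω` lies on the frontier, at distance zero, so `Ω` may be
replaced by its closure in the definition. -/
lemma isClosed_innerSet {Ω : Set (Amb n)} {η : ℝ} (hη : 0 < η) : IsClosed (innerSet Ω η) := by
  have h : innerSet Ω η = closure Ω ∩ {x | η ≤ infDist x (frontier Ω)} := by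
    ext x
    refine ⟨fun h => ⟨subset_closure h.1, h.2⟩, fun h => ⟨?_, h.2⟩⟩
    by_contra hx
    have hf : x ∈ frontier Ω := ⟨h.1, fun hi => hx (interior_subset hi)⟩
    have := h.2
    rw [mem_ofPred_eq, infDist_zero_of_mem hf] at this
    linarith
  rw [h]
  exact isClosed_closure.inter (isClosed_le continuous_const (continuous_infDist_pt _))

lemma innerSet_subset (Ω : Set (Amb n)) (η : ℝ) : innerSet Ω η ⊆ Ω := fun _ h => h.1

lemma le_infDist_frontier {Ω : Set (Amb n)} (hΩ : IsOpen Ω) (hF : (frontier Ω).Nonempty)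
    {x : Amb n} {r : ℝ} (h : ball x r ⊆ Ω) : r ≤ infDist x (frontier Ω) := by
  refine (le_infDist hF).2 fun y hy => ?_
  by_contra hlt
  have : y ∈ Ω := h (by rw [mem_ball, dist_comm]; exact not_le.1 hlt)
  rw [hΩ.frontier_eq] at hy
  exact hy.2 this

lemma infDist_frontier_pos {Ω : Set (Amb n)} (hΩ : IsOpen Ω) (hF : (frontier Ω).Nonempty)
    {x : Amb n} (hx : x ∈ Ω) : 0 < infDist x (frontier Ω) := by
  obtain ⟨r, hr, h⟩ := Metric.isOpen_iff.1 hΩ x hx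
  exact hr.trans_le (le_infDist_frontier hΩ hF h)

/-- The ball misses the frontier, so interior and exterior of `Ω` split it into two open pieces;
being connected, it stays on the side of its centre. -/
lemma ball_infDist_frontier_subset {Ω : Set (Amb n)} {x : Amb n} (hx : x ∈ Ω) :
    ball x (infDist x (frontier Ω)) ⊆ Ω := by
  by_contra h
  obtain ⟨y, hy, hyΩ⟩ := not_subset.1 h
  have hx' : 0 < infDist x (frontier Ω) := dist_nonneg.trans_lt (mem_ball.1 hy)
  have hno : ∀ z ∈ ball x (infDist x (frontier Ω)), z ∉ frontier Ω := fun z hz hzf => by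
    have := infDist_le_dist_of_mem (x := x) hzf
    rw [mem_ball, dist_comm] at hz
    linarith
  have hcov : ∀ z ∈ ball x (infDist x (frontier Ω)), z ∈ interior Ω ∨ z ∈ (closure Ω)ᶜ :=
    fun z hz => by
      by_contra hcon
      rw [not_or, mem_compl_iff, not_not] at hcon
      exact hno z hz ⟨hcon.2, hcon.1⟩
  obtain ⟨z, -, hz1, hz2⟩ := (convex_ball x (infDist x (frontier Ω))).isPreconnected
    (interior Ω) (closure Ω)ᶜ isOpen_interior isClosed_closure.isOpen_compl hcov
    ⟨x, mem_ball_self hx', (hcov x (mem_ball_self hx')).resolve_right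
      fun h => h (subset_closure hx)⟩
    ⟨y, hy, (hcov y hy).resolve_left fun h => hyΩ (interior_subset h)⟩
  exact hz2 (subset_closure (interior_subset hz1))

/-- A smooth vector field `e` along which one moves from `closure Ω` into `Ω`, uniformly up to
scale `s₀`. -/
structure IsTransversal (Ω : Set (Amb n)) (e : Amb n → Amb n) (c L s₀ : ℝ) : Prop where
  c_pos : 0 < c
  c_le : c ≤ 1
  s_pos : 0 < s₀
  smooth : ContDiff ℝ ∞ e
  norm_le : ∀ x, ‖e x‖ ≤ L
  lip : ∀ x y, s₀ * ‖e x - e y‖ ≤ ‖x - y‖ / 2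
  mem : ∀ x ∈ closure Ω, ∀ s, 0 < s → s ≤ s₀ → ∀ v : Amb n, ‖v‖ < 1 →
    x + s • e x + (c * s) • v ∈ Ω

/-- The average of `u` at scale `s` over a ball in `Ω` displaced in the direction of `e`. -/
def tr (Ω : Set (Amb n)) (e : Amb n → Amb n) (c : ℝ) (u : Amb n → ℂ) (s : ℝ) (x : Amb n) : ℂ :=
  mol (c * s) ((innerSet Ω (c * s / 4)).indicator u) (x + s • e x)

namespace IsTransversal

variable {Ω : Set (Amb n)} {e : Amb n → Amb n} {c L s₀ : ℝ}

lemma L_nonneg (H : IsTransversal Ω e c L s₀)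
    : 0 ≤ L := (norm_nonneg _).trans (H.norm_le 0)

lemma ball_subset (H : IsTransversal Ω e c L s₀)
    {x : Amb n} (hx : x ∈ closure Ω) {s : ℝ} (hs : 0 < s) (hs' : s ≤ s₀) :
    ball (x + s • e x) (c * s) ⊆ Ω := fun y hy => by
  have hcs : 0 < c * s := mul_pos H.c_pos hs
  have h := H.mem x hx s hs hs' ((c * s)⁻¹ • (y - (x + s • e x))) (by
    rw [norm_smul, norm_inv, Real.norm_of_nonneg hcs.le, inv_mul_lt_iff₀ hcs, mul_one,
      ← dist_eq_norm]
    exact hy)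
  rwa [smul_smul, mul_inv_cancel₀ hcs.ne', one_smul, add_sub_cancel] at h

lemma infDist_ge (H : IsTransversal Ω e c L s₀)
    (hΩ : IsOpen Ω) (hF : (frontier Ω).Nonempty) {x : Amb n} (hx : x ∈ closure Ω)
    {s : ℝ} (hs : 0 < s) (hs' : s ≤ s₀) {w : Amb n} (hw : w ∈ closedBall (x + s • e x) (c * s / 2)) :
    c * s / 2 ≤ infDist w (frontier Ω) := by
  refine le_infDist_frontier hΩ hF ((ball_subset_ball' ?_).trans (H.ball_subset hx hs hs'))
  rw [mem_closedBall] at hw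
  linarith

lemma closedBall_subset_innerSet (H : IsTransversal Ω e c L s₀)
    (hΩ : IsOpen Ω) (hF : (frontier Ω).Nonempty) {x : Amb n}
    (hx : x ∈ closure Ω) {s : ℝ} (hs : 0 < s) (hs' : s ≤ s₀) :
    closedBall (x + s • e x) (c * s / 2) ⊆ innerSet Ω (c * s / 4) := fun w hw => by
  have hcs : 0 < c * s := mul_pos H.c_pos hs
  refine ⟨H.ball_subset hx hs hs' (closedBall_subset_ball (by linarith) hw), ?_⟩
  have := H.infDist_ge hΩ hF hx hs hs' hw
  linarith

lemma norm_move_le (H : IsTransversal Ω e c L s₀)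
    (x v : Amb n) {s : ℝ} (hs : 0 < s) (hv : ‖v‖ ≤ 1) :
    ‖s • e x + (c * s) • v‖ ≤ (L + 1) * s := by
  refine (norm_add_le _ _).trans ?_
  have hcs : 0 < c * s := mul_pos H.c_pos hs
  rw [norm_smul, norm_smul, Real.norm_of_nonneg hs.le, Real.norm_of_nonneg hcs.le]
  have h1 := H.norm_le x
  have h2 := H.c_le
  have h3 : s * ‖e x‖ ≤ s * L := by gcongr
  have h4 : c * s * ‖v‖ ≤ 1 * s * 1 := by gcongr
  linarith

lemma lip_smul (H : IsTransversal Ω e c L s₀)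
    {s : ℝ} (hs : 0 < s) (hs' : s ≤ s₀) (x y : Amb n) :
    ‖s • e x - s • e y‖ ≤ ‖x - y‖ / 2 := by
  rw [← smul_sub, norm_smul, Real.norm_of_nonneg hs.le]
  exact (mul_le_mul_of_nonneg_right hs' (norm_nonneg _)).trans (H.lip x y)

lemma norm_fderiv_le (H : IsTransversal Ω e c L s₀)
    (x : Amb n) : ‖fderiv ℝ e x‖ ≤ 1 / (2 * s₀) := by
  have hs := H.s_pos
  have hl : LipschitzWith (1 / (2 * s₀)).toNNReal e := by
    refine LipschitzWith.of_dist_le_mul fun x y => ?_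
    rw [dist_eq_norm, dist_eq_norm, Real.coe_toNNReal _ (by positivity)]
    have := H.lip x y
    field_simp
    linarith
  have h := norm_fderiv_le_of_lipschitz ℝ hl (x₀ := x)
  rwa [Real.coe_toNNReal _ (by positivity)] at h

variable {u : Amb n → ℂ} {G : Amb n → EuclideanSpace ℂ (Fin (n + 1))}

/-- The cut-off in `tr` only serves to make the average smooth on the whole space; at points of
`closure Ω` the averaging ball lies in the inner set and does not feel it. -/
lemma tr_eq (H : IsTransversal Ω e c L s₀)
    (hΩ : IsOpen Ω) (hF : (frontier Ω).Nonempty) {x : Amb n} (hx : x ∈ closure Ω)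
    {s : ℝ} (hs : 0 < s) (hs' : s ≤ s₀) : tr Ω e c u s x = mol (c * s) u (x + s • e x) :=
  mol_congr (mul_pos H.c_pos hs) fun _ hw => indicator_of_mem
    (H.closedBall_subset_innerSet hΩ hF hx hs hs' (ball_subset_closedBall hw)) _

lemma _root_.AvTrace.locallyIntegrable_innerSet (hu : LocallyIntegrableOn u Ω) {η : ℝ}
    (hη : 0 < η) : LocallyIntegrable ((innerSet Ω η).indicator u) := by
  rw [locallyIntegrable_iff]
  intro K hK
  have hc := isClosed_innerSet (Ω := Ω) hη
  rw [IntegrableOn, integrable_indicator_iff hc.measurableSet, IntegrableOn,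
    Measure.restrict_restrict hc.measurableSet]
  exact hu.integrableOn_compact_subset (inter_subset_left.trans (innerSet_subset _ _))
    (hK.inter_left hc)

lemma contDiff_tr (H : IsTransversal Ω e c L s₀)
    (hu : LocallyIntegrableOn u Ω) {s : ℝ} (hs : 0 < s) :
    ContDiff ℝ ∞ (tr Ω e c u s) := by
  have hcs : 0 < c * s := mul_pos H.c_pos hs
  exact (contDiff_mol hcs (locallyIntegrable_innerSet hu (by positivity))).comp
    (contDiff_id.add (H.smooth.const_smul s))

lemma fderiv_tr (H : IsTransversal Ω e c L s₀)
    (hΩ : IsOpen Ω) (hF : (frontier Ω).Nonempty) (hu : HasWeakGradient Ω u G)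
    {x : Amb n} (hx : x ∈ closure Ω) {s : ℝ} (hs : 0 < s) (hs' : s ≤ s₀) :
    fderiv ℝ (tr Ω e c u s) x = (mol (c * s) (fun w => gradMap (G w)) (x + s • e x)).comp
      (ContinuousLinearMap.id ℝ (Amb n) + s • fderiv ℝ e x) := by
  have hcs : 0 < c * s := mul_pos H.c_pos hs
  have hli := locallyIntegrable_innerSet hu.1 (η := c * s / 4) (by positivity)
  have hcb := H.closedBall_subset_innerSet hΩ hF hx hs hs'
  have h1 := fderiv_mol hu hΩ.measurableSet hli hcs (hcb.trans (innerSet_subset _ _))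
    fun w hw => indicator_of_mem (hcb hw) _
  have h2 : HasFDerivAt (fun y => y + s • e y)
      (ContinuousLinearMap.id ℝ (Amb n) + s • fderiv ℝ e x) x :=
    (hasFDerivAt_id x).add (((H.smooth.differentiable (by simp)) x).hasFDerivAt.const_smul s)
  have h3 := (((contDiff_mol hcs hli).differentiable (by simp)) (x + s • e x)).hasFDerivAt.comp x h2
  rw [← h1]
  exact h3.fderiv

lemma norm_fderiv_tr_le (H : IsTransversal Ω e c L s₀)
    (hΩ : IsOpen Ω) (hF : (frontier Ω).Nonempty)
    (hu : HasWeakGradient Ω u G) {x : Amb n} (hx : x ∈ closure Ω) {s : ℝ} (hs : 0 < s)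
    (hs' : s ≤ s₀) : ‖fderiv ℝ (tr Ω e c u s) x‖ₑ ≤
      2 * ∫⁻ v, ‖kap n v‖ₑ * ‖G (x + s • e x + (c * s) • v)‖ₑ := by
  rw [H.fderiv_tr hΩ hF hu hx hs hs']
  have h1 : ‖ContinuousLinearMap.id ℝ (Amb n) + s • fderiv ℝ e x‖ ≤ 2 := by
    have h0 := H.s_pos
    have h2 : ‖s • fderiv ℝ e x‖ ≤ 1 := by
      rw [norm_smul, Real.norm_of_nonneg hs.le]
      calc s * ‖fderiv ℝ e x‖ ≤ s₀ * (1 / (2 * s₀)) := by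
            gcongr
            exact H.norm_fderiv_le x
        _ = 1 / 2 := by field_simp
        _ ≤ 1 := by norm_num
    have h3 := ContinuousLinearMap.norm_id_le (𝕜 := ℝ) (E := Amb n)
    linarith [norm_add_le (ContinuousLinearMap.id ℝ (Amb n)) (s • fderiv ℝ e x)]
  set A := mol (c * s) (fun w => gradMap (G w)) (x + s • e x)
  calc ‖A.comp (ContinuousLinearMap.id ℝ (Amb n) + s • fderiv ℝ e x)‖ₑ ≤ 2 * ‖A‖ₑ := by
        rw [mul_comm]
        refine le_trans ?_ (mul_le_mul' le_rfl (ENNReal.ofReal_ofNat 2).le)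
        rw [← ofReal_norm, ← ofReal_norm, ← ENNReal.ofReal_mul (norm_nonneg _)]
        refine ENNReal.ofReal_le_ofReal ((A.opNorm_comp_le _).trans ?_)
        gcongr
    _ ≤ _ := by
        gcongr
        refine (enorm_mol_le _ _ _).trans (lintegral_mono fun v => ?_)
        gcongr
        exact enorm_gradMap_le _

lemma enorm_tr_sub_le (H : IsTransversal Ω e c L s₀)
    (hΩ : IsOpen Ω) (hF : (frontier Ω).Nonempty) (hu : HasWeakGradient Ω u G)
    (hum : Measurable u) (hGm : Measurable G) {x : Amb n} (hx : x ∈ closure Ω) {a b : ℝ}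
    (ha : 0 < a) (hab : a ≤ b) (hb : b ≤ s₀) :
    ‖tr Ω e c u b x - tr Ω e c u a x‖ₑ ≤ ENNReal.ofReal (L + 1) *
      ∫⁻ τ in Ioc a b, ∫⁻ v, ‖kap n v‖ₑ * ‖G (x + τ • e x + (c * τ) • v)‖ₑ := by
  rw [H.tr_eq hΩ hF hx (ha.trans_le hab) hb, H.tr_eq hΩ hF hx ha (hab.trans hb)]
  refine (enorm_mol_sub_mol_le hΩ hu hum hGm H.c_pos ha hab fun τ hτ v hv =>
    H.mem x hx τ (ha.trans_le hτ.1) (hτ.2.trans hb) v (by linarith)).trans ?_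
  gcongr
  · exact H.norm_le x
  · exact H.c_le

/-- Integrate the pointwise bound over `x` first: at each `τ` the displaced average costs a factor
`2^(n+1)`, and the `τ`-interval has length at most `b`. The bound is uniform in `a`, so `a` can tend
to zero. -/
lemma lintegral_tr_sub_tr_le (H : IsTransversal Ω e c L s₀)
    (hΩ : IsOpen Ω) (hF : (frontier Ω).Nonempty)
    (hu : HasWeakGradient Ω u G) (hum : Measurable u) (hGm : Measurable G) (R : ℝ) {a b : ℝ}
    (ha : 0 < a) (hab : a ≤ b) (hb : b ≤ s₀) :
    ∫⁻ x in Ω ∩ ball 0 R, ‖tr Ω e c u b x - tr Ω e c u a x‖ₑ ≤ ENNReal.ofReal (L + 1) *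
      (ENNReal.ofReal b * (2 ^ (n + 1) * ∫⁻ x in Ω ∩ ball 0 (R + (L + 1) * s₀), ‖G x‖ₑ)) := by
  have hms : MeasurableSet (Ω ∩ ball (0 : Amb n) (R + (L + 1) * s₀)) :=
    hΩ.measurableSet.inter measurableSet_ball
  set g : Amb n → ℝ≥0∞ := (Ω ∩ ball 0 (R + (L + 1) * s₀)).indicator fun x => ‖G x‖ₑ
  have hg : Measurable g := hGm.enorm.indicator hms
  have hmeas : Measurable fun q : Amb n × ℝ =>
      ∫⁻ v, ‖kap n v‖ₑ * g (q.1 + q.2 • e q.1 + (c * q.2) • v) := by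
    have h1 : Measurable fun q : (Amb n × ℝ) × Amb n =>
        ‖kap n q.2‖ₑ * g (q.1.1 + q.1.2 • e q.1.1 + (c * q.1.2) • q.2) := by
      have he := H.smooth.continuous
      exact (continuous_kap.comp continuous_snd).enorm.measurable.mul
        (hg.comp (Continuous.measurable (by fun_prop)))
    exact h1.lintegral_prod_right'
  calc ∫⁻ x in Ω ∩ ball 0 R, ‖tr Ω e c u b x - tr Ω e c u a x‖ₑ
      ≤ ∫⁻ x, ENNReal.ofReal (L + 1) *
          ∫⁻ τ in Ioc a b, ∫⁻ v, ‖kap n v‖ₑ * g (x + τ • e x + (c * τ) • v) := by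
        refine (setLIntegral_mono' (hΩ.measurableSet.inter measurableSet_ball) fun x hx => ?_).trans
          (setLIntegral_le_lintegral _ _)
        refine (H.enorm_tr_sub_le hΩ hF hu hum hGm (subset_closure hx.1) ha hab hb).trans ?_
        refine mul_le_mul' le_rfl ?_
        refine setLIntegral_mono' measurableSet_Ioc fun τ hτ => lintegral_mono fun v => ?_
        by_cases hv : kap n v = 0
        · simp [hv]
        have hv' := norm_lt_of_kap_ne hv
        have hτ0 := ha.trans hτ.1
        have hmem : x + τ • e x + (c * τ) • v ∈ Ω ∩ ball 0 (R + (L + 1) * s₀) := by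
          refine ⟨H.mem x (subset_closure hx.1) τ hτ0 (hτ.2.trans hb) v (by linarith), ?_⟩
          have h1 := H.norm_move_le x v hτ0 (by linarith)
          have h2 := mem_ball_zero_iff.1 hx.2
          rw [mem_ball_zero_iff, add_assoc]
          have h3 : (L + 1) * τ ≤ (L + 1) * s₀ :=
            mul_le_mul_of_nonneg_left (hτ.2.trans hb) (by linarith [H.L_nonneg])
          linarith [norm_add_le x (τ • e x + (c * τ) • v)]
        simp only [g, indicator_of_mem hmem, le_refl]
    _ = ENNReal.ofReal (L + 1) * ∫⁻ τ in Ioc a b, ∫⁻ x, ∫⁻ v,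
          ‖kap n v‖ₑ * g (x + τ • e x + (c * τ) • v) := by
        rw [lintegral_const_mul' _ _ ENNReal.ofReal_ne_top,
          lintegral_lintegral_swap hmeas.aemeasurable]
    _ ≤ ENNReal.ofReal (L + 1) * ∫⁻ τ in Ioc a b, 2 ^ (n + 1) * ∫⁻ x, g x := by
        refine mul_le_mul' le_rfl ?_
        refine setLIntegral_mono' measurableSet_Ioc fun τ hτ => ?_
        exact lintegral_kap_comp_le H.smooth.continuous
          (H.lip_smul (ha.trans hτ.1) (hτ.2.trans hb)) hg
    _ ≤ _ := by
        rw [setLIntegral_const, Real.volume_Ioc, lintegral_indicator hms, mul_comm (2 ^ _ * _)]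
        gcongr
        linarith

/-- Let `a → 0` in `lintegral_tr_sub_tr_le`. As `u` is not known to be integrable up to the
boundary, the limit is taken on inner sets, where small averages converge to `u` in the mean, and
these then exhaust `Ω`. -/
lemma lintegral_tr_sub_le (H : IsTransversal Ω e c L s₀)
    (hΩ : IsOpen Ω) (hF : (frontier Ω).Nonempty)
    (hu : HasWeakGradient Ω u G) (hum : Measurable u) (hGm : Measurable G) (R : ℝ) {b : ℝ}
    (hb0 : 0 < b) (hb : b ≤ s₀) :
    ∫⁻ x in Ω ∩ ball 0 R, ‖tr Ω e c u b x - u x‖ₑ ≤ ENNReal.ofReal (L + 1) *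
      (ENNReal.ofReal b * (2 ^ (n + 1) * ∫⁻ x in Ω ∩ ball 0 (R + (L + 1) * s₀), ‖G x‖ₑ)) := by
  set B := ENNReal.ofReal (L + 1) *
      (ENNReal.ofReal b * (2 ^ (n + 1) * ∫⁻ x in Ω ∩ ball 0 (R + (L + 1) * s₀), ‖G x‖ₑ))
  have hpart : ∀ k : ℕ, ∫⁻ x in innerSet Ω (1 / (k + 1)) ∩ ball 0 R, ‖tr Ω e c u b x - u x‖ₑ ≤ B := by
    intro k
    set η : ℝ := 1 / (k + 1)
    have hη : 0 < η := by positivity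
    have hc1 := isClosed_innerSet (Ω := Ω) hη
    have hc2 := isClosed_innerSet (Ω := Ω) (half_pos hη)
    have hms2 : MeasurableSet (innerSet Ω (η / 2) ∩ closedBall 0 (R + (L + 1) * s₀)) :=
      hc2.measurableSet.inter measurableSet_closedBall
    have hms1 : MeasurableSet (innerSet Ω η ∩ ball (0 : Amb n) R) :=
      hc1.measurableSet.inter measurableSet_ball
    set g : Amb n → ℂ := (innerSet Ω (η / 2) ∩ closedBall 0 (R + (L + 1) * s₀)).indicator u
    have hgm : StronglyMeasurable g := (hum.indicator hms2).stronglyMeasurable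
    have hgi : Integrable g := by
      refine IntegrableOn.integrable_indicator ?_ hms2
      exact hu.1.integrableOn_compact_subset (inter_subset_left.trans (innerSet_subset _ _))
        ((isCompact_closedBall _ _).inter_left hc2)
    have hs0 := H.s_pos
    have hlim := tendsto_lintegral_mol_sub H.c_pos H.smooth.continuous H.norm_le
      (Λ := 1 / (2 * s₀)) (fun x y => by
        have := H.lip x y
        field_simp
        linarith) hgm hgi
    have hsmall : ∀ᶠ a : ℝ in 𝓝[>] 0, 0 < a ∧ a < b ∧ a * (L + 1) < η / 2 := by
      have c1 : Tendsto (fun s : ℝ => s * (L + 1)) (𝓝[>] 0) (𝓝 0) := by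
        simpa using ((continuous_mul_const (L + 1)).tendsto 0).mono_left nhdsWithin_le_nhds
      have c3 : Tendsto (fun s : ℝ => s) (𝓝[>] 0) (𝓝 0) := nhdsWithin_le_nhds
      filter_upwards [self_mem_nhdsWithin, c3.eventually_lt_const hb0,
        c1.eventually_lt_const (half_pos hη)] with a h1 h2 h3 using ⟨h1, h2, h3⟩
    have hlim2 := (tendsto_const_nhds (x := B)).add hlim
    rw [add_zero] at hlim2
    refine ge_of_tendsto hlim2 ?_
    filter_upwards [hsmall] with a ⟨ha0, hab, haη⟩
    have hLs : (L + 1) * a ≤ (L + 1) * s₀ :=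
      mul_le_mul_of_nonneg_left (hab.le.trans hb) (by linarith [H.L_nonneg])
    have hcont : ∀ s, 0 < s → Measurable (tr Ω e c u s) := fun s hs =>
      (H.contDiff_tr hu.1 hs).continuous.measurable
    calc ∫⁻ x in innerSet Ω η ∩ ball 0 R, ‖tr Ω e c u b x - u x‖ₑ
        ≤ ∫⁻ x in innerSet Ω η ∩ ball 0 R, (‖tr Ω e c u b x - tr Ω e c u a x‖ₑ +
            ‖mol (c * a) g (x + a • e x) - g x‖ₑ) := by
          refine setLIntegral_mono' hms1 fun x hx => ?_
          have h1 : g x = u x := indicator_of_mem (by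
            refine ⟨⟨hx.1.1, ?_⟩, ?_⟩
            · linarith [hx.1.2]
            · have := mem_ball_zero_iff.1 hx.2
              rw [mem_closedBall_zero_iff]
              have := mul_nonneg (by linarith [H.L_nonneg] : 0 ≤ L + 1) hs0.le
              linarith) _
          have h2 : mol (c * a) g (x + a • e x) = tr Ω e c u a x := by
            rw [H.tr_eq hΩ hF (subset_closure hx.1.1) ha0 (hab.le.trans hb)]
            refine mol_congr (mul_pos H.c_pos ha0) fun w hw => indicator_of_mem ?_ _
            have hwi := H.closedBall_subset_innerSet hΩ hF (subset_closure hx.1.1) ha0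
              (hab.le.trans hb) (ball_subset_closedBall hw)
            have hd : dist w x ≤ (L + 1) * a := by
              have q1 := H.norm_le x
              have q2 := H.c_le
              rw [mem_ball] at hw
              have q3 : dist (x + a • e x) x ≤ a * L := by
                rw [dist_eq_norm, add_sub_cancel_left, norm_smul, Real.norm_of_nonneg ha0.le]
                gcongr
              have q4 : c * a ≤ 1 * a := by gcongr
              linarith [dist_triangle w (x + a • e x) x]
            refine ⟨⟨hwi.1, ?_⟩, ?_⟩
            · have q5 := infDist_le_infDist_add_dist (s := frontier Ω) (x := x) (y := w)
              rw [dist_comm] at q5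
              linarith [hx.1.2]
            · have := mem_ball_zero_iff.1 hx.2
              rw [mem_closedBall_zero_iff]
              rw [dist_eq_norm] at hd
              linarith [norm_le_norm_add_norm_sub' w x]
          rw [h1, h2]
          calc ‖tr Ω e c u b x - u x‖ₑ
              = ‖(tr Ω e c u b x - tr Ω e c u a x) + (tr Ω e c u a x - u x)‖ₑ := by
                congr 1; ring
            _ ≤ _ := enorm_add_le _ _
      _ = (∫⁻ x in innerSet Ω η ∩ ball 0 R, ‖tr Ω e c u b x - tr Ω e c u a x‖ₑ) +
            ∫⁻ x in innerSet Ω η ∩ ball 0 R, ‖mol (c * a) g (x + a • e x) - g x‖ₑ :=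
          lintegral_add_left ((hcont b hb0).sub (hcont a ha0)).enorm _
      _ ≤ B + ∫⁻ x, ‖mol (c * a) g (x + a • e x) - g x‖ₑ := by
          refine add_le_add ?_ (setLIntegral_le_lintegral _ _)
          exact (lintegral_mono_set (inter_subset_inter_left _ (innerSet_subset _ _))).trans
            (H.lintegral_tr_sub_tr_le hΩ hF hu hum hGm R ha0 hab.le hb)
  have hU : Ω ∩ ball 0 R = ⋃ k : ℕ, innerSet Ω (1 / (k + 1)) ∩ ball 0 R := by
    rw [← iUnion_inter]
    congr 1
    refine Subset.antisymm (fun x hx => ?_) (iUnion_subset fun k => innerSet_subset _ _)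
    obtain ⟨k, hk⟩ := exists_nat_one_div_lt (infDist_frontier_pos hΩ hF hx)
    exact mem_iUnion.2 ⟨k, hx, hk.le⟩
  rw [hU, setLIntegral_iUnion_of_directed]
  · exact iSup_le hpart
  · refine Monotone.directed_le fun i j hij => inter_subset_inter_left _ fun x hx => ⟨hx.1, ?_⟩
    refine le_trans ?_ hx.2
    exact one_div_le_one_div_of_le (by positivity) (by gcongr)

lemma tendsto_lintegral_tr_sub (H : IsTransversal Ω e c L s₀)
    (hΩ : IsOpen Ω) (hF : (frontier Ω).Nonempty)
    (hu : HasWeakGradient Ω u G) (hum : Measurable u) (hGm : Measurable G)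
    (hGi : ∀ R : ℝ, ∫⁻ x in Ω ∩ ball 0 R, ‖G x‖ₑ ≠ ⊤) (R : ℝ) :
    Tendsto (fun s => ∫⁻ x in Ω ∩ ball 0 R, ‖tr Ω e c u s x - u x‖ₑ) (𝓝[>] 0) (𝓝 0) := by
  have h1 : Tendsto (fun b : ℝ => ENNReal.ofReal (L + 1) *
      (ENNReal.ofReal b * (2 ^ (n + 1) * ∫⁻ x in Ω ∩ ball 0 (R + (L + 1) * s₀), ‖G x‖ₑ)))
      (𝓝[>] 0) (𝓝 0) := by
    have h2 : Tendsto (fun b : ℝ => ENNReal.ofReal b) (𝓝[>] 0) (𝓝 0) := by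
      simpa using (ENNReal.continuous_ofReal.tendsto 0).mono_left nhdsWithin_le_nhds
    have h3 := ENNReal.Tendsto.const_mul (a := ENNReal.ofReal (L + 1))
      (ENNReal.Tendsto.mul_const (b := 2 ^ (n + 1) *
        ∫⁻ x in Ω ∩ ball 0 (R + (L + 1) * s₀), ‖G x‖ₑ) h2
        (Or.inr (ENNReal.mul_ne_top (by simp) (hGi _)))) (Or.inr ENNReal.ofReal_ne_top)
    simpa using h3
  refine tendsto_of_tendsto_of_tendsto_of_le_of_le' tendsto_const_nhds h1
    (Eventually.of_forall fun _ => zero_le) ?_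
  filter_upwards [Ioc_mem_nhdsGT H.s_pos] with b hb
  exact H.lintegral_tr_sub_le hΩ hF hu hum hGm R hb.1 hb.2

/-- By the chain rule the derivative is an average of the gradient composed with `id + s De`. The
averages converge in the mean, and the term with `s De` costs a factor proportional to `s`. -/
lemma tendsto_lintegral_fderiv_tr_sub (H : IsTransversal Ω e c L s₀)
    (hΩ : IsOpen Ω) (hF : (frontier Ω).Nonempty)
    (hu : HasWeakGradient Ω u G) (hGm : Measurable G)
    (hGi : ∀ R : ℝ, ∫⁻ x in Ω ∩ ball 0 R, ‖G x‖ₑ ≠ ⊤) (R : ℝ) :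
    Tendsto (fun s => ∫⁻ x in Ω ∩ ball 0 R, ‖fderiv ℝ (tr Ω e c u s) x - gradMap (G x)‖ₑ)
      (𝓝[>] 0) (𝓝 0) := by
  have hs0 := H.s_pos
  have hms : MeasurableSet (Ω ∩ ball (0 : Amb n) (R + (L + 1) * s₀)) :=
    hΩ.measurableSet.inter measurableSet_ball
  set g : Amb n → (Amb n →L[ℝ] ℂ) :=
    (Ω ∩ ball 0 (R + (L + 1) * s₀)).indicator fun x => gradMap (G x)
  have hgm : StronglyMeasurable g :=
    ((continuous_gradMap.measurable.comp hGm).indicator hms).stronglyMeasurable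
  have hgfin : ∫⁻ x, ‖g x‖ₑ ≠ ⊤ := by
    have : ∀ x, ‖g x‖ₑ = (Ω ∩ ball 0 (R + (L + 1) * s₀)).indicator (fun x => ‖gradMap (G x)‖ₑ) x :=
      fun x => enorm_indicator_eq_indicator_enorm (fun x => gradMap (G x)) x
    simp_rw [this]
    rw [lintegral_indicator hms]
    exact ((lintegral_mono fun x => enorm_gradMap_le (G x)).trans_lt (hGi _).lt_top).ne
  have hgi : Integrable g := ⟨hgm.aestronglyMeasurable, hgfin.lt_top⟩
  have hlim := tendsto_lintegral_mol_sub H.c_pos H.smooth.continuous H.norm_le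
      (Λ := 1 / (2 * s₀)) (fun x y => by
        have := H.lip x y
        field_simp
        linarith) hgm hgi
  have h2 : Tendsto (fun s : ℝ => ENNReal.ofReal (s / (2 * s₀)) *
      (2 ^ (n + 1) * ∫⁻ x, ‖g x‖ₑ)) (𝓝[>] 0) (𝓝 0) := by
    have h3 : Tendsto (fun s : ℝ => ENNReal.ofReal (s / (2 * s₀))) (𝓝[>] 0) (𝓝 0) := by
      have : Continuous fun s : ℝ => ENNReal.ofReal (s / (2 * s₀)) :=
        ENNReal.continuous_ofReal.comp (by fun_prop)
      simpa using (this.tendsto 0).mono_left nhdsWithin_le_nhds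
    simpa using ENNReal.Tendsto.mul_const h3 (Or.inr (ENNReal.mul_ne_top (by simp) hgfin))
  have hlim2 := hlim.add h2
  rw [add_zero] at hlim2
  refine tendsto_of_tendsto_of_tendsto_of_le_of_le' tendsto_const_nhds hlim2
    (Eventually.of_forall fun _ => zero_le) ?_
  filter_upwards [Ioc_mem_nhdsGT H.s_pos] with s hs
  have hgem : Measurable fun x => ‖g x‖ₑ := hgm.enorm
  have hmolm : Measurable fun x => ∫⁻ v, ‖kap n v‖ₑ * ‖g (x + s • e x + (c * s) • v)‖ₑ := by
    have h1 : Measurable fun q : Amb n × Amb n =>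
        ‖kap n q.2‖ₑ * ‖g (q.1 + s • e q.1 + (c * s) • q.2)‖ₑ := by
      have he := H.smooth.continuous
      exact (continuous_kap.comp continuous_snd).enorm.measurable.mul
        (hgem.comp (Continuous.measurable (by fun_prop)))
    exact h1.lintegral_prod_right'
  calc ∫⁻ x in Ω ∩ ball 0 R, ‖fderiv ℝ (tr Ω e c u s) x - gradMap (G x)‖ₑ
      ≤ ∫⁻ x, (‖mol (c * s) g (x + s • e x) - g x‖ₑ + ENNReal.ofReal (s / (2 * s₀)) *
          ∫⁻ v, ‖kap n v‖ₑ * ‖g (x + s • e x + (c * s) • v)‖ₑ) := by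
        refine (setLIntegral_mono' (hΩ.measurableSet.inter measurableSet_ball) fun x hx => ?_).trans
          (setLIntegral_le_lintegral _ _)
        have hxc := subset_closure hx.1
        rw [H.fderiv_tr hΩ hF hu hxc hs.1 hs.2]
        have e1 : mol (c * s) (fun w => gradMap (G w)) (x + s • e x) =
            mol (c * s) g (x + s • e x) := by
          refine mol_congr (mul_pos H.c_pos hs.1) fun w hw =>
            (indicator_of_mem ?_ fun x => gradMap (G x)).symm
          refine ⟨(H.closedBall_subset_innerSet hΩ hF hxc hs.1 hs.2 (ball_subset_closedBall hw)).1,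
            ?_⟩
          have q1 := H.norm_le x
          have q2 := H.c_le
          rw [mem_ball] at hw
          have q3 : dist (x + s • e x) x ≤ s * L := by
            rw [dist_eq_norm, add_sub_cancel_left, norm_smul, Real.norm_of_nonneg hs.1.le]
            exact mul_le_mul_of_nonneg_left q1 hs.1.le
          have q4 : c * s ≤ 1 * s := mul_le_mul_of_nonneg_right q2 hs.1.le
          have q5 := mem_ball.1 hx.2
          have q6 : (L + 1) * s ≤ (L + 1) * s₀ :=
            mul_le_mul_of_nonneg_left hs.2 (by linarith [H.L_nonneg])
          have q7 := hs.1
          rw [mem_ball]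
          linarith [dist_triangle w (x + s • e x) x, dist_triangle w x 0]
        have e2 : g x = gradMap (G x) := indicator_of_mem (by
          refine ⟨hx.1, ball_subset_ball ?_ hx.2⟩
          have := mul_nonneg (by linarith [H.L_nonneg] : 0 ≤ L + 1) hs0.le
          linarith) _
        rw [e1, ← e2]
        set A := mol (c * s) g (x + s • e x)
        have e3 : A.comp (ContinuousLinearMap.id ℝ (Amb n) + s • fderiv ℝ e x) - g x =
            (A - g x) + A.comp (s • fderiv ℝ e x) := by
          rw [ContinuousLinearMap.comp_add, ContinuousLinearMap.comp_id]
          abel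
        rw [e3]
        refine (enorm_add_le (A - g x) (A.comp (s • fderiv ℝ e x))).trans
          (add_le_add le_rfl ?_)
        refine le_trans ?_ (mul_le_mul' le_rfl (enorm_mol_le (c * s) g (x + s • e x)))
        rw [← ofReal_norm, ← ofReal_norm, ← ENNReal.ofReal_mul (div_nonneg hs.1.le (by positivity))]
        refine ENNReal.ofReal_le_ofReal ((A.opNorm_comp_le _).trans ?_)
        rw [mul_comm]
        refine mul_le_mul_of_nonneg_right ?_ (norm_nonneg _)
        rw [norm_smul, Real.norm_of_nonneg hs.1.le, div_eq_mul_one_div]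
        exact mul_le_mul_of_nonneg_left (H.norm_fderiv_le x) hs.1.le
    _ = (∫⁻ x, ‖mol (c * s) g (x + s • e x) - g x‖ₑ) + ENNReal.ofReal (s / (2 * s₀)) *
          ∫⁻ x, ∫⁻ v, ‖kap n v‖ₑ * ‖g (x + s • e x + (c * s) • v)‖ₑ := by
        rw [lintegral_add_right _ (hmolm.const_mul _), lintegral_const_mul _ hmolm]
    _ ≤ _ := by
        gcongr
        exact lintegral_kap_comp_le H.smooth.continuous (H.lip_smul hs.1 hs.2) hgem

end IsTransversal


/-! ### Weak gradients of continuously differentiable functions; change on null sets -/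

lemma continuousOn_gradVec {Ω : Set (Amb n)} (hΩ : IsOpen Ω) {u : Amb n → ℂ}
    (hu : ContDiffOn ℝ 1 u Ω) : ContinuousOn (gradVec u) Ω := by
  have h := hu.continuousOn_fderiv_of_isOpen hΩ le_rfl
  refine (PiLp.continuous_toLp 2 _).comp_continuousOn (continuousOn_pi.2 fun i => ?_)
  exact h.clm_apply continuousOn_const

/-- Integration by parts on the whole space. The compact support of the test function inside `Ω`
makes every product integrable, although nothing is known about `u` near the boundary. -/
lemma hasWeakGradient_of_contDiffOn {Ω : Set (Amb n)} (hΩ : IsOpen Ω) {u : Amb n → ℂ}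
    (hu : ContDiffOn ℝ 1 u Ω) : HasWeakGradient Ω u (gradVec u) := by
  refine ⟨hu.continuousOn.locallyIntegrableOn hΩ.measurableSet,
    (continuousOn_gradVec hΩ hu).locallyIntegrableOn hΩ.measurableSet, fun η hη hηc hηt i => ?_⟩
  set v : Amb n := EuclideanSpace.single i 1
  have hfu := hu.continuousOn_fderiv_of_isOpen hΩ le_rfl
  have hK : IsCompact (tsupport η) := hηc
  have hloc : ∀ {k : Amb n → ℂ}, Function.support k ⊆ tsupport η → ContinuousOn k (tsupport η) →
      Integrable k := fun {k} hs hk =>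
    (integrableOn_iff_integrable_of_support_subset hs).1 (hk.integrableOn_compact hK)
  have hsupp1 : ∀ x ∉ tsupport η, fderiv ℝ η x = 0 := fun x hx =>
    image_eq_zero_of_notMem_tsupport fun h => hx (tsupport_fderiv_subset ℝ h)
  have hsupp0 : ∀ x ∉ tsupport η, η x = 0 := fun x hx => image_eq_zero_of_notMem_tsupport hx
  have hcη : Continuous (fderiv ℝ η) := hη.continuous_fderiv (by simp)
  have h1 : Integrable fun x => fderiv ℝ η x v • u x := by
    refine hloc (fun x hx => ?_) ?_
    · by_contra h
      exact hx (by simp [hsupp1 x h])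
    · exact (hcη.clm_apply continuous_const).continuousOn.smul (hu.continuousOn.mono hηt)
  have h2 : Integrable fun x => η x • fderiv ℝ u x v := by
    refine hloc (fun x hx => ?_) ?_
    · by_contra h
      exact hx (by simp [hsupp0 x h])
    · exact hη.continuous.continuousOn.smul ((hfu.mono hηt).clm_apply continuousOn_const)
  have h3 : Integrable fun x => η x • u x := by
    refine hloc (fun x hx => ?_) ?_
    · by_contra h
      exact hx (by simp [hsupp0 x h])
    · exact hη.continuous.continuousOn.smul (hu.continuousOn.mono hηt)
  have key := integral_smul_fderiv_eq_neg_fderiv_smul_of_integrable h1 h2 h3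
    (fun x _ => (hη.differentiable (by simp)) x)
    fun x hx => (hu.differentiableOn one_ne_zero).differentiableAt (hΩ.mem_nhds (hηt hx))
  have e1 : ∫ x in Ω, fderiv ℝ η x v • u x = ∫ x, fderiv ℝ η x v • u x :=
    setIntegral_eq_integral_of_forall_compl_eq_zero fun x hx => by
      rw [hsupp1 x fun h => hx (hηt h)]; simp
  have e2 : ∫ x in Ω, η x • gradVec u x i = ∫ x, η x • gradVec u x i :=
    setIntegral_eq_integral_of_forall_compl_eq_zero fun x hx => by
      rw [hsupp0 x fun h => hx (hηt h)]; simp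
  rw [e1, e2]
  exact (neg_eq_iff_eq_neg.2 key).symm

lemma LocallyIntegrableOn.congr_ae' {F : Type*} [NormedAddCommGroup F] {Ω : Set (Amb n)}
    (hΩ : IsOpen Ω) {u v : Amb n → F}
    (hu : LocallyIntegrableOn u Ω) (h : u =ᵐ[volume.restrict Ω] v) : LocallyIntegrableOn v Ω := by
  rw [locallyIntegrableOn_iff hΩ.isLocallyClosed] at hu ⊢
  intro K hK hKc
  exact (hu K hK hKc).congr (ae_restrict_of_ae_restrict_of_subset hK h)

lemma HasWeakGradient.congr {Ω : Set (Amb n)} (hΩ : IsOpen Ω) {u v : Amb n → ℂ}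
    {G G' : Amb n → EuclideanSpace ℂ (Fin (n + 1))} (h : HasWeakGradient Ω u G)
    (huv : u =ᵐ[volume.restrict Ω] v) (hG : G =ᵐ[volume.restrict Ω] G') :
    HasWeakGradient Ω v G' := by
  refine ⟨LocallyIntegrableOn.congr_ae' hΩ h.1 huv, LocallyIntegrableOn.congr_ae' hΩ h.2.1 hG,
    fun η h1 h2 h3 i => ?_⟩
  have e1 : ∫ x in Ω, fderiv ℝ η x (EuclideanSpace.single i 1) • v x =
      ∫ x in Ω, fderiv ℝ η x (EuclideanSpace.single i 1) • u x :=
    integral_congr_ae (huv.mono fun x hx => by simp only [hx])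
  have e2 : ∫ x in Ω, η x • G' x i = ∫ x in Ω, η x • G x i :=
    integral_congr_ae (hG.mono fun x hx => by simp only [hx])
  rw [e1, e2, h.2.2 η h1 h2 h3 i]

lemma HasTrace.congr {Ω : Set (Amb n)} (hΩ : IsOpen Ω) {u v f : Amb n → ℂ}
    (h : HasTrace Ω u f) (huv : u =ᵐ[volume.restrict Ω] v) : HasTrace Ω v f := by
  obtain ⟨hf, G, hG, φ, hφ, hlim⟩ := h
  refine ⟨hf, G, hG.congr hΩ huv (ae_eq_refl _), φ, hφ, fun R => ⟨?_, (hlim R).2⟩⟩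
  refine (hlim R).1.congr fun k => lintegral_congr_ae ?_
  exact (ae_restrict_of_ae_restrict_of_subset inter_subset_left huv).mono fun x hx => by
    simp only [hx]

/-! ### Upper regularity of the surface measure -/

/-- `σ(B(x, r)) ≤ C rⁿ`. -/
def UpperRegular (Ω : Set (Amb n)) (C : ℝ≥0) : Prop :=
  ∀ (x : Amb n) (r : ℝ), 0 < r → surfaceMeasure Ω (ball x r) ≤ C * ENNReal.ofReal (r ^ n)

lemma UpperRegular.isLocallyFiniteMeasure {Ω : Set (Amb n)} {C : ℝ≥0} (h : UpperRegular Ω C) :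
    IsLocallyFiniteMeasure (surfaceMeasure Ω) :=
  ⟨fun x => ⟨ball x 1, ball_mem_nhds x one_pos, (h x 1 one_pos).trans_lt
    (ENNReal.mul_lt_top ENNReal.coe_lt_top ENNReal.ofReal_lt_top)⟩⟩

lemma ae_mem_frontier (Ω : Set (Amb n)) : ∀ᵐ x ∂(surfaceMeasure Ω), x ∈ frontier Ω :=
  ae_restrict_mem isClosed_frontier.measurableSet

lemma frontier_subset_closure' {Ω : Set (Amb n)} : frontier Ω ⊆ closure Ω := fun _ h => h.1

/-- The constant in the boundary estimates for averages. -/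
def bdryConst (n : ℕ) (c L : ℝ) (C : ℝ≥0) : ℝ≥0∞ :=
  kapSup n * C * ENNReal.ofReal ((2 * (L + 1)) ^ n / c ^ (n + 1) * (2 * (L + 1) / c))

lemma bdryConst_ne_top (n : ℕ) (c L : ℝ) (C : ℝ≥0) : bdryConst n c L C ≠ ⊤ :=
  ENNReal.mul_ne_top (ENNReal.mul_ne_top ENNReal.coe_ne_top ENNReal.coe_ne_top)
    ENNReal.ofReal_ne_top

namespace IsTransversal

variable {Ω : Set (Amb n)} {e : Amb n → Amb n} {c L s₀ : ℝ}

lemma dist_le_of_mem (H : IsTransversal Ω e c L s₀)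
    {x : Amb n} {s : ℝ} (hs : 0 < s) {w : Amb n}
    (hw : w ∈ ball (x + s • e x) (c * s / 2)) : dist w x < (L + 1) * s := by
  have q1 := H.norm_le x
  have q2 := H.c_le
  have q0 := H.c_pos
  rw [mem_ball] at hw
  have q3 : dist (x + s • e x) x ≤ s * L := by
    rw [dist_eq_norm, add_sub_cancel_left, norm_smul, Real.norm_of_nonneg hs.le]
    gcongr
  have q4 : c * s ≤ 1 * s := by gcongr
  linarith [dist_triangle w (x + s • e x) x]

/-- Fubini between the boundary and the collar. For a fixed point `w`, its distance `δ` to the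
boundary forces `τ` to be comparable to `δ`, and the base points `x` that reach `w` fill a surface
ball of measure at most a multiple of `τ^n`. Against the kernel density `τ^(-n-1)` there remains an
integral of `dτ/τ` over a range of bounded ratio. -/
lemma lintegral_surface_le (H : IsTransversal Ω e c L s₀)
    (hΩ : IsOpen Ω) (hF : (frontier Ω).Nonempty) {C : ℝ≥0}
    (hσ : UpperRegular Ω C) {h : Amb n → ℝ≥0∞} (hh : Measurable h) (R : ℝ) {a b : ℝ} (ha : 0 < a)
    (hb : b ≤ s₀) :
    ∫⁻ x in ball 0 R, (∫⁻ τ in Ioc a b, ∫⁻ v, ‖kap n v‖ₑ * h (x + τ • e x + (c * τ) • v))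
        ∂(surfaceMeasure Ω) ≤
      bdryConst n c L C * ∫⁻ w in (Ω ∩ ball 0 (R + (L + 1) * s₀)) ∩
        {w | infDist w (frontier Ω) ≤ (L + 1) * b}, h w := by
  have := hσ.isLocallyFiniteMeasure
  have hc := H.c_pos
  have hs0 := H.s_pos
  have hL : 0 < L + 1 := by linarith [H.L_nonneg]
  have hcd : Continuous fun w : Amb n => infDist w (frontier Ω) := continuous_infDist_pt _
  set U : Set (Amb n) := (Ω ∩ ball 0 (R + (L + 1) * s₀)) ∩
        {w | infDist w (frontier Ω) ≤ (L + 1) * b} with hU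
  have hUm : MeasurableSet U := (hΩ.measurableSet.inter measurableSet_ball).inter
    (measurableSet_le hcd.measurable measurable_const)
  set P : ℝ → ℝ≥0∞ := fun τ => kapSup n * ENNReal.ofReal (((c * τ) ^ (n + 1))⁻¹)
  have hPm : Measurable P := by
    refine Measurable.const_mul ?_ _
    exact ENNReal.measurable_ofReal.comp ((Measurable.pow_const (by fun_prop) _).inv)
  -- The relations that hold between a base point, a scale and a point of its averaging ball.
  -- Keeping them as one measurable set makes the exchange of integrals legitimate.
  set W : Set ((Amb n × ℝ) × Amb n) := {q | q.2 ∈ U ∧ c * q.1.2 / 2 ≤ infDist q.2 (frontier Ω) ∧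
    infDist q.2 (frontier Ω) ≤ (L + 1) * q.1.2 ∧ dist q.1.1 q.2 < 2 * (L + 1) * q.1.2} with hW
  have hWm : MeasurableSet W := by
    refine (hUm.preimage measurable_snd).inter (MeasurableSet.inter ?_ (MeasurableSet.inter ?_ ?_))
    · exact measurableSet_le (by fun_prop) (hcd.measurable.comp measurable_snd)
    · exact measurableSet_le (hcd.measurable.comp measurable_snd) (by fun_prop)
    · exact measurableSet_lt
        (f := fun q : (Amb n × ℝ) × Amb n => dist q.1.1 q.2)
        (g := fun q : (Amb n × ℝ) × Amb n => 2 * (L + 1) * q.1.2) (by fun_prop) (by fun_prop)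
  set k : (Amb n × ℝ) × Amb n → ℝ≥0∞ := W.indicator fun q => P q.1.2 * h q.2 with hk
  have hkm : Measurable k :=
    ((hPm.comp (measurable_snd.comp measurable_fst)).mul (hh.comp measurable_snd)).indicator hWm
  have step1 : ∀ x ∈ frontier Ω ∩ ball 0 R, ∀ τ ∈ Ioc a b,
      ∫⁻ v, ‖kap n v‖ₑ * h (x + τ • e x + (c * τ) • v) ≤ ∫⁻ w, k ((x, τ), w) := by
    intro x hx τ hτ
    have hτ0 : 0 < τ := ha.trans hτ.1
    refine (lintegral_kap_mul_le (mul_pos hc hτ0) h _).trans ?_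
    have hfin : P τ ≠ ⊤ := ENNReal.mul_ne_top ENNReal.coe_ne_top ENNReal.ofReal_ne_top
    rw [← lintegral_indicator measurableSet_ball, ← lintegral_const_mul' _ _ hfin]
    refine lintegral_mono fun w => ?_
    by_cases hw : w ∈ ball (x + τ • e x) (c * τ / 2)
    · have hxc := frontier_subset_closure' hx.1
      have hd := H.dist_le_of_mem hτ0 hw
      have hδ := infDist_le_dist_of_mem (x := w) hx.1
      have h1 := H.infDist_ge hΩ hF hxc hτ0 (hτ.2.trans hb) (ball_subset_closedBall hw)
      have hx0 := mem_ball.1 hx.2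
      have h2 : (L + 1) * τ ≤ (L + 1) * b := mul_le_mul_of_nonneg_left hτ.2 hL.le
      have h3 : (L + 1) * b ≤ (L + 1) * s₀ := mul_le_mul_of_nonneg_left hb hL.le
      have hLτ := mul_pos hL hτ0
      have hmem : ((x, τ), w) ∈ W := by
        refine ⟨⟨⟨(H.closedBall_subset_innerSet hΩ hF hxc hτ0 (hτ.2.trans hb)
          (ball_subset_closedBall hw)).1, ?_⟩, ?_⟩, h1, ?_, ?_⟩
        · rw [mem_ball]
          linarith [dist_triangle w x 0]
        · change infDist w (frontier Ω) ≤ (L + 1) * b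
          linarith
        · change infDist w (frontier Ω) ≤ (L + 1) * τ
          linarith
        · change dist x w < 2 * (L + 1) * τ
          rw [dist_comm]
          linarith
      rw [indicator_of_mem hw, hk, indicator_of_mem hmem]
    · rw [indicator_of_notMem hw, mul_zero]
      exact zero_le
  have step2 : ∀ τ ∈ Ioc a b, ∀ w, ∫⁻ x, k ((x, τ), w) ∂(surfaceMeasure Ω) ≤
      (Icc (infDist w (frontier Ω) / (L + 1)) (2 * infDist w (frontier Ω) / c)).indicator
        (fun _ => kapSup n * C * ENNReal.ofReal ((2 * (L + 1)) ^ n / c ^ (n + 1) *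
          ((L + 1) / infDist w (frontier Ω)))) τ * U.indicator h w := by
    intro τ hτ w
    have hτ0 : 0 < τ := ha.trans hτ.1
    by_cases hw : w ∈ U ∧ c * τ / 2 ≤ infDist w (frontier Ω) ∧ infDist w (frontier Ω) ≤ (L + 1) * τ
    · have hδ : 0 < infDist w (frontier Ω) := infDist_frontier_pos hΩ hF hw.1.1.1
      have hI : τ ∈ Icc (infDist w (frontier Ω) / (L + 1)) (2 * infDist w (frontier Ω) / c) := by
        constructor
        · rw [div_le_iff₀ hL]; linarith [hw.2.2]
        · rw [le_div_iff₀ hc]; linarith [hw.2.1]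
      rw [indicator_of_mem hI, indicator_of_mem hw.1]
      calc ∫⁻ x, k ((x, τ), w) ∂(surfaceMeasure Ω)
          ≤ ∫⁻ x, (ball w (2 * (L + 1) * τ)).indicator (fun _ => P τ * h w) x
              ∂(surfaceMeasure Ω) := by
            refine lintegral_mono fun x => ?_
            by_cases hm : ((x, τ), w) ∈ W
            · have hx : x ∈ ball w (2 * (L + 1) * τ) := hm.2.2.2
              rw [hk, indicator_of_mem hm, indicator_of_mem hx]
            · rw [hk, indicator_of_notMem hm]
              exact zero_le
        _ = P τ * h w * surfaceMeasure Ω (ball w (2 * (L + 1) * τ)) := by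
            rw [lintegral_indicator measurableSet_ball, setLIntegral_const]
        _ ≤ P τ * h w * (C * ENNReal.ofReal ((2 * (L + 1) * τ) ^ n)) := by
            gcongr
            exact hσ w _ (by positivity)
        _ = kapSup n * C * ENNReal.ofReal ((2 * (L + 1)) ^ n / c ^ (n + 1) * (1 / τ)) * h w := by
            have e1 : (2 * (L + 1)) ^ n / c ^ (n + 1) * (1 / τ) =
                ((c * τ) ^ (n + 1))⁻¹ * (2 * (L + 1) * τ) ^ n := by
              rw [mul_pow, mul_pow _ τ, pow_succ τ]
              field_simp
              rw [← mul_pow, ← mul_pow]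
              ring
            rw [e1, ENNReal.ofReal_mul (by positivity)]
            ring
        _ ≤ _ := by
            -- The density `1/τ` is frozen at its largest value on the admissible interval, whose
            -- length is at most `2δ/c`.
            have h1 : 1 / τ ≤ (L + 1) / infDist w (frontier Ω) := by
              rw [div_le_div_iff₀ hτ0 hδ]
              linarith [hw.2.2]
            gcongr
    · have hz : ∀ x, k ((x, τ), w) = 0 := fun x => indicator_of_notMem
        (fun hm => hw ⟨hm.1, hm.2.1, hm.2.2.1⟩) _
      simp [hz]
  calc ∫⁻ x in ball 0 R, (∫⁻ τ in Ioc a b, ∫⁻ v, ‖kap n v‖ₑ * h (x + τ • e x + (c * τ) • v))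
        ∂(surfaceMeasure Ω)
      ≤ ∫⁻ x, (∫⁻ τ in Ioc a b, ∫⁻ w, k ((x, τ), w)) ∂(surfaceMeasure Ω) := by
        refine le_trans ?_ (setLIntegral_le_lintegral (ball 0 R) _)
        refine lintegral_mono_ae ?_
        filter_upwards [ae_restrict_of_ae (ae_mem_frontier Ω), ae_restrict_mem measurableSet_ball]
          with x hx1 hx2
        exact setLIntegral_mono' measurableSet_Ioc fun τ hτ => step1 x ⟨hx1, hx2⟩ τ hτ
    _ = ∫⁻ τ in Ioc a b, ∫⁻ w, ∫⁻ x, k ((x, τ), w) ∂(surfaceMeasure Ω) := by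
        rw [lintegral_lintegral_swap]
        · refine lintegral_congr fun τ => ?_
          rw [lintegral_lintegral_swap]
          exact (hkm.comp (by fun_prop : Measurable fun q : Amb n × Amb n =>
            ((q.1, τ), q.2))).aemeasurable
        · exact (hkm.lintegral_prod_right').aemeasurable
    _ ≤ ∫⁻ τ in Ioc a b, ∫⁻ w,
          (Icc (infDist w (frontier Ω) / (L + 1)) (2 * infDist w (frontier Ω) / c)).indicator
        (fun _ => kapSup n * C * ENNReal.ofReal ((2 * (L + 1)) ^ n / c ^ (n + 1) *
          ((L + 1) / infDist w (frontier Ω)))) τ * U.indicator h w := by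
        exact setLIntegral_mono' measurableSet_Ioc fun τ hτ => lintegral_mono fun w => step2 τ hτ w
    _ ≤ ∫⁻ τ, ∫⁻ w,
          (Icc (infDist w (frontier Ω) / (L + 1)) (2 * infDist w (frontier Ω) / c)).indicator
        (fun _ => kapSup n * C * ENNReal.ofReal ((2 * (L + 1)) ^ n / c ^ (n + 1) *
          ((L + 1) / infDist w (frontier Ω)))) τ * U.indicator h w := setLIntegral_le_lintegral _ _
    _ = ∫⁻ w, ∫⁻ τ,
          (Icc (infDist w (frontier Ω) / (L + 1)) (2 * infDist w (frontier Ω) / c)).indicator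
        (fun _ => kapSup n * C * ENNReal.ofReal ((2 * (L + 1)) ^ n / c ^ (n + 1) *
          ((L + 1) / infDist w (frontier Ω)))) τ * U.indicator h w := by
        rw [lintegral_lintegral_swap]
        refine (Measurable.mul ?_ ((hh.indicator hUm).comp measurable_snd)).aemeasurable
        have hm1 : MeasurableSet {q : ℝ × Amb n | q.1 ∈
            Icc (infDist q.2 (frontier Ω) / (L + 1)) (2 * infDist q.2 (frontier Ω) / c)} := by
          have hq : Measurable fun q : ℝ × Amb n => infDist q.2 (frontier Ω) :=
            hcd.measurable.comp measurable_snd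
          exact (measurableSet_le (hq.div_const _) measurable_fst).inter
            (measurableSet_le measurable_fst ((hq.const_mul 2).div_const _))
        have hm2 : Measurable fun q : ℝ × Amb n => kapSup n * C *
            ENNReal.ofReal ((2 * (L + 1)) ^ n / c ^ (n + 1) *
          ((L + 1) / infDist q.2 (frontier Ω))) := by
          have hq : Measurable fun q : ℝ × Amb n => infDist q.2 (frontier Ω) :=
            hcd.measurable.comp measurable_snd
          exact (ENNReal.measurable_ofReal.comp ((measurable_const.div hq).const_mul _)).const_mul _
        exact hm2.indicator hm1
    _ ≤ ∫⁻ w, bdryConst n c L C * U.indicator h w := by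
        refine lintegral_mono fun w => ?_
        dsimp only
        by_cases hw : w ∈ U
        · have hδ : 0 < infDist w (frontier Ω) := infDist_frontier_pos hΩ hF hw.1.1
          rw [lintegral_mul_const _ (measurable_const.indicator measurableSet_Icc),
            lintegral_indicator measurableSet_Icc, setLIntegral_const, Real.volume_Icc]
          gcongr
          rw [bdryConst, mul_assoc, ← ENNReal.ofReal_mul (by positivity)]
          refine mul_le_mul' le_rfl (ENNReal.ofReal_le_ofReal ?_)
          rw [mul_assoc]
          refine mul_le_mul_of_nonneg_left ?_ (by positivity)
          have h1 : 0 ≤ infDist w (frontier Ω) / (L + 1) := by positivity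
          calc (L + 1) / infDist w (frontier Ω) *
                (2 * infDist w (frontier Ω) / c - infDist w (frontier Ω) / (L + 1))
              ≤ (L + 1) / infDist w (frontier Ω) * (2 * infDist w (frontier Ω) / c) := by
                gcongr
                linarith
            _ = _ := by field_simp
        · simp [indicator_of_notMem hw]
    _ = _ := by
        rw [lintegral_const_mul _ (hh.indicator hUm), lintegral_indicator hUm]

end IsTransversal


/-! ### Weighted integrals of the gradient, and the trace as a limit of averages -/

lemma continuous_gradVec {φ : Amb n → ℂ} (hφ : ContDiff ℝ 1 φ) : Continuous (gradVec φ) :=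
  continuousOn_univ.1 (continuousOn_gradVec isOpen_univ hφ.contDiffOn)

lemma setLIntegral_ball_lt_top {φ : Amb n → ℝ≥0∞} {F : Type*} [NormedAddCommGroup F]
    {g : Amb n → F} (hg : Continuous g) (hφ : ∀ x, φ x = ‖g x‖ₑ) (μ : Measure (Amb n))
    [IsLocallyFiniteMeasure μ] (R : ℝ) : ∫⁻ x in ball 0 R, φ x ∂μ < ⊤ := by
  simp_rw [hφ]
  have h := (hg.continuousOn.integrableOn_compact (μ := μ) (isCompact_closedBall (0 : Amb n) R)).2
  exact (lintegral_mono_set ball_subset_closedBall).trans_lt h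

/-- The weighted integral of a vector field on `Ω`. -/
def wInt (θ : ℝ) (Ω : Set (Amb n)) (G : Amb n → EuclideanSpace ℂ (Fin (n + 1))) : ℝ≥0∞ :=
  ∫⁻ x in Ω, ‖G x‖ₑ * ENNReal.ofReal (infDist x (frontier Ω) ^ (-θ))

/-- On the collar `δ ≤ T` one has `(T/δ)^θ ≥ 1`. This is where the weight yields a positive power of
the height of a collar. -/
lemma le_mul_weight {Ω : Set (Amb n)} (hΩ : IsOpen Ω) (hF : (frontier Ω).Nonempty) {θ T : ℝ}
    (hθ : 0 < θ) {w : Amb n} (hw : w ∈ Ω) (hT : infDist w (frontier Ω) ≤ T) (g : ℝ≥0∞) :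
    g ≤ ENNReal.ofReal (T ^ θ) * (g * ENNReal.ofReal (infDist w (frontier Ω) ^ (-θ))) := by
  have hδ := infDist_frontier_pos hΩ hF hw
  have h1 : 1 ≤ ENNReal.ofReal (T ^ θ) * ENNReal.ofReal (infDist w (frontier Ω) ^ (-θ)) := by
    rw [← ENNReal.ofReal_mul (Real.rpow_nonneg (hδ.le.trans hT) _), ← ENNReal.ofReal_one]
    refine ENNReal.ofReal_le_ofReal ?_
    rw [Real.rpow_neg hδ.le, ← div_eq_mul_inv, one_le_div (Real.rpow_pos_of_pos hδ _)]
    exact Real.rpow_le_rpow hδ.le hT hθ.le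
  calc g = 1 * g := (one_mul g).symm
    _ ≤ _ := mul_le_mul' h1 le_rfl
    _ = _ := by ring

lemma setLIntegral_le_wInt {Ω : Set (Amb n)} (hΩ : IsOpen Ω) (hF : (frontier Ω).Nonempty)
    {θ T : ℝ} (hθ : 0 < θ) (G : Amb n → EuclideanSpace ℂ (Fin (n + 1))) {V : Set (Amb n)}
    (hVm : MeasurableSet V) (hV : V ⊆ Ω) (hT : ∀ w ∈ V, infDist w (frontier Ω) ≤ T) :
    ∫⁻ w in V, ‖G w‖ₑ ≤ ENNReal.ofReal (T ^ θ) * wInt θ Ω G := by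
  calc ∫⁻ w in V, ‖G w‖ₑ ≤ ∫⁻ w in V, ENNReal.ofReal (T ^ θ) *
        (‖G w‖ₑ * ENNReal.ofReal (infDist w (frontier Ω) ^ (-θ))) :=
        setLIntegral_mono' hVm fun w hw => le_mul_weight hΩ hF hθ (hV hw) (hT w hw) _
    _ ≤ _ := by
        rw [lintegral_const_mul' _ _ ENNReal.ofReal_ne_top]
        exact mul_le_mul' le_rfl (lintegral_mono_set hV)

lemma setLIntegral_ball_ne_top_of_wInt {Ω : Set (Amb n)} (hΩ : IsOpen Ω)
    (hF : (frontier Ω).Nonempty) {θ : ℝ} (hθ : 0 < θ)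
    {G : Amb n → EuclideanSpace ℂ (Fin (n + 1))} (hG : wInt θ Ω G ≠ ⊤) (R : ℝ) :
    ∫⁻ x in Ω ∩ ball 0 R, ‖G x‖ₑ ≠ ⊤ := by
  obtain ⟨x₀, hx₀⟩ := hF
  refine ((setLIntegral_le_wInt (T := R + ‖x₀‖) hΩ ⟨x₀, hx₀⟩ hθ G
    (hΩ.measurableSet.inter measurableSet_ball) inter_subset_left fun w hw => ?_).trans_lt
    (ENNReal.mul_lt_top ENNReal.ofReal_lt_top hG.lt_top)).ne
  have h1 := infDist_le_dist_of_mem (x := w) hx₀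
  have h2 := mem_ball_zero_iff.1 hw.2
  rw [dist_eq_norm] at h1
  linarith [norm_sub_le w x₀]

namespace IsTransversal

variable {Ω : Set (Amb n)} {e : Amb n → Amb n} {c L s₀ : ℝ}
  {u : Amb n → ℂ} {G : Amb n → EuclideanSpace ℂ (Fin (n + 1))}

lemma lintegral_surface_tr_sub_le (H : IsTransversal Ω e c L s₀)
    (hΩ : IsOpen Ω) (hF : (frontier Ω).Nonempty) {C : ℝ≥0}
    (hσ : UpperRegular Ω C) (hu : HasWeakGradient Ω u G) (hum : Measurable u) (hGm : Measurable G)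
    (R : ℝ) {a b : ℝ} (ha : 0 < a) (hab : a ≤ b) (hb : b ≤ s₀) :
    ∫⁻ x in ball 0 R, ‖tr Ω e c u b x - tr Ω e c u a x‖ₑ ∂(surfaceMeasure Ω) ≤
      ENNReal.ofReal (L + 1) * bdryConst n c L C *
        ∫⁻ w in (Ω ∩ ball 0 (R + (L + 1) * s₀)) ∩
          {w | infDist w (frontier Ω) ≤ (L + 1) * b}, ‖G w‖ₑ := by
  rw [mul_assoc]
  refine le_trans ?_ (mul_le_mul' le_rfl (H.lintegral_surface_le hΩ hF hσ hGm.enorm R ha hb))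
  rw [← lintegral_const_mul' _ _ ENNReal.ofReal_ne_top]
  refine lintegral_mono_ae ?_
  filter_upwards [ae_restrict_of_ae (ae_mem_frontier Ω)] with x hx
  exact H.enorm_tr_sub_le hΩ hF hu hum hGm (frontier_subset_closure' hx) ha hab hb

lemma tendsto_tr_of_continuous (H : IsTransversal Ω e c L s₀)
    (hΩ : IsOpen Ω) (hF : (frontier Ω).Nonempty) {φ : Amb n → ℂ}
    (hφ : Continuous φ) {x : Amb n} (hx : x ∈ closure Ω) :
    Tendsto (fun a => tr Ω e c φ a x) (𝓝[>] 0) (𝓝 (φ x)) := by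
  rw [Metric.tendsto_nhds]
  intro ε hε
  obtain ⟨δ, hδ, hδ'⟩ := Metric.continuous_iff.1 hφ x (ε / 2) (half_pos hε)
  have hL : 0 < L + 1 := by linarith [H.L_nonneg]
  filter_upwards [Ioc_mem_nhdsGT H.s_pos, Ioo_mem_nhdsGT (div_pos hδ hL)] with a ha ha'
  rw [H.tr_eq hΩ hF hx ha.1 ha.2, dist_eq_norm]
  refine (norm_mol_sub_le hφ.stronglyMeasurable (φ x) _ (r := ε / 2) fun v hv => ?_).trans_lt (half_lt_self hε)
  rw [← dist_eq_norm]
  refine (hδ' _ ?_).le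
  rw [dist_eq_norm, add_assoc, add_sub_cancel_left]
  refine (H.norm_move_le x v ha.1 (by linarith)).trans_lt ?_
  rw [mul_comm]
  exact (lt_div_iff₀ hL).1 ha'.2

/-- For continuous `φ` the averages converge pointwise to `φ` on the boundary, so Fatou lets the
smaller scale tend to zero in `lintegral_surface_tr_sub_le`. -/
lemma lintegral_surface_tr_sub_self_le (H : IsTransversal Ω e c L s₀)
    (hΩ : IsOpen Ω) (hF : (frontier Ω).Nonempty) {C : ℝ≥0}
    (hσ : UpperRegular Ω C) {φ : Amb n → ℂ} (hφ : ContDiff ℝ ∞ φ) (R : ℝ) {b : ℝ} (hb0 : 0 < b)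
    (hb : b ≤ s₀) :
    ∫⁻ x in ball 0 R, ‖tr Ω e c φ b x - φ x‖ₑ ∂(surfaceMeasure Ω) ≤
      ENNReal.ofReal (L + 1) * bdryConst n c L C *
        ∫⁻ w in (Ω ∩ ball 0 (R + (L + 1) * s₀)) ∩
          {w | infDist w (frontier Ω) ≤ (L + 1) * b}, ‖gradVec φ w‖ₑ := by
  have hφ1 : ContDiff ℝ 1 φ := hφ.of_le (by norm_cast)
  have hw := hasWeakGradient_of_contDiffOn hΩ hφ1.contDiffOn
  set s : ℕ → ℝ := fun k => b / (k + 1)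
  have hs0 : ∀ k, 0 < s k := fun k => by positivity
  have hsb : ∀ k, s k ≤ b := fun k => div_le_self hb0.le (by linarith [(Nat.cast_nonneg k : (0:ℝ) ≤ k)])
  have hst : Tendsto s atTop (𝓝[>] 0) := by
    refine tendsto_nhdsWithin_iff.2 ⟨?_, Eventually.of_forall fun k => hs0 k⟩
    exact (tendsto_const_div_atTop_nhds_zero_nat b).comp (tendsto_add_atTop_nat 1) |>.congr
      fun k => by simp [s]
  have hm : ∀ k, Measurable fun x => ‖tr Ω e c φ b x - tr Ω e c φ (s k) x‖ₑ := fun k =>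
    ((H.contDiff_tr hw.1 hb0).continuous.sub
      (H.contDiff_tr hw.1 (hs0 k)).continuous).enorm.measurable
  calc ∫⁻ x in ball 0 R, ‖tr Ω e c φ b x - φ x‖ₑ ∂(surfaceMeasure Ω)
      ≤ ∫⁻ x in ball 0 R, liminf (fun k => ‖tr Ω e c φ b x - tr Ω e c φ (s k) x‖ₑ) atTop
          ∂(surfaceMeasure Ω) := by
        refine lintegral_mono_ae ?_
        filter_upwards [ae_restrict_of_ae (ae_mem_frontier Ω)] with x hx
        have h1 := (H.tendsto_tr_of_continuous hΩ hF hφ.continuous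
          (frontier_subset_closure' hx)).comp hst
        have h2 := (tendsto_const_nhds (x := tr Ω e c φ b x)).sub h1
        exact (h2.enorm.liminf_eq).ge
    _ ≤ liminf (fun k => ∫⁻ x in ball 0 R, ‖tr Ω e c φ b x - tr Ω e c φ (s k) x‖ₑ
          ∂(surfaceMeasure Ω)) atTop := lintegral_liminf_le hm
    _ ≤ _ := by
        refine liminf_le_of_frequently_le' (Frequently.of_forall fun k => ?_)
        exact H.lintegral_surface_tr_sub_le hΩ hF hσ hw hφ.continuous.measurable
          (continuous_gradVec hφ1).measurable R (hs0 k) (hsb k) hb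

/-- At a fixed scale `b` the average depends continuously on the function in the `L¹` sense. The
constant blows up as `b → 0`, so the bound is meant for a limit in the function at fixed scale. -/
lemma enorm_tr_sub_tr_le (H : IsTransversal Ω e c L s₀)
    (hΩ : IsOpen Ω) (hF : (frontier Ω).Nonempty)
    (hu : LocallyIntegrableOn u Ω) (hum : Measurable u) {φ : Amb n → ℂ} (hφ : Continuous φ)
    {R b : ℝ} (hb0 : 0 < b) (hb : b ≤ s₀) {x : Amb n} (hx : x ∈ frontier Ω) (hxR : x ∈ ball 0 R) :
    ‖tr Ω e c u b x - tr Ω e c φ b x‖ₑ ≤ kapSup n * ENNReal.ofReal (((c * b) ^ (n + 1))⁻¹) *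
      ∫⁻ w in Ω ∩ ball 0 (R + (L + 1) * s₀), ‖φ w - u w‖ₑ := by
  have hxc := frontier_subset_closure' hx
  have hcb : 0 < c * b := mul_pos H.c_pos hb0
  have hsub := (H.closedBall_subset_innerSet hΩ hF hxc hb0 hb).trans (innerSet_subset _ _)
  rw [H.tr_eq hΩ hF hxc hb0 hb, H.tr_eq hΩ hF hxc hb0 hb, ← mol_sub hum.stronglyMeasurable
    hφ.stronglyMeasurable hcb]
  · refine (enorm_mol_le_ball hcb _ _).trans ?_
    simp_rw [← enorm_neg (u _ - _), neg_sub]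
    refine mul_le_mul' le_rfl (lintegral_mono_set fun w hw => ⟨hsub (ball_subset_closedBall hw), ?_⟩)
    have h1 := H.dist_le_of_mem hb0 hw
    have h2 : (L + 1) * b ≤ (L + 1) * s₀ :=
      mul_le_mul_of_nonneg_left hb (by linarith [H.L_nonneg])
    rw [mem_ball] at hxR ⊢
    linarith [dist_triangle w x 0]
  · exact ((lintegral_mono_set ball_subset_closedBall).trans_lt
      (hu.integrableOn_compact_subset hsub (isCompact_closedBall _ _)).2).ne
  · exact ((lintegral_mono_set ball_subset_closedBall).trans_lt
      (hφ.continuousOn.integrableOn_compact (isCompact_closedBall _ _)).2).ne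

/-- The trace of `u` is the limit of the averages of `u`. -/
lemma tendsto_tr_of_hasTrace (H : IsTransversal Ω e c L s₀)
    (hΩ : IsOpen Ω) (hF : (frontier Ω).Nonempty) {C : ℝ≥0}
    (hσ : UpperRegular Ω C) (hum : Measurable u) {f : Amb n → ℂ} (hf : HasTrace Ω u f) (R : ℝ) :
    Tendsto (fun s => ∫⁻ x in ball 0 R, ‖tr Ω e c u s x - f x‖ₑ ∂(surfaceMeasure Ω))
      (𝓝[>] 0) (𝓝 0) := by
  have := hσ.isLocallyFiniteMeasure
  obtain ⟨-, G', hG', φ, hφ, hlim⟩ := hf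
  have hφ1 : ∀ k, ContDiff ℝ 1 (φ k) := fun k => (hφ k).of_le (by norm_cast)
  set R' := R + (L + 1) * s₀
  set V : ℝ → Set (Amb n) := fun s => (Ω ∩ ball 0 R') ∩
    {w | infDist w (frontier Ω) ≤ (L + 1) * s} with hVdef
  have hcd : Continuous fun w : Amb n => infDist w (frontier Ω) := continuous_infDist_pt _
  set K := ENNReal.ofReal (L + 1) * bdryConst n c L C
  have hK : K ≠ ⊤ := ENNReal.mul_ne_top ENNReal.ofReal_ne_top (bdryConst_ne_top _ _ _ _)
  have hG'm : AEStronglyMeasurable G' (volume.restrict Ω) := hG'.2.1.aestronglyMeasurable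
  have hG'e : ∀ A : Set (Amb n), A ⊆ Ω → AEMeasurable (fun w => ‖G' w‖ₑ) (volume.restrict A) :=
    fun A hA => (hG'm.mono_measure (Measure.restrict_mono_set _ hA)).enorm
  -- Insert `tr φⱼ` and `φⱼ` between `tr u` and `f`. At fixed `s`, letting `j → ∞` leaves only the
  -- integral of `|G'|` over the collar.
  have hmain : ∀ s, 0 < s → s ≤ s₀ →
      ∫⁻ x in ball 0 R, ‖tr Ω e c u s x - f x‖ₑ ∂(surfaceMeasure Ω) ≤
        K * ∫⁻ w in V s, ‖G' w‖ₑ := by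
    intro s hs hs'
    set Q := kapSup n * ENNReal.ofReal (((c * s) ^ (n + 1))⁻¹) * surfaceMeasure Ω (ball 0 R)
    have hQ : Q ≠ ⊤ := ENNReal.mul_ne_top
      (ENNReal.mul_ne_top ENNReal.coe_ne_top ENNReal.ofReal_ne_top) measure_ball_lt_top.ne
    have hj : ∀ j, ∫⁻ x in ball 0 R, ‖tr Ω e c u s x - f x‖ₑ ∂(surfaceMeasure Ω) ≤
        K * (∫⁻ w in V s, ‖G' w‖ₑ) + (Q * (∫⁻ x in Ω ∩ ball 0 R', ‖φ j x - u x‖ₑ) +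
          K * (∫⁻ x in Ω ∩ ball 0 R', ‖gradVec (φ j) x - G' x‖ₑ) +
          ∫⁻ x in ball 0 R, ‖φ j x - f x‖ₑ ∂(surfaceMeasure Ω)) := by
      intro j
      have hφl : LocallyIntegrableOn (φ j) Ω :=
        (hφ j).continuous.continuousOn.locallyIntegrableOn hΩ.measurableSet
      have m1 : Measurable fun x => ‖tr Ω e c u s x - tr Ω e c (φ j) s x‖ₑ :=
        ((H.contDiff_tr hG'.1 hs).continuous.sub
          (H.contDiff_tr hφl hs).continuous).enorm.measurable
      have m2 : Measurable fun x => ‖tr Ω e c (φ j) s x - φ j x‖ₑ :=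
        ((H.contDiff_tr hφl hs).continuous.sub (hφ j).continuous).enorm.measurable
      have i1 : ∫⁻ x in ball 0 R, ‖tr Ω e c u s x - tr Ω e c (φ j) s x‖ₑ ∂(surfaceMeasure Ω) ≤
          Q * ∫⁻ x in Ω ∩ ball 0 R', ‖φ j x - u x‖ₑ := by
        calc _ ≤ ∫⁻ x in ball 0 R, kapSup n * ENNReal.ofReal (((c * s) ^ (n + 1))⁻¹) *
              (∫⁻ w in Ω ∩ ball 0 (R + (L + 1) * s₀), ‖φ j w - u w‖ₑ) ∂(surfaceMeasure Ω) := by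
              refine lintegral_mono_ae ?_
              filter_upwards [ae_restrict_of_ae (ae_mem_frontier Ω),
                ae_restrict_mem measurableSet_ball] with x hx1 hx2
              exact H.enorm_tr_sub_tr_le hΩ hF hG'.1 hum (hφ j).continuous hs hs' hx1 hx2
          _ = _ := by
              rw [setLIntegral_const]
              ring
      have i2 : ∫⁻ x in ball 0 R, ‖tr Ω e c (φ j) s x - φ j x‖ₑ ∂(surfaceMeasure Ω) ≤
          K * ((∫⁻ w in V s, ‖G' w‖ₑ) + ∫⁻ x in Ω ∩ ball 0 R', ‖gradVec (φ j) x - G' x‖ₑ) := by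
        refine (H.lintegral_surface_tr_sub_self_le hΩ hF hσ (hφ j) R hs hs').trans
          (mul_le_mul' le_rfl ?_)
        calc ∫⁻ w in V s, ‖gradVec (φ j) w‖ₑ
            ≤ ∫⁻ w in V s, (‖G' w‖ₑ + ‖gradVec (φ j) w - G' w‖ₑ) := by
              refine lintegral_mono fun w => ?_
              calc ‖gradVec (φ j) w‖ₑ = ‖G' w + (gradVec (φ j) w - G' w)‖ₑ := by congr 1; abel
                _ ≤ _ := enorm_add_le _ _
          _ = (∫⁻ w in V s, ‖G' w‖ₑ) + ∫⁻ w in V s, ‖gradVec (φ j) w - G' w‖ₑ :=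
              lintegral_add_left' (hG'e _ (inter_subset_left.trans inter_subset_left)) _
          _ ≤ _ := add_le_add le_rfl (lintegral_mono_set inter_subset_left)
      calc ∫⁻ x in ball 0 R, ‖tr Ω e c u s x - f x‖ₑ ∂(surfaceMeasure Ω)
          ≤ ∫⁻ x in ball 0 R, (‖tr Ω e c u s x - tr Ω e c (φ j) s x‖ₑ +
              (‖tr Ω e c (φ j) s x - φ j x‖ₑ + ‖φ j x - f x‖ₑ)) ∂(surfaceMeasure Ω) := by
            refine lintegral_mono fun x => ?_
            calc ‖tr Ω e c u s x - f x‖ₑ = ‖(tr Ω e c u s x - tr Ω e c (φ j) s x) +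
                  ((tr Ω e c (φ j) s x - φ j x) + (φ j x - f x))‖ₑ := by congr 1; ring
              _ ≤ _ := (enorm_add_le _ _).trans (add_le_add le_rfl (enorm_add_le _ _))
        _ = _ := by rw [lintegral_add_left m1, lintegral_add_left m2]
        _ ≤ _ := add_le_add i1 (add_le_add i2 le_rfl)
        _ = _ := by ring
    have hl := (tendsto_const_nhds (x := K * ∫⁻ w in V s, ‖G' w‖ₑ) (f := atTop (α := ℕ))).add
      (((ENNReal.Tendsto.const_mul (hlim R').1 (Or.inr hQ)).add
        (ENNReal.Tendsto.const_mul (hlim R').2.1 (Or.inr hK))).add (hlim R).2.2)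
    simp only [mul_zero, add_zero] at hl
    exact ge_of_tendsto' hl hj
  -- A weak gradient is only locally integrable inside `Ω`; integrability up to the boundary comes
  -- from its finite `L¹` distance to a smooth gradient.
  have hfin : ∫⁻ w in Ω ∩ ball 0 R', ‖G' w‖ₑ ≠ ⊤ := by
    obtain ⟨j, hj⟩ := ((hlim R').2.1.eventually_lt_const one_pos).exists
    have : ∫⁻ w in Ω ∩ ball 0 R', ‖G' w‖ₑ ≤ (∫⁻ w in Ω ∩ ball 0 R', ‖gradVec (φ j) w‖ₑ) +
        ∫⁻ w in Ω ∩ ball 0 R', ‖gradVec (φ j) w - G' w‖ₑ := by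
      rw [← lintegral_add_left (continuous_gradVec (hφ1 j)).enorm.measurable]
      refine lintegral_mono fun w => ?_
      calc ‖G' w‖ₑ = ‖gradVec (φ j) w - (gradVec (φ j) w - G' w)‖ₑ := by congr 1; abel
        _ ≤ _ := enorm_sub_le
    refine (this.trans_lt (ENNReal.add_lt_top.2 ⟨?_, hj.trans ENNReal.one_lt_top⟩)).ne
    exact (lintegral_mono_set inter_subset_right).trans_lt
      (setLIntegral_ball_lt_top (continuous_gradVec (hφ1 j)) (fun _ => rfl) _ _)
  -- The collars decrease to the empty set, since every point of the open set `Ω` has positive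
  -- distance to the frontier.
  have hV0 : Tendsto (fun s => ∫⁻ w in V s, ‖G' w‖ₑ) (𝓝[>] 0) (𝓝 0) := by
    have hSm : ∀ s : ℝ, MeasurableSet {w : Amb n | infDist w (frontier Ω) ≤ (L + 1) * s} :=
      fun s => measurableSet_le hcd.measurable measurable_const
    have hL : 0 < L + 1 := by linarith [H.L_nonneg]
    have h1 : Tendsto ((volume.restrict (Ω ∩ ball (0 : Amb n) R')) ∘ fun s : ℝ =>
        {w : Amb n | infDist w (frontier Ω) ≤ (L + 1) * s}) (𝓝[>] 0) (𝓝 0) := by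
      have h2 := tendsto_measure_biInter_gt (μ := volume.restrict (Ω ∩ ball (0 : Amb n) R'))
        (s := fun s : ℝ => {w : Amb n | infDist w (frontier Ω) ≤ (L + 1) * s}) (a := 0)
        (fun r _ => (hSm r).nullMeasurableSet)
        (fun i j _ hij w hw => le_trans hw (mul_le_mul_of_nonneg_left hij hL.le))
        ⟨1, one_pos, ((measure_mono (subset_univ _)).trans_lt (by
          rw [Measure.restrict_apply_univ]
          exact (measure_mono inter_subset_right).trans_lt measure_ball_lt_top)).ne⟩
      have h3 : volume.restrict (Ω ∩ ball (0 : Amb n) R')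
          (⋂ r > (0 : ℝ), {w : Amb n | infDist w (frontier Ω) ≤ (L + 1) * r}) = 0 := by
        rw [Measure.restrict_apply' (hΩ.measurableSet.inter measurableSet_ball)]
        refine measure_mono_null ?_ measure_empty
        rintro w ⟨hw1, hw2⟩
        have hδ := infDist_frontier_pos hΩ hF hw2.1
        have h4 := mem_iInter₂.1 hw1 (infDist w (frontier Ω) / (2 * (L + 1))) (by positivity)
        have h5 : infDist w (frontier Ω) ≤
          (L + 1) * (infDist w (frontier Ω) / (2 * (L + 1))) := h4
        have h6 : (L + 1) * (infDist w (frontier Ω) / (2 * (L + 1))) =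
          infDist w (frontier Ω) / 2 := by field_simp
        exfalso
        linarith
      rwa [h3] at h2
    have h4 := tendsto_setLIntegral_zero hfin h1
    refine h4.congr fun s => ?_
    rw [Measure.restrict_restrict (hSm s), inter_comm]
  have hK0 := ENNReal.Tendsto.const_mul hV0 (Or.inr hK)
  rw [mul_zero] at hK0
  refine tendsto_of_tendsto_of_tendsto_of_le_of_le' tendsto_const_nhds hK0
    (Eventually.of_forall fun _ => zero_le) ?_
  filter_upwards [Ioc_mem_nhdsGT H.s_pos] with s hs
  exact hmain s hs.1 hs.2

end IsTransversal


/-! ### A smooth partition of unity on the integer grid -/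

/-- A smooth bump on the line whose integer translates sum to one. -/
def lineBump (t : ℝ) : ℝ := Real.smoothTransition (t + 1) - Real.smoothTransition t

lemma contDiff_lineBump : ContDiff ℝ ∞ lineBump :=
  (Real.smoothTransition.contDiff.comp (contDiff_id.add contDiff_const)).sub
    Real.smoothTransition.contDiff

lemma lineBump_nonneg (t : ℝ) : 0 ≤ lineBump t := by
  rcases le_total t 0 with h | h
  · rw [lineBump, Real.smoothTransition.zero_of_nonpos h, sub_zero]
    exact Real.smoothTransition.nonneg _
  · rw [lineBump, Real.smoothTransition.one_of_one_le (by linarith), sub_nonneg]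
    exact Real.smoothTransition.le_one _

lemma lineBump_le_one (t : ℝ) : lineBump t ≤ 1 := by
  have h1 := Real.smoothTransition.le_one (t + 1)
  have h2 := Real.smoothTransition.nonneg t
  rw [lineBump]; linarith

lemma lineBump_eq_zero {t : ℝ} (h : 1 ≤ |t|) : lineBump t = 0 := by
  rcases le_abs'.1 h with h | h
  · rw [lineBump, Real.smoothTransition.zero_of_nonpos (by linarith),
      Real.smoothTransition.zero_of_nonpos (by linarith), sub_zero]
  · rw [lineBump, Real.smoothTransition.one_of_one_le (by linarith),
      Real.smoothTransition.one_of_one_le (by linarith), sub_self]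

/-- The bump is a difference of consecutive translates of a smooth step, so its translates
telescope; only the two integers around `t` contribute. -/
lemma sum_lineBump (t : ℝ) : ∑ i ∈ Finset.Icc ⌊t⌋ (⌊t⌋ + 1), lineBump (t - i) = 1 := by
  have h1 := Int.floor_le t
  have h2 := Int.lt_floor_add_one t
  have h3 : Finset.Icc ⌊t⌋ (⌊t⌋ + 1) = {⌊t⌋, ⌊t⌋ + 1} := by
    ext i; simp only [Finset.mem_Icc, Finset.mem_insert, Finset.mem_singleton]; omega
  rw [h3, Finset.sum_pair (by omega), lineBump, lineBump]
  push_cast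
  rw [Real.smoothTransition.one_of_one_le (x := t - ⌊t⌋ + 1) (by linarith),
    Real.smoothTransition.zero_of_nonpos (x := t - (⌊t⌋ + 1)) (by linarith),
    show t - (⌊t⌋ + 1) + 1 = t - (⌊t⌋ : ℝ) by ring]
  ring

/-- A smooth bump on the ambient space whose integer translates sum to one. -/
def gridBump (n : ℕ) (y : Amb n) : ℝ := ∏ j, lineBump (y j)

/-- The grid point with integer coordinates `i`. -/
def gridPt (i : Fin (n + 1) → ℤ) : Amb n := WithLp.toLp 2 fun j => (i j : ℝ)

lemma contDiff_gridBump : ContDiff ℝ ∞ (gridBump n) :=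
  contDiff_prod fun j _ => contDiff_lineBump.comp (EuclideanSpace.proj (𝕜 := ℝ) j).contDiff

lemma gridBump_nonneg (y : Amb n) : 0 ≤ gridBump n y :=
  Finset.prod_nonneg fun _ _ => lineBump_nonneg _

lemma gridBump_le_one (y : Amb n) : gridBump n y ≤ 1 :=
  Finset.prod_le_one (fun _ _ => lineBump_nonneg _) fun _ _ => lineBump_le_one _

lemma norm_le_of_forall_abs_le {y : Amb n} {B : ℝ} (h : ∀ j, |y j| ≤ B) : ‖y‖ ≤ (n + 1) * B := by
  have hB : 0 ≤ B := (abs_nonneg _).trans (h 0)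
  rw [EuclideanSpace.norm_eq, Real.sqrt_le_left (by positivity)]
  have h1 : ∑ i, ‖y i‖ ^ 2 ≤ ∑ _i : Fin (n + 1), B ^ 2 := by
    refine Finset.sum_le_sum fun i _ => ?_
    rw [Real.norm_eq_abs]
    exact pow_le_pow_left₀ (abs_nonneg _) (h i) 2
  refine h1.trans ?_
  simp only [Finset.sum_const, Finset.card_univ, Fintype.card_fin, nsmul_eq_mul]
  push_cast
  nlinarith [sq_nonneg B, (Nat.cast_nonneg n : (0:ℝ) ≤ n), mul_nonneg (Nat.cast_nonneg n : (0:ℝ) ≤ n) (sq_nonneg B), mul_nonneg (mul_nonneg (Nat.cast_nonneg n : (0:ℝ) ≤ n) (Nat.cast_nonneg n : (0:ℝ) ≤ n)) (sq_nonneg B)]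

lemma support_gridBump : Function.support (gridBump n) ⊆ closedBall 0 (n + 1) := fun y hy => by
  rw [mem_closedBall_zero_iff]
  have := norm_le_of_forall_abs_le (y := y) (B := 1) fun j => by
    by_contra hj
    exact hy (Finset.prod_eq_zero (Finset.mem_univ j) (lineBump_eq_zero (not_le.1 hj).le))
  linarith

lemma exists_bound_fderiv_gridBump (n : ℕ) :
    ∃ B : ℝ, 0 ≤ B ∧ ∀ y, ‖fderiv ℝ (gridBump n) y‖ ≤ B := by
  have hc : HasCompactSupport (gridBump n) :=
    HasCompactSupport.intro (isCompact_closedBall 0 ((n : ℝ) + 1)) fun y hy => by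
      by_contra h
      exact hy (support_gridBump h)
  have h := (contDiff_gridBump (n := n)).continuous_fderiv (by simp)
  obtain ⟨B, hB⟩ := (hc.fderiv ℝ).exists_bound_of_continuous h
  exact ⟨B, (norm_nonneg _).trans (hB 0), hB⟩

/-- Expand the product over coordinates of the one-dimensional sums. A grid point outside the
resulting box has a coordinate at distance at least one, where the bump vanishes. -/
lemma hasSum_gridBump (y : Amb n) :
    HasSum (fun i : Fin (n + 1) → ℤ => gridBump n (y - gridPt i)) 1 := by
  have h1 : ∑ i ∈ Fintype.piFinset fun j => Finset.Icc ⌊y j⌋ (⌊y j⌋ + 1),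
      gridBump n (y - gridPt i) = 1 := by
    have := (Finset.prod_univ_sum (fun j : Fin (n + 1) => Finset.Icc ⌊y j⌋ (⌊y j⌋ + 1))
      (fun j i => lineBump (y j - (i : ℝ)))).symm
    simp_rw [sum_lineBump, Finset.prod_const_one] at this
    exact this
  rw [← h1]
  refine hasSum_sum_of_ne_finset_zero fun i hi => ?_
  rw [Fintype.mem_piFinset, not_forall] at hi
  obtain ⟨j, hj⟩ := hi
  refine Finset.prod_eq_zero (Finset.mem_univ j) (lineBump_eq_zero ?_)
  change 1 ≤ |y j - (i j : ℝ)|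
  rw [Finset.mem_Icc, not_and_or, not_le, not_le] at hj
  have h1 := Int.floor_le (y j)
  have h2 := Int.lt_floor_add_one (y j)
  rcases hj with hj | hj
  · have : (i j : ℝ) + 1 ≤ ⌊y j⌋ := by exact_mod_cast hj
    exact le_abs.2 (Or.inl (by linarith))
  · have : (⌊y j⌋ : ℝ) + 1 + 1 ≤ i j := by exact_mod_cast hj
    exact le_abs.2 (Or.inr (by linarith))

/-- A ball of radius `B` contains boundedly many grid points. -/
lemma tsum_indicator_gridPt_le (y : Amb n) {B : ℝ} (hB : 0 ≤ B) :
    ∑' i : Fin (n + 1) → ℤ, (ball (gridPt i) B).indicator (fun _ => (1 : ℝ≥0∞)) y ≤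
      ENNReal.ofReal ((2 * B + 1) ^ (n + 1)) := by
  set I := Fintype.piFinset fun j => Finset.Icc ⌈y j - B⌉ ⌊y j + B⌋
  have h0 : ∀ i ∉ I, (ball (gridPt i) B).indicator (fun _ => (1 : ℝ≥0∞)) y = 0 := fun i hi => by
    refine indicator_of_notMem (fun hy => hi ?_) _
    refine Fintype.mem_piFinset.2 fun j => ?_
    have h1 : |y j - i j| ≤ dist y (gridPt i) := by
      rw [dist_eq_norm, ← Real.norm_eq_abs]
      exact PiLp.norm_apply_le (y - gridPt i) j
    have h2 := abs_le.1 (h1.trans (mem_ball.1 hy).le)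
    rw [Finset.mem_Icc]
    exact ⟨Int.ceil_le.2 (by linarith), Int.le_floor.2 (by linarith)⟩
  rw [tsum_eq_sum h0]
  calc ∑ i ∈ I, (ball (gridPt i) B).indicator (fun _ => (1 : ℝ≥0∞)) y ≤ ∑ _i ∈ I, 1 :=
        Finset.sum_le_sum fun i _ => indicator_le_self' (by simp) _
    _ = (I.card : ℝ≥0∞) := by simp
    _ ≤ _ := by
      rw [← ENNReal.ofReal_natCast]
      refine ENNReal.ofReal_le_ofReal ?_
      rw [Fintype.card_piFinset]
      push_cast
      calc ∏ j, ((Finset.Icc ⌈y j - B⌉ ⌊y j + B⌋).card : ℝ) ≤ ∏ _j : Fin (n + 1), (2 * B + 1) := by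
            refine Finset.prod_le_prod (fun _ _ => Nat.cast_nonneg _) fun j _ => ?_
            rw [Int.card_Icc]
            have h1 := Int.floor_le (y j + B)
            have h2 := Int.le_ceil (y j - B)
            have h3 : (((⌊y j + B⌋ + 1 - ⌈y j - B⌉).toNat : ℤ) : ℝ) ≤ 2 * B + 1 := by
              rw [Int.toNat_eq_max]
              push_cast
              refine max_le (by linarith) (by linarith)
            exact_mod_cast h3
        _ = _ := by simp

/-- Boundedly many dyadic scales are comparable to a given number. -/
lemma tsum_dyadic_le {s α B δ : ℝ} (hs : 0 < s) (hα : 0 < α) (hαB : α ≤ B) :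
    ∑' k : ℤ, (if α * (s * 2 ^ (-k)) ≤ δ ∧ δ ≤ B * (s * 2 ^ (-k)) then (1 : ℝ≥0∞) else 0) ≤
      ENNReal.ofReal (Real.logb 2 (B / α) + 1) := by
  have hB : 0 < B := hα.trans_le hαB
  rcases le_or_gt δ 0 with hδ | hδ
  · have : ∀ k : ℤ, ¬ (α * (s * 2 ^ (-k)) ≤ δ ∧ δ ≤ B * (s * 2 ^ (-k))) := fun k h => by
      have : 0 < α * (s * (2 : ℝ) ^ (-k)) := by positivity
      linarith [h.1]
    simp_rw [if_neg (this _), tsum_zero, zero_le]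
  set I := Finset.Icc ⌈Real.logb 2 (α * s / δ)⌉ ⌊Real.logb 2 (B * s / δ)⌋
  have h0 : ∀ k ∉ I, (if α * (s * 2 ^ (-k)) ≤ δ ∧ δ ≤ B * (s * 2 ^ (-k))
      then (1 : ℝ≥0∞) else 0) = 0 := fun k hk => by
    refine if_neg fun h => hk ?_
    rw [Finset.mem_Icc, Int.ceil_le, Int.le_floor]
    have h2 : (0 : ℝ) < 2 ^ k := by positivity
    have e : (2 : ℝ) ^ (-k) = (2 ^ k)⁻¹ := zpow_neg _ _
    rw [e] at h
    constructor
    · rw [Real.logb_le_iff_le_rpow (by norm_num) (by positivity), Real.rpow_intCast, div_le_iff₀ hδ]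
      have := h.1
      rw [← mul_assoc, ← div_eq_mul_inv, div_le_iff₀ h2] at this
      linarith
    · rw [Real.le_logb_iff_rpow_le (by norm_num) (by positivity), Real.rpow_intCast, le_div_iff₀ hδ]
      have := h.2
      rw [← mul_assoc, ← div_eq_mul_inv, le_div_iff₀ h2] at this
      linarith
  rw [tsum_eq_sum h0]
  calc _ ≤ ∑ _i ∈ I, (1 : ℝ≥0∞) := Finset.sum_le_sum fun i _ => by split_ifs <;> simp
    _ = (I.card : ℝ≥0∞) := by simp
    _ ≤ _ := by
      rw [← ENNReal.ofReal_natCast]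
      refine ENNReal.ofReal_le_ofReal ?_
      rw [Int.card_Icc]
      have h1 := Int.floor_le (Real.logb 2 (B * s / δ))
      have h2 := Int.le_ceil (Real.logb 2 (α * s / δ))
      have h4 : Real.logb 2 (B * s / δ) - Real.logb 2 (α * s / δ) = Real.logb 2 (B / α) := by
        rw [← Real.logb_div (by positivity) (by positivity)]
        congr 1
        field_simp
      have h5 : 0 ≤ Real.logb 2 (B / α) := Real.logb_nonneg (by norm_num) ((one_le_div hα).2 hαB)
      have h3 : (((⌊Real.logb 2 (B * s / δ)⌋ + 1 - ⌈Real.logb 2 (α * s / δ)⌉).toNat : ℤ) : ℝ) ≤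
          Real.logb 2 (B / α) + 1 := by
        rw [Int.toNat_eq_max]
        push_cast
        refine max_le (by linarith) (by linarith)
      exact_mod_cast h3

/-! ### Atoms -/

section Atoms

variable {θ : ℝ} {Ω : Set (Amb n)} {a : Amb n → ℂ}

lemma IsAtom.aestronglyMeasurable (h : IsAtom θ Ω a) :
    AEStronglyMeasurable a (surfaceMeasure Ω) := by
  obtain ⟨x₀, hx₀, r, hr, hs, ⟨K, hK⟩, _⟩ := h
  exact hK.continuousOn.aestronglyMeasurable isClosed_frontier.measurableSet

lemma isAtom_zero (hF : (frontier Ω).Nonempty) : IsAtom θ Ω (0 : Amb n → ℂ) := by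
  obtain ⟨x₀, hx₀⟩ := hF
  refine ⟨x₀, hx₀, 1, one_pos, by simp, ⟨0, LipschitzWith.const' (0 : ℂ) |>.lipschitzOnWith⟩,
    by simp, Eventually.of_forall fun x => ⟨0, ?_, by simp⟩⟩
  have : gradMap (0 : EuclideanSpace ℂ (Fin (n + 1))) = 0 := by
    ext v; simp [gradMap_apply]
  rw [this]
  exact hasFDerivWithinAt_const (0 : ℂ) x _

/-- The exponent `n/(n-θ)` is the one for which the factor `r^(θ-n)` from the sup bound cancels the
measure of the supporting ball, so the bound does not depend on the radius. -/
lemma IsAtom.eLpNorm_le (hn : 1 ≤ n) (hθ₁ : θ < 1) {C : ℝ≥0} (hσ : UpperRegular Ω C)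
    (h : IsAtom θ Ω a) :
    eLpNorm a (ENNReal.ofReal (n / (n - θ))) (surfaceMeasure Ω) ≤
      (C : ℝ≥0∞) ^ (((n : ℝ) - θ) / n) := by
  obtain ⟨x₀, hx₀, r, hr, hs, -, hb, -⟩ := h
  have hn' : (1 : ℝ) ≤ n := by exact_mod_cast hn
  have hs' : Function.support a ⊆ ball x₀ r := (subset_tsupport a).trans (hs.trans inter_subset_left)
  have hq : 0 < ((n : ℝ) - θ) / n := div_pos (by linarith) (by linarith)
  rw [← eLpNorm_restrict_eq_of_support_subset hs']
  refine (eLpNorm_le_of_ae_bound (ae_restrict_of_ae hb)).trans ?_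
  rw [Measure.restrict_apply_univ, ENNReal.toReal_ofReal (by rw [← inv_div]; positivity), inv_div]
  calc _ ≤ ((C : ℝ≥0∞) * ENNReal.ofReal (r ^ n)) ^ (((n : ℝ) - θ) / n) *
        ENNReal.ofReal (r ^ (θ - n)) :=
        mul_le_mul' (ENNReal.rpow_le_rpow (hσ x₀ r hr) hq.le) le_rfl
    _ = (C : ℝ≥0∞) ^ (((n : ℝ) - θ) / n) := by
        rw [ENNReal.mul_rpow_of_nonneg _ _ hq.le, mul_assoc,
          ENNReal.ofReal_rpow_of_pos (by positivity), ← ENNReal.ofReal_mul (by positivity),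
          ← Real.rpow_natCast, ← Real.rpow_mul hr.le, ← Real.rpow_add hr]
        have : (n : ℝ) * (((n : ℝ) - θ) / n) + (θ - n) = 0 := by field_simp; ring
        rw [this, Real.rpow_zero, ENNReal.ofReal_one, mul_one]

variable {ι : Type*} [Countable ι]

/-- On a ball of finite measure Hölder turns the uniform `L^p` bound for atoms into an `L¹` bound,
so the series converges absolutely almost everywhere there; countably many balls cover the space. -/
lemma ae_summable_atoms (hn : 1 ≤ n) (hθ₀ : 0 < θ) (hθ₁ : θ < 1) {C : ℝ≥0}
    (hσ : UpperRegular Ω C) {lam : ι → ℂ} {a : ι → Amb n → ℂ} (ha : ∀ i, IsAtom θ Ω (a i))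
    (hlam : ∑' i, ‖lam i‖ₑ ≠ ⊤) :
    ∀ᵐ x ∂(surfaceMeasure Ω), Summable fun i => lam i * a i x := by
  have := hσ.isLocallyFiniteMeasure
  have hn' : (1 : ℝ) ≤ n := by exact_mod_cast hn
  set p := ENNReal.ofReal (n / (n - θ))
  have hp : 1 ≤ p := by
    rw [← ENNReal.ofReal_one]
    exact ENNReal.ofReal_le_ofReal ((one_le_div (by linarith)).2 (by linarith))
  have hR : ∀ R : ℕ, ∀ᵐ x ∂(surfaceMeasure Ω).restrict (ball 0 R),
      Summable fun i => lam i * a i x := fun R => by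
    set μ := (surfaceMeasure Ω).restrict (ball 0 R)
    have hμ : μ univ ≠ ⊤ := by
      rw [Measure.restrict_apply_univ]
      exact measure_ball_lt_top.ne
    set D := (C : ℝ≥0∞) ^ (((n : ℝ) - θ) / n) *
      μ univ ^ (1 / (1 : ℝ≥0∞).toReal - 1 / p.toReal)
    have hq : 0 < ((n : ℝ) - θ) / n := div_pos (by linarith) (by linarith)
    have hD : D ≠ ⊤ := by
      refine ENNReal.mul_ne_top (ENNReal.rpow_ne_top_of_nonneg hq.le ENNReal.coe_ne_top)
        (ENNReal.rpow_ne_top_of_nonneg ?_ hμ)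
      rw [ENNReal.toReal_ofReal (by rw [← inv_div]; positivity), one_div_div, ENNReal.toReal_one]
      have : ((n : ℝ) - θ) / n ≤ 1 := (div_le_one (by linarith)).2 (by linarith)
      linarith
    have h1 : ∀ i, ∫⁻ x, ‖a i x‖ₑ ∂μ ≤ D := fun i => by
      rw [← eLpNorm_one_eq_lintegral_enorm]
      refine (eLpNorm_le_eLpNorm_mul_rpow_measure_univ hp
        (ha i).aestronglyMeasurable.restrict).trans (mul_le_mul' ?_ le_rfl)
      exact (eLpNorm_mono_measure _ Measure.restrict_le_self).trans ((ha i).eLpNorm_le hn hθ₁ hσ)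
    have h2 : ∫⁻ x, ∑' i, ‖lam i * a i x‖ₑ ∂μ ≠ ⊤ := by
      rw [lintegral_tsum fun i => ((ha i).aestronglyMeasurable.restrict.const_mul _).enorm]
      have : ∀ i, ∫⁻ x, ‖lam i * a i x‖ₑ ∂μ ≤ ‖lam i‖ₑ * D := fun i => by
        simp_rw [enorm_mul]
        rw [lintegral_const_mul' _ _ enorm_ne_top]
        exact mul_le_mul' le_rfl (h1 i)
      refine ((ENNReal.tsum_le_tsum this).trans_lt ?_).ne
      rw [ENNReal.tsum_mul_right]
      exact ENNReal.mul_lt_top hlam.lt_top hD.lt_top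
    have h3 := ae_lt_top' (AEMeasurable.tsum fun i =>
      ((ha i).aestronglyMeasurable.restrict.const_mul (lam i)).enorm) h2
    filter_upwards [h3] with x hx
    refine Summable.of_norm ?_
    have := ENNReal.summable_toReal hx.ne
    simpa only [toReal_enorm] using this
  have h4 := (ae_restrict_iUnion_iff (μ := surfaceMeasure Ω) (fun R : ℕ => ball (0 : Amb n) R) _).2 hR
  rwa [iUnion_ball_nat, Measure.restrict_univ] at h4

/-- An upper bound for the atomic norm from a series of atoms over a countable index set. -/
lemma atomicNorm_le_tsum (hn : 1 ≤ n) (hθ₀ : 0 < θ) (hθ₁ : θ < 1) (hF : (frontier Ω).Nonempty)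
    {C : ℝ≥0} (hσ : UpperRegular Ω C) {lam : ι → ℂ} {a : ι → Amb n → ℂ}
    (ha : ∀ i, IsAtom θ Ω (a i)) (hlam : ∑' i, ‖lam i‖ₑ ≠ ⊤) {f : Amb n → ℂ} {c : ℂ}
    (hf : ∀ᵐ x ∂(surfaceMeasure Ω), HasSum (fun i => lam i * a i x) (f x - c)) :
    atomicNorm θ Ω f ≤ ∑' i, ‖lam i‖ₑ := by
  have hn' : (1 : ℝ) ≤ n := by exact_mod_cast hn
  -- The definition requires a sequence: reindex by naturals and fill the gaps with zero atoms and
  -- zero coefficients.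
  obtain ⟨g, hg⟩ := exists_injective_nat ι
  set lam' : ℕ → ℂ := Function.extend g lam 0
  set a' : ℕ → Amb n → ℂ := Function.extend g a 0
  have ha' : ∀ j, IsAtom θ Ω (a' j) := fun j => by
    by_cases hj : ∃ i, g i = j
    · obtain ⟨i, rfl⟩ := hj
      rw [show a' (g i) = a i from hg.extend_apply a 0 i]
      exact ha i
    · rw [show a' j = 0 from Function.extend_apply' _ _ _ hj]
      exact isAtom_zero hF
  have hsum : ∑' j, ‖lam' j‖ₑ = ∑' i, ‖lam i‖ₑ := by
    rw [← tsum_extend_zero hg]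
    refine tsum_congr fun j => ?_
    by_cases hj : ∃ i, g i = j
    · obtain ⟨i, rfl⟩ := hj
      rw [hg.extend_apply, show lam' (g i) = lam i from hg.extend_apply _ _ i]
    · rw [Function.extend_apply' _ _ _ hj, show lam' j = 0 from Function.extend_apply' _ _ _ hj]
      simp
  have hf' : ∀ᵐ x ∂(surfaceMeasure Ω), HasSum (fun j => lam' j * a' j x) (f x - c) := by
    filter_upwards [hf] with x hx
    rw [← hasSum_extend_zero hg] at hx
    convert hx using 2 with j
    by_cases hj : ∃ i, g i = j
    · obtain ⟨i, rfl⟩ := hj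
      rw [hg.extend_apply, show lam' (g i) = lam i from hg.extend_apply _ _ i,
        show a' (g i) = a i from hg.extend_apply a 0 i]
    · rw [Function.extend_apply' _ _ _ hj, show lam' j = 0 from Function.extend_apply' _ _ _ hj]
      simp
  rw [← hsum] at hlam ⊢
  refine iInf_le_of_le c (iInf_le_of_le lam' (iInf_le_of_le a' (iInf_le_of_le ⟨ha', ?_⟩ le_rfl)))
  set p := ENNReal.ofReal (n / (n - θ))
  have hp : 1 ≤ p := by
    rw [← ENNReal.ofReal_one]
    exact ENNReal.ofReal_le_ofReal ((one_le_div (by linarith)).2 (by linarith))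
  set D := (C : ℝ≥0∞) ^ (((n : ℝ) - θ) / n)
  have hD : D ≠ ⊤ := ENNReal.rpow_ne_top_of_nonneg (by
    exact (div_pos (by linarith) (by linarith)).le) ENNReal.coe_ne_top
  have hterm : ∀ j, eLpNorm (fun x => lam' j * a' j x) p (surfaceMeasure Ω) ≤ ‖lam' j‖ₑ * D :=
    fun j => by
      rw [show (fun x => lam' j * a' j x) = lam' j • a' j from rfl, eLpNorm_const_smul]
      exact mul_le_mul' le_rfl ((ha' j).eLpNorm_le hn hθ₁ hσ)
  -- The remainder is the almost everywhere limit of partial tails; Fatou in `L^p` and Minkowski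
  -- bound it by the tail of the coefficients.
  have hbd : ∀ k : ℕ, eLpNorm (fun x => f x - (c + ∑ j ∈ Finset.range k, lam' j * a' j x)) p
      (surfaceMeasure Ω) ≤ (∑' j, ‖lam' (j + k)‖ₑ) * D := fun k => by
    have hm : ∀ m : ℕ, AEStronglyMeasurable
        (fun x => ∑ j ∈ Finset.range m, lam' (j + k) * a' (j + k) x) (surfaceMeasure Ω) := fun m => by
      exact Finset.aestronglyMeasurable_fun_sum _ fun j _ =>
        (ha' _).aestronglyMeasurable.const_mul _
    have hlim : ∀ᵐ x ∂(surfaceMeasure Ω), Tendsto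
        (fun m => ∑ j ∈ Finset.range m, lam' (j + k) * a' (j + k) x) atTop
        (𝓝 (f x - (c + ∑ j ∈ Finset.range k, lam' j * a' j x))) := by
      filter_upwards [hf'] with x hx
      have := ((hasSum_nat_add_iff' k).2 hx).tendsto_sum_nat
      rwa [sub_sub] at this
    refine (Lp.eLpNorm_lim_le_liminf_eLpNorm hm _ hlim).trans ?_
    refine liminf_le_of_le (by isBoundedDefault) fun b hb => ?_
    obtain ⟨m, hm'⟩ := hb.exists
    refine hm'.trans ?_
    have e1 : (fun x => ∑ j ∈ Finset.range m, lam' (j + k) * a' (j + k) x) =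
        ∑ j ∈ Finset.range m, fun x => lam' (j + k) * a' (j + k) x := by
      ext x; simp
    rw [e1]
    refine (eLpNorm_sum_le (fun j _ => (ha' _).aestronglyMeasurable.const_mul _) hp).trans ?_
    refine (Finset.sum_le_sum fun j _ => hterm (j + k)).trans ?_
    rw [← Finset.sum_mul]
    exact mul_le_mul' (ENNReal.sum_le_tsum _) le_rfl
  have h0 := ENNReal.Tendsto.mul_const (b := D) (ENNReal.tendsto_sum_nat_add _ hlam) (Or.inr hD)
  rw [zero_mul] at h0
  exact tendsto_of_tendsto_of_tendsto_of_le_of_le tendsto_const_nhds h0 (fun _ => zero_le) hbd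

end Atoms


/-! ### Atoms from localized differences -/

section DyadicAtoms

variable {θ : ℝ} {Ω : Set (Amb n)}

/-- A continuously differentiable function with the right bounds on the boundary is a multiple of
an atom there. -/
lemma exists_isAtom_mul_eq {b : Amb n → ℂ} (hb : ContDiff ℝ 1 b) {x₀ : Amb n}
    (hx₀ : x₀ ∈ frontier Ω) {r r' : ℝ} (hr : 0 < r) (hr' : r' < r)
    (hsupp : ∀ x ∈ frontier Ω, b x ≠ 0 → x ∈ closedBall x₀ r')
    (hlip : ∃ K : ℝ≥0, LipschitzOnWith K b (frontier Ω)) {Λ : ℝ} (hΛ : 0 ≤ Λ)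
    (h0 : ∀ x ∈ frontier Ω, ‖b x‖ ≤ Λ * r ^ (θ - n))
    (h1 : ∀ x ∈ frontier Ω, (n + 1) * ‖fderiv ℝ b x‖ ≤ Λ * r ^ (θ - 1 - n)) :
    ∃ a, IsAtom θ Ω a ∧ ∀ x ∈ frontier Ω, (Λ : ℂ) * a x = b x := by
  classical
  -- With `Λ = 0` the function vanishes on the boundary and no rescaling is possible; the zero atom
  -- serves.
  rcases hΛ.eq_or_lt with rfl | hΛ
  · refine ⟨0, isAtom_zero ⟨x₀, hx₀⟩, fun x hx => ?_⟩
    have := h0 x hx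
    rw [zero_mul, norm_le_zero_iff] at this
    rw [this]; simp
  -- Atoms are extended by zero off the boundary, so the smooth function is restricted by an
  -- indicator. Its ambient derivative still represents the derivative within the frontier.
  set a : Amb n → ℂ := (frontier Ω).indicator fun x => ((Λ⁻¹ : ℝ) : ℂ) * b x
  have ha : ∀ x ∈ frontier Ω, a x = ((Λ⁻¹ : ℝ) : ℂ) * b x := fun x hx => indicator_of_mem hx _
  have hnorm : ∀ z : ℂ, ‖((Λ⁻¹ : ℝ) : ℂ) * z‖ = Λ⁻¹ * ‖z‖ := fun z => by
    rw [norm_mul, Complex.norm_real, Real.norm_of_nonneg (by positivity)]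
  refine ⟨a, ⟨x₀, hx₀, r, hr, ?_, ?_, ?_, ?_⟩, fun x hx => ?_⟩
  · have hcl : IsClosed (closedBall x₀ r' ∩ frontier Ω) := isClosed_closedBall.inter isClosed_frontier
    refine (closure_minimal (fun x hx => ?_) hcl).trans
      (inter_subset_inter_left _ (closedBall_subset_ball hr'))
    have hxF : x ∈ frontier Ω := by
      by_contra h
      exact hx (indicator_of_notMem h _)
    refine ⟨hsupp x hxF fun h => hx ?_, hxF⟩
    rw [ha x hxF, h, mul_zero]
  · obtain ⟨K, hK⟩ := hlip
    refine ⟨Λ⁻¹.toNNReal * K, LipschitzOnWith.of_dist_le_mul fun x hx y hy => ?_⟩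
    rw [ha x hx, ha y hy, dist_eq_norm, ← mul_sub, hnorm, NNReal.coe_mul,
      Real.coe_toNNReal _ (by positivity), mul_assoc, ← dist_eq_norm]
    exact mul_le_mul_of_nonneg_left (hK.dist_le_mul x hx y hy) (by positivity)
  · filter_upwards [ae_mem_frontier Ω] with x hx
    rw [ha x hx, hnorm, inv_mul_le_iff₀ hΛ]
    exact h0 x hx
  · filter_upwards [ae_mem_frontier Ω] with x hx
    refine ⟨((Λ⁻¹ : ℝ) : ℂ) • gradVec b x, ?_, ?_⟩
    · have hd := (hb.differentiable one_ne_zero x).hasFDerivAt.const_smul (((Λ⁻¹ : ℝ) : ℂ))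
      have e : gradMap (((Λ⁻¹ : ℝ) : ℂ) • gradVec b x) = ((Λ⁻¹ : ℝ) : ℂ) • fderiv ℝ b x := by
        refine clm_ext_single fun i => ?_
        rw [gradMap_single]
        rfl
      rw [e]
      exact hd.hasFDerivWithinAt.congr ha (ha x hx)
    · rw [norm_smul, Complex.norm_real, Real.norm_of_nonneg (by positivity), inv_mul_le_iff₀ hΛ]
      refine le_trans ?_ (h1 x hx)
      have := norm_le_of_norm_gradMap_le (g := gradVec b x)
      rwa [gradMap_gradVec] at this
  · rw [ha x hx, ← mul_assoc, ← Complex.ofReal_mul, mul_inv_cancel₀ hΛ.ne', Complex.ofReal_one,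
      one_mul]

/-- The bump of the grid of side `t` at the grid point with coordinates `i`. -/
def gridCut (t : ℝ) (i : Fin (n + 1) → ℤ) (x : Amb n) : ℝ := gridBump n (t⁻¹ • x - gridPt i)

lemma contDiff_gridCut (t : ℝ) (i : Fin (n + 1) → ℤ) : ContDiff ℝ ∞ (gridCut t i) :=
  contDiff_gridBump.comp ((contDiff_const_smul t⁻¹).sub contDiff_const)

lemma support_gridCut {t : ℝ} (ht : 0 < t) (i : Fin (n + 1) → ℤ) :
    Function.support (gridCut t i) ⊆ closedBall (t • gridPt i) ((n + 1) * t) := fun x hx => by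
  have h := mem_closedBall_zero_iff.1 (support_gridBump (n := n) (Function.mem_support.2 hx))
  rw [mem_closedBall, dist_eq_norm]
  have e : x - t • gridPt i = t • (t⁻¹ • x - gridPt i) := by
    rw [smul_sub, smul_smul, mul_inv_cancel₀ ht.ne', one_smul]
  rw [e, norm_smul, Real.norm_of_nonneg ht.le]
  nlinarith

lemma norm_fderiv_gridCut_le {B : ℝ} (hB : ∀ y, ‖fderiv ℝ (gridBump n) y‖ ≤ B) {t : ℝ} (ht : 0 < t)
    (i : Fin (n + 1) → ℤ) (x : Amb n) : ‖fderiv ℝ (gridCut t i) x‖ ≤ B * t⁻¹ := by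
  have h1 : HasFDerivAt (fun x : Amb n => t⁻¹ • x - gridPt i)
      (t⁻¹ • ContinuousLinearMap.id ℝ (Amb n)) x :=
    ((hasFDerivAt_id x).const_smul t⁻¹).sub_const _
  have h2 := ((contDiff_gridBump (n := n)).differentiable (by simp)
    (t⁻¹ • x - gridPt i)).hasFDerivAt.comp x h1
  rw [show gridCut t i = gridBump n ∘ fun x => t⁻¹ • x - gridPt i from rfl, h2.fderiv]
  refine (ContinuousLinearMap.opNorm_comp_le _ _).trans ?_
  have hB0 : 0 ≤ B := (norm_nonneg _).trans (hB 0)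
  refine mul_le_mul (hB _) ?_ (norm_nonneg _) hB0
  rw [norm_smul, Real.norm_of_nonneg (by positivity)]
  exact mul_le_of_le_one_right (by positivity) ContinuousLinearMap.norm_id_le

/-- At scale `t` the cut-off loses `1/t` on differentiation, which is the ratio between the two
bounds assumed of `φ` and between the two bounds for an atom of radius comparable to `t`. The
coefficient `t^(-θ) J` is what matching the normalizations leaves, up to a constant. -/
lemma exists_isAtom_gridCut {B : ℝ} (hB : ∀ y, ‖fderiv ℝ (gridBump n) y‖ ≤ B)
    (hn : 1 ≤ n) (hF : (frontier Ω).Nonempty) {φ : Amb n → ℂ} (hφ : ContDiff ℝ 1 φ)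
    {t J : ℝ} (ht : 0 < t) (hJ : 0 ≤ J) (i : Fin (n + 1) → ℤ)
    (h0 : ∀ x ∈ frontier Ω, x ∈ closedBall (t • gridPt i) ((n + 1) * t) →
      ‖φ x‖ ≤ (t ^ n)⁻¹ * J)
    (h1 : ∀ x ∈ frontier Ω, x ∈ closedBall (t • gridPt i) ((n + 1) * t) →
      ‖fderiv ℝ φ x‖ ≤ (t ^ (n + 1))⁻¹ * J) :
    ∃ a, IsAtom θ Ω a ∧ ∀ x ∈ frontier Ω,
      (((n + 1) * (1 + B) * (2 * n + 3) ^ (n + 1 - θ) * (t ^ (-θ) * J) : ℝ) : ℂ) * a x =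
        gridCut t i x * φ x := by
  have hB0 : 0 ≤ B := (norm_nonneg _).trans (hB 0)
  have hn' : (1 : ℝ) ≤ n := by exact_mod_cast hn
  set b : Amb n → ℂ := fun x => gridCut t i x * φ x
  have hsub : Function.support b ⊆ closedBall (t • gridPt i) ((n + 1) * t) := fun x hx =>
    support_gridCut ht i fun h => hx (by simp only [b, h, Complex.ofReal_zero, zero_mul])
  have hts : tsupport b ⊆ closedBall (t • gridPt i) ((n + 1) * t) :=
    closure_minimal hsub isClosed_closedBall
  have hcut : ContDiff ℝ 1 (gridCut t i) := (contDiff_gridCut t i).of_le (by norm_cast)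
  have hb : ContDiff ℝ 1 b := (Complex.ofRealCLM.contDiff.comp hcut).mul hφ
  by_cases hne : (frontier Ω ∩ closedBall (t • gridPt i) ((n + 1) * t)).Nonempty
  swap
  -- An atom must be centred on the boundary. If the bump reaches no boundary point, the product
  -- vanishes there and the zero atom is enough.
  · refine ⟨0, isAtom_zero hF, fun x hx => ?_⟩
    have : b x = 0 := by
      by_contra h
      exact hne ⟨x, hx, hsub h⟩
    rw [Pi.zero_apply, mul_zero]
    exact this.symm
  obtain ⟨x₀, hx₀, hx₀'⟩ := hne
  set P : ℝ := (n + 1) * (1 + B)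
  have hP : 1 ≤ P := by nlinarith
  -- The bump lies in a ball of radius `(n+1)t`, so seen from a boundary point `x₀` of that ball its
  -- support has radius at most `(2n+2)t`. The extra `t` leaves room for the open ball in the
  -- definition of an atom.
  set ρ : ℝ := 2 * n + 3
  have hρ : 1 ≤ ρ := by simp only [ρ]; linarith
  have hρ0 : 0 < ρ := by linarith
  have key0 : P * ρ ^ (n + 1 - θ) * (t ^ (-θ) * J) * (ρ * t) ^ (θ - n) =
      P * ρ * ((t ^ n)⁻¹ * J) := by
    rw [Real.mul_rpow hρ0.le ht.le]
    calc _ = P * (ρ ^ (n + 1 - θ) * ρ ^ (θ - n)) * ((t ^ (-θ) * t ^ (θ - n)) * J) := by ring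
      _ = _ := by
        rw [← Real.rpow_add hρ0, ← Real.rpow_add ht, ← Real.rpow_natCast, ← Real.rpow_neg ht.le,
          show (n : ℝ) + 1 - θ + (θ - n) = 1 by ring, show -θ + (θ - n) = -(n : ℝ) by ring,
          Real.rpow_one]
  have key1 : P * ρ ^ (n + 1 - θ) * (t ^ (-θ) * J) * (ρ * t) ^ (θ - 1 - n) =
      P * ((t ^ (n + 1))⁻¹ * J) := by
    rw [Real.mul_rpow hρ0.le ht.le]
    calc _ = P * (ρ ^ (n + 1 - θ) * ρ ^ (θ - 1 - n)) * ((t ^ (-θ) * t ^ (θ - 1 - n)) * J) := by ring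
      _ = _ := by
        rw [← Real.rpow_add hρ0, ← Real.rpow_add ht, ← Real.rpow_natCast t (n + 1),
          ← Real.rpow_neg ht.le]
        push_cast
        ring_nf
        simp
  have hle1 : ∀ x, ‖((gridCut t i x : ℝ) : ℂ)‖ ≤ 1 := fun x => by
    rw [Complex.norm_real, gridCut, Real.norm_of_nonneg (gridBump_nonneg _)]
    exact gridBump_le_one _
  refine exists_isAtom_mul_eq hb hx₀ (r := ρ * t) (r' := (2 * n + 2) * t) (by positivity)
    (by simp only [ρ]; nlinarith) (fun x _ hx => ?_) ?_ (by positivity) (fun x hx => ?_)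
    fun x hx => ?_
  · have h2 := mem_closedBall.1 (hsub hx)
    rw [mem_closedBall] at hx₀' ⊢
    have h3 := dist_triangle_right x x₀ (t • gridPt i)
    nlinarith
  · have hcs : HasCompactSupport b := (isCompact_closedBall _ _).of_isClosed_subset
      (isClosed_tsupport _) hts
    obtain ⟨K, hK⟩ := hb.lipschitzWith_of_hasCompactSupport hcs one_ne_zero
    exact ⟨K, hK.lipschitzOnWith⟩
  · rw [key0]
    have hnn : 0 ≤ (t ^ n)⁻¹ * J := by positivity
    by_cases hxs : b x = 0
    · rw [hxs, norm_zero]; positivity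
    · have h3 := h0 x hx (hsub hxs)
      have h4 : ‖b x‖ ≤ 1 * ‖φ x‖ := by
        simp only [b]
        rw [norm_mul]
        exact mul_le_mul_of_nonneg_right (hle1 x) (norm_nonneg _)
      have : 1 ≤ P * ρ := by nlinarith
      nlinarith
  · rw [key1]
    have hnn : 0 ≤ (t ^ (n + 1))⁻¹ * J := by positivity
    by_cases hxs : x ∈ closedBall (t • gridPt i) ((n + 1) * t)
    swap
    · have : fderiv ℝ b x = 0 :=
        image_eq_zero_of_notMem_tsupport fun h => hxs (hts (tsupport_fderiv_subset ℝ h))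
      rw [this, norm_zero, mul_zero]
      positivity
    have hd := (Complex.ofRealCLM.hasFDerivAt.comp x
      (hcut.differentiable one_ne_zero x).hasFDerivAt).mul
      (hφ.differentiable one_ne_zero x).hasFDerivAt
    have hd' : fderiv ℝ b x = ((gridCut t i x : ℝ) : ℂ) • fderiv ℝ φ x +
        φ x • Complex.ofRealCLM.comp (fderiv ℝ (gridCut t i) x) := hd.fderiv
    have hfc : ‖Complex.ofRealCLM.comp (fderiv ℝ (gridCut t i) x)‖ ≤ B * t⁻¹ := by
      refine (ContinuousLinearMap.opNorm_comp_le _ _).trans ?_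
      rw [Complex.ofRealCLM_norm, one_mul]
      exact norm_fderiv_gridCut_le hB ht i x
    have h5 : ‖fderiv ℝ b x‖ ≤ 1 * ((t ^ (n + 1))⁻¹ * J) + (t ^ n)⁻¹ * J * (B * t⁻¹) := by
      rw [hd']
      refine (norm_add_le _ _).trans ?_
      rw [norm_smul, norm_smul]
      exact add_le_add (mul_le_mul (hle1 x) (h1 x hx hxs) (norm_nonneg _) zero_le_one)
        (mul_le_mul (h0 x hx hxs) hfc (norm_nonneg _) (by positivity))
    have h6 : (t ^ n)⁻¹ * J * (B * t⁻¹) = B * ((t ^ (n + 1))⁻¹ * J) := by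
      rw [pow_succ, mul_inv]; ring
    rw [h6] at h5
    calc (n + 1) * ‖fderiv ℝ b x‖ ≤ (n + 1) * (1 * ((t ^ (n + 1))⁻¹ * J) + B * ((t ^ (n + 1))⁻¹ * J)) := by gcongr
      _ = _ := by simp only [P]; ring

/-- The part of `Ω` at distance comparable to `t` from the boundary. -/
def shell (Ω : Set (Amb n)) (α B t : ℝ) : Set (Amb n) :=
  {w ∈ Ω | α * t ≤ infDist w (frontier Ω) ∧ infDist w (frontier Ω) ≤ B * t}

lemma measurableSet_shell (hΩ : IsOpen Ω) (α B t : ℝ) : MeasurableSet (shell Ω α B t) := by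
  have hcd : Continuous fun w : Amb n => infDist w (frontier Ω) := continuous_infDist_pt _
  exact hΩ.measurableSet.inter ((measurableSet_le measurable_const hcd.measurable).inter
    (measurableSet_le hcd.measurable measurable_const))

/-- Bounded overlap: a point at distance `δ` from the boundary lies in the shells of boundedly many
dyadic scales, and at each scale in boundedly many of the grid balls. In a shell `t` is at least
`δ/B`, so `t^(-θ)` is at most a multiple of `δ^(-θ)`. -/
lemma tsum_shell_le (hΩ : IsOpen Ω) (hF : (frontier Ω).Nonempty) (hθ₀ : 0 < θ)
    {G : Amb n → EuclideanSpace ℂ (Fin (n + 1))} (hG : Measurable G) {s α B B' : ℝ} (hs : 0 < s)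
    (hα : 0 < α) (hαB : α ≤ B) (hB' : 0 ≤ B') :
    ∑' p : ℤ × (Fin (n + 1) → ℤ), ENNReal.ofReal ((s * 2 ^ (-p.1)) ^ (-θ)) *
        ∫⁻ w in shell Ω α B (s * 2 ^ (-p.1)) ∩
          ball ((s * 2 ^ (-p.1)) • gridPt p.2) (B' * (s * 2 ^ (-p.1))), ‖G w‖ₑ ≤
      ENNReal.ofReal (B ^ θ) * ENNReal.ofReal (Real.logb 2 (B / α) + 1) *
        ENNReal.ofReal ((2 * B' + 1) ^ (n + 1)) * wInt θ Ω G := by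
  have hB : 0 < B := hα.trans_le hαB
  have ht : ∀ k : ℤ, 0 < s * (2 : ℝ) ^ (-k) := fun k => by positivity
  set F : ℤ × (Fin (n + 1) → ℤ) → Amb n → ℝ≥0∞ := fun p =>
    (shell Ω α B (s * 2 ^ (-p.1)) ∩
          ball ((s * 2 ^ (-p.1)) • gridPt p.2) (B' * (s * 2 ^ (-p.1)))).indicator
      fun w => ENNReal.ofReal ((s * 2 ^ (-p.1)) ^ (-θ)) * ‖G w‖ₑ
  have hms : ∀ p : ℤ × (Fin (n + 1) → ℤ), MeasurableSet (shell Ω α B (s * 2 ^ (-p.1)) ∩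
          ball ((s * 2 ^ (-p.1)) • gridPt p.2) (B' * (s * 2 ^ (-p.1)))) := fun p =>
    (measurableSet_shell hΩ _ _ _).inter measurableSet_ball
  have e1 : ∀ p : ℤ × (Fin (n + 1) → ℤ), ENNReal.ofReal ((s * 2 ^ (-p.1)) ^ (-θ)) *
        ∫⁻ w in shell Ω α B (s * 2 ^ (-p.1)) ∩
          ball ((s * 2 ^ (-p.1)) • gridPt p.2) (B' * (s * 2 ^ (-p.1))), ‖G w‖ₑ =
      ∫⁻ w in Ω, F p w := fun p => by
    rw [← lintegral_const_mul' _ _ ENNReal.ofReal_ne_top]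
    simp only [F]
    have hsub : shell Ω α B (s * 2 ^ (-p.1)) ∩
        ball ((s * 2 ^ (-p.1)) • gridPt p.2) (B' * (s * 2 ^ (-p.1))) ⊆ Ω := fun w hw => hw.1.1
    rw [lintegral_indicator (hms p), Measure.restrict_restrict (hms p),
      inter_eq_self_of_subset_left hsub]
  simp_rw [e1]
  rw [← lintegral_tsum fun p => ((hG.enorm.const_mul _).indicator (hms p)).aemeasurable, wInt,
    ← lintegral_const_mul' _ _ (by finiteness)]
  refine setLIntegral_mono' hΩ.measurableSet fun w hw => ?_
  have hδ := infDist_frontier_pos hΩ hF hw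
  set δ := infDist w (frontier Ω)
  have hk : ∀ k : ℤ, ∑' i : Fin (n + 1) → ℤ, F (k, i) w ≤
      (if α * (s * 2 ^ (-k)) ≤ δ ∧ δ ≤ B * (s * 2 ^ (-k)) then (1 : ℝ≥0∞) else 0) *
        (ENNReal.ofReal (B ^ θ) * ENNReal.ofReal ((2 * B' + 1) ^ (n + 1)) *
          (‖G w‖ₑ * ENNReal.ofReal (δ ^ (-θ)))) := fun k => by
    set t := s * (2 : ℝ) ^ (-k)
    by_cases hks : α * t ≤ δ ∧ δ ≤ B * t
    swap
    · have : ∀ i, F (k, i) w = 0 := fun i => indicator_of_notMem (fun h => hks h.1.2) _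
      simp_rw [this, tsum_zero]
      exact zero_le
    rw [if_pos hks, one_mul]
    have hw1 : ENNReal.ofReal (t ^ (-θ)) ≤ ENNReal.ofReal (B ^ θ) * ENNReal.ofReal (δ ^ (-θ)) := by
      rw [← ENNReal.ofReal_mul (by positivity)]
      refine ENNReal.ofReal_le_ofReal ?_
      rw [Real.rpow_neg (ht k).le, Real.rpow_neg hδ.le, ← div_eq_mul_inv,
        le_div_iff₀ (by positivity), inv_mul_le_iff₀ (Real.rpow_pos_of_pos (ht k) _), mul_comm,
        ← Real.mul_rpow hB.le (ht k).le]
      exact Real.rpow_le_rpow hδ.le hks.2 hθ₀.le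
    have hi : ∀ i, F (k, i) w ≤ (ball (gridPt i) B').indicator (fun _ => (1 : ℝ≥0∞)) (t⁻¹ • w) *
        (ENNReal.ofReal (t ^ (-θ)) * ‖G w‖ₑ) := fun i => by
      by_cases hwi : w ∈ ball (t • gridPt i) (B' * t)
      · have : t⁻¹ • w ∈ ball (gridPt i) B' := by
          rw [mem_ball, dist_eq_norm] at hwi ⊢
          have e : t⁻¹ • w - gridPt i = t⁻¹ • (w - t • gridPt i) := by
            rw [smul_sub, smul_smul, inv_mul_cancel₀ (ht k).ne', one_smul]
          rw [e, norm_smul, norm_inv, Real.norm_of_nonneg (ht k).le, inv_mul_lt_iff₀ (ht k)]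
          linarith
        rw [indicator_of_mem this, one_mul]
        exact indicator_le_self _ _ _
      · rw [show F (k, i) w = 0 from indicator_of_notMem (fun h => hwi h.2) _]
        exact zero_le
    refine (ENNReal.tsum_le_tsum hi).trans ?_
    rw [ENNReal.tsum_mul_right]
    refine (mul_le_mul' (tsum_indicator_gridPt_le _ hB') (mul_le_mul' hw1 le_rfl)).trans (le_of_eq ?_)
    ring
  refine (le_of_eq (ENNReal.tsum_prod (f := fun k i => F (k, i) w))).trans ?_
  refine (ENNReal.tsum_le_tsum hk).trans ?_
  rw [ENNReal.tsum_mul_right]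
  refine (mul_le_mul' (tsum_dyadic_le hs hα hαB) le_rfl).trans (le_of_eq ?_)
  ring

/-- Dyadic pieces controlled by a vector field near the boundary decompose into atoms. -/
lemma exists_dyadic_atoms (n : ℕ) (hn : 1 ≤ n) {θ : ℝ} (hθ₀ : 0 < θ) {α B : ℝ}
    (hα : 0 < α) (hαB : α ≤ B) (K : ℝ≥0) : ∃ C : ℝ≥0, ∀ (Ω : Set (Amb n)), IsOpen Ω →
    (frontier Ω).Nonempty → ∀ (G : Amb n → EuclideanSpace ℂ (Fin (n + 1))), Measurable G →
    wInt θ Ω G ≠ ⊤ → ∀ (s : ℝ), 0 < s → ∀ D : ℤ → Amb n → ℂ, (∀ k, ContDiff ℝ 1 (D k)) →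
    (∀ k, ∀ x ∈ frontier Ω, ‖D k x‖ₑ ≤ K * ENNReal.ofReal (((s * 2 ^ (-k)) ^ n)⁻¹) *
      ∫⁻ w in shell Ω α B (s * 2 ^ (-k)) ∩ ball x (B * (s * 2 ^ (-k))), ‖G w‖ₑ) →
    (∀ k, ∀ x ∈ frontier Ω, ‖fderiv ℝ (D k) x‖ₑ ≤ K * ENNReal.ofReal (((s * 2 ^ (-k)) ^ (n + 1))⁻¹) *
      ∫⁻ w in shell Ω α B (s * 2 ^ (-k)) ∩ ball x (B * (s * 2 ^ (-k))), ‖G w‖ₑ) →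
    ∃ (lam : ℤ × (Fin (n + 1) → ℤ) → ℂ) (a : ℤ × (Fin (n + 1) → ℤ) → Amb n → ℂ),
      (∀ p, IsAtom θ Ω (a p)) ∧ (∑' p, ‖lam p‖ₑ ≤ C * wInt θ Ω G) ∧
      ∀ x ∈ frontier Ω, ∀ k i, lam (k, i) * a (k, i) x = gridCut (s * 2 ^ (-k)) i x * D k x := by
  obtain ⟨Bη, hBη0, hBη⟩ := exists_bound_fderiv_gridBump n
  have hB : 0 < B := hα.trans_le hαB
  set P : ℝ := (n + 1) * (1 + Bη) * (2 * n + 3) ^ (n + 1 - θ)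
  have hP : 0 ≤ P := by positivity
  -- Chosen so that the grid ball of radius `B' t` contains the ball of radius `B t` about any point
  -- of the bump, whose support has radius `(n+1) t`.
  set B' : ℝ := B + n + 2
  have hB'0 : 0 ≤ B' := by positivity
  set C : ℝ≥0∞ := ENNReal.ofReal (P * K) * (ENNReal.ofReal (B ^ θ) * ENNReal.ofReal (Real.logb 2 (B / α) + 1) *
        ENNReal.ofReal ((2 * B' + 1) ^ (n + 1)))
  have hC : C ≠ ⊤ := by finiteness
  refine ⟨C.toNNReal, fun Ω hΩ hF G hG hW s hs D hD h0 h1 => ?_⟩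
  rw [ENNReal.coe_toNNReal hC]
  set t : ℤ → ℝ := fun k => s * 2 ^ (-k)
  have ht : ∀ k, 0 < t k := fun k => by positivity
  set J : ℤ × (Fin (n + 1) → ℤ) → ℝ≥0∞ := fun p =>
    ∫⁻ w in shell Ω α B (t p.1) ∩ ball (t p.1 • gridPt p.2) (B' * t p.1), ‖G w‖ₑ
  have hJ : ∀ p, J p ≠ ⊤ := fun p => by
    refine ((setLIntegral_le_wInt (T := B * t p.1) hΩ hF hθ₀ G
      ((measurableSet_shell hΩ _ _ _).inter measurableSet_ball) (fun w hw => hw.1.1)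
      fun w hw => hw.1.2.2).trans_lt ?_).ne
    exact ENNReal.mul_lt_top ENNReal.ofReal_lt_top hW.lt_top
  have hsub : ∀ k i x, x ∈ closedBall (t k • gridPt i) ((n + 1) * t k) →
      ∫⁻ w in shell Ω α B (t k) ∩ ball x (B * t k), ‖G w‖ₑ ≤ J (k, i) := fun k i x hx => by
    refine lintegral_mono_set (inter_subset_inter_right _ (ball_subset_ball' ?_))
    have := mem_closedBall.1 hx
    have := ht k
    simp only [B']
    nlinarith
  have hex : ∀ p : ℤ × (Fin (n + 1) → ℤ), ∃ a, IsAtom θ Ω a ∧ ∀ x ∈ frontier Ω,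
      ((P * (t p.1 ^ (-θ) * (K * (J p).toReal)) : ℝ) : ℂ) * a x = gridCut (t p.1) p.2 x * D p.1 x := by
    rintro ⟨k, i⟩
    refine exists_isAtom_gridCut hBη hn hF (hD k) (ht k) (by positivity) i
      (fun x hx hxi => ?_) fun x hx hxi => ?_
    · have h2 := (h0 k x hx).trans (mul_le_mul' le_rfl (hsub k i x hxi))
      have h3 := ENNReal.toReal_mono (by have := hJ (k, i); finiteness) h2
      rw [toReal_enorm, ENNReal.toReal_mul, ENNReal.toReal_mul, ENNReal.toReal_ofReal
        (by have := ht k; positivity), ENNReal.coe_toReal] at h3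
      refine h3.trans (le_of_eq ?_)
      ring
    · have h2 := (h1 k x hx).trans (mul_le_mul' le_rfl (hsub k i x hxi))
      have h3 := ENNReal.toReal_mono (by have := hJ (k, i); finiteness) h2
      rw [toReal_enorm, ENNReal.toReal_mul, ENNReal.toReal_mul, ENNReal.toReal_ofReal
        (by have := ht k; positivity), ENNReal.coe_toReal] at h3
      refine h3.trans (le_of_eq ?_)
      ring
  choose a ha hab using hex
  refine ⟨fun p => ((P * (t p.1 ^ (-θ) * (K * (J p).toReal)) : ℝ) : ℂ), a, ha, ?_,
    fun x hx k i => hab (k, i) x hx⟩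
  have hl : ∀ p : ℤ × (Fin (n + 1) → ℤ), ‖((P * (t p.1 ^ (-θ) * (K * (J p).toReal)) : ℝ) : ℂ)‖ₑ =
      ENNReal.ofReal (P * K) * (ENNReal.ofReal (t p.1 ^ (-θ)) * J p) := fun p => by
    have := ht p.1
    rw [← ofReal_norm, Complex.norm_real, Real.norm_of_nonneg (by positivity),
      show P * (t p.1 ^ (-θ) * (K * (J p).toReal)) = P * K * (t p.1 ^ (-θ) * (J p).toReal) by ring,
      ENNReal.ofReal_mul (p := P * K) (by positivity),
      ENNReal.ofReal_mul (p := t p.1 ^ (-θ)) (by positivity), ENNReal.ofReal_toReal (hJ p)]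
  simp_rw [hl]
  rw [ENNReal.tsum_mul_left]
  refine (mul_le_mul' le_rfl (tsum_shell_le hΩ hF hθ₀ hG hs hα hαB hB'0)).trans (le_of_eq ?_)
  simp only [C]
  ring

end DyadicAtoms


/-! ### Existence of traces and their atomic decomposition -/

lemma shell_mono {Ω : Set (Amb n)} {α α' B B' t t' : ℝ} (h1 : α' * t' ≤ α * t)
    (h2 : B * t ≤ B' * t') : shell Ω α B t ⊆ shell Ω α' B' t' :=
  fun _ hw => ⟨hw.1, h1.trans hw.2.1, hw.2.2.trans h2⟩

/-- The constant in the pointwise estimates for averages and their differences. -/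
def pieceConst (n : ℕ) (c L : ℝ) : ℝ≥0 :=
  ((L + 1).toNNReal + 2) * kapSup n * (((c / 2) ^ (n + 1))⁻¹).toNNReal

/-- If two functions agree with the limits in the mean of the same family, they agree. -/
lemma ae_eq_of_tendsto_lintegral_sub {Ω : Set (Amb n)} {T : ℕ → Amb n → ℂ}
    (hT : ∀ m, Continuous (T m)) {f g : Amb n → ℂ}
    (hfm : AEStronglyMeasurable f (surfaceMeasure Ω))
    (hgm : AEStronglyMeasurable g (surfaceMeasure Ω))
    (hf : ∀ R : ℕ, Tendsto (fun m => ∫⁻ x in ball 0 R, ‖T m x - f x‖ₑ ∂(surfaceMeasure Ω))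
      atTop (𝓝 0))
    (hg : ∀ R : ℕ, Tendsto (fun m => ∫⁻ x in ball 0 R, ‖T m x - g x‖ₑ ∂(surfaceMeasure Ω))
      atTop (𝓝 0)) : f =ᵐ[surfaceMeasure Ω] g := by
  have hR : ∀ R : ℕ, ∀ᵐ x ∂(surfaceMeasure Ω).restrict (ball 0 R), f x = g x := fun R => by
    have h1 := (hf R).add (hg R)
    rw [add_zero] at h1
    have h2 : ∫⁻ x in ball 0 R, ‖f x - g x‖ₑ ∂(surfaceMeasure Ω) ≤ 0 := by
      refine ge_of_tendsto' h1 fun m => ?_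
      have hm : AEMeasurable (fun x => ‖T m x - f x‖ₑ) ((surfaceMeasure Ω).restrict (ball 0 R)) :=
        ((hT m).aestronglyMeasurable.sub hfm.restrict).enorm
      rw [← lintegral_add_left' hm]
      refine lintegral_mono fun x => ?_
      calc ‖f x - g x‖ₑ = ‖(T m x - g x) - (T m x - f x)‖ₑ := by congr 1; ring
        _ ≤ ‖T m x - g x‖ₑ + ‖T m x - f x‖ₑ := enorm_sub_le
        _ = _ := add_comm _ _
    have h3 := (lintegral_eq_zero_iff' (hfm.restrict.sub hgm.restrict).enorm).1
      (nonpos_iff_eq_zero.1 h2)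
    filter_upwards [h3] with x hx
    exact sub_eq_zero.1 (enorm_eq_zero.1 hx)
  have h4 := (ae_restrict_iUnion_iff (μ := surfaceMeasure Ω)
    (fun R : ℕ => ball (0 : Amb n) R) _).2 hR
  rwa [iUnion_ball_nat, Measure.restrict_univ] at h4

namespace IsTransversal

variable {Ω : Set (Amb n)} {e : Amb n → Amb n} {c L s₀ : ℝ}
  {u : Amb n → ℂ} {G : Amb n → EuclideanSpace ℂ (Fin (n + 1))} {θ : ℝ}

/-- For every `τ` between `b/2` and `b` the averaging ball lies in one Whitney region at height `b`,
so a single integral serves all these scales. -/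
lemma lintegral_kap_le_shell (H : IsTransversal Ω e c L s₀)
    (hΩ : IsOpen Ω) (hF : (frontier Ω).Nonempty) {x : Amb n}
    (hx : x ∈ frontier Ω) {b τ : ℝ} (hb : 0 < b) (hb' : b ≤ s₀) (hτ : b / 2 ≤ τ) (hτ' : τ ≤ b) :
    ∫⁻ v, ‖kap n v‖ₑ * ‖G (x + τ • e x + (c * τ) • v)‖ₑ ≤
      kapSup n * ENNReal.ofReal (((c / 2) ^ (n + 1))⁻¹) * ENNReal.ofReal ((b ^ (n + 1))⁻¹) *
        ∫⁻ w in shell Ω (c / 4) (L + 1) b ∩ ball x ((L + 1) * b), ‖G w‖ₑ := by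
  have hc := H.c_pos
  have hL := H.L_nonneg
  have hτ0 : 0 < τ := by linarith
  have hcτ : 0 < c * τ := by positivity
  refine (lintegral_kap_mul_le hcτ (fun w => ‖G w‖ₑ) _).trans ?_
  rw [mul_assoc (kapSup n : ℝ≥0∞) (ENNReal.ofReal _) (ENNReal.ofReal _),
    ← ENNReal.ofReal_mul (by positivity)]
  refine mul_le_mul' (mul_le_mul' le_rfl (ENNReal.ofReal_le_ofReal ?_)) (lintegral_mono_set ?_)
  · rw [← mul_inv, ← mul_pow]
    refine inv_anti₀ (by positivity) (pow_le_pow_left₀ (by positivity) ?_ _)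
    nlinarith
  · intro w hw
    have h1 := H.closedBall_subset_innerSet hΩ hF (frontier_subset_closure' hx) hτ0 (hτ'.trans hb')
      (ball_subset_closedBall hw)
    have h2 := H.infDist_ge hΩ hF (frontier_subset_closure' hx) hτ0 (hτ'.trans hb')
      (ball_subset_closedBall hw)
    have h3 := H.dist_le_of_mem hτ0 hw
    have h4 : (L + 1) * τ ≤ (L + 1) * b := by gcongr
    refine ⟨⟨h1.1, ?_, ?_⟩, mem_ball.2 (h3.trans_le h4)⟩
    · nlinarith
    · exact (infDist_le_dist_of_mem hx).trans (h3.le.trans h4)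

/-- Integration over `τ` between `b/2` and `b` gains the factor `b` that separates the bound for the
function from the one for its derivative. -/
lemma enorm_tr_half_sub_le (H : IsTransversal Ω e c L s₀)
    (hΩ : IsOpen Ω) (hF : (frontier Ω).Nonempty)
    (hu : HasWeakGradient Ω u G) (hum : Measurable u) (hGm : Measurable G) {x : Amb n}
    (hx : x ∈ frontier Ω) {b : ℝ} (hb : 0 < b) (hb' : b ≤ s₀) :
    ‖tr Ω e c u (b / 2) x - tr Ω e c u b x‖ₑ ≤ pieceConst n c L * ENNReal.ofReal ((b ^ n)⁻¹) *
      ∫⁻ w in shell Ω (c / 4) (L + 1) b ∩ ball x ((L + 1) * b), ‖G w‖ₑ := by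
  have hc := H.c_pos
  set J := ∫⁻ w in shell Ω (c / 4) (L + 1) b ∩ ball x ((L + 1) * b), ‖G w‖ₑ
  rw [← enorm_neg, neg_sub]
  refine (H.enorm_tr_sub_le hΩ hF hu hum hGm (frontier_subset_closure' hx) (half_pos hb)
    (half_le_self hb.le) hb').trans ?_
  have h1 : ∫⁻ τ in Ioc (b / 2) b, ∫⁻ v, ‖kap n v‖ₑ * ‖G (x + τ • e x + (c * τ) • v)‖ₑ ≤
      ∫⁻ τ in Ioc (b / 2) b, kapSup n * ENNReal.ofReal (((c / 2) ^ (n + 1))⁻¹) *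
        ENNReal.ofReal ((b ^ (n + 1))⁻¹) * J :=
    setLIntegral_mono' measurableSet_Ioc fun τ hτ =>
      H.lintegral_kap_le_shell hΩ hF hx hb hb' hτ.1.le hτ.2
  refine (mul_le_mul' le_rfl h1).trans ?_
  rw [setLIntegral_const, Real.volume_Ioc]
  have h2 : ENNReal.ofReal ((b ^ (n + 1))⁻¹) * ENNReal.ofReal (b - b / 2) ≤
      ENNReal.ofReal ((b ^ n)⁻¹) := by
    rw [← ENNReal.ofReal_mul (by positivity)]
    refine ENNReal.ofReal_le_ofReal ?_
    rw [pow_succ, mul_inv, mul_assoc]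
    refine mul_le_of_le_one_right (by positivity) ?_
    rw [inv_mul_le_iff₀ hb]
    linarith
  calc _ = ENNReal.ofReal (L + 1) * kapSup n * ENNReal.ofReal (((c / 2) ^ (n + 1))⁻¹) *
        (ENNReal.ofReal ((b ^ (n + 1))⁻¹) * ENNReal.ofReal (b - b / 2)) * J := by ring
    _ ≤ (ENNReal.ofReal (L + 1) + 2) * kapSup n * ENNReal.ofReal (((c / 2) ^ (n + 1))⁻¹) *
        ENNReal.ofReal ((b ^ n)⁻¹) * J := by
        gcongr
        exact le_self_add
    _ = _ := by
        rw [pieceConst]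
        push_cast
        rfl

lemma enorm_fderiv_tr_le_shell (H : IsTransversal Ω e c L s₀)
    (hΩ : IsOpen Ω) (hF : (frontier Ω).Nonempty)
    (hu : HasWeakGradient Ω u G) {x : Amb n} (hx : x ∈ frontier Ω) {b τ : ℝ} (hb : 0 < b)
    (hb' : b ≤ s₀) (hτ : b / 2 ≤ τ) (hτ' : τ ≤ b) :
    ‖fderiv ℝ (tr Ω e c u τ) x‖ₑ ≤ pieceConst n c L * ENNReal.ofReal ((b ^ (n + 1))⁻¹) *
      ∫⁻ w in shell Ω (c / 4) (L + 1) b ∩ ball x ((L + 1) * b), ‖G w‖ₑ := by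
  refine (H.norm_fderiv_tr_le hΩ hF hu (frontier_subset_closure' hx) (by linarith)
    (hτ'.trans hb')).trans ?_
  refine (mul_le_mul' le_rfl (H.lintegral_kap_le_shell hΩ hF hx hb hb' hτ hτ')).trans ?_
  set J := ∫⁻ w in shell Ω (c / 4) (L + 1) b ∩ ball x ((L + 1) * b), ‖G w‖ₑ
  calc _ = 2 * kapSup n * ENNReal.ofReal (((c / 2) ^ (n + 1))⁻¹) *
        ENNReal.ofReal ((b ^ (n + 1))⁻¹) * J := by ring
    _ ≤ (ENNReal.ofReal (L + 1) + 2) * kapSup n * ENNReal.ofReal (((c / 2) ^ (n + 1))⁻¹) *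
        ENNReal.ofReal ((b ^ (n + 1))⁻¹) * J := by
        gcongr
        exact le_add_self
    _ = _ := by
        rw [pieceConst]
        push_cast
        rfl

lemma enorm_fderiv_tr_half_sub_le (H : IsTransversal Ω e c L s₀)
    (hΩ : IsOpen Ω) (hF : (frontier Ω).Nonempty)
    (hu : HasWeakGradient Ω u G) {x : Amb n} (hx : x ∈ frontier Ω) {b : ℝ} (hb : 0 < b)
    (hb' : b ≤ s₀) :
    ‖fderiv ℝ (fun y => tr Ω e c u (b / 2) y - tr Ω e c u b y) x‖ₑ ≤
      (2 * pieceConst n c L : ℝ≥0) * ENNReal.ofReal ((b ^ (n + 1))⁻¹) *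
      ∫⁻ w in shell Ω (c / 4) (L + 1) b ∩ ball x ((L + 1) * b), ‖G w‖ₑ := by
  have hd : ∀ τ, 0 < τ → DifferentiableAt ℝ (tr Ω e c u τ) x := fun τ hτ =>
    (H.contDiff_tr hu.1 hτ).differentiable (by simp) x
  rw [fderiv_fun_sub (hd _ (half_pos hb)) (hd _ hb), ENNReal.coe_mul, ENNReal.coe_ofNat,
    mul_assoc, mul_assoc, two_mul, ← mul_assoc]
  refine enorm_sub_le.trans (add_le_add ?_ ?_)
  · exact H.enorm_fderiv_tr_le_shell hΩ hF hu hx hb hb' le_rfl (half_le_self hb.le)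
  · exact H.enorm_fderiv_tr_le_shell hΩ hF hu hx hb hb' (half_le_self hb.le) le_rfl

/-- The collar has height `(L+1) b`, so the weight yields the factor `b^θ`. This decay makes the
averages converge on the boundary. -/
lemma lintegral_surface_tr_sub_le_wInt (H : IsTransversal Ω e c L s₀)
    (hΩ : IsOpen Ω) (hF : (frontier Ω).Nonempty) {C : ℝ≥0}
    (hσ : UpperRegular Ω C) (hθ₀ : 0 < θ) (hu : HasWeakGradient Ω u G) (hum : Measurable u)
    (hGm : Measurable G) (R : ℝ) {a b : ℝ} (ha : 0 < a) (hab : a ≤ b) (hb : b ≤ s₀) :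
    ∫⁻ x in ball 0 R, ‖tr Ω e c u b x - tr Ω e c u a x‖ₑ ∂(surfaceMeasure Ω) ≤
      ENNReal.ofReal (b ^ θ) * (ENNReal.ofReal (L + 1) * bdryConst n c L C *
        (ENNReal.ofReal ((L + 1) ^ θ) * wInt θ Ω G)) := by
  have hL := H.L_nonneg
  refine (H.lintegral_surface_tr_sub_le hΩ hF hσ hu hum hGm R ha hab hb).trans ?_
  have hcd : Continuous fun w : Amb n => infDist w (frontier Ω) := continuous_infDist_pt _
  have h1 := setLIntegral_le_wInt (θ := θ) (T := (L + 1) * b) (V := (Ω ∩ ball 0 (R + (L + 1) * s₀)) ∩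
          {w | infDist w (frontier Ω) ≤ (L + 1) * b}) hΩ hF hθ₀ G
    ((hΩ.measurableSet.inter measurableSet_ball).inter
      (measurableSet_le hcd.measurable measurable_const)) (fun w hw => hw.1.1) fun w hw => hw.2
  refine (mul_le_mul' le_rfl h1).trans (le_of_eq ?_)
  rw [Real.mul_rpow (by linarith) (by linarith), ENNReal.ofReal_mul (by positivity)]
  ring

/-- The averages have a limit on the boundary. -/
lemma exists_boundary_limit (H : IsTransversal Ω e c L s₀)
    (hΩ : IsOpen Ω) (hF : (frontier Ω).Nonempty) {C : ℝ≥0}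
    (hσ : UpperRegular Ω C) (hθ₀ : 0 < θ) (hu : HasWeakGradient Ω u G) (hum : Measurable u)
    (hGm : Measurable G) (hW : wInt θ Ω G ≠ ⊤) :
    ∃ f : Amb n → ℂ, AEStronglyMeasurable f (surfaceMeasure Ω) ∧
      (∀ᵐ x ∂(surfaceMeasure Ω), Tendsto (fun m : ℕ => tr Ω e c u (s₀ * 2 ^ (-(m : ℤ))) x)
        atTop (𝓝 (f x))) ∧
      ∀ R : ℝ, ∀ b, 0 < b → b ≤ s₀ →
        ∫⁻ x in ball 0 R, ‖tr Ω e c u b x - f x‖ₑ ∂(surfaceMeasure Ω) ≤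
          ENNReal.ofReal (b ^ θ) * (ENNReal.ofReal (L + 1) * bdryConst n c L C *
            (ENNReal.ofReal ((L + 1) ^ θ) * wInt θ Ω G)) := by
  have hs0 := H.s_pos
  set s : ℕ → ℝ := fun m => s₀ * 2 ^ (-(m : ℤ)) with hsdef
  have hsp : ∀ m, 0 < s m := fun m => by positivity
  have hsucc : ∀ m, s (m + 1) = s m / 2 := fun m => by
    simp only [s]
    push_cast
    rw [neg_add, zpow_add₀ two_ne_zero, zpow_neg_one]
    ring
  have hsle : ∀ m, s m ≤ s₀ := fun m => by
    refine mul_le_of_le_one_right hs0.le ?_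
    rw [zpow_neg, zpow_natCast]
    exact inv_le_one_of_one_le₀ (one_le_pow₀ one_le_two)
  set T : ℕ → Amb n → ℂ := fun m => tr Ω e c u (s m)
  have hT : ∀ m, Continuous (T m) := fun m => (H.contDiff_tr hu.1 (hsp m)).continuous
  set Q := ENNReal.ofReal (L + 1) * bdryConst n c L C * (ENNReal.ofReal ((L + 1) ^ θ) * wInt θ Ω G)
  have hQ : Q ≠ ⊤ := by
    have := bdryConst_ne_top n c L C
    finiteness
  -- Along dyadic scales the factors `s^θ` form a convergent geometric series because `θ > 0`.
  have hgeo : ∑' m, ENNReal.ofReal (s m ^ θ) ≠ ⊤ := by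
    have h1 : ∀ m : ℕ, s m ^ θ = s₀ ^ θ * ((2 : ℝ) ^ (-θ)) ^ m := fun m => by
      simp only [s]
      rw [Real.mul_rpow hs0.le (by positivity), ← Real.rpow_intCast, ← Real.rpow_mul zero_le_two,
        ← Real.rpow_natCast, ← Real.rpow_mul zero_le_two]
      push_cast
      ring_nf
    have h2 : Summable fun m => s m ^ θ := by
      simp_rw [h1]
      refine (summable_geometric_of_lt_one (by positivity) ?_).mul_left _
      exact Real.rpow_lt_one_of_one_lt_of_neg one_lt_two (by linarith)
    exact h2.tsum_ofReal_ne_top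
  have hsum : ∀ R : ℕ, ∀ᵐ x ∂(surfaceMeasure Ω).restrict (ball 0 R),
      Summable fun m => T (m + 1) x - T m x := fun R => by
    have hm : ∀ m, AEMeasurable (fun x => ‖T (m + 1) x - T m x‖ₑ)
        ((surfaceMeasure Ω).restrict (ball 0 R)) := fun m =>
      ((hT (m + 1)).sub (hT m)).enorm.aemeasurable
    have h1 : ∫⁻ x in ball 0 R, ∑' m, ‖T (m + 1) x - T m x‖ₑ ∂(surfaceMeasure Ω) ≠ ⊤ := by
      rw [lintegral_tsum hm]
      refine ((ENNReal.tsum_le_tsum fun m => ?_).trans_lt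
        ((ENNReal.tsum_mul_right (a := Q)).trans_lt (ENNReal.mul_lt_top hgeo.lt_top hQ.lt_top))).ne
      have := H.lintegral_surface_tr_sub_le_wInt hΩ hF hσ hθ₀ hu hum hGm R (hsp (m + 1))
        (by rw [hsucc]; exact half_le_self (hsp m).le) (hsle m)
      refine le_trans (lintegral_mono fun x => ?_) this
      rw [← enorm_neg, neg_sub]
    have h2 := ae_lt_top' (AEMeasurable.tsum hm) h1
    filter_upwards [h2] with x hx
    refine Summable.of_norm ?_
    have := ENNReal.summable_toReal hx.ne
    simpa only [toReal_enorm] using this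
  have hsum' := (ae_restrict_iUnion_iff (μ := surfaceMeasure Ω)
    (fun R : ℕ => ball (0 : Amb n) R) _).2 hsum
  rw [iUnion_ball_nat, Measure.restrict_univ] at hsum'
  set f : Amb n → ℂ := fun x => T 0 x + ∑' m, (T (m + 1) x - T m x)
  have hlim : ∀ᵐ x ∂(surfaceMeasure Ω), Tendsto (fun m => T m x) atTop (𝓝 (f x)) := by
    filter_upwards [hsum'] with x hx
    have := (hx.hasSum.tendsto_sum_nat).const_add (T 0 x)
    refine this.congr fun m => ?_
    rw [Finset.sum_range_sub (fun m => T m x)]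
    ring
  have hfm : AEStronglyMeasurable f (surfaceMeasure Ω) :=
    aestronglyMeasurable_of_tendsto_ae atTop (fun m => (hT m).aestronglyMeasurable) hlim
  refine ⟨f, hfm, hlim, fun R b hb hb' => ?_⟩
  have hst : Tendsto s atTop (𝓝 0) := by
    have := (tendsto_pow_atTop_nhds_zero_of_lt_one (r := (1 / 2 : ℝ)) (by norm_num)
      (by norm_num)).const_mul s₀
    rw [mul_zero] at this
    refine this.congr fun m => ?_
    simp only [s]
    rw [zpow_neg, zpow_natCast, one_div, inv_pow]
  have hcv : Continuous (tr Ω e c u b) := (H.contDiff_tr hu.1 hb).continuous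
  -- Fatou extends the estimate between two scales to the limit, with the same rate in `b`.
  have hfat : ∫⁻ x in ball 0 R, ‖tr Ω e c u b x - f x‖ₑ ∂(surfaceMeasure Ω) ≤
      liminf (fun m => ∫⁻ x in ball 0 R, ‖tr Ω e c u b x - T m x‖ₑ ∂(surfaceMeasure Ω)) atTop := by
    refine le_trans (lintegral_mono_ae ?_) (lintegral_liminf_le fun m => (hcv.sub (hT m)).enorm.measurable)
    filter_upwards [ae_restrict_of_ae hlim] with x hx
    exact (((tendsto_const_nhds.sub hx).enorm).liminf_eq).ge
  refine hfat.trans (liminf_le_of_le (by isBoundedDefault) fun q hq => ?_)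
  obtain ⟨m, hm1, hm2⟩ := (hq.and (hst.eventually_le_const hb)).exists
  exact hm1.trans (H.lintegral_surface_tr_sub_le_wInt hΩ hF hσ hθ₀ hu hum hGm R (hsp m) hm2 hb')

/-- The averages of `u` at scales tending to zero are the approximating smooth functions: they and
their gradients converge locally in the mean up to the boundary, and their boundary values converge
at the rate `s^θ`. -/
lemma exists_hasTrace (H : IsTransversal Ω e c L s₀)
    (hΩ : IsOpen Ω) (hF : (frontier Ω).Nonempty) {C : ℝ≥0}
    (hσ : UpperRegular Ω C) (hθ₀ : 0 < θ) (hu : HasWeakGradient Ω u G) (hum : Measurable u)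
    (hGm : Measurable G) (hW : wInt θ Ω G ≠ ⊤) :
    ∃ f, HasTrace Ω u f := by
  have := hσ.isLocallyFiniteMeasure
  have hs0 := H.s_pos
  obtain ⟨f, hfm, -, hf⟩ := H.exists_boundary_limit hΩ hF hσ hθ₀ hu hum hGm hW
  set Q := ENNReal.ofReal (L + 1) * bdryConst n c L C * (ENNReal.ofReal ((L + 1) ^ θ) * wInt θ Ω G)
  have hQ : Q ≠ ⊤ := by
    have := bdryConst_ne_top n c L C
    finiteness
  have hGi := fun R => setLIntegral_ball_ne_top_of_wInt hΩ hF hθ₀ hW R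
  set s : ℕ → ℝ := fun m => s₀ / (m + 1)
  have hsp : ∀ m, 0 < s m := fun m => by positivity
  have hsle : ∀ m, s m ≤ s₀ := fun m =>
    div_le_self hs0.le (by linarith [(Nat.cast_nonneg m : (0 : ℝ) ≤ m)])
  have hst : Tendsto s atTop (𝓝[>] 0) := by
    refine tendsto_nhdsWithin_iff.2 ⟨?_, Eventually.of_forall hsp⟩
    exact tendsto_const_nhds.div_atTop (tendsto_natCast_atTop_atTop.atTop_add tendsto_const_nhds)
  refine ⟨f, ?_, G, hu, fun m => tr Ω e c u (s m), fun m => H.contDiff_tr hu.1 (hsp m), fun R =>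
    ⟨(H.tendsto_lintegral_tr_sub hΩ hF hu hum hGm hGi R).comp hst, ?_, ?_⟩⟩
  · rw [locallyIntegrable_iff]
    intro K hK
    obtain ⟨R, hR⟩ := hK.isBounded.subset_ball (0 : Amb n)
    refine IntegrableOn.mono_set ⟨hfm.restrict, ?_⟩ hR
    have hc : Continuous (tr Ω e c u s₀) := (H.contDiff_tr hu.1 hs0).continuous
    have h1 : ∫⁻ x in ball 0 R, ‖f x‖ₑ ∂(surfaceMeasure Ω) ≤
        (∫⁻ x in ball 0 R, ‖tr Ω e c u s₀ x‖ₑ ∂(surfaceMeasure Ω)) +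
        ∫⁻ x in ball 0 R, ‖tr Ω e c u s₀ x - f x‖ₑ ∂(surfaceMeasure Ω) := by
      rw [← lintegral_add_left hc.enorm.measurable]
      refine lintegral_mono fun x => ?_
      calc ‖f x‖ₑ = ‖tr Ω e c u s₀ x - (tr Ω e c u s₀ x - f x)‖ₑ := by congr 1; ring
        _ ≤ _ := enorm_sub_le
    refine h1.trans_lt (ENNReal.add_lt_top.2
      ⟨setLIntegral_ball_lt_top hc (fun _ => rfl) _ _, (hf R s₀ hs0 le_rfl).trans_lt ?_⟩)
    exact ENNReal.mul_lt_top ENNReal.ofReal_lt_top hQ.lt_top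
  · have h1 := ENNReal.Tendsto.const_mul (a := ENNReal.ofReal (n + 1))
      ((H.tendsto_lintegral_fderiv_tr_sub hΩ hF hu hGm hGi R).comp hst)
      (Or.inr ENNReal.ofReal_ne_top)
    rw [mul_zero] at h1
    refine tendsto_of_tendsto_of_tendsto_of_le_of_le tendsto_const_nhds h1 (fun _ => zero_le)
      fun m => ?_
    rw [Function.comp_apply, ← lintegral_const_mul' _ _ ENNReal.ofReal_ne_top]
    refine lintegral_mono fun x => ?_
    have := enorm_le_enorm_gradMap (gradVec (tr Ω e c u (s m)) x - G x)
    rwa [gradMap_sub, gradMap_gradVec] at this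
  · have h1 : Tendsto (fun m => ENNReal.ofReal (s m ^ θ) * Q) atTop (𝓝 0) := by
      have h2 : Tendsto (fun m => s m ^ θ) atTop (𝓝 0) := by
        have := (tendsto_nhds_of_tendsto_nhdsWithin hst).rpow_const (p := θ) (Or.inr hθ₀.le)
        rwa [Real.zero_rpow hθ₀.ne'] at this
      have h3 := ENNReal.Tendsto.mul_const (b := Q) (ENNReal.tendsto_ofReal h2) (Or.inr hQ)
      rwa [ENNReal.ofReal_zero, zero_mul] at h3
    exact tendsto_of_tendsto_of_tendsto_of_le_of_le tendsto_const_nhds h1 (fun _ => zero_le)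
      fun m => hf R (s m) (hsp m) (hsle m)

/-- Dyadic averages converge almost everywhere to some limit. That limit and `f` are both local `L¹`
limits of the averages on the boundary, hence equal; pointwise convergence to the given trace
follows. -/
lemma ae_tendsto_tr_of_hasTrace (H : IsTransversal Ω e c L s₀)
    (hΩ : IsOpen Ω) (hF : (frontier Ω).Nonempty) {C : ℝ≥0}
    (hσ : UpperRegular Ω C) (hθ₀ : 0 < θ) (hu : HasWeakGradient Ω u G) (hum : Measurable u)
    (hGm : Measurable G) (hW : wInt θ Ω G ≠ ⊤) {f : Amb n → ℂ} (hf : HasTrace Ω u f) :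
    ∀ᵐ x ∂(surfaceMeasure Ω), Tendsto (fun m : ℕ => tr Ω e c u (s₀ * 2 ^ (-(m : ℤ))) x)
        atTop (𝓝 (f x)) := by
  have hs0 := H.s_pos
  obtain ⟨f₁, hfm, hlim, hf₁⟩ := H.exists_boundary_limit hΩ hF hσ hθ₀ hu hum hGm hW
  set Q := ENNReal.ofReal (L + 1) * bdryConst n c L C * (ENNReal.ofReal ((L + 1) ^ θ) * wInt θ Ω G)
  have hQ : Q ≠ ⊤ := by
    have := bdryConst_ne_top n c L C
    finiteness
  set s : ℕ → ℝ := fun m => s₀ / (m + 1)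
  have hsp : ∀ m, 0 < s m := fun m => by positivity
  have hsle : ∀ m, s m ≤ s₀ := fun m =>
    div_le_self hs0.le (by linarith [(Nat.cast_nonneg m : (0 : ℝ) ≤ m)])
  have hst : Tendsto s atTop (𝓝[>] 0) := by
    refine tendsto_nhdsWithin_iff.2 ⟨?_, Eventually.of_forall hsp⟩
    exact tendsto_const_nhds.div_atTop (tendsto_natCast_atTop_atTop.atTop_add tendsto_const_nhds)
  have heq : f₁ =ᵐ[surfaceMeasure Ω] f := by
    refine ae_eq_of_tendsto_lintegral_sub (T := fun m => tr Ω e c u (s m))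
      (fun m => (H.contDiff_tr hu.1 (hsp m)).continuous) hfm hf.1.aestronglyMeasurable
      (fun R => ?_) fun R => (H.tendsto_tr_of_hasTrace hΩ hF hσ hum hf R).comp hst
    have h1 : Tendsto (fun m => ENNReal.ofReal (s m ^ θ) * Q) atTop (𝓝 0) := by
      have h2 : Tendsto (fun m => s m ^ θ) atTop (𝓝 0) := by
        have := (tendsto_nhds_of_tendsto_nhdsWithin hst).rpow_const (p := θ) (Or.inr hθ₀.le)
        rwa [Real.zero_rpow hθ₀.ne'] at this
      have h3 := ENNReal.Tendsto.mul_const (b := Q) (ENNReal.tendsto_ofReal h2) (Or.inr hQ)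
      rwa [ENNReal.ofReal_zero, zero_mul] at h3
    exact tendsto_of_tendsto_of_tendsto_of_le_of_le tendsto_const_nhds h1 (fun _ => zero_le)
      fun m => hf₁ R (s m) (hsp m) (hsle m)
  filter_upwards [hlim, heq] with x hx1 hx2
  rwa [hx2] at hx1

end IsTransversal


/-! ### The atomic norm of a trace -/

/-- The tangential gradient controls the Lipschitz constant of functions on the boundary. -/
def GradControls (Ω : Set (Amb n)) (C : ℝ≥0) : Prop :=
  ∀ a : Amb n → ℂ, (∀ R : ℝ, ∃ K : ℝ≥0, LipschitzOnWith K a (frontier Ω ∩ ball 0 R)) →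
    ∀ l : ℝ, 0 ≤ l → (∀ᵐ x ∂(surfaceMeasure Ω), ∃ g : EuclideanSpace ℂ (Fin (n + 1)),
      HasFDerivWithinAt a (gradMap g) (frontier Ω) x ∧ ‖g‖ ≤ l) →
    ∀ x ∈ frontier Ω, ∀ y ∈ frontier Ω, ‖a x - a y‖ ≤ C * l * dist x y

lemma GradControls.norm_sub_le {Ω : Set (Amb n)} {C : ℝ≥0} (h : GradControls Ω C) {φ : Amb n → ℂ}
    (hφ : ContDiff ℝ 1 φ) {l : ℝ} (hl : 0 ≤ l) (hb : ∀ x ∈ frontier Ω, ‖fderiv ℝ φ x‖ ≤ l)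
    {x y : Amb n} (hx : x ∈ frontier Ω) (hy : y ∈ frontier Ω) :
    ‖φ x - φ y‖ ≤ C * ((n + 1) * l) * dist x y := by
  refine h φ (fun R => ?_) _ (by positivity) ?_ x hx y hy
  · obtain ⟨K, hK⟩ := (isCompact_closedBall (0 : Amb n) R).exists_bound_of_continuousOn
      (hφ.continuous_fderiv one_ne_zero).continuousOn
    refine ⟨K.toNNReal, ((convex_ball (0 : Amb n) R).lipschitzOnWith_of_nnnorm_fderiv_le
      (f := φ) (𝕜 := ℝ) (fun z _ => hφ.differentiable one_ne_zero z) fun z hz => ?_).mono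
      inter_subset_right⟩
    exact NNReal.coe_le_coe.1 ((hK z (ball_subset_closedBall hz)).trans (Real.le_coe_toNNReal K))
  · filter_upwards [ae_mem_frontier Ω] with z hz
    refine ⟨gradVec φ z, ?_, ?_⟩
    · rw [gradMap_gradVec]
      exact (hφ.differentiable one_ne_zero z).hasFDerivAt.hasFDerivWithinAt
    · have := norm_le_of_norm_gradMap_le (g := gradVec φ z)
      rw [gradMap_gradVec] at this
      exact this.trans (mul_le_mul_of_nonneg_left (hb z hz) (by positivity))

/-- Reduces atomic estimates to pointwise bounds on dyadic pieces. The identity with `f` is required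
only where the pieces are summable, because almost everywhere summability is itself a consequence of
the atomic decomposition. -/
lemma atomicNorm_le_of_dyadic (n : ℕ) (hn : 1 ≤ n) {θ : ℝ} (hθ₀ : 0 < θ) (hθ₁ : θ < 1) {α B : ℝ}
    (hα : 0 < α) (hαB : α ≤ B) (K : ℝ≥0) : ∃ C : ℝ≥0, ∀ (Ω : Set (Amb n)), IsOpen Ω →
    (frontier Ω).Nonempty → ∀ C' : ℝ≥0, UpperRegular Ω C' →
    ∀ (G : Amb n → EuclideanSpace ℂ (Fin (n + 1))), Measurable G →
    wInt θ Ω G ≠ ⊤ → ∀ (s : ℝ), 0 < s → ∀ D : ℤ → Amb n → ℂ, (∀ k, ContDiff ℝ 1 (D k)) →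
    (∀ k, ∀ x ∈ frontier Ω, ‖D k x‖ₑ ≤ K * ENNReal.ofReal (((s * 2 ^ (-k)) ^ n)⁻¹) *
      ∫⁻ w in shell Ω α B (s * 2 ^ (-k)) ∩ ball x (B * (s * 2 ^ (-k))), ‖G w‖ₑ) →
    (∀ k, ∀ x ∈ frontier Ω, ‖fderiv ℝ (D k) x‖ₑ ≤ K * ENNReal.ofReal (((s * 2 ^ (-k)) ^ (n + 1))⁻¹) *
      ∫⁻ w in shell Ω α B (s * 2 ^ (-k)) ∩ ball x (B * (s * 2 ^ (-k))), ‖G w‖ₑ) →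
    ∀ (f : Amb n → ℂ) (c : ℂ), (∀ᵐ x ∂(surfaceMeasure Ω), Summable (fun k => D k x) →
      ∑' k, D k x = f x - c) → atomicNorm θ Ω f ≤ C * wInt θ Ω G := by
  obtain ⟨C, hC⟩ := exists_dyadic_atoms n hn hθ₀ hα hαB K
  refine ⟨C, fun Ω hΩ hF C' hσ G hG hW s hs D hD h0 h1 f c hf => ?_⟩
  obtain ⟨lam, a, ha, hlam, heq⟩ := hC Ω hΩ hF G hG hW s hs D hD h0 h1
  have hlt : ∑' p, ‖lam p‖ₑ ≠ ⊤ :=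
    (hlam.trans_lt (ENNReal.mul_lt_top ENNReal.coe_lt_top hW.lt_top)).ne
  refine (atomicNorm_le_tsum hn hθ₀ hθ₁ hF hσ ha hlt (c := c) ?_).trans hlam
  filter_upwards [ae_summable_atoms hn hθ₀ hθ₁ hσ ha hlt, hf, ae_mem_frontier Ω] with x hx1 hx2 hx3
  -- Regroup the absolutely convergent series of atoms by scale: at each scale the grid bumps add up
  -- to one.
  have h2 : ∀ k, HasSum (fun i => lam (k, i) * a (k, i) x) (D k x) := fun k => by
    have h3 := (Complex.hasSum_ofReal.2
      (hasSum_gridBump ((s * 2 ^ (-k))⁻¹ • x))).mul_right (D k x)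
    rw [Complex.ofReal_one, one_mul] at h3
    refine h3.congr_fun fun i => ?_
    exact heq x hx3 k i
  have h4 := hx1.hasSum.prod_fiberwise h2
  rw [← hx2 h4.summable, h4.tsum_eq]
  exact hx1.hasSum

lemma summable_natCast {F : ℤ → ℂ} (h : Summable F) : Summable fun m : ℕ => F m :=
  h.comp_injective Nat.cast_injective

lemma summable_neg_natCast_add_one {F : ℤ → ℂ} (h : Summable F) :
    Summable fun m : ℕ => F (-((m : ℤ) + 1)) :=
  h.comp_injective (i := fun m : ℕ => -((m : ℤ) + 1)) fun a b h => by simpa using h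

namespace IsTransversal

/-- The atomic norm of a trace on a domain with bounded boundary. -/
theorem atomicNorm_le_of_bounded (n : ℕ) (hn : 1 ≤ n) {θ : ℝ} (hθ₀ : 0 < θ) (hθ₁ : θ < 1) {c L B₁ : ℝ}
    (hc : 0 < c) (hc1 : c ≤ 1) (hL : 0 ≤ L) (hB₁ : 0 ≤ B₁) (C₅ : ℝ≥0) : ∃ C : ℝ≥0,
    ∀ (Ω : Set (Amb n)) (e : Amb n → Amb n) (s₀ : ℝ), IsTransversal Ω e c L s₀ → IsOpen Ω →
    (frontier Ω).Nonempty → ∀ C' : ℝ≥0, UpperRegular Ω C' → GradControls Ω C₅ →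
    (∀ x ∈ frontier Ω, ∀ y ∈ frontier Ω, dist x y ≤ B₁ * s₀) →
    ∀ (u : Amb n → ℂ) (G : Amb n → EuclideanSpace ℂ (Fin (n + 1))), Measurable u → Measurable G →
    HasWeakGradient Ω u G → wInt θ Ω G ≠ ⊤ → ∀ f, HasTrace Ω u f →
    atomicNorm θ Ω f ≤ C * wInt θ Ω G := by
  -- Half of the natural `c / 4`, and `B` enlarged by `B₁`, because the coarsest piece is stored at
  -- `k = -1`, where the scale is `2 s₀`, and its bound must cover gradients at every point of the
  -- boundary.
  set α := c / 8
  set B := L + 1 + B₁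
  set K₀ := pieceConst n c L
  set K : ℝ≥0 := 2 * K₀ + 2 ^ (n + 1) * K₀ + 2 ^ n * (C₅ * (n + 1) * B₁.toNNReal) * K₀
  have hα : 0 < α := by simp only [α]; positivity
  have hαB : α ≤ B := by simp only [α, B]; linarith
  have hB : 0 < B := by linarith
  obtain ⟨C, hC⟩ := atomicNorm_le_of_dyadic n hn hθ₀ hθ₁ hα hαB K
  refine ⟨C, fun Ω e s₀ H hΩ hF C' hσ hgc hdiam u G hum hGm hu hW f hf => ?_⟩
  have hs0 := H.s_pos
  obtain ⟨x₀, hx₀⟩ := hF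
  have hF : (frontier Ω).Nonempty := ⟨x₀, hx₀⟩
  set t : ℤ → ℝ := fun k => s₀ * 2 ^ (-k)
  have ht : ∀ k, 0 < t k := fun k => by positivity
  have htle : ∀ k, 0 ≤ k → t k ≤ s₀ := fun k hk => by
    refine mul_le_of_le_one_right hs0.le ?_
    rw [zpow_neg]
    exact inv_le_one_of_one_le₀ (one_le_zpow₀ one_le_two hk)
  have ht1 : t (-1) = 2 * s₀ := by simp only [t]; norm_num; ring
  have htsucc : ∀ k, t (k + 1) = t k / 2 := fun k => by
    simp only [t]
    rw [neg_add, zpow_add₀ two_ne_zero, zpow_neg_one]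
    ring
  set T : ℝ → Amb n → ℂ := tr Ω e c u
  have hT : ∀ b, 0 < b → ContDiff ℝ 1 (T b) := fun b hb =>
    (H.contDiff_tr hu.1 hb).of_le (by norm_cast)
  set J : ℤ → Amb n → ℝ≥0∞ := fun k x => ∫⁻ w in shell Ω α B (t k) ∩ ball x (B * t k), ‖G w‖ₑ
  have hJ : ∀ k x, J k x ≠ ⊤ := fun k x => by
    refine ((setLIntegral_le_wInt (T := B * t k) hΩ hF hθ₀ G
      ((measurableSet_shell hΩ _ _ _).inter measurableSet_ball) (fun w hw => hw.1.1)
      fun w hw => hw.1.2.2).trans_lt ?_).ne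
    exact ENNReal.mul_lt_top ENNReal.ofReal_lt_top hW.lt_top
  have hJ1 : ∀ k x, ∫⁻ w in shell Ω (c / 4) (L + 1) (t k) ∩ ball x ((L + 1) * t k), ‖G w‖ₑ ≤ J k x :=
    fun k x => by
      have := ht k
      refine lintegral_mono_set (inter_subset_inter (shell_mono ?_ ?_) (ball_subset_ball ?_))
      · simp only [α]; nlinarith
      · simp only [B]; nlinarith
      · simp only [B]; nlinarith
  have hJ2 : ∀ x ∈ frontier Ω, ∀ y ∈ frontier Ω,
      ∫⁻ w in shell Ω (c / 4) (L + 1) s₀ ∩ ball y ((L + 1) * s₀), ‖G w‖ₑ ≤ J (-1) x :=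
    fun x hx y hy => by
      have h2 := hdiam y hy x hx
      simp only [J]
      rw [ht1]
      refine lintegral_mono_set (inter_subset_inter (shell_mono ?_ ?_) (ball_subset_ball' ?_))
      · simp only [α]; linarith
      · simp only [B]; nlinarith
      · simp only [B]; nlinarith
  -- Differences of averages at the scales up to `s₀`, then the coarsest average minus its value at
  -- `x₀` as the piece `k = -1`, and nothing beyond. They telescope to `f - T s₀ x₀`.
  set D : ℤ → Amb n → ℂ := fun k x =>
    if 0 ≤ k then T (t k / 2) x - T (t k) x else if k = -1 then T s₀ x - T s₀ x₀ else 0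
  have hDpos : ∀ k, 0 ≤ k → D k = fun x => T (t k / 2) x - T (t k) x := fun k hk => by
    ext x; simp only [D, if_pos hk]
  have hD1 : D (-1) = fun x => T s₀ x - T s₀ x₀ := by
    ext x; simp [D]
  have hD0 : ∀ k, ¬ 0 ≤ k → k ≠ -1 → D k = fun _ => 0 := fun k hk hk' => by
    ext x; simp only [D, if_neg hk, if_neg hk']
  have hpow : ∀ m : ℕ, ENNReal.ofReal ((s₀ ^ m)⁻¹) = 2 ^ m * ENNReal.ofReal ((t (-1) ^ m)⁻¹) :=
    fun m => by
      rw [ht1, show (2 : ℝ≥0∞) ^ m = ENNReal.ofReal (2 ^ m) by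
        rw [ENNReal.ofReal_pow zero_le_two, ENNReal.ofReal_ofNat],
        ← ENNReal.ofReal_mul (by positivity), mul_pow, mul_inv, ← mul_assoc,
        mul_inv_cancel₀ (by positivity), one_mul]
  have hK1 : 2 * K₀ ≤ K := by simp only [K]; rw [add_assoc]; exact le_self_add
  have hK0 : K₀ ≤ K := (le_mul_of_one_le_left' one_le_two).trans hK1
  have hK2 : 2 ^ (n + 1) * K₀ ≤ K := le_self_add.trans' le_add_self
  have hK3 : 2 ^ n * (C₅ * (n + 1) * B₁.toNNReal) * K₀ ≤ K := le_add_self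
  have hf1 : ∀ x ∈ frontier Ω, ∀ y ∈ frontier Ω, ‖fderiv ℝ (T s₀) y‖ₑ ≤
      K₀ * ENNReal.ofReal ((s₀ ^ (n + 1))⁻¹) * J (-1) x := fun x hx y hy =>
    (H.enorm_fderiv_tr_le_shell hΩ hF hu hy hs0 le_rfl (half_le_self hs0.le) le_rfl).trans
      (mul_le_mul' le_rfl (hJ2 x hx y hy))
  refine hC Ω hΩ hF C' hσ G hGm hW s₀ hs0 D (fun k => ?_) (fun k x hx => ?_) (fun k x hx => ?_) f
    (T s₀ x₀) ?_
  · rcases le_or_gt 0 k with hk | hk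
    · rw [hDpos k hk]
      exact (hT _ (half_pos (ht k))).sub (hT _ (ht k))
    · by_cases hk1 : k = -1
      · rw [hk1, hD1]
        exact (hT _ hs0).sub contDiff_const
      · rw [hD0 k hk.not_ge hk1]
        exact contDiff_const
  · rcases le_or_gt 0 k with hk | hk
    · rw [hDpos k hk]
      refine (H.enorm_tr_half_sub_le hΩ hF hu hum hGm hx (ht k) (htle k hk)).trans ?_
      exact mul_le_mul' (mul_le_mul' (ENNReal.coe_le_coe.2 hK0) le_rfl) (hJ1 k x)
    · by_cases hk1 : k = -1
      · rw [hk1, hD1]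
        set l := (K₀ * ENNReal.ofReal ((s₀ ^ (n + 1))⁻¹) * J (-1) x)
        have hl : l ≠ ⊤ := by have := hJ (-1) x; finiteness
        -- The coarsest piece has no smaller difference to draw on: its size comes from the gradient
        -- bound on the whole boundary times the diameter, at most `B₁ s₀`.
        have h2 := hgc.norm_sub_le (hT s₀ hs0) (l := l.toReal) ENNReal.toReal_nonneg
          (fun y hy => by
            have := ENNReal.toReal_mono hl (hf1 x hx y hy)
            rwa [toReal_enorm] at this) hx hx₀
        have h3 : ‖T s₀ x - T s₀ x₀‖ ≤ C₅ * ((n + 1) * l.toReal) * (B₁ * s₀) :=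
          h2.trans (mul_le_mul_of_nonneg_left (hdiam x hx x₀ hx₀) (by positivity))
        rw [← ofReal_norm]
        refine (ENNReal.ofReal_le_ofReal h3).trans ?_
        have e1 : ENNReal.ofReal (C₅ * ((n + 1) * l.toReal) * (B₁ * s₀)) =
            C₅ * (n + 1) * ENNReal.ofReal B₁ * (ENNReal.ofReal s₀ * l) := by
          rw [show C₅ * ((n + 1) * l.toReal) * (B₁ * s₀) =
            (C₅ : ℝ) * (n + 1) * B₁ * (s₀ * l.toReal) by ring,
            ENNReal.ofReal_mul (by positivity), ENNReal.ofReal_mul hs0.le,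
            ENNReal.ofReal_mul (by positivity), ENNReal.ofReal_mul (by positivity),
            ENNReal.ofReal_toReal hl, ENNReal.ofReal_coe_nnreal,
            show ENNReal.ofReal ((n : ℝ) + 1) = n + 1 by
              exact_mod_cast ENNReal.ofReal_natCast (n + 1)]
        have e2 : ENNReal.ofReal s₀ * ENNReal.ofReal ((s₀ ^ (n + 1))⁻¹) =
            ENNReal.ofReal ((s₀ ^ n)⁻¹) := by
          rw [← ENNReal.ofReal_mul hs0.le]
          congr 1
          rw [pow_succ]
          field_simp
        rw [e1]
        calc _ = C₅ * (n + 1) * ENNReal.ofReal B₁ * K₀ *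
              (ENNReal.ofReal s₀ * ENNReal.ofReal ((s₀ ^ (n + 1))⁻¹)) * J (-1) x := by
              simp only [l]; ring
          _ = ((2 ^ n * (C₅ * (n + 1) * B₁.toNNReal) * K₀ : ℝ≥0) : ℝ≥0∞) *
              ENNReal.ofReal ((t (-1) ^ n)⁻¹) * J (-1) x := by
              rw [e2, hpow]
              push_cast
              rw [show ((B₁.toNNReal : ℝ≥0) : ℝ≥0∞) = ENNReal.ofReal B₁ from rfl]
              ring
          _ ≤ _ := mul_le_mul' (mul_le_mul' (ENNReal.coe_le_coe.2 hK3) le_rfl) le_rfl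
      · rw [hD0 k hk.not_ge hk1, enorm_zero]
        exact zero_le
  · rcases le_or_gt 0 k with hk | hk
    · rw [hDpos k hk]
      refine (H.enorm_fderiv_tr_half_sub_le hΩ hF hu hx (ht k) (htle k hk)).trans ?_
      exact mul_le_mul' (mul_le_mul' (ENNReal.coe_le_coe.2 hK1) le_rfl) (hJ1 k x)
    · by_cases hk1 : k = -1
      · rw [hk1, hD1, fderiv_sub_const]
        refine (hf1 x hx x hx).trans ?_
        rw [hpow]
        calc _ = ((2 ^ (n + 1) * K₀ : ℝ≥0) : ℝ≥0∞) *
              ENNReal.ofReal ((t (-1) ^ (n + 1))⁻¹) * J (-1) x := by push_cast; ring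
          _ ≤ _ := mul_le_mul' (mul_le_mul' (ENNReal.coe_le_coe.2 hK2) le_rfl) le_rfl
      · rw [hD0 k hk.not_ge hk1, fderiv_fun_const, Pi.zero_apply,
          ← ofReal_norm, norm_zero, ENNReal.ofReal_zero]
        exact zero_le
  · filter_upwards [H.ae_tendsto_tr_of_hasTrace hΩ hF hσ hθ₀ hu hum hGm hW hf] with x hx hsum
    have s1 : Summable fun m : ℕ => D (m : ℤ) x := summable_natCast (F := fun k => D k x) hsum
    have s2 : Summable fun m : ℕ => D (-((m : ℤ) + 1)) x :=
      summable_neg_natCast_add_one (F := fun k => D k x) hsum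
    have h1 : ∑' m : ℕ, D (m : ℤ) x = f x - T s₀ x := by
      refine tendsto_nhds_unique s1.hasSum.tendsto_sum_nat ?_
      refine (hx.sub_const (T s₀ x)).congr fun m => ?_
      have e : ∀ m : ℕ, D (m : ℤ) x = T (t ((m + 1 : ℕ) : ℤ)) x - T (t (m : ℤ)) x := fun m => by
        rw [hDpos _ (Int.natCast_nonneg m), Nat.cast_add_one, htsucc]
      simp_rw [e]
      rw [Finset.sum_range_sub (fun m : ℕ => T (t (m : ℤ)) x)]
      simp [t, T]
    have h2 : ∑' m : ℕ, D (-((m : ℤ) + 1)) x = T s₀ x - T s₀ x₀ := by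
      rw [tsum_eq_single 0 fun m hm => by
        rw [hD0 _ (by omega) (by omega)]]
      simp [hD1]
    have hsumZ : HasSum (fun k => D k x) ((f x - T s₀ x) + (T s₀ x - T s₀ x₀)) :=
      HasSum.of_nat_of_neg_add_one (h1 ▸ s1.hasSum) (h2 ▸ s2.hasSum)
    rw [hsumZ.tsum_eq]
    ring

/-- The atomic norm of a trace on a domain on which the transversal field serves every scale. -/
theorem atomicNorm_le_of_unbounded (n : ℕ) (hn : 1 ≤ n) {θ : ℝ} (hθ₀ : 0 < θ) (hθ₁ : θ < 1)
    {c L : ℝ} (hc : 0 < c) (hc1 : c ≤ 1) (hL : 0 ≤ L) : ∃ C : ℝ≥0,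
    ∀ (Ω : Set (Amb n)) (e : Amb n → Amb n), (∀ s₀, 0 < s₀ → IsTransversal Ω e c L s₀) → IsOpen Ω →
    (frontier Ω).Nonempty → ∀ C' : ℝ≥0, UpperRegular Ω C' → ∀ C₅ : ℝ≥0, GradControls Ω C₅ →
    ∀ (u : Amb n → ℂ) (G : Amb n → EuclideanSpace ℂ (Fin (n + 1))), Measurable u → Measurable G →
    HasWeakGradient Ω u G → wInt θ Ω G ≠ ⊤ → ∀ f, HasTrace Ω u f →
    atomicNorm θ Ω f ≤ C * wInt θ Ω G := by
  set α := c / 4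
  set B := L + 1
  set K₀ := pieceConst n c L
  have hα : 0 < α := by simp only [α]; positivity
  have hαB : α ≤ B := by simp only [α, B]; linarith
  have hB : 0 < B := by linarith
  obtain ⟨C, hC⟩ := atomicNorm_le_of_dyadic n hn hθ₀ hθ₁ hα hαB (2 * K₀)
  refine ⟨C, fun Ω e H hΩ hF C' hσ C₅ hgc u G hum hGm hu hW f hf => ?_⟩
  set t : ℤ → ℝ := fun k => 1 * 2 ^ (-k)
  have ht : ∀ k, 0 < t k := fun k => by positivity
  have htsucc : ∀ k, t (k + 1) = t k / 2 := fun k => by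
    simp only [t]
    rw [neg_add, zpow_add₀ two_ne_zero, zpow_neg_one]
    ring
  set T : ℝ → Amb n → ℂ := tr Ω e c u
  have hT : ∀ b, 0 < b → ContDiff ℝ 1 (T b) := fun b hb =>
    ((H b hb).contDiff_tr hu.1 hb).of_le (by norm_cast)
  set D : ℤ → Amb n → ℂ := fun k x => T (t k / 2) x - T (t k) x
  -- Telescoping over the large scales: where the pieces are summable, the averages have a limit as
  -- the scale tends to infinity.
  have hneg : ∀ x, (Summable fun k => D k x) →
      Tendsto (fun m : ℕ => T (t (-(m : ℤ))) x) atTop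
        (𝓝 (T (t 0) x - ∑' m : ℕ, D (-((m : ℤ) + 1)) x)) := fun x hsum => by
    have s2 : Summable fun m : ℕ => D (-((m : ℤ) + 1)) x :=
      summable_neg_natCast_add_one (F := fun k => D k x) hsum
    refine (s2.hasSum.tendsto_sum_nat.const_sub (T (t 0) x)).congr fun m => ?_
    have e : ∀ m : ℕ, D (-((m : ℤ) + 1)) x =
        T (t (-(m : ℤ))) x - T (t (-((m + 1 : ℕ) : ℤ))) x := fun m => by
      simp only [D]
      rw [← htsucc]
      push_cast
      congr 3
      ring
    simp_rw [e]
    rw [Finset.sum_range_sub' (fun m : ℕ => T (t (-(m : ℤ))) x)]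
    simp
  -- That limit does not depend on the point: at scale `b` the gradient of the average is at most a
  -- multiple of `b^(θ-n-1)`, so by `GradControls` the difference between two fixed points tends to
  -- zero.
  have hdiff : ∀ x ∈ frontier Ω, ∀ y ∈ frontier Ω,
      Tendsto (fun m : ℕ => T (t (-(m : ℤ))) x - T (t (-(m : ℤ))) y) atTop (𝓝 0) :=
    fun x hx y hy => by
      set w := (wInt θ Ω G).toReal
      have hbd : ∀ m : ℕ, ‖T (t (-(m : ℤ))) x - T (t (-(m : ℤ))) y‖ ≤
          C₅ * ((n + 1) * (K₀ * B ^ θ * w)) * dist x y * (t (-(m : ℤ))) ^ (θ - (n + 1 : ℝ)) := fun m => by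
        set b := t (-(m : ℤ))
        have hb : 0 < b := ht _
        have h2 := hgc.norm_sub_le (hT b hb) (l := K₀ * (b ^ (n + 1))⁻¹ * ((B * b) ^ θ * w))
          (by positivity) (fun z hz => by
            have h3 := ((H b hb).enorm_fderiv_tr_le_shell hΩ hF hu hz hb le_rfl
              (half_le_self hb.le) le_rfl).trans (mul_le_mul' le_rfl
              (setLIntegral_le_wInt (T := B * b) hΩ hF hθ₀ G
                ((measurableSet_shell hΩ _ _ _).inter measurableSet_ball) (fun w hw => hw.1.1)
                fun w hw => hw.1.2.2))
            have h4 := ENNReal.toReal_mono (by finiteness) h3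
            rwa [toReal_enorm, ENNReal.toReal_mul, ENNReal.toReal_mul, ENNReal.toReal_mul,
              ENNReal.toReal_ofReal (by positivity), ENNReal.toReal_ofReal (by positivity),
              ENNReal.coe_toReal] at h4) hx hy
        refine h2.trans (le_of_eq ?_)
        rw [Real.rpow_sub hb, Real.mul_rpow hB.le hb.le,
          show ((n : ℝ) + 1) = ((n + 1 : ℕ) : ℝ) by push_cast; rfl, Real.rpow_natCast]
        ring
      have hlim : Tendsto (fun m : ℕ => (t (-(m : ℤ))) ^ (θ - (n + 1 : ℝ))) atTop (𝓝 0) := by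
        have h5 : Tendsto (fun m : ℕ => t (-(m : ℤ))) atTop atTop := by
          refine (tendsto_pow_atTop_atTop_of_one_lt (one_lt_two (α := ℝ))).congr fun m => ?_
          simp [t]
        have h6 := (tendsto_rpow_neg_atTop (y := n + 1 - θ) (by
          have : (1 : ℝ) ≤ n := by exact_mod_cast hn
          linarith)).comp h5
        refine h6.congr fun m => ?_
        rw [Function.comp_apply, neg_sub]
      have h7 := hlim.const_mul (C₅ * ((n + 1) * (K₀ * B ^ θ * w)) * dist x y)
      rw [mul_zero] at h7
      exact squeeze_zero_norm hbd h7
  -- The common limit at infinity is the additive constant of the decomposition; if no point is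
  -- summable, any value will do.
  have hc : ∃ c₁ : ℂ, ∀ x ∈ frontier Ω, (Summable fun k => D k x) →
      Tendsto (fun m : ℕ => T (t (-(m : ℤ))) x) atTop (𝓝 c₁) := by
    by_cases hex : ∃ y ∈ frontier Ω, Summable fun k => D k y
    · obtain ⟨y, hy, hsy⟩ := hex
      refine ⟨T (t 0) y - ∑' m : ℕ, D (-((m : ℤ) + 1)) y, fun x hx hsx => ?_⟩
      have := (hdiff x hx y hy).add (hneg y hsy)
      rw [zero_add] at this
      simpa using this
    · exact ⟨0, fun x hx hsx => (hex ⟨x, hx, hsx⟩).elim⟩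
  obtain ⟨c₁, hc₁⟩ := hc
  refine hC Ω hΩ hF C' hσ G hGm hW 1 one_pos D
    (fun k => (hT _ (half_pos (ht k))).sub (hT _ (ht k))) (fun k x hx => ?_) (fun k x hx => ?_) f
    c₁ ?_
  · refine ((H (t k) (ht k)).enorm_tr_half_sub_le hΩ hF hu hum hGm hx (ht k) le_rfl).trans ?_
    exact mul_le_mul' (mul_le_mul' (ENNReal.coe_le_coe.2
      (le_mul_of_one_le_left' one_le_two)) le_rfl) le_rfl
  · exact (H (t k) (ht k)).enorm_fderiv_tr_half_sub_le hΩ hF hu hx (ht k) le_rfl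
  · filter_upwards [(H 1 one_pos).ae_tendsto_tr_of_hasTrace hΩ hF hσ hθ₀ hu hum hGm hW hf,
      ae_mem_frontier Ω] with x hx hxF hsum
    have s1 : Summable fun m : ℕ => D (m : ℤ) x := summable_natCast (F := fun k => D k x) hsum
    have s2 : Summable fun m : ℕ => D (-((m : ℤ) + 1)) x :=
      summable_neg_natCast_add_one (F := fun k => D k x) hsum
    have h1 : ∑' m : ℕ, D (m : ℤ) x = f x - T (t 0) x := by
      refine tendsto_nhds_unique s1.hasSum.tendsto_sum_nat ?_
      refine (hx.sub_const (T (t 0) x)).congr fun m => ?_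
      have e : ∀ m : ℕ, D (m : ℤ) x = T (t ((m + 1 : ℕ) : ℤ)) x - T (t (m : ℤ)) x := fun m => by
        simp only [D]
        rw [Nat.cast_add_one, htsucc]
      simp_rw [e]
      rw [Finset.sum_range_sub (fun m : ℕ => T (t (m : ℤ)) x)]
      simp [t, T]
    have h2 := tendsto_nhds_unique (hneg x hsum) (hc₁ x hxF hsum)
    have hsumZ := HasSum.of_nat_of_neg_add_one (f := fun k => D k x) s1.hasSum s2.hasSum
    rw [hsumZ.tsum_eq, h1, ← h2]
    ring

end IsTransversal


/-! ### Lipschitz functions with almost everywhere bounded derivative -/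

/-- Project onto the direction of the increment `w`: the real function `Re(conj w · f)` is
Lipschitz, hence absolutely continuous, and the fundamental theorem of calculus gives `|w|² ≤ |w|
l`. -/
lemma norm_sub_le_of_ae_deriv {f : ℝ → ℂ} {K : ℝ≥0} (hf : LipschitzOnWith K f (Icc 0 1)) {l : ℝ}
    (hd : ∀ᵐ t : ℝ, t ∈ Ioo (0 : ℝ) 1 → ∃ v, HasDerivAt f v t ∧ ‖v‖ ≤ l) : ‖f 1 - f 0‖ ≤ l := by
  set w := f 1 - f 0
  set L : ℂ →L[ℝ] ℝ := Complex.reCLM.comp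
    ((ContinuousLinearMap.mul ℝ ℂ (starRingEnd ℂ w)))
  have hL : ∀ z, L z = (starRingEnd ℂ w * z).re := fun z => rfl
  have hLn : ∀ z, ‖L z‖ ≤ ‖w‖ * ‖z‖ := fun z => by
    rw [hL, Real.norm_eq_abs]
    refine (Complex.abs_re_le_norm _).trans ?_
    rw [norm_mul, RCLike.norm_conj]
  have hac : AbsolutelyContinuousOnInterval (fun t => L (f t)) 0 1 := by
    have : LipschitzOnWith (‖L‖₊ * K) (fun t => L (f t)) (uIcc 0 1) := by
      rw [uIcc_of_le zero_le_one]
      exact L.lipschitz.comp_lipschitzOnWith hf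
    exact this.absolutelyContinuousOnInterval
  have h1 := hac.integral_deriv_eq_sub
  have h2 : ‖∫ t in (0 : ℝ)..1, deriv (fun t => L (f t)) t‖ ≤ ‖w‖ * l * |1 - 0| := by
    refine intervalIntegral.norm_integral_le_of_norm_le_const_ae ?_
    have h3 : ∀ᵐ t : ℝ, t ≠ 1 := by simp [ae_iff, measure_singleton]
    filter_upwards [hd, h3] with t ht h3 ht'
    rw [uIoc_of_le zero_le_one] at ht'
    obtain ⟨v, hv, hvl⟩ := ht ⟨ht'.1, lt_of_le_of_ne ht'.2 h3⟩
    have := (L.hasFDerivAt.comp_hasDerivAt t hv).deriv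
    rw [show deriv (fun t => L (f t)) t = L v from this]
    exact (hLn v).trans (mul_le_mul_of_nonneg_left hvl (norm_nonneg _))
  rw [h1, ← map_sub, hL, ← Complex.normSq_eq_conj_mul_self, Complex.ofReal_re,
    Complex.normSq_eq_norm_sq, Real.norm_of_nonneg (by positivity)] at h2
  rcases (norm_nonneg w).eq_or_lt with h | h
  · rw [← h]
    have h4 : NeZero (volume (Ioo (0 : ℝ) 1)) := ⟨by simp⟩
    have h5 : ∃ᵐ t : ℝ, t ∈ Ioo (0 : ℝ) 1 := by
      rw [frequently_ae_mem_iff]; simp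
    obtain ⟨t, ht1, ht2⟩ := (h5.and_eventually hd).exists
    obtain ⟨v, -, hv⟩ := ht2 ht1
    exact (norm_nonneg v).trans hv
  · norm_num at h2
    nlinarith

/-- The given segment may lie inside the exceptional null set. By Fubini almost every translate of
it meets that set in a null set of parameters; such translations are dense, and continuity brings
the estimate back. -/
lemma norm_sub_le_of_ae_fderiv {b : EuclideanSpace ℝ (Fin n) → ℂ}
    {D : Set (EuclideanSpace ℝ (Fin n))} (hD : IsOpen D) (hconv : Convex ℝ D) {K : ℝ≥0}
    (hb : LipschitzOnWith K b D) {l : ℝ}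
    (hd : ∀ᵐ y, y ∈ D → ∃ b' : EuclideanSpace ℝ (Fin n) →L[ℝ] ℂ, HasFDerivAt b b' y ∧ ‖b'‖ ≤ l)
    {y₁ y₂ : EuclideanSpace ℝ (Fin n)} (h1 : y₁ ∈ D) (h2 : y₂ ∈ D) :
    ‖b y₂ - b y₁‖ ≤ l * ‖y₂ - y₁‖ := by
  set w := y₂ - y₁
  obtain ⟨S, hSsub, hSm, hS0⟩ := exists_measurable_superset_of_null (ae_iff.1 hd)
  have hmeas : MeasurableSet {p : EuclideanSpace ℝ (Fin n) × ℝ | y₁ + p.1 + p.2 • w ∉ S} := by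
    have : Measurable fun p : EuclideanSpace ℝ (Fin n) × ℝ => y₁ + p.1 + p.2 • w := by fun_prop
    exact this hSm.compl
  have hae : ∀ᵐ h : EuclideanSpace ℝ (Fin n), ∀ᵐ t : ℝ, y₁ + h + t • w ∉ S := by
    rw [Measure.ae_ae_comm (p := fun h t => y₁ + h + t • w ∉ S) hmeas]
    refine Eventually.of_forall fun t => ?_
    have hmp := measurePreserving_add_left volume (y₁ + t • w)
    have := hmp.quasiMeasurePreserving.preimage_null hS0
    rw [ae_iff]
    refine measure_mono_null (fun h hh => ?_) this
    have hh' : y₁ + h + t • w ∈ S := not_not.1 hh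
    rw [mem_preimage, show y₁ + t • w + h = y₁ + h + t • w by abel]
    exact hh'
  -- Good translations accumulate at zero, which is all that the limit needs.
  have hdense := (Measure.dense_of_ae hae) 0
  have hfreq := mem_closure_iff_frequently.1 hdense
  have hc1 : ∀ y ∈ D, Tendsto (fun h => b (y + h)) (𝓝 0) (𝓝 (b y)) := fun y hy => by
    have := (hb.continuousOn.continuousAt (hD.mem_nhds hy)).tendsto
    have h3 : Tendsto (fun h => y + h) (𝓝 0) (𝓝 y) := by
      simpa using (tendsto_const_nhds (x := y)).add (tendsto_id (x := 𝓝 (0 : EuclideanSpace ℝ (Fin n))))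
    exact this.comp h3
  have hmem : ∀ y ∈ D, ∀ᶠ h in 𝓝 (0 : EuclideanSpace ℝ (Fin n)), y + h ∈ D := fun y hy => by
    have h3 : Tendsto (fun h => y + h) (𝓝 0) (𝓝 y) := by
      simpa using (tendsto_const_nhds (x := y)).add (tendsto_id (x := 𝓝 (0 : EuclideanSpace ℝ (Fin n))))
    exact h3.eventually (hD.mem_nhds hy)
  refine le_of_tendsto_of_frequently ((hc1 y₂ h2).sub (hc1 y₁ h1)).norm ?_
  refine (hfreq.and_eventually ((hmem y₁ h1).and (hmem y₂ h2))).mono fun h ⟨hh, hm1, hm2⟩ => ?_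
  have hseg : ∀ t ∈ Icc (0 : ℝ) 1, y₁ + h + t • w ∈ D := fun t ht => by
    have := hconv.add_smul_sub_mem hm1 hm2 ht
    rwa [add_sub_add_right_eq_sub] at this
  have hlip : LipschitzOnWith (K * ‖w‖₊) (fun t : ℝ => b (y₁ + h + t • w)) (Icc 0 1) := by
    refine LipschitzOnWith.of_dist_le_mul fun s hs t ht => ?_
    refine (hb.dist_le_mul _ (hseg s hs) _ (hseg t ht)).trans (le_of_eq ?_)
    rw [dist_add_left, dist_eq_norm, ← sub_smul, norm_smul, ← dist_eq_norm]
    push_cast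
    ring
  have := norm_sub_le_of_ae_deriv hlip (l := l * ‖w‖) (by
    filter_upwards [hh] with t ht ht'
    have hnot : y₁ + h + t • w ∉ S := ht
    have hP := not_not.1 fun hcon => hnot (hSsub hcon)
    obtain ⟨b', hb', hbl⟩ := hP (hseg t (Ioo_subset_Icc_self ht'))
    have hder : HasDerivAt (fun t : ℝ => y₁ + h + t • w) w t := by
      have := ((hasDerivAt_id t).smul_const w).const_add (y₁ + h)
      simpa using this
    refine ⟨b' w, hb'.comp_hasDerivAt t hder, (b'.le_opNorm w).trans ?_⟩
    exact mul_le_mul_of_nonneg_right hbl (norm_nonneg _))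
  simp only [one_smul, zero_smul, add_zero] at this
  rwa [show y₁ + h + w = y₂ + h by simp only [w]; abel] at this

/-! ### Chains along connected sets -/

/-- The image of `F` under `g` contains the interval between the two values, and this interval is
covered by images of diameter at most `d j`. Comparing lengths gives the bound without constructing
a chain of overlapping pieces. -/
lemma abs_sub_le_sum_of_isPreconnected {F : Set (Amb n)} (hF : IsPreconnected F) {ι : Type*}
    [Fintype ι] {U : ι → Set (Amb n)} (hcov : F ⊆ ⋃ j, U j) {g : Amb n → ℝ} (hg : ContinuousOn g F)
    {d : ι → ℝ} (hd0 : ∀ j, 0 ≤ d j)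
    (hd : ∀ j, ∀ x ∈ F ∩ U j, ∀ y ∈ F ∩ U j, |g x - g y| ≤ d j) {x y : Amb n} (hx : x ∈ F)
    (hy : y ∈ F) : |g x - g y| ≤ ∑ j, d j := by
  have h1 : uIcc (g y) (g x) ⊆ ⋃ j, g '' (F ∩ U j) := by
    refine ((hF.image g hg).ordConnected.uIcc_subset (mem_image_of_mem g hy)
      (mem_image_of_mem g hx)).trans ?_
    rintro _ ⟨z, hz, rfl⟩
    obtain ⟨j, hj⟩ := mem_iUnion.1 (hcov hz)
    exact mem_iUnion.2 ⟨j, mem_image_of_mem g ⟨hz, hj⟩⟩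
  have h2 : volume (uIcc (g y) (g x)) ≤ ∑ j, ENNReal.ofReal (d j) := by
    refine (measure_mono h1).trans ((measure_iUnion_fintype_le _ _).trans
      (Finset.sum_le_sum fun j _ => (Real.volume_le_diam _).trans (Metric.ediam_le ?_)))
    rintro _ ⟨a, ha, rfl⟩ _ ⟨b, hb, rfl⟩
    rw [edist_dist, Real.dist_eq]
    exact ENNReal.ofReal_le_ofReal (hd j a ha b hb)
  rw [Real.volume_interval, ← ENNReal.ofReal_sum_of_nonneg fun j _ => hd0 j] at h2
  exact (ENNReal.ofReal_le_ofReal_iff (Finset.sum_nonneg fun j _ => hd0 j)).1 h2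

/-! ### Graph coordinates -/

section Coordinates

lemma dist_fst_le (A : Coord n) (x y : Amb n) : dist (A x).fst (A y).fst ≤ dist x y := by
  rw [dist_eq_norm, dist_eq_norm, ← A.norm_map (x - y), map_sub]
  exact WithLp.norm_fst_le _ (A x - A y)

lemma abs_snd_sub_le (A : Coord n) (x y : Amb n) : |(A x).snd - (A y).snd| ≤ dist x y := by
  rw [← Real.norm_eq_abs, dist_eq_norm, ← A.norm_map (x - y), map_sub]
  exact WithLp.norm_snd_le _ (A x - A y)

lemma dist_le_fst_add_snd (A : Coord n) (x y : Amb n) :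
    dist x y ≤ dist (A x).fst (A y).fst + |(A x).snd - (A y).snd| := by
  have h := WithLp.prod_norm_sq_eq_of_L2 (A x - A y)
  rw [← map_sub, A.norm_map, map_sub, WithLp.sub_fst, WithLp.sub_snd] at h
  rw [dist_eq_norm, dist_eq_norm, ← Real.norm_eq_abs]
  refine abs_le_of_sq_le_sq' ?_ (by positivity) |>.2
  nlinarith [norm_nonneg ((A x).fst - (A y).fst), norm_nonneg ((A x).snd - (A y).snd)]

/-- The parametrization of the graph of `ψ` in the coordinates `A`. -/
def graphMap (A : Coord n) (ψ : EuclideanSpace ℝ (Fin n) → ℝ) (y : EuclideanSpace ℝ (Fin n)) :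
    Amb n := A.symm (WithLp.toLp 2 (y, ψ y))

variable {A : Coord n} {ψ : EuclideanSpace ℝ (Fin n) → ℝ} {M : ℝ≥0}

@[simp] lemma fst_graphMap (y : EuclideanSpace ℝ (Fin n)) : (A (graphMap A ψ y)).fst = y := by
  simp [graphMap]

@[simp] lemma snd_graphMap (y : EuclideanSpace ℝ (Fin n)) : (A (graphMap A ψ y)).snd = ψ y := by
  simp [graphMap]

lemma graphMap_fst {x : Amb n} (h : (A x).snd = ψ (A x).fst) : graphMap A ψ (A x).fst = x := by
  rw [graphMap, ← h]
  exact A.symm_apply_apply x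

lemma lipschitzWith_graphMap (hψ : LipschitzWith M ψ) : LipschitzWith (1 + M) (graphMap A ψ) := by
  refine LipschitzWith.of_dist_le_mul fun y y' => (dist_le_fst_add_snd A _ _).trans ?_
  simp only [fst_graphMap, snd_graphMap]
  have := hψ.dist_le_mul y y'
  rw [Real.dist_eq] at this
  push_cast
  linarith

lemma euclideanHausdorffMeasure_image_le {X Y : Type*} [EMetricSpace X] [EMetricSpace Y]
    [MeasurableSpace X] [BorelSpace X] [MeasurableSpace Y] [BorelSpace Y] {f : X → Y} {K : ℝ≥0}
    (hf : LipschitzWith K f) (s : Set X) :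
    Measure.euclideanHausdorffMeasure n (f '' s) ≤
      (K : ℝ≥0∞) ^ n * Measure.euclideanHausdorffMeasure n s := by
  rw [Measure.euclideanHausdorffMeasure_def, Measure.euclideanHausdorffMeasure_def,
    Measure.smul_apply, Measure.smul_apply, ENNReal.smul_def, ENNReal.smul_def, smul_eq_mul,
    smul_eq_mul]
  have := hf.hausdorffMeasure_image_le (d := n) (Nat.cast_nonneg n) s
  rw [ENNReal.rpow_natCast] at this
  calc _ ≤ _ := mul_le_mul' le_rfl this
    _ = _ := by ring

/-- The volume of the unit ball of `ℝⁿ`. -/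
def volBall (n : ℕ) : ℝ≥0 := (volume (ball (0 : EuclideanSpace ℝ (Fin n)) 1)).toNNReal

lemma volume_ball_eq (y : EuclideanSpace ℝ (Fin n)) {r : ℝ} (hr : 0 < r) :
    volume (ball y r) = volBall n * ENNReal.ofReal (r ^ n) := by
  rw [Measure.addHaar_ball_of_pos _ _ hr, finrank_euclideanSpace_fin, volBall,
    ENNReal.coe_toNNReal measure_ball_lt_top.ne, mul_comm]

lemma volBall_pos : 0 < volBall n :=
  ENNReal.toNNReal_pos (measure_ball_pos _ _ one_pos).ne' measure_ball_lt_top.ne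

/-- A ball meets each graph in the Lipschitz image of a ball of the same radius in `ℝⁿ`. -/
lemma upperRegular_of_cover {Ω : Set (Amb n)} {ι : Type*} [Fintype ι] {A : ι → Coord n}
    {ψ : ι → EuclideanSpace ℝ (Fin n) → ℝ} (hψ : ∀ j, LipschitzWith M (ψ j))
    (hcov : frontier Ω ⊆ ⋃ j, {x | (A j x).snd = ψ j (A j x).fst}) :
    UpperRegular Ω (Fintype.card ι * ((1 + M) ^ n * volBall n)) := fun x r hr => by
  rw [surfaceMeasure, Measure.restrict_apply measurableSet_ball]
  have h1 : ball x r ∩ frontier Ω ⊆ ⋃ j, graphMap (A j) (ψ j) '' ball (A j x).fst r := by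
    rintro z ⟨hz, hzF⟩
    obtain ⟨j, hj⟩ := mem_iUnion.1 (hcov hzF)
    exact mem_iUnion.2 ⟨j, (A j z).fst, (dist_fst_le (A j) z x).trans_lt hz, graphMap_fst hj⟩
  refine (measure_mono h1).trans ((measure_iUnion_fintype_le _ _).trans
    ((Finset.sum_le_sum (g := fun _ => ((1 + M : ℝ≥0) : ℝ≥0∞) ^ n * (volBall n * ENNReal.ofReal (r ^ n)))
      fun j _ => ?_).trans (le_of_eq ?_)))
  · refine (euclideanHausdorffMeasure_image_le (lipschitzWith_graphMap (hψ j)) _).trans ?_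
    rw [EuclideanSpace.euclideanHausdorffMeasure_eq_volume, volume_ball_eq _ hr]
  · rw [Finset.sum_const, Finset.card_univ, nsmul_eq_mul]
    push_cast
    ring

/-- `σ(B(x, s)) ≥ c sⁿ` for boundary points `x` and radii up to `R`. -/
def LowerRegular (Ω : Set (Amb n)) (c : ℝ≥0) (R : ℝ) : Prop :=
  ∀ x ∈ frontier Ω, ∀ s, 0 < s → s ≤ R → c * ENNReal.ofReal (s ^ n) ≤ surfaceMeasure Ω (ball x s)

/-- In the cylinder about `z` the set `Ω` is the region above the graph of `ψ`. -/
structure LocalGraph (Ω : Set (Amb n)) (M : ℝ≥0) (A : Coord n) (ψ : EuclideanSpace ℝ (Fin n) → ℝ)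
    (z : Amb n) (ρ : ℝ) : Prop where
  lip : LipschitzWith M ψ
  on_graph : (A z).snd = ψ (A z).fst
  iff : ∀ x, dist (A x).fst (A z).fst < 2 * ρ → |(A x).snd - (A z).snd| < (4 + 4 * M) * ρ →
    (x ∈ Ω ↔ ψ (A x).fst < (A x).snd)

lemma continuous_fst_coord (A : Coord n) : Continuous fun x => (A x).fst :=
  (WithLp.continuous_fst 2 _ _).comp A.continuous

lemma continuous_snd_coord (A : Coord n) : Continuous fun x => (A x).snd :=
  (WithLp.continuous_snd 2 _ _).comp A.continuous

/-- The unit vector in the direction of the `t`-axis. -/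
def upVec (A : Coord n) : Amb n := A.symm (WithLp.toLp 2 (0, 1))

lemma fst_add_smul_upVec (A : Coord n) (x : Amb n) (s : ℝ) : (A (x + s • upVec A)).fst = (A x).fst := by
  simp [upVec]

lemma snd_add_smul_upVec (A : Coord n) (x : Amb n) (s : ℝ) :
    (A (x + s • upVec A)).snd = (A x).snd + s := by
  simp [upVec]

lemma norm_upVec (A : Coord n) : ‖upVec A‖ = 1 := by
  rw [upVec, A.symm.norm_map]
  have := WithLp.prod_norm_sq_eq_of_L2 (WithLp.toLp 2 ((0 : EuclideanSpace ℝ (Fin n)), (1 : ℝ)))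
  simp only [WithLp.toLp_fst, WithLp.toLp_snd, norm_zero, norm_one] at this
  nlinarith [norm_nonneg (WithLp.toLp 2 ((0 : EuclideanSpace ℝ (Fin n)), (1 : ℝ)))]

namespace LocalGraph

variable {Ω : Set (Amb n)} {z : Amb n} {ρ : ℝ}

/-- Inside the cylinder a point below the graph has a neighbourhood free of `Ω`, a point above is
interior, and a point of the graph is a limit of points obtained by moving up. -/
lemma mem_frontier_iff (H : LocalGraph Ω M A ψ z ρ) (hΩ : IsOpen Ω) {x : Amb n}
    (h1 : dist (A x).fst (A z).fst < 2 * ρ) (h2 : |(A x).snd - (A z).snd| < (4 + 4 * M) * ρ) :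
    x ∈ frontier Ω ↔ (A x).snd = ψ (A x).fst := by
  have hc1 := continuous_fst_coord A
  have hc2 := continuous_snd_coord A
  have hZ : {x | dist (A x).fst (A z).fst < 2 * ρ ∧ |(A x).snd - (A z).snd| < (4 + 4 * M) * ρ} ∈ 𝓝 x := by
    refine IsOpen.mem_nhds ?_ ⟨h1, h2⟩
    exact (isOpen_lt (hc1.dist continuous_const) continuous_const).inter
      (isOpen_lt (hc2.sub continuous_const).abs continuous_const)
  rw [hΩ.frontier_eq]
  constructor
  · rintro ⟨hcl, hno⟩
    refine le_antisymm (not_lt.1 fun h => hno ((H.iff x h1 h2).2 h)) ?_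
    by_contra hlt
    have hop : {x | (A x).snd < ψ (A x).fst} ∈ 𝓝 x :=
      (isOpen_lt hc2 (H.lip.continuous.comp hc1)).mem_nhds (not_le.1 hlt)
    obtain ⟨y, ⟨hy1, hy2⟩, hy3⟩ := mem_closure_iff_nhds.1 hcl _ (inter_mem hZ hop)
    exact lt_asymm ((H.iff y hy1.1 hy1.2).1 hy3) hy2
  · intro heq
    refine ⟨mem_closure_iff_nhds.2 fun U hU => ?_, fun h => ((H.iff x h1 h2).1 h).ne' heq⟩
    have ht : Tendsto (fun s : ℝ => x + s • upVec A) (𝓝[>] 0) (𝓝 x) := by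
      have : Continuous fun s : ℝ => x + s • upVec A := by fun_prop
      have h3 := this.tendsto 0
      rw [zero_smul, add_zero] at h3
      exact h3.mono_left nhdsWithin_le_nhds
    obtain ⟨s, ⟨hs1, hs2⟩, hs3⟩ := ((ht.eventually (inter_mem hU hZ)).and self_mem_nhdsWithin).exists
    refine ⟨_, hs1, (H.iff _ hs2.1 hs2.2).2 ?_⟩
    rw [fst_add_smul_upVec, snd_add_smul_upVec, heq]
    exact lt_add_of_pos_right _ hs3

lemma graphMap_mem (H : LocalGraph Ω M A ψ z ρ) (hΩ : IsOpen Ω) {y : EuclideanSpace ℝ (Fin n)}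
    (hy : dist y (A z).fst < 2 * ρ) : graphMap A ψ y ∈ frontier Ω := by
  rw [H.mem_frontier_iff hΩ] <;> simp only [fst_graphMap, snd_graphMap]
  · exact hy
  · rw [H.on_graph, ← Real.dist_eq]
    refine (H.lip.dist_le_mul _ _).trans_lt ?_
    have hd : 0 ≤ dist y (A z).fst := dist_nonneg
    have hM : (0 : ℝ) ≤ M := M.2
    nlinarith

lemma coord_lt (A : Coord n) (M : ℝ≥0) {x : Amb n} (hx : x ∈ ball z (2 * ρ)) :
    dist (A x).fst (A z).fst < 2 * ρ ∧ |(A x).snd - (A z).snd| < (4 + 4 * M) * ρ := by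
  rw [mem_ball] at hx
  refine ⟨(dist_fst_le A x z).trans_lt hx, (abs_snd_sub_le A x z).trans_lt ?_⟩
  have hM : (0 : ℝ) ≤ M := M.2
  have := dist_nonneg (x := x) (y := z)
  nlinarith

lemma snd_eq (H : LocalGraph Ω M A ψ z ρ) (hΩ : IsOpen Ω) {x : Amb n} (hx : x ∈ ball z (2 * ρ))
    (hF : x ∈ frontier Ω) : (A x).snd = ψ (A x).fst :=
  (H.mem_frontier_iff hΩ (coord_lt A M hx).1 (coord_lt A M hx).2).1 hF

/-- Projection along the axis does not increase `n`-dimensional measure, and the projection of the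
surface ball contains a ball of radius `s/(1+M)`. -/
lemma measure_ball_ge (H : LocalGraph Ω M A ψ z ρ) (hΩ : IsOpen Ω) {x : Amb n}
    (hx : x ∈ ball z ρ) (hF : x ∈ frontier Ω) {s : ℝ} (hs : 0 < s) (hs' : s ≤ ρ) :
    (volBall n / (1 + M) ^ n : ℝ≥0) * ENNReal.ofReal (s ^ n) ≤ surfaceMeasure Ω (ball x s) := by
  have hM : (0 : ℝ) ≤ M := M.2
  have hM1 : (0 : ℝ) < 1 + M := by positivity
  have hρ : 0 < ρ := hs.trans_le hs'
  rw [surfaceMeasure, Measure.restrict_apply measurableSet_ball]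
  have hsub : ball (A x).fst (s / (1 + M)) ⊆ (fun w => (A w).fst) '' (ball x s ∩ frontier Ω) := by
    intro y hy
    have hyx := mem_ball.1 hy
    have h1 := dist_fst_le A x z
    have h2 := mem_ball.1 hx
    have h3 : s / (1 + M) ≤ s := div_le_self hs.le (by linarith)
    have hyz : dist y (A z).fst < 2 * ρ := by
      linarith [dist_triangle y (A x).fst (A z).fst]
    refine ⟨graphMap A ψ y, ⟨?_, H.graphMap_mem hΩ hyz⟩, fst_graphMap y⟩
    have h4 := (lipschitzWith_graphMap (A := A) H.lip).dist_le_mul y (A x).fst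
    rw [graphMap_fst (H.snd_eq hΩ (ball_subset_ball (by linarith) hx) hF)] at h4
    rw [mem_ball]
    refine h4.trans_lt ?_
    rw [lt_div_iff₀ hM1] at hyx
    push_cast
    linarith
  have hl : LipschitzWith 1 fun w => (A w).fst :=
    LipschitzWith.of_dist_le_mul fun a b => by simpa using dist_fst_le A a b
  have h5 := euclideanHausdorffMeasure_image_le (n := n) hl (ball x s ∩ frontier Ω)
  rw [ENNReal.coe_one, one_pow, one_mul, EuclideanSpace.euclideanHausdorffMeasure_eq_volume] at h5
  refine le_trans (le_of_eq ?_) ((measure_mono hsub).trans h5)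
  rw [volume_ball_eq _ (by positivity), div_pow, ENNReal.ofReal_div_of_pos (by positivity),
    ENNReal.coe_div (by positivity), ENNReal.mul_comm_div,
    show ENNReal.ofReal ((1 + (M : ℝ)) ^ n) = (((1 + M) ^ n : ℝ≥0) : ℝ≥0∞) by
      rw [← ENNReal.ofReal_coe_nnreal]; push_cast; rfl]

/-- The tangential gradient controls differences within one chart. -/
lemma norm_sub_le (H : LocalGraph Ω M A ψ z ρ) (hΩ : IsOpen Ω) {a : Amb n → ℂ}
    (ha : ∀ R : ℝ, ∃ K : ℝ≥0, LipschitzOnWith K a (frontier Ω ∩ ball 0 R)) {l : ℝ} (hl : 0 ≤ l)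
    (hd : ∀ᵐ x ∂(surfaceMeasure Ω), ∃ g : EuclideanSpace ℂ (Fin (n + 1)),
      HasFDerivWithinAt a (gradMap g) (frontier Ω) x ∧ ‖g‖ ≤ l) {x y : Amb n}
    (hx : x ∈ ball z (2 * ρ)) (hxF : x ∈ frontier Ω) (hy : y ∈ ball z (2 * ρ))
    (hyF : y ∈ frontier Ω) : ‖a x - a y‖ ≤ (1 + M) * l * dist x y := by
  set D := ball (A z).fst (2 * ρ)
  have hlipX := lipschitzWith_graphMap (A := A) H.lip
  have hmap : MapsTo (graphMap A ψ) D (frontier Ω) := fun w hw => H.graphMap_mem hΩ hw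
  obtain ⟨K, hK⟩ := ha (‖z‖ + ((1 + M : ℝ≥0) : ℝ) * (2 * ρ))
  have hb : LipschitzOnWith (K * (1 + M)) (a ∘ graphMap A ψ) D := by
    refine hK.comp hlipX.lipschitzOnWith fun w hw => ⟨hmap hw, ?_⟩
    have h1 := hlipX.dist_le_mul w (A z).fst
    rw [graphMap_fst H.on_graph, dist_eq_norm] at h1
    rw [mem_ball_zero_iff]
    have h2 : ((1 + M : ℝ≥0) : ℝ) * dist w (A z).fst < ((1 + M : ℝ≥0) : ℝ) * (2 * ρ) :=
      mul_lt_mul_of_pos_left hw (by positivity)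
    linarith [norm_sub_norm_le (graphMap A ψ w) z]
  have hlπ : LipschitzWith 1 fun w => (A w).fst :=
    LipschitzWith.of_dist_le_mul fun a b => by simpa using dist_fst_le A a b
  have hae : ∀ᵐ w, w ∈ D → ∃ b' : EuclideanSpace ℝ (Fin n) →L[ℝ] ℂ,
      HasFDerivAt (a ∘ graphMap A ψ) b' w ∧ ‖b'‖ ≤ l * (1 + M) := by
    -- A null set of the boundary projects to a null set of `ℝⁿ`, so the tangential bound can be
    -- pulled back to almost every parameter; Rademacher then makes the parametrization itself
    -- differentiable.
    have hnull : ∀ᵐ w, w ∈ D → ∃ g : EuclideanSpace ℂ (Fin (n + 1)),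
        HasFDerivWithinAt a (gradMap g) (frontier Ω) (graphMap A ψ w) ∧ ‖g‖ ≤ l := by
      rw [surfaceMeasure, ae_restrict_iff' isClosed_frontier.measurableSet, ae_iff] at hd
      have h5 := euclideanHausdorffMeasure_image_le (n := n) hlπ {x | ¬(x ∈ frontier Ω →
        ∃ g, HasFDerivWithinAt a (gradMap g) (frontier Ω) x ∧ ‖g‖ ≤ l)}
      rw [hd, mul_zero, EuclideanSpace.euclideanHausdorffMeasure_eq_volume] at h5
      rw [ae_iff]
      refine measure_mono_null (fun w hw => ?_) (le_antisymm h5 zero_le)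
      have hw' := Classical.not_imp.1 hw
      exact ⟨graphMap A ψ w, fun h => hw'.2 (h (hmap hw'.1)), fst_graphMap w⟩
    filter_upwards [hnull, hlipX.ae_differentiableAt] with w h1 h2 hwD
    obtain ⟨g, hg, hgl⟩ := h1 hwD
    have h3 := (hg.comp w h2.hasFDerivAt.hasFDerivWithinAt hmap).hasFDerivAt
      (isOpen_ball.mem_nhds hwD)
    refine ⟨_, h3, (ContinuousLinearMap.opNorm_comp_le _ _).trans ?_⟩
    refine mul_le_mul ((norm_gradMap_le g).trans hgl) ?_ (norm_nonneg _) hl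
    have := norm_fderiv_le_of_lipschitz ℝ hlipX (x₀ := w)
    push_cast at this
    exact this
  have hxD : (A x).fst ∈ D := (coord_lt A M hx).1
  have hyD : (A y).fst ∈ D := (coord_lt A M hy).1
  have h6 := norm_sub_le_of_ae_fderiv isOpen_ball (convex_ball _ _) hb hae hyD hxD
  rw [Function.comp_apply, Function.comp_apply, graphMap_fst (H.snd_eq hΩ hx hxF),
    graphMap_fst (H.snd_eq hΩ hy hyF), ← dist_eq_norm (A x).fst] at h6
  refine h6.trans ?_
  rw [mul_comm l]
  exact mul_le_mul_of_nonneg_left (dist_fst_le A x y) (by positivity)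

end LocalGraph

end Coordinates


/-! ### Geometry of Lipschitz domains -/

section GraphDomain

variable {A : Coord n} {ψ : EuclideanSpace ℝ (Fin n) → ℝ} {M : ℝ≥0}

lemma snd_eq_of_mem_frontier_epigraph (hψ : LipschitzWith M ψ) {z : Amb n}
    (hz : z ∈ frontier (epigraph A ψ)) : (A z).snd = ψ (A z).fst :=
  (frontier_lt_subset_eq (hψ.continuous.comp (continuous_fst_coord A)) (continuous_snd_coord A)
    hz).symm

lemma localGraph_epigraph (hψ : LipschitzWith M ψ) {z : Amb n}
    (hz : z ∈ frontier (epigraph A ψ)) (ρ : ℝ) : LocalGraph (epigraph A ψ) M A ψ z ρ :=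
  ⟨hψ, snd_eq_of_mem_frontier_epigraph hψ hz, fun _ _ _ => Iff.rfl⟩

lemma isOpen_epigraph (hψ : LipschitzWith M ψ) : IsOpen (epigraph A ψ) :=
  isOpen_lt (hψ.continuous.comp (continuous_fst_coord A)) (continuous_snd_coord A)

lemma upperRegular_epigraph (hψ : LipschitzWith M ψ) :
    UpperRegular (epigraph A ψ) ((1 + M) ^ n * volBall n) := by
  have := upperRegular_of_cover (Ω := epigraph A ψ) (ι := Unit) (A := fun _ => A)
    (ψ := fun _ => ψ) (fun _ => hψ) fun x hx =>
      mem_iUnion.2 ⟨(), snd_eq_of_mem_frontier_epigraph hψ hx⟩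
  simpa using this

lemma lowerRegular_epigraph (hψ : LipschitzWith M ψ) (R : ℝ) :
    LowerRegular (epigraph A ψ) (volBall n / (1 + M) ^ n) R := fun _ hx s hs _ =>
  (localGraph_epigraph hψ hx s).measure_ball_ge (isOpen_epigraph hψ) (mem_ball_self hs) hx hs le_rfl

/-- A graph is a single chart of arbitrary radius, so one chart contains both points. -/
lemma gradControls_epigraph (hψ : LipschitzWith M ψ) : GradControls (epigraph A ψ) (1 + M) := by
  intro a ha l hl hd x hx y hy
  have hp := dist_nonneg (x := x) (y := y)
  refine (localGraph_epigraph hψ hx (dist x y + 1)).norm_sub_le (isOpen_epigraph hψ) ha hl hd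
    (mem_ball_self (by linarith)) hx ?_ hy
  rw [mem_ball, dist_comm]
  linarith

/-- Moving up from a point above the graph stays above the graph, with room to spare. -/
lemma lt_snd_add (hψ : LipschitzWith M ψ) {x v : Amb n} (hx : ψ (A x).fst ≤ (A x).snd) {s : ℝ}
    (hs : 0 < s) (hv : ‖v‖ < 1) :
    ψ (A (x + s • upVec A + (1 / (1 + M) * s) • v)).fst <
      (A (x + s • upVec A + (1 / (1 + M) * s) • v)).snd := by
  set y := x + s • upVec A
  set c : ℝ := 1 / (1 + M)
  have hM : (0 : ℝ) ≤ M := M.2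
  have hc : 0 < c := by positivity
  have h1 : dist (y + (c * s) • v) y = c * s * ‖v‖ := by
    rw [dist_eq_norm, add_sub_cancel_left, norm_smul, Real.norm_of_nonneg (by positivity)]
  have h2 := (dist_fst_le A (y + (c * s) • v) y)
  have h3 := abs_le.1 (abs_snd_sub_le A (y + (c * s) • v) y)
  rw [h1] at h2 h3
  have h4 := hψ.dist_le_mul (A (y + (c * s) • v)).fst (A y).fst
  rw [Real.dist_eq] at h4
  have h5 := abs_le.1 h4
  have h6 : (A y).fst = (A x).fst := fst_add_smul_upVec A x s
  have h7 : (A y).snd = (A x).snd + s := snd_add_smul_upVec A x s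
  have h8 : (M : ℝ) * dist (A (y + (c * s) • v)).fst (A y).fst ≤ M * (c * s * ‖v‖) := by gcongr
  have h9 : c * s * ‖v‖ * (1 + M) < s := by
    have : c * (1 + M) = 1 := by simp only [c]; field_simp
    calc c * s * ‖v‖ * (1 + M) = c * (1 + M) * s * ‖v‖ := by ring
      _ = s * ‖v‖ := by rw [this, one_mul]
      _ < s := mul_lt_of_lt_one_right hs hv
  rw [h6] at h5 h8
  linarith

lemma isTransversal_epigraph (hψ : LipschitzWith M ψ) {s₀ : ℝ} (hs₀ : 0 < s₀) :
    IsTransversal (epigraph A ψ) (fun _ => upVec A) (1 / (1 + M)) 1 s₀ := by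
  have hM : (0 : ℝ) ≤ M := M.2
  refine ⟨by positivity, (div_le_one (by positivity)).2 (by linarith), hs₀, contDiff_const,
    fun _ => (norm_upVec A).le, fun x y => ?_, fun x hx s hs _ v hv => ?_⟩
  · rw [sub_self, norm_zero, mul_zero]
    positivity
  · have hx' : ψ (A x).fst ≤ (A x).snd := closure_lt_subset_le
      (hψ.continuous.comp (continuous_fst_coord A)) (continuous_snd_coord A) hx
    exact lt_snd_add hψ hx' hs hv

end GraphDomain

/-- The geometric properties of a Lipschitz domain with bounded boundary that are used below. -/
structure BoundedGeometry (Ω : Set (Amb n)) (c L B : ℝ) (C₁ C₂ C₃ : ℝ≥0) (e : Amb n → Amb n)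
    (s₀ : ℝ) : Prop where
  transversal : IsTransversal Ω e c L s₀
  upper : UpperRegular Ω C₁
  lower : LowerRegular Ω C₂ (16 * B * s₀)
  gradControls : GradControls Ω C₃
  dist_le : ∀ x ∈ frontier Ω, ∀ y ∈ frontier Ω, dist x y ≤ B * s₀

lemma ball_subset_of_infDist_lt {Ω : Set (Amb n)} {x y : Amb n} (hx : x ∈ Ω)
    (h : dist y x < infDist x (frontier Ω)) : y ∈ Ω := ball_infDist_frontier_subset hx h

/-- The transversal field of a family of charts. -/
lemma isTransversal_of_charts {Ω : Set (Amb n)} {N : ℕ} {M : ℝ≥0} {r c₀ s₀ Lχ : ℝ}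
    (hc₀ : 1 ≤ c₀) (hr : 0 < r) {z : Fin N → Amb n} {ρ : Fin N → ℝ}
    (hρ : ∀ j, 1 / c₀ * r < ρ j) (hcov : frontier Ω ⊆ ⋃ j, ball (z j) (ρ j))
    (hF : (frontier Ω).Nonempty) {A : Fin N → Coord n} {ψ : Fin N → EuclideanSpace ℝ (Fin n) → ℝ}
    (H : ∀ j, LocalGraph Ω M (A j) (ψ j) (z j) (ρ j)) {χ : Amb n → ℝ} (hχ : ContDiff ℝ ∞ χ)
    (hχ0 : ∀ x, 0 ≤ χ x) (hχ1 : ∀ x, χ x ≤ 1) (hχone : ∀ x, ‖x‖ ≤ 5 / 4 → χ x = 1)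
    (hχzero : ∀ x, 3 / 2 ≤ ‖x‖ → χ x = 0) (hχl : ∀ x y, |χ x - χ y| ≤ Lχ * ‖x - y‖) (hLχ : 0 ≤ Lχ)
    (hs₀ : 0 < s₀) (hs₁ : 8 * (N + 1) * s₀ ≤ 1 / c₀ * r) (hs₂ : 2 * N * Lχ * s₀ ≤ 1 / c₀ * r) :
    IsTransversal Ω (fun x => ∑ j, χ ((ρ j)⁻¹ • (x - z j)) • upVec (A j)) (1 / (1 + M)) N s₀ := by
  have hM : (0 : ℝ) ≤ M := M.2
  have hρ0 : ∀ j, 0 < ρ j := fun j => lt_trans (by positivity) (hρ j)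
  set X : Fin N → Amb n → ℝ := fun j x => χ ((ρ j)⁻¹ • (x - z j))
  have hX0 : ∀ j x, 0 ≤ X j x := fun j x => hχ0 _
  have hX1 : ∀ j x, X j x ≤ 1 := fun j x => hχ1 _
  have hnorm : ∀ j x, ‖(ρ j)⁻¹ • (x - z j)‖ = dist x (z j) / ρ j := fun j x => by
    rw [norm_smul, norm_inv, Real.norm_of_nonneg (hρ0 j).le, dist_eq_norm, inv_mul_eq_div]
  have hXsupp : ∀ j x, X j x ≠ 0 → dist x (z j) < 3 / 2 * ρ j := fun j x h => by
    by_contra hcon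
    refine h (hχzero _ ?_)
    rw [hnorm, le_div_iff₀ (hρ0 j)]
    exact not_lt.1 hcon
  have hXone : ∀ j x, dist x (z j) ≤ 5 / 4 * ρ j → X j x = 1 := fun j x h => by
    refine hχone _ ?_
    rwa [hnorm, div_le_iff₀ (hρ0 j)]
  have hsumle : ∀ (T : Finset (Fin N)) x, ‖∑ j ∈ T, X j x • upVec (A j)‖ ≤ N := fun T x => by
    refine (norm_sum_le _ _).trans ?_
    calc ∑ j ∈ T, ‖X j x • upVec (A j)‖ ≤ ∑ _j ∈ T, (1 : ℝ) := by
          refine Finset.sum_le_sum fun j _ => ?_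
          rw [norm_smul, norm_upVec, mul_one, Real.norm_of_nonneg (hX0 j x)]
          exact hX1 j x
      _ ≤ N := by
          rw [Finset.sum_const, nsmul_eq_mul, mul_one]
          exact_mod_cast (Finset.card_le_univ T).trans_eq (Fintype.card_fin N)
  set c : ℝ := 1 / (1 + M)
  have hc : 0 < c := by positivity
  have hc1 : c ≤ 1 := (div_le_one (by positivity)).2 (by linarith)
  -- First for points of `Ω` itself. All displacements are at most `(N+1) s₀`, an eighth of the
  -- smallest chart radius, so they stay inside the cylinders involved.
  have hinner : ∀ x ∈ Ω, ∀ s, 0 < s → s ≤ s₀ → ∀ v : Amb n, ‖v‖ < 1 →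
      x + s • (∑ j, X j x • upVec (A j)) + (c * s) • v ∈ Ω := by
    intro x hx s hs hs' v hv
    have hmove : ∀ T : Finset (Fin N), ∀ w : Amb n, ‖w‖ ≤ 1 →
        dist (x + s • (∑ j ∈ T, X j x • upVec (A j)) + (c * s) • w) x ≤ (N + 1) * s₀ := fun T w hw => by
      rw [dist_eq_norm, add_assoc, add_sub_cancel_left]
      refine (norm_add_le _ _).trans ?_
      rw [norm_smul, norm_smul, Real.norm_of_nonneg hs.le, Real.norm_of_nonneg (by positivity)]
      have h1 := mul_le_mul hs' (hsumle T x) (norm_nonneg _) hs₀.le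
      have h2 : c * s * ‖w‖ ≤ 1 * s₀ * 1 := by gcongr
      linarith
    have hmove0 : ∀ T : Finset (Fin N),
        dist (x + s • (∑ j ∈ T, X j x • upVec (A j))) x ≤ (N + 1) * s₀ := fun T => by
      have := hmove T 0 (by simp)
      rwa [smul_zero, add_zero] at this
    have hN1 : (0 : ℝ) ≤ (N + 1) * s₀ := by positivity
    rcases lt_or_ge ((N + 1) * s₀) (infDist x (frontier Ω)) with hfar | hnear
    · exact ball_subset_of_infDist_lt hx ((hmove _ v hv.le).trans_lt hfar)
    obtain ⟨p, hp, hxp⟩ := (infDist_lt_iff hF (r := 2 * ((N + 1) * s₀))).1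
      (hnear.trans_lt (by nlinarith [(by positivity : (0 : ℝ) < (N + 1) * s₀)]))
    obtain ⟨k, hk⟩ := mem_iUnion.1 (hcov hp)
    rw [mem_ball] at hk
    have hxk : dist x (z k) ≤ 5 / 4 * ρ k := by
      have := hρ k
      nlinarith [dist_triangle x p (z k)]
    -- Add the summands of the field one at a time: each active one moves straight up in its own
    -- chart, which cannot leave `Ω`.
    have hstep : ∀ T : Finset (Fin N), x + s • (∑ j ∈ T, X j x • upVec (A j)) ∈ Ω := by
      intro T
      induction T using Finset.induction_on with
      | empty => simpa using hx
      | insert j T hj ih =>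
        have e : x + s • (∑ i ∈ insert j T, X i x • upVec (A i)) =
            (x + s • (∑ i ∈ T, X i x • upVec (A i))) + (s * X j x) • upVec (A j) := by
          rw [Finset.sum_insert hj, smul_add, smul_smul]
          abel
        by_cases hXj : X j x = 0
        · rw [e, hXj, mul_zero, zero_smul, add_zero]
          exact ih
        have h1 := hXsupp j x hXj
        have h2 := hρ j
        have hb1 : x + s • (∑ i ∈ T, X i x • upVec (A i)) ∈ ball (z j) (2 * ρ j) := by
          rw [mem_ball]
          nlinarith [dist_triangle (x + s • (∑ i ∈ T, X i x • upVec (A i))) x (z j), hmove0 T]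
        have hb2 : x + s • (∑ i ∈ insert j T, X i x • upVec (A i)) ∈ ball (z j) (2 * ρ j) := by
          rw [mem_ball]
          nlinarith [dist_triangle (x + s • (∑ i ∈ insert j T, X i x • upVec (A i))) x (z j),
            hmove0 (insert j T)]
        have hc1 := LocalGraph.coord_lt (A j) M hb1
        have hc2 := LocalGraph.coord_lt (A j) M hb2
        rw [(H j).iff _ hc2.1 hc2.2, e, fst_add_smul_upVec, snd_add_smul_upVec]
        have := ((H j).iff _ hc1.1 hc1.2).1 ih
        have h3 : 0 ≤ s * X j x := mul_nonneg hs.le (hX0 j x)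
        linarith
    -- The chart `k` with full weight is kept for last; its step of length `s` provides the room for
    -- the ball of radius `c s`.
    have hy := hstep (Finset.univ.erase k)
    set y := x + s • (∑ j ∈ Finset.univ.erase k, X j x • upVec (A j))
    have e : x + s • (∑ j, X j x • upVec (A j)) + (c * s) • v = y + s • upVec (A k) + (c * s) • v := by
      rw [← Finset.add_sum_erase _ _ (Finset.mem_univ k), hXone k x hxk, one_smul, smul_add]
      simp only [y]
      abel
    have h2 := hρ k
    have hb1 : y ∈ ball (z k) (2 * ρ k) := by
      rw [mem_ball]
      nlinarith [dist_triangle y x (z k), hmove0 (Finset.univ.erase k)]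
    have hb2 : y + s • upVec (A k) + (c * s) • v ∈ ball (z k) (2 * ρ k) := by
      rw [← e, mem_ball]
      nlinarith [dist_triangle (x + s • (∑ j, X j x • upVec (A j)) + (c * s) • v) x (z k),
        hmove Finset.univ v hv.le]
    have hc1 := LocalGraph.coord_lt (A k) M hb1
    have hc2 := LocalGraph.coord_lt (A k) M hb2
    rw [e, (H k).iff _ hc2.1 hc2.2]
    exact lt_snd_add (H k).lip (((H k).iff _ hc1.1 hc1.2).1 hy).le hs hv
  have hsm : ContDiff ℝ ∞ fun x => ∑ j, X j x • upVec (A j) := by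
    refine ContDiff.sum fun j _ => ContDiff.fun_smul (f := X j) ?_ contDiff_const
    exact hχ.comp ((contDiff_id.sub contDiff_const).const_smul _)
  refine ⟨hc, hc1, hs₀, hsm, hsumle Finset.univ, fun x y => ?_, fun x hx s hs hs' v hv => ?_⟩
  · rw [← Finset.sum_sub_distrib]
    have h1 : ‖∑ j, (X j x • upVec (A j) - X j y • upVec (A j))‖ ≤
        ∑ _j : Fin N, Lχ * (c₀ / r) * ‖x - y‖ := by
      refine norm_sum_le_of_le _ fun j _ => ?_
      rw [← sub_smul, norm_smul, norm_upVec, mul_one, Real.norm_eq_abs]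
      refine (hχl _ _).trans ?_
      rw [← smul_sub, sub_sub_sub_cancel_right, norm_smul, norm_inv,
        Real.norm_of_nonneg (hρ0 j).le, mul_assoc]
      refine mul_le_mul_of_nonneg_left (mul_le_mul_of_nonneg_right ?_ (norm_nonneg _)) hLχ
      rw [show c₀ / r = (1 / c₀ * r)⁻¹ by field_simp]
      exact inv_anti₀ (by positivity) (hρ j).le
    rw [Finset.sum_const, Finset.card_univ, Fintype.card_fin, nsmul_eq_mul] at h1
    calc s₀ * _ ≤ s₀ * (N * (Lχ * (c₀ / r) * ‖x - y‖)) := mul_le_mul_of_nonneg_left h1 hs₀.le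
      _ = (2 * N * Lχ * s₀) * (c₀ / r * ‖x - y‖) / 2 := by ring
      _ ≤ (1 / c₀ * r) * (c₀ / r * ‖x - y‖) / 2 := by gcongr
      _ = ‖x - y‖ / 2 := by field_simp
  · obtain ⟨a, ha, hax⟩ := mem_closure_iff_seq_limit.1 hx
    set E : Amb n → Amb n := fun x => x + s • (∑ j, X j x • upVec (A j))
    have hEc : Continuous E := continuous_id.add (hsm.continuous.const_smul s)
    -- Passage to the closure: approximate `x` from `Ω` and absorb the displacement error into `v`,
    -- which stays in the open unit ball.
    have hlim : Tendsto (fun k => v + (c * s)⁻¹ • (E x - E (a k))) atTop (𝓝 v) := by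
      have h1 := (tendsto_const_nhds (x := E x)).sub ((hEc.tendsto x).comp hax)
      have h2 := (h1.const_smul (c * s)⁻¹).const_add v
      rw [sub_self, smul_zero, add_zero] at h2
      exact h2
    obtain ⟨k, hk⟩ := (hlim.norm.eventually_lt_const hv).exists
    have := hinner (a k) (ha k) s hs hs' _ hk
    rw [smul_add, smul_smul, mul_inv_cancel₀ (by positivity), one_smul] at this
    convert this using 1
    simp only [E]
    abel

/-- Up to constants `r` is the only length: every chart radius lies between `r/c₀` and `c₀ r`, and
`s₀` is a fixed fraction of `r`. Estimates within one chart are local; connectedness of the frontier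
turns them into global ones through the sum of the chart diameters. -/
lemma exists_boundedGeometry (n : ℕ) (M : ℝ≥0) (N : ℕ) (c₀ : ℝ) :
    ∃ (L B : ℝ) (C₁ C₂ C₃ : ℝ≥0), 0 ≤ L ∧ 0 < B ∧ 0 < C₂ ∧ ∀ Ω : Set (Amb n), IsOpen Ω →
    IsConnected (frontier Ω) → 1 ≤ c₀ → ∀ r : ℝ, 0 < r → ∀ (z : Fin N → Amb n) (ρ : Fin N → ℝ),
      (∀ j, z j ∈ frontier Ω ∧ 1 / c₀ * r < ρ j ∧ ρ j < c₀ * r) →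
      frontier Ω ⊆ ⋃ j, ball (z j) (ρ j) →
      (∀ j, ∃ (A : Coord n) (ψ : EuclideanSpace ℝ (Fin n) → ℝ),
          LipschitzWith M ψ ∧ z j ∈ frontier (epigraph A ψ) ∧
          cylinder A (z j) (2 * ρ j) ((8 + 8 * M) * ρ j) ∩ Ω =
            cylinder A (z j) (2 * ρ j) ((8 + 8 * M) * ρ j) ∩ epigraph A ψ) →
      ∃ (e : Amb n → Amb n) (s₀ : ℝ), BoundedGeometry Ω (1 / (1 + M)) L B C₁ C₂ C₃ e s₀ := by
  let χ : ContDiffBump (0 : Amb n) := ⟨5 / 4, 3 / 2, by norm_num, by norm_num⟩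
  have hχs : ContDiff ℝ ∞ χ := χ.contDiff
  obtain ⟨Kχ, hKχ⟩ := (χ.contDiff (n := 1)).lipschitzWith_of_hasCompactSupport
    χ.hasCompactSupport one_ne_zero
  obtain ⟨Lχ, hLχdef⟩ : ∃ Lχ : ℝ, Lχ = (Kχ : ℝ) := ⟨_, rfl⟩
  have hLχ : 0 ≤ Lχ := hLχdef ▸ Kχ.2
  -- With `Q s₀ = r/c₀` both smallness conditions of `isTransversal_of_charts` hold.
  set Q : ℝ := 8 * (N + 1) + 2 * N * Lχ
  have hQ : 0 < Q := by positivity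
  set B : ℝ := 2 * N * c₀ ^ 2 * Q + 1
  have hB : 0 < B := by positivity
  -- Radii up to `16 B s₀` may exceed the chart size; dividing by `T` brings them below `r/c₀`, and
  -- the lower regularity constant pays `T^n`.
  set T : ℝ := 16 * B / Q + 1
  have hT : 1 ≤ T := le_add_of_nonneg_left (by positivity)
  set C₃ : ℝ≥0 := (1 + M) * (1 + 2 * N * (c₀ ^ 2).toNNReal)
  refine ⟨N, B, Fintype.card (Fin N) * ((1 + M) ^ n * volBall n),
    volBall n / (1 + M) ^ n / T.toNNReal ^ n, C₃, by positivity, hB, ?_, ?_⟩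
  · have := volBall_pos (n := n)
    have : 0 < T.toNNReal := Real.toNNReal_pos.2 (by linarith)
    positivity
  intro Ω hΩ hconn hc₀ r hr z ρ hz hcov hch
  choose A ψ hψ hzψ hcyl using hch
  have hM : (0 : ℝ) ≤ M := M.2
  have H : ∀ j, LocalGraph Ω M (A j) (ψ j) (z j) (ρ j) := fun j =>
    ⟨hψ j, snd_eq_of_mem_frontier_epigraph (hψ j) (hzψ j), fun x h1 h2 => by
      have hx : x ∈ cylinder (A j) (z j) (2 * ρ j) ((8 + 8 * M) * ρ j) :=
        ⟨h1, h2.trans_eq (by ring)⟩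
      have := Set.ext_iff.1 (hcyl j) x
      exact ⟨fun h => (this.1 ⟨hx, h⟩).2, fun h => (this.2 ⟨hx, h⟩).2⟩⟩
  set s₀ : ℝ := 1 / c₀ * r / Q
  have hs₀ : 0 < s₀ := by positivity
  have hs₀Q : Q * s₀ = 1 / c₀ * r := by simp only [s₀]; field_simp
  have hρ0 : ∀ j, 0 < ρ j := fun j => lt_trans (by positivity) (hz j).2.1
  have hsumρ : ∑ j, 2 * ρ j ≤ 2 * N * c₀ ^ 2 * (1 / c₀ * r) := by
    calc ∑ j, 2 * ρ j ≤ ∑ _j : Fin N, 2 * (c₀ * r) :=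
          Finset.sum_le_sum fun j _ => by linarith [(hz j).2.2]
      _ = 2 * N * c₀ ^ 2 * (1 / c₀ * r) := by
          rw [Finset.sum_const, Finset.card_univ, Fintype.card_fin, nsmul_eq_mul]
          field_simp
  have hclose : ∀ j, ∀ x ∈ frontier Ω ∩ ball (z j) (ρ j), ∀ y ∈ frontier Ω ∩ ball (z j) (ρ j),
      dist x y ≤ 2 * ρ j := fun j x hx y hy => by
    have h1 := mem_ball.1 hx.2
    have h2 := mem_ball.1 hy.2
    linarith [dist_triangle_right x y (z j)]
  refine ⟨_, s₀, ⟨isTransversal_of_charts hc₀ hr (fun j => (hz j).2.1) hcov hconn.nonempty H hχs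
    (fun x => χ.nonneg) (fun x => χ.le_one) (fun x hx => χ.one_of_mem_closedBall
      (mem_closedBall_zero_iff.2 hx)) (fun x hx => χ.zero_of_le_dist (by rwa [dist_zero_right]))
    (fun x y => ?_) hLχ hs₀ ?_ ?_, ?_, ?_, ?_, ?_⟩⟩
  · have := hKχ.dist_le_mul x y
    rwa [Real.dist_eq, dist_eq_norm, ← hLχdef] at this
  · rw [← hs₀Q]
    refine mul_le_mul_of_nonneg_right ?_ hs₀.le
    have : 0 ≤ 2 * (N : ℝ) * Lχ := by positivity
    linarith
  · rw [← hs₀Q]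
    refine mul_le_mul_of_nonneg_right ?_ hs₀.le
    have : 0 ≤ 8 * ((N : ℝ) + 1) := by positivity
    linarith
  · refine upperRegular_of_cover (A := A) hψ fun x hx => ?_
    obtain ⟨j, hj⟩ := mem_iUnion.1 (hcov hx)
    exact mem_iUnion.2 ⟨j, (H j).snd_eq hΩ (ball_subset_ball (by linarith [hρ0 j]) hj) hx⟩
  · intro x hx s hs hs'
    obtain ⟨j, hj⟩ := mem_iUnion.1 (hcov hx)
    have hT0 : 0 < T := by linarith
    have h1 : s / T ≤ ρ j := by
      refine le_trans ?_ (hz j).2.1.le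
      rw [← hs₀Q, div_le_iff₀ hT0]
      refine hs'.trans ?_
      have : Q * s₀ * T = 16 * B * s₀ + Q * s₀ := by simp only [T]; field_simp
      rw [this]
      nlinarith
    have h2 := (H j).measure_ball_ge hΩ hj hx (s := s / T) (by positivity) h1
    refine le_trans (le_of_eq ?_) (h2.trans (measure_mono (ball_subset_ball (div_le_self hs.le hT))))
    rw [div_pow, ENNReal.ofReal_div_of_pos (by positivity),
      ENNReal.coe_div (pow_ne_zero _ (Real.toNNReal_pos.2 hT0).ne'), ENNReal.mul_comm_div,
      show ENNReal.ofReal (T ^ n) = ((T.toNNReal ^ n : ℝ≥0) : ℝ≥0∞) by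
        rw [ENNReal.ofReal_pow hT0.le]; push_cast; rfl]
  · intro a ha l hl hd x hx y hy
    obtain ⟨j, hj⟩ := mem_iUnion.1 (hcov hx)
    have hC : (C₃ : ℝ) = (1 + M) * (1 + 2 * N * c₀ ^ 2) := by
      simp only [C₃]
      push_cast
      rw [Real.coe_toNNReal _ (by positivity)]
    have hdxy := dist_nonneg (x := x) (y := y)
    have hnn : 0 ≤ 2 * (N : ℝ) * c₀ ^ 2 := by positivity
    rw [hC]
    -- Close points share a chart. For distant points the increment is at most the sum over all
    -- charts, which is comparable to `r` and hence to their distance.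
    rcases lt_or_ge (dist x y) (1 / c₀ * r) with hlt | hge
    · refine ((H j).norm_sub_le hΩ ha hl hd (ball_subset_ball (by linarith [hρ0 j]) hj) hx ?_ hy).trans ?_
      · rw [mem_ball] at hj ⊢
        have := (hz j).2.1
        rw [dist_comm] at hlt
        linarith [dist_triangle y x (z j)]
      · have : 0 ≤ (1 + (M : ℝ)) * l * dist x y := by positivity
        nlinarith
    · have hcont : ContinuousOn a (frontier Ω) := fun w hw => by
        obtain ⟨K, hK⟩ := ha (‖w‖ + 1)
        have h1 := hK.continuousOn w ⟨hw, by rw [mem_ball_zero_iff]; linarith⟩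
        refine h1.mono_of_mem_nhdsWithin (inter_mem_nhdsWithin _
          (isOpen_ball.mem_nhds ?_))
        rw [mem_ball_zero_iff]; linarith
      have h1 := abs_sub_le_sum_of_isPreconnected hconn.isPreconnected hcov (g := fun w => ‖a w - a y‖)
        (hcont.sub continuousOn_const).norm (d := fun j => (1 + M) * l * (2 * ρ j))
        (fun j => by have := hρ0 j; positivity) (fun j w hw w' hw' => by
          refine (abs_norm_sub_norm_le _ _).trans ?_
          rw [sub_sub_sub_cancel_right]
          have hsub : ball (z j) (ρ j) ⊆ ball (z j) (2 * ρ j) :=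
            ball_subset_ball (by linarith [hρ0 j])
          refine ((H j).norm_sub_le hΩ ha hl hd (hsub hw.2) hw.1 (hsub hw'.2) hw'.1).trans ?_
          exact mul_le_mul_of_nonneg_left (hclose j w hw w' hw') (by positivity)) hx hy
      rw [sub_self, norm_zero, sub_zero, abs_norm, ← Finset.mul_sum] at h1
      refine h1.trans ?_
      have h3 : ∑ j, 2 * ρ j ≤ (1 + 2 * N * c₀ ^ 2) * dist x y := by
        refine hsumρ.trans ?_
        nlinarith [mul_le_mul_of_nonneg_left hge hnn]
      calc _ ≤ (1 + M) * l * ((1 + 2 * N * c₀ ^ 2) * dist x y) :=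
            mul_le_mul_of_nonneg_left h3 (by positivity)
        _ = _ := by ring
  · intro x hx y hy
    have h1 := abs_sub_le_sum_of_isPreconnected hconn.isPreconnected hcov (g := fun w => dist w y)
      (continuous_id.dist continuous_const).continuousOn (d := fun j => 2 * ρ j)
      (fun j => by have := hρ0 j; positivity)
      (fun j w hw w' hw' => (abs_dist_sub_le w w' y).trans (hclose j w hw w' hw')) hx hy
    rw [dist_self, sub_zero, abs_of_nonneg dist_nonneg] at h1
    refine h1.trans (hsumρ.trans ?_)
    rw [← hs₀Q]
    simp only [B]
    nlinarith


/-! ### Integrals of powers of the distance over the boundary -/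

/-- A constant for sums of geometric series arising from dyadic annuli. -/
def geomConst (a β : ℝ) : ℝ := 2 ^ a * (1 - 2 ^ (-β))⁻¹

lemma geomConst_nonneg (a : ℝ) {β : ℝ} (hβ : 0 < β) : 0 ≤ geomConst a β := by
  have : (2 : ℝ) ^ (-β) < 1 := Real.rpow_lt_one_of_one_lt_of_neg one_lt_two (by linarith)
  exact mul_nonneg (by positivity) (inv_nonneg.2 (by linarith))

lemma tsum_geom_le {x : ℝ} (hx : 0 ≤ x) (a : ℝ) {β : ℝ} (hβ : 0 < β) :
    ∑' k : ℕ, ENNReal.ofReal (2 ^ a * x * ((2 : ℝ) ^ (-β)) ^ k) =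
      ENNReal.ofReal (geomConst a β * x) := by
  have h1 : (2 : ℝ) ^ (-β) < 1 := Real.rpow_lt_one_of_one_lt_of_neg one_lt_two (by linarith)
  rw [← ENNReal.ofReal_tsum_of_nonneg (fun k => by positivity)
    ((summable_geometric_of_lt_one (by positivity) h1).mul_left _), tsum_mul_left,
    tsum_geometric_of_lt_one (by positivity) h1, geomConst]
  congr 1
  ring

section Powers

variable {Ω : Set (Amb n)} {C : ℝ≥0}

/-- Sum over dyadic annuli shrinking to `p`; the series is geometric because `γ < n`. -/
lemma UpperRegular.lintegral_ball_rpow_le (hσ : UpperRegular Ω C) {γ : ℝ} (hγ : 0 < γ)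
    (hγn : γ < n) (p : Amb n) {r : ℝ} (hr : 0 < r) :
    ∫⁻ x in ball p r, ENNReal.ofReal (dist x p ^ (-γ)) ∂(surfaceMeasure Ω) ≤
      C * ENNReal.ofReal (geomConst γ (n - γ) * r ^ (n - γ)) := by
  have hpt : ∀ x ∈ ball p r, ENNReal.ofReal (dist x p ^ (-γ)) ≤
      ∑' k : ℕ, (ball p (r * (2 : ℝ)⁻¹ ^ k)).indicator
        (fun _ => ENNReal.ofReal ((r * (2 : ℝ)⁻¹ ^ (k + 1)) ^ (-γ))) x := fun x hx => by
    rcases (dist_nonneg (x := x) (y := p)).eq_or_lt with h0 | h0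
    -- At the centre the negative power takes the default value `0`, so nothing is needed there.
    · rw [← h0, Real.zero_rpow (by linarith), ENNReal.ofReal_zero]
      exact zero_le
    obtain ⟨k, hk1, hk2⟩ := exists_nat_pow_near_of_lt_one (x := dist x p / r) (y := (2 : ℝ)⁻¹)
      (by positivity) ((div_le_one hr).2 (mem_ball.1 hx).le) (by norm_num) (by norm_num)
    by_cases hlt : dist x p / r < (2 : ℝ)⁻¹ ^ k
    · refine le_trans ?_ (ENNReal.le_tsum k)
      rw [lt_div_iff₀ hr] at hk1
      rw [div_lt_iff₀ hr] at hlt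
      rw [indicator_of_mem (by rw [mem_ball]; linarith)]
      refine ENNReal.ofReal_le_ofReal (Real.rpow_le_rpow_of_nonpos (by positivity) ?_ (by linarith))
      linarith
    -- The balls are open, so a point exactly on a dyadic sphere is assigned to the next larger
    -- ball, whose constant equals the required value.
    · have heq : dist x p / r = (2 : ℝ)⁻¹ ^ k := le_antisymm hk2 (not_lt.1 hlt)
      have hk0 : k ≠ 0 := by
        rintro rfl
        rw [pow_zero, div_eq_one_iff_eq hr.ne'] at heq
        exact (mem_ball.1 hx).ne heq
      obtain ⟨m, rfl⟩ := Nat.exists_eq_succ_of_ne_zero hk0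
      refine le_trans ?_ (ENNReal.le_tsum m)
      rw [div_eq_iff hr.ne'] at heq
      rw [indicator_of_mem (by
        rw [mem_ball, heq, mul_comm]
        refine mul_lt_mul_of_pos_left ?_ hr
        exact pow_lt_pow_right_of_lt_one₀ (by norm_num) (by norm_num) (Nat.lt_succ_self m))]
      rw [heq, mul_comm]
  refine (setLIntegral_mono' measurableSet_ball hpt).trans ((setLIntegral_le_lintegral _ _).trans ?_)
  rw [lintegral_tsum fun k => (measurable_const.indicator measurableSet_ball).aemeasurable,
    ← tsum_geom_le (by positivity) γ (by linarith : 0 < (n : ℝ) - γ), ← ENNReal.tsum_mul_left]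
  refine ENNReal.tsum_le_tsum fun k => ?_
  rw [lintegral_indicator measurableSet_ball, setLIntegral_const]
  refine (mul_le_mul' le_rfl (hσ p _ (by positivity))).trans (le_of_eq ?_)
  rw [mul_left_comm, ← ENNReal.ofReal_mul (by positivity)]
  congr 2
  have e1 : ∀ j : ℕ, (2 : ℝ)⁻¹ ^ j = 2 ^ (-(j : ℝ)) := fun j => by
    rw [Real.rpow_neg zero_le_two, Real.rpow_natCast, inv_pow]
  rw [e1, e1, Real.mul_rpow hr.le (by positivity), mul_pow, Real.rpow_sub hr, Real.rpow_neg hr.le,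
    ← Real.rpow_natCast ((2 : ℝ) ^ (-(k : ℝ))) n, ← Real.rpow_natCast ((2 : ℝ) ^ (-(n - γ))) k,
    ← Real.rpow_mul zero_le_two, ← Real.rpow_mul zero_le_two, ← Real.rpow_mul zero_le_two,
    Real.rpow_natCast r, Nat.cast_succ,
    show -((k : ℝ) + 1) * -γ = γ + k * γ by ring,
    show -(n - γ) * (k : ℝ) = k * γ + -k * n by ring, Real.rpow_add two_pos, Real.rpow_add two_pos]
  ring

/-- Sum over dyadic annuli growing from `p`; geometric because `γ > N`. Stated for a general measure
so that it serves both surface and Lebesgue measure. -/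
lemma lintegral_compl_ball_rpow_le {μ : Measure (Amb n)} {N : ℕ} {p : Amb n}
    (hμ : ∀ r, 0 < r → μ (ball p r) ≤ C * ENNReal.ofReal (r ^ N)) {γ : ℝ}
    (hγn : (N : ℝ) < γ) {r : ℝ} (hr : 0 < r) :
    ∫⁻ x in (ball p r)ᶜ, ENNReal.ofReal (dist x p ^ (-γ)) ∂μ ≤
      C * ENNReal.ofReal (geomConst N (γ - N) * r ^ (N - γ)) := by
  have hγ : 0 < γ := lt_of_le_of_lt (Nat.cast_nonneg N) hγn
  have hpt : ∀ x ∈ (ball p r)ᶜ, ENNReal.ofReal (dist x p ^ (-γ)) ≤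
      ∑' k : ℕ, (ball p (r * (2 : ℝ) ^ (k + 1))).indicator
        (fun _ => ENNReal.ofReal ((r * (2 : ℝ) ^ k) ^ (-γ))) x := fun x hx => by
    have hx' : r ≤ dist x p := not_lt.1 hx
    obtain ⟨k, hk1, hk2⟩ := exists_nat_pow_near (x := dist x p / r) (y := (2 : ℝ))
      ((one_le_div hr).2 hx') (by norm_num)
    refine le_trans ?_ (ENNReal.le_tsum k)
    rw [le_div_iff₀ hr] at hk1
    rw [div_lt_iff₀ hr] at hk2
    rw [indicator_of_mem (by rw [mem_ball]; linarith)]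
    refine ENNReal.ofReal_le_ofReal (Real.rpow_le_rpow_of_nonpos (by positivity) ?_ (by linarith))
    linarith
  refine (setLIntegral_mono' measurableSet_ball.compl hpt).trans
    ((setLIntegral_le_lintegral _ _).trans ?_)
  rw [lintegral_tsum fun k => (measurable_const.indicator measurableSet_ball).aemeasurable,
    ← tsum_geom_le (by positivity) N (by linarith : 0 < γ - (N : ℝ)), ← ENNReal.tsum_mul_left]
  refine ENNReal.tsum_le_tsum fun k => ?_
  rw [lintegral_indicator measurableSet_ball, setLIntegral_const]
  refine (mul_le_mul' le_rfl (hμ _ (by positivity))).trans (le_of_eq ?_)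
  rw [mul_left_comm, ← ENNReal.ofReal_mul (by positivity)]
  congr 2
  rw [pow_succ, Real.mul_rpow hr.le (by positivity), mul_pow, mul_pow, Real.rpow_sub hr,
    Real.rpow_neg hr.le, Real.rpow_natCast, Real.rpow_natCast,
    ← Real.rpow_natCast (2 ^ (-(γ - N)) : ℝ) k, ← Real.rpow_mul zero_le_two, ← Real.rpow_natCast _ k,
    ← Real.rpow_mul zero_le_two, ← Real.rpow_natCast (2 ^ (k : ℝ) : ℝ) N,
    ← Real.rpow_mul zero_le_two,
    show -(γ - N) * k = k * -γ + k * (N : ℝ) by ring, Real.rpow_add two_pos]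
  ring

lemma UpperRegular.lintegral_compl_ball_rpow_le (hσ : UpperRegular Ω C) {γ : ℝ}
    (hγn : (n : ℝ) < γ) (p : Amb n) {r : ℝ} (hr : 0 < r) :
    ∫⁻ x in (ball p r)ᶜ, ENNReal.ofReal (dist x p ^ (-γ)) ∂(surfaceMeasure Ω) ≤
      C * ENNReal.ofReal (geomConst n (γ - n) * r ^ (n - γ)) :=
  AvTrace.lintegral_compl_ball_rpow_le (hσ p) hγn hr

end Powers

/-! ### The double integral of an atom -/

section AtomToSlobodeckij

variable {Ω : Set (Amb n)} {θ : ℝ} {C C₃ : ℝ≥0}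

/-- A bound for the double integral of an atom. -/
def atomConst (n : ℕ) (θ : ℝ) (C C₃ : ℝ≥0) : ℝ≥0∞ :=
  2 * (C * C) * ENNReal.ofReal (C₃ * geomConst (n + θ - 1) (1 - θ) + 2 * geomConst n θ)

lemma enorm_div_edist {z : ℂ} {x y : Amb n} {β : ℝ} (h : x ≠ y) :
    ‖z‖ₑ / edist x y ^ β = ENNReal.ofReal (‖z‖ * dist x y ^ (-β)) := by
  have hd := dist_pos.2 h
  rw [edist_dist, ENNReal.ofReal_rpow_of_pos hd, ← ofReal_norm,
    ← ENNReal.ofReal_div_of_pos (by positivity), Real.rpow_neg hd.le, div_eq_mul_inv]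

lemma aemeasurable_slobodeckij {f : Amb n → ℂ} (hf : AEStronglyMeasurable f (surfaceMeasure Ω))
    [SFinite (surfaceMeasure Ω)] (β : ℝ) :
    AEMeasurable (fun p : Amb n × Amb n => ‖f p.2 - f p.1‖ₑ / edist p.2 p.1 ^ β)
      ((surfaceMeasure Ω).prod (surfaceMeasure Ω)) := by
  have h1 : AEMeasurable (fun p : Amb n × Amb n => ‖f p.2 - f p.1‖ₑ)
      ((surfaceMeasure Ω).prod (surfaceMeasure Ω)) := (hf.comp_snd.sub hf.comp_fst).enorm
  have h2 : Measurable fun p : Amb n × Amb n => edist p.2 p.1 ^ β :=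
    (measurable_snd.edist measurable_fst).pow_const β
  exact h1.div h2.aemeasurable

/-- At distance below `r` the Lipschitz bound leaves the singularity `|x-y|^(1-n-θ)`, integrable
since `θ < 1`; beyond `r` the sup bound suffices, since `θ > 0`. Each inner integral is at most a
multiple of `r^(-n)`, which the measure of the supporting ball cancels. -/
lemma slobodeckijNorm_atom_le (hn : 1 ≤ n) (hθ₀ : 0 < θ) (hθ₁ : θ < 1) (hσ : UpperRegular Ω C)
    (hgc : GradControls Ω C₃) {a : Amb n → ℂ} (ha : IsAtom θ Ω a) :
    slobodeckijNorm θ Ω a ≤ atomConst n θ C C₃ := by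
  have hloc := hσ.isLocallyFiniteMeasure
  have hn' : (1 : ℝ) ≤ n := by exact_mod_cast hn
  have hmeas := aemeasurable_slobodeckij ha.aestronglyMeasurable (n + θ)
  obtain ⟨x₀, hx₀, r, hr, hs, ⟨K, hK⟩, hb, hg⟩ := ha
  have hlip := hgc a (fun R => ⟨K, hK.mono inter_subset_left⟩) (r ^ (θ - 1 - n)) (by positivity) hg
  set σ := surfaceMeasure Ω
  set F : Amb n → Amb n → ℝ≥0∞ := fun y x => ‖a x - a y‖ₑ / edist x y ^ (n + θ : ℝ)
  have hsupp : ∀ x, x ∉ ball x₀ r → a x = 0 := fun x hx =>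
    image_eq_zero_of_notMem_tsupport fun h => hx (hs h).1
  have hsymm : ∀ x y, F y x = F x y := fun x y => by
    simp only [F]
    rw [edist_comm, ← enorm_neg, neg_sub]
  set Q : ℝ := C₃ * geomConst (n + θ - 1) (1 - θ) + 2 * geomConst n θ
  have hinner : ∀ᵐ y ∂σ, ∫⁻ x, F y x ∂σ ≤ C * ENNReal.ofReal (Q * r ^ (-(n : ℝ))) := by
    filter_upwards [hb, ae_mem_frontier Ω] with y hy hyF
    have hpt : ∀ᵐ x ∂σ, F y x ≤ (ball y r).indicator (fun x =>
        ENNReal.ofReal (C₃ * r ^ (θ - 1 - n)) * ENNReal.ofReal (dist x y ^ (-((n : ℝ) + θ - 1)))) x +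
        ((ball y r)ᶜ).indicator (fun x => ENNReal.ofReal (2 * r ^ (θ - n)) *
          ENNReal.ofReal (dist x y ^ (-((n : ℝ) + θ)))) x := by
      filter_upwards [hb, ae_mem_frontier Ω] with x hx hxF
      -- On the diagonal the integrand is `0 / 0`, which is `0` in the extended nonnegative reals.
      rcases eq_or_ne x y with rfl | hxy
      · have : F x x = 0 := by simp [F]
        rw [this]
        exact zero_le
      have hd := dist_pos.2 hxy
      simp only [F]
      rw [enorm_div_edist hxy]
      by_cases hxr : x ∈ ball y r
      · rw [indicator_of_mem hxr, indicator_of_notMem (show x ∉ (ball y r)ᶜ from not_not.2 hxr), add_zero,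
          ← ENNReal.ofReal_mul (by positivity)]
        refine ENNReal.ofReal_le_ofReal ?_
        calc ‖a x - a y‖ * dist x y ^ (-((n : ℝ) + θ))
            ≤ (C₃ * r ^ (θ - 1 - n) * dist x y) * dist x y ^ (-((n : ℝ) + θ)) := by
              gcongr
              exact hlip x hxF y hyF
          _ = C₃ * r ^ (θ - 1 - n) * (dist x y ^ (1 : ℝ) * dist x y ^ (-((n : ℝ) + θ))) := by
              rw [Real.rpow_one]; ring
          _ = _ := by
              rw [← Real.rpow_add hd]
              ring_nf
      · rw [indicator_of_notMem hxr, indicator_of_mem (show x ∈ (ball y r)ᶜ from hxr), zero_add,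
          ← ENNReal.ofReal_mul (by positivity)]
        refine ENNReal.ofReal_le_ofReal (mul_le_mul_of_nonneg_right ?_ (by positivity))
        linarith [norm_sub_le (a x) (a y)]
    have hmi : AEMeasurable ((ball y r).indicator (fun x =>
        ENNReal.ofReal (C₃ * r ^ (θ - 1 - n)) * ENNReal.ofReal (dist x y ^ (-((n : ℝ) + θ - 1))))) σ := by
      refine Measurable.aemeasurable (Measurable.indicator ?_ measurableSet_ball)
      fun_prop
    refine (lintegral_mono_ae hpt).trans ?_
    rw [lintegral_add_left' hmi, lintegral_indicator measurableSet_ball,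
      lintegral_indicator measurableSet_ball.compl, lintegral_const_mul' _ _ ENNReal.ofReal_ne_top,
      lintegral_const_mul' _ _ ENNReal.ofReal_ne_top]
    have h1 := hσ.lintegral_ball_rpow_le (γ := n + θ - 1) (by linarith) (by linarith) y hr
    have h2 := hσ.lintegral_compl_ball_rpow_le (γ := n + θ) (by linarith) y hr
    rw [show (n : ℝ) - (n + θ - 1) = 1 - θ by ring] at h1
    rw [show (n : ℝ) - (n + θ) = -θ by ring, show (n : ℝ) + θ - n = θ by ring] at h2
    refine (add_le_add (mul_le_mul' le_rfl h1) (mul_le_mul' le_rfl h2)).trans (le_of_eq ?_)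
    have g1 := geomConst_nonneg ((n : ℝ) + θ - 1) (β := 1 - θ) (by linarith)
    have g2 := geomConst_nonneg (n : ℝ) hθ₀
    rw [mul_left_comm, mul_left_comm (ENNReal.ofReal (2 * r ^ (θ - n))), ← mul_add,
      ← ENNReal.ofReal_mul (by positivity), ← ENNReal.ofReal_mul (by positivity),
      ← ENNReal.ofReal_add (by positivity) (by positivity)]
    congr 2
    have e1 : r ^ (θ - 1 - n) * r ^ (1 - θ) = r ^ (-(n : ℝ)) := by
      rw [← Real.rpow_add hr]; ring_nf
    have e2 : r ^ (θ - n) * r ^ (-θ) = r ^ (-(n : ℝ)) := by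
      rw [← Real.rpow_add hr]; ring_nf
    calc _ = C₃ * geomConst (n + θ - 1) (1 - θ) * (r ^ (θ - 1 - n) * r ^ (1 - θ)) +
          2 * geomConst n θ * (r ^ (θ - n) * r ^ (-θ)) := by ring
      _ = _ := by rw [e1, e2]; simp only [Q]; ring
  have hhalf : ∫⁻ y in ball x₀ r, ∫⁻ x, F y x ∂σ ∂σ ≤ C * C * ENNReal.ofReal Q := by
    have g1 := geomConst_nonneg ((n : ℝ) + θ - 1) (β := 1 - θ) (by linarith)
    have g2 := geomConst_nonneg (n : ℝ) hθ₀
    have hQ : 0 ≤ Q := by positivity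
    refine (lintegral_mono_ae (ae_restrict_of_ae hinner)).trans ?_
    rw [setLIntegral_const]
    refine (mul_le_mul' le_rfl (hσ x₀ r hr)).trans (le_of_eq ?_)
    rw [mul_mul_mul_comm, ← ENNReal.ofReal_mul (by positivity), mul_assoc Q, Real.rpow_neg hr.le,
      Real.rpow_natCast, inv_mul_cancel₀ (by positivity), mul_one]
  -- A nonzero difference needs one of the two points in the supporting ball, and by symmetry both
  -- cases give the same integral; hence the factor `2` in `atomConst`.
  have hle : ∀ y x, F y x ≤ (ball x₀ r).indicator (fun y => F y x) y +
      (ball x₀ r).indicator (fun x => F y x) x := fun y x => by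
    by_cases hy : y ∈ ball x₀ r
    · rw [indicator_of_mem hy]; exact le_self_add
    by_cases hx : x ∈ ball x₀ r
    · rw [indicator_of_mem hx]; exact le_add_self
    · have : F y x = 0 := by simp [F, hsupp x hx, hsupp y hy]
      rw [this]; exact zero_le
  have hmeas' : AEMeasurable (Function.uncurry F) (σ.prod σ) := hmeas
  have hm1 : AEMeasurable (Function.uncurry fun y x => (ball x₀ r).indicator (fun y => F y x) y)
      (σ.prod σ) := by
    have : (Function.uncurry fun y x => (ball x₀ r).indicator (fun y => F y x) y) =
        (Prod.fst ⁻¹' ball x₀ r).indicator (Function.uncurry F) := rfl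
    rw [this]
    exact hmeas'.indicator (measurable_fst measurableSet_ball)
  have hcalc1 : ∫⁻ y, ∫⁻ x, (ball x₀ r).indicator (fun y => F y x) y ∂σ ∂σ =
      ∫⁻ y in ball x₀ r, ∫⁻ x, F y x ∂σ ∂σ := by
    rw [← lintegral_indicator measurableSet_ball]
    refine lintegral_congr fun y => ?_
    by_cases hy : y ∈ ball x₀ r
    · simp only [indicator_of_mem hy]
    · simp only [indicator_of_notMem hy, lintegral_zero]
  have hcalc2 : ∫⁻ y, ∫⁻ x, (ball x₀ r).indicator (fun x => F y x) x ∂σ ∂σ =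
      ∫⁻ y in ball x₀ r, ∫⁻ x, F y x ∂σ ∂σ := by
    rw [← hcalc1, lintegral_lintegral_swap hm1]
    refine lintegral_congr fun y => lintegral_congr fun x => ?_
    by_cases hx : x ∈ ball x₀ r
    · simp only [indicator_of_mem hx, hsymm]
    · simp only [indicator_of_notMem hx]
  have hmid : ∀ᵐ y ∂σ, AEMeasurable (fun x => (ball x₀ r).indicator (fun y => F y x) y) σ :=
    hm1.aestronglyMeasurable.prodMk_left.mono fun _ h => h.aemeasurable
  calc slobodeckijNorm θ Ω a = ∫⁻ y, ∫⁻ x, F y x ∂σ ∂σ := rfl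
    _ ≤ ∫⁻ y, ((∫⁻ x, (ball x₀ r).indicator (fun y => F y x) y ∂σ) +
        ∫⁻ x, (ball x₀ r).indicator (fun x => F y x) x ∂σ) ∂σ := by
        refine lintegral_mono_ae ?_
        filter_upwards [hmid] with y hy
        rw [← lintegral_add_left' hy]
        exact lintegral_mono fun x => hle y x
    _ = (∫⁻ y, ∫⁻ x, (ball x₀ r).indicator (fun y => F y x) y ∂σ ∂σ) +
        ∫⁻ y, ∫⁻ x, (ball x₀ r).indicator (fun x => F y x) x ∂σ ∂σ :=
        lintegral_add_left' hm1.lintegral_prod_right' _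
    _ ≤ C * C * ENNReal.ofReal Q + C * C * ENNReal.ofReal Q := by
        rw [hcalc1, hcalc2]
        exact add_le_add hhalf hhalf
    _ = _ := by rw [atomConst]; ring

/-- The double integral is controlled by the atomic norm. -/
theorem slobodeckijNorm_le_atomicNorm (hn : 1 ≤ n) (hθ₀ : 0 < θ) (hθ₁ : θ < 1)
    (hσ : UpperRegular Ω C) (hgc : GradControls Ω C₃) {f : Amb n → ℂ}
    (hf : AEStronglyMeasurable f (surfaceMeasure Ω)) :
    slobodeckijNorm θ Ω f ≤ (atomConst n θ C C₃ + 1) * atomicNorm θ Ω f := by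
  have hloc := hσ.isLocallyFiniteMeasure
  have hn' : (1 : ℝ) ≤ n := by exact_mod_cast hn
  have hQ : atomConst n θ C C₃ + 1 ≠ ⊤ := by rw [atomConst]; finiteness
  -- The added `1` makes the constant nonzero, so that it can be moved across the infimum by
  -- division.
  have hQ0 : atomConst n θ C C₃ + 1 ≠ 0 := by simp
  rw [mul_comm, ← ENNReal.div_le_iff_le_mul (Or.inl hQ0) (Or.inl hQ)]
  refine le_iInf fun c => le_iInf fun lam => le_iInf fun a => le_iInf fun ⟨ha, hlim⟩ => ?_
  rw [ENNReal.div_le_iff_le_mul (Or.inl hQ0) (Or.inl hQ)]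
  set σ := surfaceMeasure Ω
  set S : ℕ → Amb n → ℂ := fun k x => c + ∑ j ∈ Finset.range k, lam j * a j x
  have hSm : ∀ k, AEStronglyMeasurable (S k) σ := fun k =>
    aestronglyMeasurable_const.add (Finset.aestronglyMeasurable_fun_sum _ fun j _ =>
      (ha j).aestronglyMeasurable.const_mul _)
  have hlim' : Tendsto (fun k => eLpNorm (S k - f) (ENNReal.ofReal (n / (n - θ))) σ) atTop (𝓝 0) := by
    refine hlim.congr fun k => ?_
    rw [← eLpNorm_neg]
    congr 1
    ext x
    simp [S]
  have hp0 : ENNReal.ofReal (n / (n - θ)) ≠ 0 := by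
    rw [ne_eq, ENNReal.ofReal_eq_zero, not_le]
    exact div_pos (by linarith) (by linarith)
  -- Convergence in `L^p` gives pointwise convergence along a subsequence of partial sums, enough
  -- for the pointwise bound of `|f x - f y|` by the full series.
  obtain ⟨ns, -, hns⟩ := (tendstoInMeasure_of_tendsto_eLpNorm hp0 hSm hf hlim').exists_seq_tendsto_ae
  have hpt : ∀ x y, Tendsto (fun i => S (ns i) x) atTop (𝓝 (f x)) →
      Tendsto (fun i => S (ns i) y) atTop (𝓝 (f y)) →
      ‖f x - f y‖ₑ ≤ ∑' j, ‖lam j‖ₑ * ‖a j x - a j y‖ₑ := fun x y hx hy => by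
    refine le_of_tendsto' (hx.sub hy).enorm fun i => ?_
    have e : S (ns i) x - S (ns i) y = ∑ j ∈ Finset.range (ns i), lam j * (a j x - a j y) := by
      simp only [S]
      rw [add_sub_add_left_eq_sub, ← Finset.sum_sub_distrib]
      exact Finset.sum_congr rfl fun j _ => by ring
    rw [e]
    refine (enorm_sum_le _ _).trans ((Finset.sum_le_sum fun j _ => ?_).trans (ENNReal.sum_le_tsum _))
    rw [enorm_mul]
  set F : ℕ → Amb n → Amb n → ℝ≥0∞ := fun j y x =>
    ‖lam j‖ₑ * (‖a j x - a j y‖ₑ / edist x y ^ (n + θ : ℝ))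
  have hFm : ∀ j, AEMeasurable (Function.uncurry (F j)) (σ.prod σ) := fun j =>
    (aemeasurable_slobodeckij (ha j).aestronglyMeasurable (n + θ)).const_mul _
  calc slobodeckijNorm θ Ω f ≤ ∫⁻ y, ∫⁻ x, ∑' j, F j y x ∂σ ∂σ := by
        refine lintegral_mono_ae ?_
        filter_upwards [hns] with y hy
        refine lintegral_mono_ae ?_
        filter_upwards [hns] with x hx
        refine (ENNReal.div_le_div_right (hpt x y hx hy) _).trans (le_of_eq ?_)
        rw [div_eq_mul_inv, ← ENNReal.tsum_mul_right]
        exact tsum_congr fun j => by simp only [F]; rw [mul_assoc, div_eq_mul_inv]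
    _ = ∫⁻ y, ∑' j, ∫⁻ x, F j y x ∂σ ∂σ := by
        have hall : ∀ᵐ y ∂σ, ∀ j, AEMeasurable (fun x => F j y x) σ :=
          ae_all_iff.2 fun j => (hFm j).aestronglyMeasurable.prodMk_left.mono fun _ h => h.aemeasurable
        refine lintegral_congr_ae ?_
        filter_upwards [hall] with y hy
        exact lintegral_tsum hy
    _ = ∑' j, ∫⁻ y, ∫⁻ x, F j y x ∂σ ∂σ := lintegral_tsum fun j => (hFm j).lintegral_prod_right'
    _ ≤ ∑' j, ‖lam j‖ₑ * (atomConst n θ C C₃ + 1) := by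
        refine ENNReal.tsum_le_tsum fun j => ?_
        have : ∫⁻ y, ∫⁻ x, F j y x ∂σ ∂σ = ‖lam j‖ₑ * slobodeckijNorm θ Ω (a j) := by
          simp only [F]
          simp_rw [lintegral_const_mul' _ _ (enorm_ne_top (x := lam j))]
          rfl
        rw [this]
        exact mul_le_mul' le_rfl ((slobodeckijNorm_atom_le hn hθ₀ hθ₁ hσ hgc (ha j)).trans
          le_self_add)
    _ = _ := by rw [ENNReal.tsum_mul_right]

end AtomToSlobodeckij


/-! ### Averaged norms -/

section Averages

variable {Ω : Set (Amb n)} {θ : ℝ} {G : Amb n → EuclideanSpace ℂ (Fin (n + 1))}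

lemma volume_ambBall (x : Amb n) {r : ℝ} (hr : 0 < r) :
    volume (ball x r) = ENNReal.ofReal (r ^ (n + 1)) * volume (ball (0 : Amb n) 1) := by
  rw [Measure.addHaar_ball_of_pos _ _ hr, finrank_euclideanSpace_fin]

lemma eLpNorm_one_cond_ball (x : Amb n) {r : ℝ} (hr : 0 < r) :
    eLpNorm G 1 (ProbabilityTheory.cond volume (ball x r)) =
      ∫⁻ w, (ENNReal.ofReal (r ^ (n + 1)) * volume (ball (0 : Amb n) 1))⁻¹ *
        (ball x r).indicator (fun w => ‖G w‖ₑ) w := by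
  rw [lintegral_const_mul' _ _ (by
      rw [← volume_ambBall x hr]
      exact ENNReal.inv_ne_top.2 (measure_ball_pos _ _ hr).ne'),
    lintegral_indicator measurableSet_ball, ← volume_ambBall x hr, eLpNorm_one_eq_lintegral_enorm,
    ProbabilityTheory.cond, lintegral_smul_measure, smul_eq_mul]

/-- Averages over Whitney balls dominate the weighted integral. -/
lemma wInt_le_avNorm_one (hΩ : IsOpen Ω) (hF : (frontier Ω).Nonempty) (hθ₀ : 0 < θ) (hθ₁ : θ < 1)
    (hG : Measurable G) : wInt θ Ω G ≤ 2 ^ (n + 2) * avNorm θ 1 Ω G := by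
  set δ : Amb n → ℝ := fun x => infDist x (frontier Ω)
  have hδm : Measurable δ := measurable_infDist
  set κ : ℝ≥0∞ := volume (ball (0 : Amb n) 1)
  have hκ0 : κ ≠ 0 := (measure_ball_pos _ _ one_pos).ne'
  have hκt : κ ≠ ⊤ := measure_ball_lt_top.ne
  set P : Amb n → ℝ≥0∞ := fun x => (ENNReal.ofReal ((δ x / 2) ^ (n + 1)) * κ)⁻¹ *
    ENNReal.ofReal (δ x ^ (-θ))
  have hPm : Measurable P := by fun_prop
  set K : Amb n → Amb n → ℝ≥0∞ := fun x w => P x * (ball x (δ x / 2)).indicator (fun w => ‖G w‖ₑ) w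
  have hKm : Measurable (Function.uncurry K) := by
    have hs : MeasurableSet {p : Amb n × Amb n | dist p.2 p.1 < δ p.1 / 2} :=
      measurableSet_lt (measurable_snd.dist measurable_fst)
        ((hδm.comp measurable_fst).div_const 2)
    exact (hPm.comp measurable_fst).mul ((hG.enorm.comp measurable_snd).indicator hs)
  have hav : avNorm θ 1 Ω G = ∫⁻ x in Ω, ∫⁻ w, K x w := by
    refine setLIntegral_congr_fun hΩ.measurableSet fun x hx => ?_
    have hx0 : 0 < δ x := infDist_frontier_pos hΩ hF hx
    change eLpNorm G 1 (ProbabilityTheory.cond volume (ball x (δ x / 2))) *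
      ENNReal.ofReal (δ x ^ (-θ)) = _
    rw [eLpNorm_one_cond_ball x (half_pos hx0), mul_comm,
      ← lintegral_const_mul' _ _ ENNReal.ofReal_ne_top]
    refine lintegral_congr fun w => ?_
    simp only [K, P]
    ring
  rw [hav, lintegral_lintegral_swap hKm.aemeasurable, wInt,
    ← lintegral_const_mul' _ _ (by finiteness)]
  refine (setLIntegral_mono' hΩ.measurableSet fun w hw => ?_).trans (setLIntegral_le_lintegral Ω _)
  have hw0 : 0 < δ w := infDist_frontier_pos hΩ hF hw
  -- If `|x - w| < δ(w)/3` then `δ(x) > 2δ(w)/3`, so `w` belongs to the Whitney ball of `x`, and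
  -- `δ(x) < 4δ(w)/3`. The volume ratio `2^(-n-1)` and `(4/3)^(-θ) ≥ 1/2` give the constant
  -- `2^(n+2)`.
  have hsub : ball w (δ w / 3) ⊆ Ω := (ball_subset_ball (by linarith)).trans
    (ball_infDist_frontier_subset hw)
  set Q : ℝ≥0∞ := (ENNReal.ofReal ((4 / 3 * δ w / 2) ^ (n + 1)) * κ)⁻¹ *
    ENNReal.ofReal ((4 / 3 * δ w) ^ (-θ))
  have hpt : ∀ x ∈ ball w (δ w / 3), Q * ‖G w‖ₑ ≤ K x w := fun x hx => by
    rw [mem_ball] at hx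
    have h1 : δ w ≤ δ x + dist w x := infDist_le_infDist_add_dist
    have h2 : δ x ≤ δ w + dist x w := infDist_le_infDist_add_dist
    rw [dist_comm] at h1
    have hx0 : 0 < δ x := by linarith
    simp only [K]
    rw [indicator_of_mem (by rw [mem_ball, dist_comm]; linarith)]
    refine mul_le_mul' (mul_le_mul' (ENNReal.inv_le_inv.2 (mul_le_mul' (ENNReal.ofReal_le_ofReal
      (pow_le_pow_left₀ (by linarith) (by linarith) _)) le_rfl)) (ENNReal.ofReal_le_ofReal
      (Real.rpow_le_rpow_of_nonpos hx0 (by linarith) (by linarith)))) le_rfl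
  have hlow : Q * ‖G w‖ₑ * volume (ball w (δ w / 3)) ≤ ∫⁻ x in Ω, K x w := by
    rw [← setLIntegral_const]
    exact (setLIntegral_mono' measurableSet_ball hpt).trans (lintegral_mono_set hsub)
  refine le_trans ?_ (mul_le_mul' le_rfl hlow)
  rw [volume_ambBall w (by linarith : 0 < δ w / 3)]
  have hQ : ENNReal.ofReal (δ w ^ (-θ)) ≤
      2 ^ (n + 2) * (Q * (ENNReal.ofReal ((δ w / 3) ^ (n + 1)) * κ)) := by
    have e : Q * (ENNReal.ofReal ((δ w / 3) ^ (n + 1)) * κ) =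
        ENNReal.ofReal ((4 / 3 * δ w) ^ (-θ) * (2⁻¹ : ℝ) ^ (n + 1)) := by
      have hpos : 0 < (4 / 3 * δ w / 2) ^ (n + 1) := by positivity
      simp only [Q]
      rw [ENNReal.mul_inv (Or.inr hκt) (Or.inr hκ0)]
      calc _ = (ENNReal.ofReal ((4 / 3 * δ w) ^ (-θ)) *
          ((ENNReal.ofReal ((4 / 3 * δ w / 2) ^ (n + 1)))⁻¹ * ENNReal.ofReal ((δ w / 3) ^ (n + 1)))) *
            (κ⁻¹ * κ) := by ring
        _ = _ := by
          rw [ENNReal.inv_mul_cancel hκ0 hκt, mul_one, ← ENNReal.ofReal_inv_of_pos hpos,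
            ← ENNReal.ofReal_mul (by positivity), ← ENNReal.ofReal_mul (by positivity), ← inv_pow,
            ← mul_pow]
          congr 3
          field_simp
          norm_num
    rw [e, show (2 : ℝ≥0∞) ^ (n + 2) = ENNReal.ofReal (2 ^ (n + 2)) by
      rw [ENNReal.ofReal_pow zero_le_two, ENNReal.ofReal_ofNat], ← ENNReal.ofReal_mul (by positivity)]
    refine ENNReal.ofReal_le_ofReal ?_
    have h4 : (2 : ℝ)⁻¹ ≤ (4 / 3 : ℝ) ^ (-θ) := by
      rw [Real.rpow_neg (by norm_num)]
      refine inv_anti₀ (by positivity) ?_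
      calc (4 / 3 : ℝ) ^ θ ≤ (4 / 3) ^ (1 : ℝ) :=
            Real.rpow_le_rpow_of_exponent_le (by norm_num) hθ₁.le
        _ ≤ 2 := by norm_num
    rw [Real.mul_rpow (by norm_num) hw0.le]
    have h5 : 0 ≤ δ w ^ (-θ) := by positivity
    have h6 : (2 : ℝ) ^ (n + 2) * 2⁻¹ ^ (n + 1) = 2 := by
      rw [pow_succ 2 (n + 1), mul_right_comm, ← mul_pow]
      norm_num
    calc δ w ^ (-θ) = 2⁻¹ * δ w ^ (-θ) * 2 := by ring
      _ ≤ (4 / 3) ^ (-θ) * δ w ^ (-θ) * 2 := by gcongr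
      _ = _ := by linear_combination -((4 / 3 : ℝ) ^ (-θ) * δ w ^ (-θ)) * h6
  calc ‖G w‖ₑ * ENNReal.ofReal (δ w ^ (-θ)) ≤
      ‖G w‖ₑ * (2 ^ (n + 2) * (Q * (ENNReal.ofReal ((δ w / 3) ^ (n + 1)) * κ))) :=
        mul_le_mul' le_rfl hQ
    _ = _ := by ring

lemma avNorm_congr (hΩ : IsOpen Ω) (q : ℝ≥0∞) {G' : Amb n → EuclideanSpace ℂ (Fin (n + 1))}
    (h : G =ᵐ[volume.restrict Ω] G') : avNorm θ q Ω G = avNorm θ q Ω G' := by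
  refine setLIntegral_congr_fun hΩ.measurableSet fun x hx => ?_
  congr 1
  refine eLpNorm_congr_ae ?_
  refine Measure.ae_smul_measure (ae_restrict_of_ae_restrict_of_subset ?_ h) _
  exact (ball_subset_ball (by linarith [infDist_nonneg (x := x) (s := frontier Ω)])).trans
    (ball_infDist_frontier_subset hx)

/-- The averages are taken over probability measures, for which `L^p` norms increase with the
exponent. -/
lemma avNorm_mono_exponent (hΩ : IsOpen Ω) (hF : (frontier Ω).Nonempty) {p q : ℝ≥0∞} (hpq : p ≤ q)
    (hG : AEStronglyMeasurable G (volume.restrict Ω)) : avNorm θ p Ω G ≤ avNorm θ q Ω G := by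
  refine setLIntegral_mono' hΩ.measurableSet fun x hx => mul_le_mul' ?_ le_rfl
  have hx0 := infDist_frontier_pos hΩ hF hx
  have : IsProbabilityMeasure (ProbabilityTheory.cond volume
      (ball x (infDist x (frontier Ω) / 2))) :=
    ProbabilityTheory.cond_isProbabilityMeasure_of_finite (measure_ball_pos _ _ (half_pos hx0)).ne'
      measure_ball_lt_top.ne
  refine eLpNorm_le_eLpNorm_of_exponent_le hpq (AEStronglyMeasurable.smul_measure ?_ _)
  exact hG.mono_set ((ball_subset_ball (by linarith)).trans (ball_infDist_frontier_subset hx))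

end Averages


/-! ### A homogeneous kernel -/

/-- The kernel `|v|^{-2n-2}`. -/
def powKer (v : Amb n) : ℝ := (‖v‖ ^ 2)⁻¹ ^ (n + 1)

lemma powKer_nonneg (v : Amb n) : 0 ≤ powKer v := by unfold powKer; positivity

lemma powKer_eq_rpow (v : Amb n) : powKer v = ‖v‖ ^ (-(2 * n + 2 : ℝ)) := by
  rw [powKer, inv_pow, ← pow_mul, Real.rpow_neg (norm_nonneg v), ← Real.rpow_natCast]
  push_cast
  ring_nf

lemma measurable_powKer : Measurable (powKer : Amb n → ℝ) := by unfold powKer; fun_prop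

lemma powKer_le {v w : Amb n} {a : ℝ} (hv : v ≠ 0) (h : ‖v‖ ≤ a * ‖w‖) :
    powKer w ≤ (a ^ 2) ^ (n + 1) * powKer v := by
  have hv' := norm_pos_iff.2 hv
  have hpos : 0 < a * ‖w‖ := hv'.trans_le h
  have ha : a ≠ 0 := by rintro rfl; simp at hpos
  have hw : 0 < ‖w‖ := (norm_nonneg w).lt_of_ne' (by rintro h0; simp [h0] at hpos)
  rw [powKer, powKer, ← mul_pow]
  refine pow_le_pow_left₀ (by positivity) ?_ _
  rw [← div_eq_mul_inv, inv_eq_one_div, div_le_div_iff₀ (by positivity) (by positivity), one_mul,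
    ← mul_pow]
  exact pow_le_pow_left₀ (norm_nonneg v) h 2

lemma hasFDerivAt_powKer {v : Amb n} (hv : v ≠ 0) :
    HasFDerivAt (powKer : Amb n → ℝ)
      (((n + 1 : ℕ) * ((‖v‖ ^ 2)⁻¹ ^ n) * (-((‖v‖ ^ 2) ^ 2)⁻¹)) • (2 • innerSL ℝ v)) v := by
  have h1 := ((hasDerivAt_inv (x := ‖v‖ ^ 2) (by positivity)).fun_pow (n + 1))
  have h2 := (hasStrictFDerivAt_norm_sq v).hasFDerivAt
  exact h1.comp_hasFDerivAt v h2

lemma contDiffAt_powKer {v : Amb n} (hv : v ≠ 0) {m : ℕ∞} : ContDiffAt ℝ m (powKer : Amb n → ℝ) v :=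
  ((contDiff_norm_sq ℝ).contDiffAt.inv (by positivity)).pow (n + 1)

lemma norm_fderiv_powKer_le {v : Amb n} (hv : v ≠ 0) :
    ‖fderiv ℝ (powKer : Amb n → ℝ) v‖ ≤ (2 * n + 2) * ‖v‖⁻¹ * powKer v := by
  have hv' := norm_pos_iff.2 hv
  rw [(hasFDerivAt_powKer hv).fderiv, norm_smul, ← Nat.cast_smul_eq_nsmul ℝ, norm_smul,
    innerSL_apply_norm, norm_mul, norm_mul, norm_neg, Real.norm_of_nonneg (by positivity),
    Real.norm_of_nonneg (by positivity), Real.norm_of_nonneg (by positivity),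
    Real.norm_of_nonneg (by positivity), powKer, pow_succ (‖v‖ ^ 2)⁻¹ n]
  refine le_of_eq ?_
  push_cast
  generalize (‖v‖ ^ 2)⁻¹ ^ n = a
  field_simp

section Potential

variable {E : Type*} [NormedAddCommGroup E] [NormedSpace ℝ E] {Ω : Set (Amb n)} {g : Amb n → E}

/-- The potential of the measure `g σ` with respect to the kernel `powKer`. -/
def pot (Ω : Set (Amb n)) (g : Amb n → E) (x : Amb n) : E :=
  ∫ y, powKer (x - y) • g y ∂(surfaceMeasure Ω)

lemma sub_ne_zero_of_notMem_frontier {x y : Amb n} (hx : x ∉ frontier Ω) (hy : y ∈ frontier Ω) :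
    x - y ≠ 0 := sub_ne_zero.2 fun h => hx (h ▸ hy)

lemma infDist_pos_of_notMem (hF : (frontier Ω).Nonempty) {x : Amb n} (hx : x ∉ frontier Ω) :
    0 < infDist x (frontier Ω) := (isClosed_frontier.notMem_iff_infDist_pos hF).1 hx

lemma infDist_le_norm_sub {x y : Amb n} (hy : y ∈ frontier Ω) :
    infDist x (frontier Ω) ≤ ‖x - y‖ := by
  rw [← dist_eq_norm]
  exact infDist_le_dist_of_mem hy

lemma norm_sub_le_two_mul {x₀ x y : Amb n} (hy : y ∈ frontier Ω)
    (hx : x ∈ ball x₀ (infDist x₀ (frontier Ω) / 2)) : ‖x₀ - y‖ ≤ 2 * ‖x - y‖ := by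
  have h1 := infDist_le_norm_sub (x := x₀) hy
  rw [mem_ball, dist_comm, dist_eq_norm] at hx
  have h2 : ‖x₀ - y‖ ≤ ‖x₀ - x‖ + ‖x - y‖ := by
    rw [← sub_add_sub_cancel x₀ x y]
    exact norm_add_le _ _
  linarith

lemma notMem_frontier_of_mem_ball {x₀ x : Amb n}
    (hx : x ∈ ball x₀ (infDist x₀ (frontier Ω) / 2)) : x ∉ frontier Ω := fun h => by
  have h1 := infDist_le_dist_of_mem (x := x₀) h
  rw [mem_ball, dist_comm] at hx
  linarith [dist_nonneg (x := x₀) (y := x)]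

/-- On the Whitney ball of `x₀` the distance to any boundary point is at least half its value at the
centre. The derivative of the kernel is thus dominated by the kernel at the centre, uniformly in
`x`. -/
lemma norm_fderiv_powKer_sub_le (hF : (frontier Ω).Nonempty) {x₀ x y : Amb n}
    (hx₀ : x₀ ∉ frontier Ω) (hy : y ∈ frontier Ω)
    (hx : x ∈ ball x₀ (infDist x₀ (frontier Ω) / 2)) :
    ‖fderiv ℝ (powKer : Amb n → ℝ) (x - y)‖ ≤
      (2 * n + 2) * (infDist x₀ (frontier Ω) / 2)⁻¹ * 4 ^ (n + 1) * powKer (x₀ - y) := by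
  have hδ := infDist_pos_of_notMem hF hx₀
  have h1 := norm_sub_le_two_mul hy hx
  have h2 := infDist_le_norm_sub (x := x₀) hy
  have h3 := powKer_le (sub_ne_zero_of_notMem_frontier hx₀ hy) h1
  refine (norm_fderiv_powKer_le
    (sub_ne_zero_of_notMem_frontier (notMem_frontier_of_mem_ball hx) hy)).trans ?_
  rw [mul_assoc _ ((4 : ℝ) ^ (n + 1))]
  have := powKer_nonneg (x - y)
  norm_num at h3
  gcongr
  linarith

lemma aestronglyMeasurable_fderiv_powKer (hg : AEStronglyMeasurable g (surfaceMeasure Ω))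
    (x : Amb n) :
    AEStronglyMeasurable (fun y => (fderiv ℝ (powKer : Amb n → ℝ) (x - y)).smulRight (g y))
      (surfaceMeasure Ω) := by
  have h1 : AEStronglyMeasurable (fun y => fderiv ℝ (powKer : Amb n → ℝ) (x - y))
      (surfaceMeasure Ω) :=
    ((measurable_fderiv ℝ _).comp (measurable_const.sub measurable_id)).aestronglyMeasurable
  exact (ContinuousLinearMap.smulRightL ℝ (Amb n) E).aestronglyMeasurable_comp₂ h1 hg

/-- Differentiation under the integral: by `norm_fderiv_powKer_sub_le`, integrability at the centre
alone dominates all derivatives nearby. -/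
lemma hasFDerivAt_pot (hF : (frontier Ω).Nonempty)
    (hg : AEStronglyMeasurable g (surfaceMeasure Ω)) {x₀ : Amb n} (hx₀ : x₀ ∉ frontier Ω)
    (hi : Integrable (fun y => powKer (x₀ - y) • g y) (surfaceMeasure Ω)) :
    HasFDerivAt (pot Ω g)
      (∫ y, (fderiv ℝ powKer (x₀ - y)).smulRight (g y) ∂(surfaceMeasure Ω)) x₀ := by
  have hδ := infDist_pos_of_notMem hF hx₀
  refine hasFDerivAt_integral_of_dominated_of_fderiv_le (𝕜 := ℝ)
    (F := fun x y => powKer (x - y) • g y)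
    (F' := fun x y => (fderiv ℝ powKer (x - y)).smulRight (g y))
    (bound := fun y => (2 * n + 2) * (infDist x₀ (frontier Ω) / 2)⁻¹ * 4 ^ (n + 1) *
      ‖powKer (x₀ - y) • g y‖) (ball_mem_nhds x₀ (half_pos hδ)) ?_ hi
    (aestronglyMeasurable_fderiv_powKer hg x₀) ?_ (hi.norm.const_mul _) ?_
  · exact Eventually.of_forall fun x => (measurable_powKer.comp
      (measurable_const.sub measurable_id)).aestronglyMeasurable.smul hg
  · filter_upwards [ae_mem_frontier Ω] with y hy x hx
    rw [ContinuousLinearMap.norm_smulRight_apply, norm_smul, Real.norm_of_nonneg (powKer_nonneg _),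
      ← mul_assoc]
    exact mul_le_mul_of_nonneg_right (norm_fderiv_powKer_sub_le hF hx₀ hy hx) (norm_nonneg _)
  · filter_upwards [ae_mem_frontier Ω] with y hy x hx
    have h := (contDiffAt_powKer (m := 1) (sub_ne_zero_of_notMem_frontier
      (notMem_frontier_of_mem_ball hx) hy)).differentiableAt one_ne_zero |>.hasFDerivAt
    exact (h.comp x ((hasFDerivAt_id x).sub_const y)).smul_const (g y)

lemma contDiffOn_pot (hF : (frontier Ω).Nonempty)
    (hg : AEStronglyMeasurable g (surfaceMeasure Ω))
    (hi : ∀ x ∉ frontier Ω, Integrable (fun y => powKer (x - y) • g y) (surfaceMeasure Ω)) :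
    ContDiffOn ℝ 1 (pot Ω g) (frontier Ω)ᶜ := by
  have hd := fun x (hx : x ∈ (frontier Ω)ᶜ) => hasFDerivAt_pot hF hg hx (hi x hx)
  rw [show (1 : WithTop ℕ∞) = 0 + 1 from (zero_add 1).symm, contDiffOn_succ_iff_fderiv_of_isOpen isClosed_frontier.isOpen_compl]
  refine ⟨fun x hx => (hd x hx).differentiableAt.differentiableWithinAt, by simp, ?_⟩
  rw [contDiffOn_zero]
  refine ContinuousOn.congr (f := fun x =>
    ∫ y, (fderiv ℝ powKer (x - y)).smulRight (g y) ∂(surfaceMeasure Ω)) ?_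
    fun x hx => (hd x hx).fderiv
  intro x₀ hx₀
  have hδ := infDist_pos_of_notMem hF hx₀
  refine ContinuousAt.continuousWithinAt (continuousAt_of_dominated
    (bound := fun y => (2 * n + 2) * (infDist x₀ (frontier Ω) / 2)⁻¹ * 4 ^ (n + 1) *
      ‖powKer (x₀ - y) • g y‖)
    (Eventually.of_forall fun x => aestronglyMeasurable_fderiv_powKer hg x) ?_
    ((hi x₀ hx₀).norm.const_mul _) ?_)
  · filter_upwards [ball_mem_nhds x₀ (half_pos hδ)] with x hx
    filter_upwards [ae_mem_frontier Ω] with y hy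
    rw [ContinuousLinearMap.norm_smulRight_apply, norm_smul, Real.norm_of_nonneg (powKer_nonneg _),
      ← mul_assoc]
    exact mul_le_mul_of_nonneg_right (norm_fderiv_powKer_sub_le hF hx₀ hy hx) (norm_nonneg _)
  · filter_upwards [ae_mem_frontier Ω] with y hy
    have h := (contDiffAt_powKer (m := 1) (sub_ne_zero_of_notMem_frontier hx₀ hy)).continuousAt_fderiv
      one_ne_zero
    have h' : ContinuousAt (fun x => fderiv ℝ powKer (x - y)) x₀ :=
      ContinuousAt.comp (f := fun x => x - y) h (by fun_prop)
    exact ((ContinuousLinearMap.smulRightL ℝ (Amb n) E).flip (g y)).continuous.continuousAt.comp h'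

end Potential


/-! ### Normalized potentials -/

section Extension

variable {Ω : Set (Amb n)} {θ : ℝ} {C₁ : ℝ≥0} {f : Amb n → ℂ}

/-- The inner integral in the double integral defining `slobodeckijNorm`. -/
def diffInt (θ : ℝ) (Ω : Set (Amb n)) (f : Amb n → ℂ) (x : Amb n) : ℝ≥0∞ :=
  ∫⁻ y, ‖f y - f x‖ₑ / edist y x ^ (n + θ : ℝ) ∂(surfaceMeasure Ω)

/-- The extension of a function on `∂Ω` by weighted averages. -/
def potExt (Ω : Set (Amb n)) (f : Amb n → ℂ) (x : Amb n) : ℂ :=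
  (pot Ω (fun _ => (1 : ℝ)) x)⁻¹ • pot Ω f x

lemma lintegral_powKer_lt_top (hσ : UpperRegular Ω C₁) (hF : (frontier Ω).Nonempty) {x : Amb n}
    (hx : x ∉ frontier Ω) : ∫⁻ y, ENNReal.ofReal (powKer (x - y)) ∂(surfaceMeasure Ω) < ⊤ := by
  have hδ := infDist_pos_of_notMem hF hx
  have h := hσ.lintegral_compl_ball_rpow_le (γ := 2 * n + 2)
    (by linarith [(Nat.cast_nonneg n : (0 : ℝ) ≤ n)]) x hδ
  refine lt_of_le_of_lt ?_ (h.trans_lt (by finiteness))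
  rw [← lintegral_indicator measurableSet_ball.compl]
  refine lintegral_mono_ae ?_
  filter_upwards [ae_mem_frontier Ω] with y hy
  rw [indicator_of_mem, powKer_eq_rpow, ← dist_eq_norm, dist_comm]
  rw [mem_compl_iff, mem_ball, not_lt, dist_comm]
  exact infDist_le_dist_of_mem hy

lemma measurable_powKer_sub (x : Amb n) : Measurable fun y => powKer (x - y) :=
  measurable_powKer.comp (measurable_const.sub measurable_id)

lemma integrable_powKer (hσ : UpperRegular Ω C₁) (hF : (frontier Ω).Nonempty) {x : Amb n}
    (hx : x ∉ frontier Ω) : Integrable (fun y => powKer (x - y)) (surfaceMeasure Ω) := by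
  refine ⟨(measurable_powKer_sub x).aestronglyMeasurable, ?_⟩
  rw [hasFiniteIntegral_iff_ofReal (Eventually.of_forall fun y => powKer_nonneg _)]
  exact lintegral_powKer_lt_top hσ hF hx

/-- Since `dist y x ≤ (1 + Λ) dist w y`, the part `|w-y|^(-n-θ)` of the kernel becomes the kernel of
the double integral, and the rest is at most `δ^(θ-n-2)`. The condition on `Λ` is that `w`
approaches `x` nontangentially. -/
lemma lintegral_powKer_mul_le (hθ₀ : 0 < θ) (hθ₁ : θ < 1) (hF : (frontier Ω).Nonempty)
    {x w : Amb n} (hx : x ∈ frontier Ω)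
    (hw : w ∉ frontier Ω) {Λ : ℝ} (hΛ : 0 ≤ Λ) (h : dist w x ≤ Λ * infDist w (frontier Ω)) :
    ∫⁻ y, ENNReal.ofReal (powKer (w - y)) * ‖f y - f x‖ₑ ∂(surfaceMeasure Ω) ≤
      ENNReal.ofReal ((1 + Λ) ^ (n + θ) * infDist w (frontier Ω) ^ (θ - (n + 2))) *
        diffInt θ Ω f x := by
  have hδ := infDist_pos_of_notMem hF hw
  have hn0 : (0 : ℝ) ≤ n := Nat.cast_nonneg n
  rw [diffInt, ← lintegral_const_mul' _ _ ENNReal.ofReal_ne_top]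
  refine lintegral_mono_ae ?_
  filter_upwards [ae_mem_frontier Ω] with y hy
  rcases eq_or_ne y x with rfl | hyx
  · simp
  have hd := dist_pos.2 hyx
  have hwy : infDist w (frontier Ω) ≤ dist w y := infDist_le_dist_of_mem hy
  have hwy0 := hδ.trans_le hwy
  rw [enorm_div_edist hyx, ← ofReal_norm, ← ENNReal.ofReal_mul (powKer_nonneg _),
    ← ENNReal.ofReal_mul (by positivity)]
  refine ENNReal.ofReal_le_ofReal ?_
  rw [mul_left_comm, mul_comm]
  refine mul_le_mul_of_nonneg_left ?_ (norm_nonneg _)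
  have h1 : dist y x ≤ (1 + Λ) * dist w y := by
    have := dist_triangle_left y x w
    nlinarith [mul_le_mul_of_nonneg_left hwy hΛ]
  rw [powKer_eq_rpow, ← dist_eq_norm]
  calc dist w y ^ (-(2 * n + 2 : ℝ)) = dist w y ^ (-(n + θ)) * dist w y ^ (θ - (n + 2)) := by
        rw [← Real.rpow_add hwy0]
        ring_nf
    _ ≤ ((1 + Λ) ^ (n + θ) * dist y x ^ (-(n + θ))) * infDist w (frontier Ω) ^ (θ - (n + 2)) := by
        refine mul_le_mul ?_ (Real.rpow_le_rpow_of_nonpos hδ hwy (by linarith)) (by positivity)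
          (by positivity)
        rw [Real.rpow_neg hwy0.le, Real.rpow_neg hd.le, ← div_eq_mul_inv, inv_eq_one_div,
          div_le_div_iff₀ (by positivity) (by positivity), one_mul,
          ← Real.mul_rpow (by positivity) hwy0.le]
        exact Real.rpow_le_rpow hd.le h1 (by linarith)
    _ = _ := by ring

/-- One boundary point with finite `diffInt` is enough for all `w` off the boundary: every `w` is
nontangential to it for its own `Λ`. -/
lemma integrable_powKer_smul (hθ₀ : 0 < θ) (hθ₁ : θ < 1) (hσ : UpperRegular Ω C₁)
    (hF : (frontier Ω).Nonempty) (hf : AEStronglyMeasurable f (surfaceMeasure Ω)) {x : Amb n}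
    (hx : x ∈ frontier Ω) (hfx : diffInt θ Ω f x ≠ ⊤) {w : Amb n} (hw : w ∉ frontier Ω) :
    Integrable (fun y => powKer (w - y) • f y) (surfaceMeasure Ω) := by
  have hδ := infDist_pos_of_notMem hF hw
  have h1 : Integrable (fun y => powKer (w - y) • (f y - f x)) (surfaceMeasure Ω) := by
    refine ⟨(measurable_powKer_sub w).aestronglyMeasurable.smul
      (hf.sub aestronglyMeasurable_const), ?_⟩
    rw [hasFiniteIntegral_iff_enorm]
    simp_rw [enorm_smul, Real.enorm_of_nonneg (powKer_nonneg _)]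
    exact (lintegral_powKer_mul_le hθ₀ hθ₁ hF hx hw (Λ := dist w x / infDist w (frontier Ω))
      (by positivity) (by field_simp; rfl)).trans_lt (by finiteness)
  have h2 := h1.add ((integrable_powKer hσ hF hw).smul_const (f x))
  refine h2.congr (Eventually.of_forall fun y => ?_)
  simp only [Pi.add_apply]
  rw [← smul_add, sub_add_cancel]

/-- The lower bound for the normalizing potential. -/
lemma le_pot_one {C₂ : ℝ≥0} {R : ℝ} (hσ : UpperRegular Ω C₁) (hσ' : LowerRegular Ω C₂ R)
    (hF : (frontier Ω).Nonempty) {x : Amb n} (hx : x ∉ frontier Ω)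
    (hR : infDist x (frontier Ω) ≤ R) :
    C₂ / 4 ^ (n + 1) * (infDist x (frontier Ω) ^ (n + 2))⁻¹ ≤ pot Ω (fun _ => (1 : ℝ)) x := by
  have hδ := infDist_pos_of_notMem hF hx
  obtain ⟨p, hp, hxp⟩ := isClosed_frontier.exists_infDist_eq_dist hF x
  set δ := infDist x (frontier Ω)
  have hpot : ENNReal.ofReal (pot Ω (fun _ => (1 : ℝ)) x) =
      ∫⁻ y, ENNReal.ofReal (powKer (x - y)) ∂(surfaceMeasure Ω) := by
    rw [pot, ofReal_integral_eq_lintegral_ofReal]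
    · simp
    · simpa using integrable_powKer hσ hF hx
    · exact Eventually.of_forall fun y => by simpa using powKer_nonneg (x - y)
  have hnn : 0 ≤ pot Ω (fun _ => (1 : ℝ)) x :=
    integral_nonneg fun y => by simpa using powKer_nonneg (x - y)
  rw [← ENNReal.ofReal_le_ofReal_iff hnn, hpot]
  -- Within `δ` of the nearest boundary point the kernel is at least `(2δ)^(-2n-2)`, and that
  -- surface ball has measure at least `C₂ δ^n`.
  have hlow : ∀ y ∈ ball p δ ∩ frontier Ω,
      ENNReal.ofReal (((2 * δ) ^ 2)⁻¹ ^ (n + 1)) ≤ ENNReal.ofReal (powKer (x - y)) := fun y hy => by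
    refine ENNReal.ofReal_le_ofReal (pow_le_pow_left₀ (by positivity) ?_ _)
    have h0 : 0 < ‖x - y‖ := norm_pos_iff.2 (sub_ne_zero_of_notMem_frontier hx hy.2)
    refine inv_anti₀ (by positivity) (pow_le_pow_left₀ (norm_nonneg _) ?_ 2)
    rw [← dist_eq_norm]
    have := dist_triangle_right x y p
    have := mem_ball.1 hy.1
    linarith
  have hmeas : surfaceMeasure Ω (ball p δ ∩ frontier Ω) = surfaceMeasure Ω (ball p δ) := by
    refine measure_congr ?_
    filter_upwards [ae_mem_frontier Ω] with y hy
    exact propext ⟨fun h => h.1, fun h => ⟨h, hy⟩⟩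
  calc ENNReal.ofReal (C₂ / 4 ^ (n + 1) * (δ ^ (n + 2))⁻¹)
      = ENNReal.ofReal (((2 * δ) ^ 2)⁻¹ ^ (n + 1)) * (C₂ * ENNReal.ofReal (δ ^ n)) := by
        rw [← ENNReal.ofReal_coe_nnreal, ← ENNReal.ofReal_mul (by positivity),
          ← ENNReal.ofReal_mul (by positivity)]
        congr 1
        rw [mul_pow, mul_inv, mul_pow, inv_pow, inv_pow, ← pow_mul, ← pow_mul,
          show 2 * (n + 1) = (n + 2) + n by ring, pow_add δ]
        norm_num
        rw [show (2 : ℝ) ^ (n + 2 + n) = 4 ^ (n + 1) by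
          rw [show (4 : ℝ) = 2 ^ 2 by norm_num, ← pow_mul]; ring_nf]
        field_simp
        ring
    _ ≤ ENNReal.ofReal (((2 * δ) ^ 2)⁻¹ ^ (n + 1)) * surfaceMeasure Ω (ball p δ ∩ frontier Ω) := by
        rw [hmeas]
        exact mul_le_mul' le_rfl (hσ' p hp δ hδ hR)
    _ = ∫⁻ _ in ball p δ ∩ frontier Ω, ENNReal.ofReal (((2 * δ) ^ 2)⁻¹ ^ (n + 1))
          ∂(surfaceMeasure Ω) := (setLIntegral_const _ _).symm
    _ ≤ _ := (setLIntegral_mono' (measurableSet_ball.inter isClosed_frontier.measurableSet)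
        hlow).trans (setLIntegral_le_lintegral _ _)

lemma pot_sub_const (hσ : UpperRegular Ω C₁) (hF : (frontier Ω).Nonempty) {x : Amb n}
    (hx : x ∉ frontier Ω) (hi : Integrable (fun y => powKer (x - y) • f y) (surfaceMeasure Ω))
    (a : ℂ) : pot Ω (fun y => f y - a) x = pot Ω f x - pot Ω (fun _ => (1 : ℝ)) x • a := by
  rw [pot, pot, pot, ← integral_smul_const, ← integral_sub hi]
  · refine integral_congr_ae (Eventually.of_forall fun y => ?_)
    simp only [smul_sub, smul_eq_mul, mul_one]
  · simpa using (integrable_powKer hσ hF hx).smul_const a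

lemma potExt_sub_eq (hσ : UpperRegular Ω C₁) (hF : (frontier Ω).Nonempty) {x : Amb n}
    (hx : x ∉ frontier Ω) (hi : Integrable (fun y => powKer (x - y) • f y) (surfaceMeasure Ω))
    (hZ : pot Ω (fun _ => (1 : ℝ)) x ≠ 0) (a : ℂ) :
    potExt Ω f x - a = (pot Ω (fun _ => (1 : ℝ)) x)⁻¹ • pot Ω (fun y => f y - a) x := by
  rw [pot_sub_const hσ hF hx hi, smul_sub, smul_smul, inv_mul_cancel₀ hZ, one_smul, potExt]

lemma enorm_potExt_sub_le (hσ : UpperRegular Ω C₁) (hF : (frontier Ω).Nonempty) {x : Amb n}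
    (hx : x ∉ frontier Ω) (hi : Integrable (fun y => powKer (x - y) • f y) (surfaceMeasure Ω))
    (hZ : 0 < pot Ω (fun _ => (1 : ℝ)) x) (a : ℂ) :
    ‖potExt Ω f x - a‖ₑ ≤ ENNReal.ofReal (pot Ω (fun _ => (1 : ℝ)) x)⁻¹ *
      ∫⁻ y, ENNReal.ofReal (powKer (x - y)) * ‖f y - a‖ₑ ∂(surfaceMeasure Ω) := by
  rw [potExt_sub_eq hσ hF hx hi hZ.ne', enorm_smul, Real.enorm_of_nonneg (by positivity)]
  refine mul_le_mul' le_rfl ((enorm_integral_le_lintegral_enorm _).trans (le_of_eq ?_))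
  refine lintegral_congr fun y => ?_
  rw [enorm_smul, Real.enorm_of_nonneg (powKer_nonneg _)]

/-- The Hölder-type bound behind the trace: the normalizer is at least `κ δ^(-n-2)`, so after
division the error at nontangential points is of order `δ^θ`. -/
lemma enorm_potExt_sub_le_diffInt (hθ₀ : 0 < θ) (hθ₁ : θ < 1) (hσ : UpperRegular Ω C₁)
    (hF : (frontier Ω).Nonempty) {x w : Amb n} (hx : x ∈ frontier Ω) (hw : w ∉ frontier Ω)
    (hi : Integrable (fun y => powKer (w - y) • f y) (surfaceMeasure Ω)) {κ : ℝ} (hκ : 0 < κ)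
    (hZ : κ * (infDist w (frontier Ω) ^ (n + 2))⁻¹ ≤ pot Ω (fun _ => (1 : ℝ)) w)
    {Λ : ℝ} (hΛ : 0 ≤ Λ) (h : dist w x ≤ Λ * infDist w (frontier Ω)) :
    ‖potExt Ω f w - f x‖ₑ ≤ ENNReal.ofReal (κ⁻¹ * (1 + Λ) ^ (n + θ) *
      infDist w (frontier Ω) ^ θ) * diffInt θ Ω f x := by
  have hδ := infDist_pos_of_notMem hF hw
  have hZ0 : 0 < κ * (infDist w (frontier Ω) ^ (n + 2))⁻¹ := by positivity
  refine (enorm_potExt_sub_le hσ hF hw hi (hZ0.trans_le hZ) (f x)).trans ?_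
  refine (mul_le_mul' (ENNReal.ofReal_le_ofReal (inv_anti₀ hZ0 hZ))
    (lintegral_powKer_mul_le hθ₀ hθ₁ hF hx hw hΛ h)).trans (le_of_eq ?_)
  rw [← mul_assoc, ← ENNReal.ofReal_mul (by positivity)]
  congr 2
  rw [mul_inv, inv_inv, Real.rpow_sub hδ,
    show ((n : ℝ) + 2) = ((n + 2 : ℕ) : ℝ) by push_cast; ring, Real.rpow_natCast]
  field_simp

/-- The double integral that dominates the gradient of `potExt Ω f`. -/
def diffPot (θ : ℝ) (Ω : Set (Amb n)) (f : Amb n → ℂ) (x : Amb n) : ℝ≥0∞ :=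
  ∫⁻ y, ∫⁻ z, ‖f z - f y‖ₑ * ENNReal.ofReal (max ‖x - y‖ ‖x - z‖ ^ (-(2 * n + 1 + θ)))
    ∂(surfaceMeasure Ω) ∂(surfaceMeasure Ω)

/-- Subtracting the constant `potExt Ω f x` from `f` makes the numerator vanish at `x`, so the
derivative of the normalizer drops out and only differences of `f` remain. -/
lemma hasFDerivAt_potExt (hσ : UpperRegular Ω C₁) (hF : (frontier Ω).Nonempty)
    (hf : AEStronglyMeasurable f (surfaceMeasure Ω))
    (hi : ∀ x ∉ frontier Ω, Integrable (fun y => powKer (x - y) • f y) (surfaceMeasure Ω))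
    (hZ : ∀ x ∉ frontier Ω, 0 < pot Ω (fun _ => (1 : ℝ)) x) {x : Amb n} (hx : x ∉ frontier Ω) :
    HasFDerivAt (potExt Ω f) ((pot Ω (fun _ => (1 : ℝ)) x)⁻¹ •
      ∫ y, (fderiv ℝ powKer (x - y)).smulRight (f y - potExt Ω f x) ∂(surfaceMeasure Ω)) x := by
  set a := potExt Ω f x
  have hi1 : Integrable (fun y => powKer (x - y) • (1 : ℝ)) (surfaceMeasure Ω) := by
    simpa using integrable_powKer hσ hF hx
  have hia : Integrable (fun y => powKer (x - y) • (f y - a)) (surfaceMeasure Ω) := by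
    simp only [smul_sub]
    exact (hi x hx).sub ((integrable_powKer hσ hF hx).smul_const a)
  have hfa : AEStronglyMeasurable (fun y => f y - a) (surfaceMeasure Ω) :=
    hf.sub aestronglyMeasurable_const
  have h1 := hasFDerivAt_pot hF aestronglyMeasurable_const hx hi1
  have h2 := hasFDerivAt_pot hF hfa hx hia
  have h0 : pot Ω (fun y => f y - a) x = 0 := by
    rw [pot_sub_const hσ hF hx (hi x hx), sub_eq_zero]
    simp only [a, potExt]
    rw [smul_smul, mul_inv_cancel₀ (hZ x hx).ne', one_smul]
  have h3 := ((hasDerivAt_inv (hZ x hx).ne').comp_hasFDerivAt x h1).smul h2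
  have h4 := h3.add_const a
  refine (h4.congr_of_eventuallyEq ?_).congr_fderiv ?_
  · filter_upwards [isClosed_frontier.isOpen_compl.mem_nhds hx] with w hw
    have := potExt_sub_eq hσ hF hw (hi w hw) (hZ w hw).ne' a
    rw [← sub_eq_iff_eq_add]
    exact this
  · ext v
    rw [h0, ContinuousLinearMap.smulRight_zero, add_zero]
    rfl

/-- Keep the exponent `2n+1+θ` on the larger of the two distances and replace every other factor by
the corresponding power of `δ`; the powers of `δ` add up to `θ`. The assumption `θ < 1` makes the
exponent left over when `B` is the larger one nonpositive. -/
lemma rpow_mul_rpow_le {δ A B : ℝ} (hθ₁ : θ < 1) (hδ : 0 < δ) (hA : δ ≤ A) (hB : δ ≤ B) :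
    δ ^ (n + 2) * δ ^ (n + 2) * (A⁻¹ * A ^ (-(2 * n + 2 : ℝ)) * B ^ (-(2 * n + 2 : ℝ))) ≤
      δ ^ θ * max A B ^ (-(2 * n + 1 + θ)) := by
  have hn0 : (0 : ℝ) ≤ n := Nat.cast_nonneg n
  have hA0 := hδ.trans_le hA
  have hB0 := hδ.trans_le hB
  have e : δ ^ (n + 2) = δ ^ ((n : ℝ) + 2) := by
    rw [← Real.rpow_natCast]; push_cast; rfl
  rw [e, ← Real.rpow_neg_one, ← Real.rpow_add hA0]
  rcases le_total B A with h | h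
  · rw [max_eq_left h]
    calc δ ^ ((n : ℝ) + 2) * δ ^ ((n : ℝ) + 2) *
          (A ^ (-1 + -(2 * n + 2 : ℝ)) * B ^ (-(2 * n + 2 : ℝ)))
        = δ ^ ((n : ℝ) + 2) * δ ^ ((n : ℝ) + 2) *
          (A ^ (-(2 * n + 1 + θ)) * A ^ (-(2 - θ)) * B ^ (-(2 * n + 2 : ℝ))) := by
          rw [← Real.rpow_add hA0]; ring_nf
      _ ≤ δ ^ ((n : ℝ) + 2) * δ ^ ((n : ℝ) + 2) *
          (A ^ (-(2 * n + 1 + θ)) * δ ^ (-(2 - θ)) * δ ^ (-(2 * n + 2 : ℝ))) := by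
          have q1 := Real.rpow_le_rpow_of_nonpos hδ hA (by linarith : -(2 - θ) ≤ 0)
          have q2 := Real.rpow_le_rpow_of_nonpos hδ hB (by linarith : -(2 * n + 2 : ℝ) ≤ 0)
          gcongr
      _ = δ ^ ((n : ℝ) + 2) * δ ^ ((n : ℝ) + 2) * δ ^ (-(2 - θ)) * δ ^ (-(2 * n + 2 : ℝ)) *
          A ^ (-(2 * n + 1 + θ)) := by ring
      _ = _ := by
          rw [← Real.rpow_add hδ, ← Real.rpow_add hδ, ← Real.rpow_add hδ]
          ring_nf
  · rw [max_eq_right h]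
    calc δ ^ ((n : ℝ) + 2) * δ ^ ((n : ℝ) + 2) *
          (A ^ (-1 + -(2 * n + 2 : ℝ)) * B ^ (-(2 * n + 2 : ℝ)))
        = δ ^ ((n : ℝ) + 2) * δ ^ ((n : ℝ) + 2) *
          (A ^ (-1 + -(2 * n + 2 : ℝ)) * (B ^ (-(2 * n + 1 + θ)) * B ^ (-(1 - θ)))) := by
          rw [← Real.rpow_add hB0]; ring_nf
      _ ≤ δ ^ ((n : ℝ) + 2) * δ ^ ((n : ℝ) + 2) *
          (δ ^ (-1 + -(2 * n + 2 : ℝ)) * (B ^ (-(2 * n + 1 + θ)) * δ ^ (-(1 - θ)))) := by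
          have q1 := Real.rpow_le_rpow_of_nonpos hδ hB (by linarith : -(1 - θ) ≤ 0)
          have q2 := Real.rpow_le_rpow_of_nonpos hδ hA (by linarith : -1 + -(2 * n + 2 : ℝ) ≤ 0)
          gcongr
      _ = δ ^ ((n : ℝ) + 2) * δ ^ ((n : ℝ) + 2) * δ ^ (-1 + -(2 * n + 2 : ℝ)) * δ ^ (-(1 - θ)) *
          B ^ (-(2 * n + 1 + θ)) := by ring
      _ = _ := by
          rw [← Real.rpow_add hδ, ← Real.rpow_add hδ, ← Real.rpow_add hδ]
          ring_nf

/-- In the derivative, `f y - potExt Ω f x` is itself a weighted mean of `f y - f z`. This yields a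
double integral with two normalizers, each contributing `κ⁻¹ δ^(n+2)`, and `rpow_mul_rpow_le`
collects the powers. -/
lemma enorm_fderiv_potExt_le (hθ₁ : θ < 1) (hσ : UpperRegular Ω C₁) (hF : (frontier Ω).Nonempty)
    (hf : AEStronglyMeasurable f (surfaceMeasure Ω))
    (hi : ∀ x ∉ frontier Ω, Integrable (fun y => powKer (x - y) • f y) (surfaceMeasure Ω))
    (hZ : ∀ x ∉ frontier Ω, 0 < pot Ω (fun _ => (1 : ℝ)) x) {x : Amb n} (hx : x ∉ frontier Ω)
    {κ : ℝ} (hκ : 0 < κ)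
    (hZx : κ * (infDist x (frontier Ω) ^ (n + 2))⁻¹ ≤ pot Ω (fun _ => (1 : ℝ)) x) :
    ‖fderiv ℝ (potExt Ω f) x‖ₑ ≤ ENNReal.ofReal ((2 * n + 2) * (κ⁻¹ * κ⁻¹) *
      infDist x (frontier Ω) ^ θ) * diffPot θ Ω f x := by
  have hδ := infDist_pos_of_notMem hF hx
  set δ := infDist x (frontier Ω)
  set Z := pot Ω (fun _ => (1 : ℝ)) x
  have hZ0 : 0 < Z := hZ x hx
  have hZi : Z⁻¹ ≤ κ⁻¹ * δ ^ (n + 2) := by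
    rw [← inv_inv (δ ^ (n + 2)), ← mul_inv]
    exact inv_anti₀ (by positivity) hZx
  rw [(hasFDerivAt_potExt hσ hF hf hi hZ hx).fderiv, enorm_smul, Real.enorm_of_nonneg (by positivity)]
  have h1 : ∀ᵐ y ∂(surfaceMeasure Ω),
      ‖(fderiv ℝ powKer (x - y)).smulRight (f y - potExt Ω f x)‖ₑ ≤
      ENNReal.ofReal ((2 * n + 2) * ‖x - y‖⁻¹ * powKer (x - y)) * (ENNReal.ofReal Z⁻¹ *
        ∫⁻ z, ENNReal.ofReal (powKer (x - z)) * ‖f z - f y‖ₑ ∂(surfaceMeasure Ω)) := by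
    filter_upwards [ae_mem_frontier Ω] with y hy
    rw [← ofReal_norm, ContinuousLinearMap.norm_smulRight_apply, ENNReal.ofReal_mul (norm_nonneg _),
      ofReal_norm (f y - potExt Ω f x), ← enorm_neg (f y - potExt Ω f x), neg_sub]
    exact mul_le_mul' (ENNReal.ofReal_le_ofReal (norm_fderiv_powKer_le
      (sub_ne_zero_of_notMem_frontier hx hy))) (enorm_potExt_sub_le hσ hF hx (hi x hx) hZ0 (f y))
  refine (mul_le_mul' (ENNReal.ofReal_le_ofReal hZi)
    ((enorm_integral_le_lintegral_enorm _).trans (lintegral_mono_ae h1))).trans ?_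
  rw [diffPot, ← lintegral_const_mul' _ _ ENNReal.ofReal_ne_top,
    ← lintegral_const_mul' _ _ ENNReal.ofReal_ne_top]
  refine lintegral_mono_ae ?_
  filter_upwards [ae_mem_frontier Ω] with y hy
  rw [← lintegral_const_mul' _ _ ENNReal.ofReal_ne_top,
    ← lintegral_const_mul' _ _ ENNReal.ofReal_ne_top,
    ← lintegral_const_mul' _ _ ENNReal.ofReal_ne_top,
    ← lintegral_const_mul' _ _ ENNReal.ofReal_ne_top]
  refine lintegral_mono_ae ?_
  filter_upwards [ae_mem_frontier Ω] with z hz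
  have hA : δ ≤ ‖x - y‖ := infDist_le_norm_sub hy
  have hB : δ ≤ ‖x - z‖ := infDist_le_norm_sub hz
  have hk1 := powKer_nonneg (x - y)
  have hk2 := powKer_nonneg (x - z)
  rw [← ofReal_norm, ← ENNReal.ofReal_mul hk2, ← ENNReal.ofReal_mul (by positivity),
    ← ENNReal.ofReal_mul (by positivity), ← ENNReal.ofReal_mul (by positivity),
    ← ENNReal.ofReal_mul (by positivity), ← ENNReal.ofReal_mul (by positivity)]
  refine ENNReal.ofReal_le_ofReal ?_
  have hnum := rpow_mul_rpow_le (n := n) hθ₁ hδ hA hB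
  rw [← powKer_eq_rpow, ← powKer_eq_rpow] at hnum
  calc κ⁻¹ * δ ^ (n + 2) * ((2 * n + 2) * ‖x - y‖⁻¹ * powKer (x - y) *
        (Z⁻¹ * (powKer (x - z) * ‖f z - f y‖)))
      ≤ κ⁻¹ * δ ^ (n + 2) * ((2 * n + 2) * ‖x - y‖⁻¹ * powKer (x - y) *
        (κ⁻¹ * δ ^ (n + 2) * (powKer (x - z) * ‖f z - f y‖))) := by gcongr
    _ = (2 * n + 2) * (κ⁻¹ * κ⁻¹) * (δ ^ (n + 2) * δ ^ (n + 2) *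
        (‖x - y‖⁻¹ * powKer (x - y) * powKer (x - z))) * ‖f z - f y‖ := by ring
    _ ≤ (2 * n + 2) * (κ⁻¹ * κ⁻¹) * (δ ^ θ * max ‖x - y‖ ‖x - z‖ ^ (-(2 * n + 1 + θ))) *
        ‖f z - f y‖ := by gcongr
    _ = _ := by ring

end Extension


/-! ### The gradient of the extension -/

section Gradient

variable {Ω : Set (Amb n)} {θ : ℝ} {C₁ C₂ : ℝ≥0} {f : Amb n → ℂ}

/-- The constant in `lintegral_max_rpow_le`. -/
def maxConst (n : ℕ) (θ : ℝ) : ℝ≥0∞ :=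
  volBall (n + 1) * ENNReal.ofReal ((1 + geomConst (n + 1 : ℕ) (n + θ)) * 2 ^ (n + θ))

/-- Inside the ball about `y` of half the distance the other point is far, so the integrand is
bounded there; outside, use the distance to `y`, whose power decays faster than the dimension. -/
lemma lintegral_max_rpow_le (hθ₀ : 0 < θ) {y z : Amb n} (hyz : y ≠ z) :
    ∫⁻ x, ENNReal.ofReal (max ‖x - y‖ ‖x - z‖ ^ (-(2 * n + 1 + θ))) ≤
      maxConst n θ * ENNReal.ofReal (dist y z ^ (-(n + θ))) := by
  have hn0 : (0 : ℝ) ≤ n := Nat.cast_nonneg n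
  have hρ := dist_pos.2 hyz
  set ρ := dist y z
  have hg := geomConst_nonneg ((n + 1 : ℕ) : ℝ) (β := n + θ) (by linarith)
  have hin : ∀ x ∈ ball y (ρ / 2), ENNReal.ofReal (max ‖x - y‖ ‖x - z‖ ^ (-(2 * n + 1 + θ))) ≤
      ENNReal.ofReal ((ρ / 2) ^ (-(2 * n + 1 + θ))) := fun x hx => by
    refine ENNReal.ofReal_le_ofReal (Real.rpow_le_rpow_of_nonpos (half_pos hρ) ?_ (by linarith))
    refine le_max_of_le_right ?_
    rw [← dist_eq_norm]
    have := dist_triangle_left y z x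
    have := mem_ball.1 hx
    linarith
  have hout : ∀ x ∈ (ball y (ρ / 2))ᶜ, ENNReal.ofReal (max ‖x - y‖ ‖x - z‖ ^ (-(2 * n + 1 + θ))) ≤
      ENNReal.ofReal (dist x y ^ (-(2 * n + 1 + θ))) := fun x hx => by
    refine ENNReal.ofReal_le_ofReal (Real.rpow_le_rpow_of_nonpos ?_ ?_ (by linarith))
    · exact (half_pos hρ).trans_le (not_lt.1 hx)
    · rw [dist_eq_norm]
      exact le_max_left _ _
  rw [← lintegral_add_compl _ (measurableSet_ball (x := y) (ε := ρ / 2))]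
  have h2 := lintegral_compl_ball_rpow_le (μ := (volume : Measure (Amb n))) (N := n + 1) (p := y)
    (fun r hr => (volume_ball_eq y hr).le) (γ := 2 * n + 1 + θ) (by push_cast; linarith)
    (half_pos hρ)
  refine (add_le_add ((setLIntegral_mono' measurableSet_ball hin).trans (le_of_eq
    (setLIntegral_const _ _))) ((setLIntegral_mono' measurableSet_ball.compl hout).trans h2)).trans
    (le_of_eq ?_)
  rw [volume_ball_eq y (half_pos hρ), mul_left_comm, ← mul_add, ← ENNReal.ofReal_mul (by positivity),
    show (2 * n + 1 + θ - (n + 1 : ℕ) : ℝ) = n + θ by push_cast; ring,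
    show ((n + 1 : ℕ) - (2 * n + 1 + θ) : ℝ) = -(n + θ) by push_cast; ring,
    ← ENNReal.ofReal_add (by positivity) (by positivity), maxConst, mul_assoc,
    ← ENNReal.ofReal_mul (by positivity)]
  congr 2
  rw [← Real.rpow_natCast (ρ / 2), ← Real.rpow_add (half_pos hρ),
    show -(2 * n + 1 + θ) + (n + 1 : ℕ) = -(n + θ : ℝ) by push_cast; ring,
    Real.div_rpow hρ.le zero_le_two, Real.rpow_neg zero_le_two, div_inv_eq_mul]
  ring

lemma measurable_diff (hf : Measurable f) : Measurable fun p : (Amb n × Amb n) × Amb n =>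
    ‖f p.2 - f p.1.2‖ₑ *
      ENNReal.ofReal (max ‖p.1.1 - p.1.2‖ ‖p.1.1 - p.2‖ ^ (-(2 * n + 1 + θ))) := by
  have h1 : Measurable fun p : (Amb n × Amb n) × Amb n => f p.2 - f p.1.2 :=
    (hf.comp measurable_snd).sub (hf.comp (measurable_snd.comp measurable_fst))
  exact h1.enorm.mul (by fun_prop)

/-- Integrating the double integral `diffPot` over the whole space gives the Slobodeckij norm. -/
lemma lintegral_diffPot_le (hθ₀ : 0 < θ) (hσ : UpperRegular Ω C₁) (hf : Measurable f) :
    ∫⁻ x, diffPot θ Ω f x ≤ maxConst n θ * slobodeckijNorm θ Ω f := by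
  have hloc := hσ.isLocallyFiniteMeasure
  have hm := measurable_diff (θ := θ) hf
  set σ := surfaceMeasure Ω
  have hC : maxConst n θ ≠ ⊤ := by unfold maxConst; finiteness
  set H : Amb n → Amb n → Amb n → ℝ≥0∞ := fun x y z =>
    ‖f z - f y‖ₑ * ENNReal.ofReal (max ‖x - y‖ ‖x - z‖ ^ (-(2 * n + 1 + θ)))
  have hA : AEMeasurable (Function.uncurry fun x y => ∫⁻ z, H x y z ∂σ) (volume.prod σ) :=
    (Measurable.lintegral_prod_right' (ν := σ) hm).aemeasurable
  calc ∫⁻ x, diffPot θ Ω f x = ∫⁻ x, ∫⁻ y, ∫⁻ z, H x y z ∂σ ∂σ := rfl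
    _ = ∫⁻ y, ∫⁻ x, (∫⁻ z, H x y z ∂σ) ∂volume ∂σ := lintegral_lintegral_swap hA
    _ = ∫⁻ y, ∫⁻ z, ∫⁻ x, H x y z ∂volume ∂σ ∂σ := by
        refine lintegral_congr fun y => lintegral_lintegral_swap ?_
        exact (hm.comp ((measurable_fst.prodMk measurable_const).prodMk
          measurable_snd : Measurable fun q : Amb n × Amb n => ((q.1, y), q.2))).aemeasurable
    _ ≤ ∫⁻ y, ∫⁻ z, maxConst n θ * (‖f z - f y‖ₑ / edist z y ^ (n + θ : ℝ)) ∂σ ∂σ := by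
        refine lintegral_mono fun y => lintegral_mono fun z => ?_
        simp only [H]
        rw [lintegral_const_mul' _ _ (enorm_ne_top (x := f z - f y))]
        rcases eq_or_ne z y with rfl | hzy
        · simp
        rw [enorm_div_edist hzy, ENNReal.ofReal_mul (norm_nonneg _), ofReal_norm, mul_left_comm,
          dist_comm]
        exact mul_le_mul' le_rfl (lintegral_max_rpow_le hθ₀ hzy.symm)
    _ = _ := by
        simp_rw [lintegral_const_mul' _ _ hC]
        rfl

/-- All distances to boundary points at most double when passing from a point of a Whitney ball to
its centre, so the kernel changes by a bounded factor. This is the Harnack-type property that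
permits `q = ∞`. -/
lemma diffPot_le (hθ₀ : 0 < θ) (hF : (frontier Ω).Nonempty) {x w : Amb n} (hx : x ∉ frontier Ω)
    (hw : w ∈ ball x (infDist x (frontier Ω) / 2)) :
    diffPot θ Ω f w ≤ ENNReal.ofReal (2 ^ (2 * n + 1 + θ)) * diffPot θ Ω f x := by
  have hδ := infDist_pos_of_notMem hF hx
  have hn0 : (0 : ℝ) ≤ n := Nat.cast_nonneg n
  unfold diffPot
  rw [← lintegral_const_mul' _ _ ENNReal.ofReal_ne_top]
  refine lintegral_mono_ae ?_
  filter_upwards [ae_mem_frontier Ω] with y hy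
  rw [← lintegral_const_mul' _ _ ENNReal.ofReal_ne_top]
  refine lintegral_mono_ae ?_
  filter_upwards [ae_mem_frontier Ω] with z hz
  rw [mul_left_comm]
  refine mul_le_mul' le_rfl ?_
  rw [← ENNReal.ofReal_mul (by positivity)]
  refine ENNReal.ofReal_le_ofReal ?_
  have h1 := norm_sub_le_two_mul hy hw
  have h2 := norm_sub_le_two_mul hz hw
  have h3 : max ‖x - y‖ ‖x - z‖ ≤ 2 * max ‖w - y‖ ‖w - z‖ := by
    rw [mul_max_of_nonneg _ _ zero_le_two]
    exact max_le_max h1 h2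
  have h4 : 0 < max ‖x - y‖ ‖x - z‖ :=
    lt_max_of_lt_left (hδ.trans_le (infDist_le_norm_sub hy))
  have h5 : 0 < max ‖w - y‖ ‖w - z‖ := by linarith
  calc max ‖w - y‖ ‖w - z‖ ^ (-(2 * n + 1 + θ))
      = 2 ^ (2 * n + 1 + θ) * (2 * max ‖w - y‖ ‖w - z‖) ^ (-(2 * n + 1 + θ)) := by
        rw [Real.mul_rpow zero_le_two h5.le, ← mul_assoc, ← Real.rpow_add two_pos, add_neg_cancel,
          Real.rpow_zero, one_mul]
    _ ≤ _ := mul_le_mul_of_nonneg_left (Real.rpow_le_rpow_of_nonpos h4 h3 (by linarith))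
        (by positivity)

lemma rpow_infDist_le (hθ₀ : 0 < θ) (hθ₁ : θ < 1) {x w : Amb n}
    (hw : w ∈ ball x (infDist x (frontier Ω) / 2)) :
    infDist w (frontier Ω) ^ θ ≤ 2 * infDist x (frontier Ω) ^ θ := by
  have h0 : 0 ≤ infDist x (frontier Ω) := infDist_nonneg
  have h1 : infDist w (frontier Ω) ≤ infDist x (frontier Ω) + dist w x :=
    infDist_le_infDist_add_dist
  have h2 := mem_ball.1 hw
  calc infDist w (frontier Ω) ^ θ ≤ (2 * infDist x (frontier Ω)) ^ θ :=
        Real.rpow_le_rpow infDist_nonneg (by linarith) hθ₀.le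
    _ = 2 ^ θ * infDist x (frontier Ω) ^ θ := Real.mul_rpow zero_le_two h0
    _ ≤ _ := by
        gcongr
        calc (2 : ℝ) ^ θ ≤ 2 ^ (1 : ℝ) := Real.rpow_le_rpow_of_exponent_le one_le_two hθ₁.le
          _ = 2 := Real.rpow_one 2

/-- The factor `δ^θ` of the gradient bound cancels the weight exactly, leaving an unweighted
integral. -/
lemma avNorm_top_le (hΩ : IsOpen Ω) (hF : (frontier Ω).Nonempty)
    {G : Amb n → EuclideanSpace ℂ (Fin (n + 1))} {T : Amb n → ℝ≥0∞}
    (h : ∀ x ∈ Ω, ∀ w ∈ ball x (infDist x (frontier Ω) / 2),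
      ‖G w‖ₑ ≤ ENNReal.ofReal (infDist x (frontier Ω) ^ θ) * T x) :
    avNorm θ ⊤ Ω G ≤ ∫⁻ x in Ω, T x := by
  refine setLIntegral_mono' hΩ.measurableSet fun x hx => ?_
  have hδ := infDist_frontier_pos hΩ hF hx
  have h1 : eLpNorm G ⊤ (ProbabilityTheory.cond volume (ball x (infDist x (frontier Ω) / 2))) ≤
      ENNReal.ofReal (infDist x (frontier Ω) ^ θ) * T x := by
    rw [eLpNorm_exponent_top]
    refine essSup_le_of_ae_le _ (Measure.ae_smul_measure ?_ _)
    filter_upwards [ae_restrict_mem measurableSet_ball] with w hw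
    exact h x hx w hw
  refine (mul_le_mul' h1 le_rfl).trans (le_of_eq ?_)
  rw [mul_right_comm, ← ENNReal.ofReal_mul (by positivity), ← Real.rpow_add hδ, add_neg_cancel,
    Real.rpow_zero, ENNReal.ofReal_one, one_mul]

/-- The constant in the gradient bound for `potExt`. -/
def gradConst (n : ℕ) (θ : ℝ) (C₂ : ℝ≥0) : ℝ :=
  (2 * n + 2) * ((C₂ / 4 ^ (n + 1) : ℝ)⁻¹ * (C₂ / 4 ^ (n + 1) : ℝ)⁻¹) * 2 * 2 ^ (2 * n + 1 + θ)

lemma notMem_frontier_of_mem (hΩ : IsOpen Ω) {x : Amb n} (hx : x ∈ Ω) : x ∉ frontier Ω := fun h => by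
  rw [hΩ.frontier_eq] at h
  exact h.2 hx

lemma LowerRegular.pot_pos {R : ℝ} (hσ' : LowerRegular Ω C₂ R) (hR : 0 < R) (hC₂ : 0 < C₂)
    (hσ : UpperRegular Ω C₁) (hF : (frontier Ω).Nonempty) {x : Amb n} (hx : x ∉ frontier Ω) :
    0 < pot Ω (fun _ => (1 : ℝ)) x := by
  obtain ⟨p, hp⟩ := hF
  have h1 := hσ' p hp R hR le_rfl
  have h0 : 0 < (C₂ : ℝ≥0∞) * ENNReal.ofReal (R ^ n) :=
    ENNReal.mul_pos (by exact_mod_cast hC₂.ne') (ENNReal.ofReal_pos.2 (by positivity)).ne'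
  have hi := integrable_powKer hσ ⟨p, hp⟩ hx
  simp only [pot, smul_eq_mul, mul_one]
  rw [integral_pos_iff_support_of_nonneg (fun y => powKer_nonneg _) hi]
  refine (h0.trans_le h1).trans_le ((measure_mono (subset_univ _)).trans (le_of_eq ?_))
  refine measure_congr ?_
  filter_upwards [ae_mem_frontier Ω] with y hy
  refine propext ⟨fun _ => ?_, fun _ => trivial⟩
  have := norm_pos_iff.2 (sub_ne_zero_of_notMem_frontier hx hy)
  have h2 : 0 < powKer (x - y) := by unfold powKer; positivity
  exact h2.ne'

lemma enorm_fderiv_potExt_le_of_mem_ball (hθ₀ : 0 < θ) (hθ₁ : θ < 1) (hσ : UpperRegular Ω C₁)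
    {R : ℝ} (hσ' : LowerRegular Ω C₂ R) (hR : 0 < R) (hC₂ : 0 < C₂) (hF : (frontier Ω).Nonempty)
    (hf : AEStronglyMeasurable f (surfaceMeasure Ω))
    (hi : ∀ x ∉ frontier Ω, Integrable (fun y => powKer (x - y) • f y) (surfaceMeasure Ω))
    {x w : Amb n} (hx : x ∉ frontier Ω) (hw : w ∈ ball x (infDist x (frontier Ω) / 2))
    (hwR : infDist w (frontier Ω) ≤ R) :
    ‖fderiv ℝ (potExt Ω f) w‖ₑ ≤ ENNReal.ofReal (infDist x (frontier Ω) ^ θ) *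
      (ENNReal.ofReal (gradConst n θ C₂) * diffPot θ Ω f x) := by
  have hδ := infDist_pos_of_notMem hF hx
  have hwF := notMem_frontier_of_mem_ball hw
  have hκ : (0 : ℝ) < C₂ / 4 ^ (n + 1) := div_pos (by exact_mod_cast hC₂) (by positivity)
  refine (enorm_fderiv_potExt_le hθ₁ hσ hF hf hi (fun x hx => hσ'.pot_pos hR hC₂ hσ hF hx) hwF hκ
    (le_pot_one hσ hσ' hF hwF hwR)).trans ?_
  refine (mul_le_mul' (ENNReal.ofReal_le_ofReal (mul_le_mul_of_nonneg_left
    (rpow_infDist_le hθ₀ hθ₁ hw) (by positivity))) (diffPot_le hθ₀ hF hx hw)).trans (le_of_eq ?_)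
  rw [← mul_assoc, ← mul_assoc (ENNReal.ofReal (infDist x (frontier Ω) ^ θ)),
    ← ENNReal.ofReal_mul (by positivity), ← ENNReal.ofReal_mul (p := infDist x (frontier Ω) ^ θ) (by positivity)]
  congr 2
  rw [gradConst]
  ring

lemma contDiffOn_potExt (hσ : UpperRegular Ω C₁) (hF : (frontier Ω).Nonempty)
    (hf : AEStronglyMeasurable f (surfaceMeasure Ω))
    (hi : ∀ x ∉ frontier Ω, Integrable (fun y => powKer (x - y) • f y) (surfaceMeasure Ω))
    (hZ : ∀ x ∉ frontier Ω, 0 < pot Ω (fun _ => (1 : ℝ)) x) :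
    ContDiffOn ℝ 1 (potExt Ω f) (frontier Ω)ᶜ := by
  have h1 := contDiffOn_pot (Ω := Ω) (g := fun _ => (1 : ℝ)) hF aestronglyMeasurable_const
    fun x hx => by simpa using integrable_powKer hσ hF hx
  exact (h1.inv fun x hx => (hZ x hx).ne').smul (contDiffOn_pot hF hf hi)

lemma enorm_gradVec_le (u : Amb n → ℂ) (x : Amb n) :
    ‖gradVec u x‖ₑ ≤ ENNReal.ofReal (n + 1) * ‖fderiv ℝ u x‖ₑ := by
  have := enorm_le_enorm_gradMap (gradVec u x)
  rwa [gradMap_gradVec] at this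

lemma measurable_diffInt (hσ : UpperRegular Ω C₁) (hf : Measurable f) :
    Measurable (diffInt θ Ω f) := by
  have hloc := hσ.isLocallyFiniteMeasure
  refine Measurable.lintegral_prod_right' (f := fun p : Amb n × Amb n =>
    ‖f p.2 - f p.1‖ₑ / edist p.2 p.1 ^ (n + θ : ℝ)) ?_
  have h1 : Measurable fun p : Amb n × Amb n => f p.2 - f p.1 :=
    (hf.comp measurable_snd).sub (hf.comp measurable_fst)
  exact h1.enorm.div ((measurable_snd.edist measurable_fst).pow_const _)

lemma ae_diffInt_ne_top (hσ : UpperRegular Ω C₁) (hf : Measurable f)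
    (hS : slobodeckijNorm θ Ω f ≠ ⊤) : ∀ᵐ x ∂(surfaceMeasure Ω), diffInt θ Ω f x ≠ ⊤ :=
  (ae_lt_top (measurable_diffInt hσ hf) hS).mono fun _ hx => hx.ne

end Gradient


/-! ### The trace of the extension -/

section Trace

variable {Ω : Set (Amb n)} {θ : ℝ} {C₁ C₂ : ℝ≥0} {f : Amb n → ℂ}

lemma HasTrace.congr_right {u f' : Amb n → ℂ} (h : HasTrace Ω u f)
    (hf : f =ᵐ[surfaceMeasure Ω] f') : HasTrace Ω u f' := by
  obtain ⟨hloc, G, hG, φ, hφ, hlim⟩ := h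
  refine ⟨hloc.congr hf, G, hG, φ, hφ, fun R => ⟨(hlim R).1, (hlim R).2.1, ?_⟩⟩
  refine (hlim R).2.2.congr fun k => lintegral_congr_ae ?_
  exact (ae_restrict_of_ae hf).mono fun x hx => by simp only [hx]

lemma measurable_indicator_of_continuousOn {E : Type*} [TopologicalSpace E] [Zero E]
    [MeasurableSpace E] [BorelSpace E] (hΩ : IsOpen Ω) {g : Amb n → E} (hg : ContinuousOn g Ω) :
    Measurable (Ω.indicator g) := by
  classical
  rw [← Set.piecewise_eq_indicator]
  exact hg.measurable_piecewise continuousOn_const hΩ.measurableSet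

/-- A function that agrees with the normalized potential of `f` near the boundary has trace `f`. -/
lemma IsTransversal.hasTrace_of_eq_potExt {e : Amb n → Amb n} {c L s₀ : ℝ}
    (H : IsTransversal Ω e c L s₀) (hΩ : IsOpen Ω) (hF : (frontier Ω).Nonempty)
    (hθ₀ : 0 < θ) (hθ₁ : θ < 1) (hσ : UpperRegular Ω C₁) {R : ℝ} (hσ' : LowerRegular Ω C₂ R)
    (hR : 0 < R) (hC₂ : 0 < C₂) (hf : Measurable f) (hS : slobodeckijNorm θ Ω f ≠ ⊤)
    {u : Amb n → ℂ} (hu : ContDiffOn ℝ 1 u Ω) (hav : avNorm θ ⊤ Ω (gradVec u) ≠ ⊤)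
    (heq : ∀ w ∈ Ω, infDist w (frontier Ω) < R → u w = potExt Ω f w) : HasTrace Ω u f := by
  have hc := H.c_pos
  have hs0 := H.s_pos
  have hL := H.L_nonneg
  have hκ : (0 : ℝ) < C₂ / 4 ^ (n + 1) := div_pos (by exact_mod_cast hC₂) (by positivity)
  set κ : ℝ := C₂ / 4 ^ (n + 1)
  set u₀ := Ω.indicator u
  set G₀ := Ω.indicator (gradVec u)
  have hum : Measurable u₀ := measurable_indicator_of_continuousOn hΩ hu.continuousOn
  have hGm : Measurable G₀ := measurable_indicator_of_continuousOn hΩ (continuousOn_gradVec hΩ hu)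
  have hu₀ : u =ᵐ[volume.restrict Ω] u₀ := (indicator_ae_eq_restrict hΩ.measurableSet).symm
  have hG₀ : gradVec u =ᵐ[volume.restrict Ω] G₀ :=
    (indicator_ae_eq_restrict hΩ.measurableSet).symm
  have hw := (hasWeakGradient_of_contDiffOn hΩ hu).congr hΩ hu₀ hG₀
  have hW : wInt θ Ω G₀ ≠ ⊤ := by
    refine ((wInt_le_avNorm_one hΩ hF hθ₀ hθ₁ hGm).trans_lt (ENNReal.mul_lt_top (by finiteness)
      ((avNorm_mono_exponent hΩ hF le_top hGm.aestronglyMeasurable).trans_lt ?_))).ne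
    rw [← avNorm_congr hΩ ⊤ hG₀]
    exact hav.lt_top
  -- Some trace exists because the averaged norm is finite. It remains to see that the averages
  -- converge pointwise to `f` itself.
  obtain ⟨f', hf'⟩ := H.exists_hasTrace hΩ hF hσ hθ₀ hw hum hGm hW
  have hlim := H.ae_tendsto_tr_of_hasTrace hΩ hF hσ hθ₀ hw hum hGm hW hf'
  refine (hf'.congr hΩ hu₀.symm).congr_right ?_
  filter_upwards [hlim, ae_diffInt_ne_top hσ hf hS, ae_mem_frontier Ω] with x hx hfin hxF
  refine tendsto_nhds_unique hx ?_
  set s : ℕ → ℝ := fun m => s₀ * 2 ^ (-(m : ℤ))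
  have hsp : ∀ m, 0 < s m := fun m => by positivity
  have hsle : ∀ m, s m ≤ s₀ := fun m => mul_le_of_le_one_right hs0.le
    (zpow_le_one_of_nonpos₀ one_le_two (by simp))
  have hs : Tendsto s atTop (𝓝 0) := by
    have : Tendsto (fun m : ℕ => s₀ * (2⁻¹ : ℝ) ^ m) atTop (𝓝 (s₀ * 0)) :=
      (tendsto_pow_atTop_nhds_zero_of_lt_one (by norm_num) (by norm_num)).const_mul _
    rw [mul_zero] at this
    refine this.congr fun m => ?_
    simp [s]
  have hls : Tendsto (fun m => (L + 1) * s m) atTop (𝓝 0) := by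
    simpa using hs.const_mul (L + 1)
  -- The averaging balls approach `x` nontangentially: their points are within `(L+1)s` of `x` and
  -- at least `c s / 2` from the boundary.
  set Λ : ℝ := 2 * (L + 1) / c
  have hΛ : 0 ≤ Λ := by positivity
  set D := (diffInt θ Ω f x).toReal
  -- Where `diffInt` is finite, as it is almost everywhere, the error of the average is of order
  -- `s^θ`.
  have hbound : ∀ᶠ m in atTop, ‖tr Ω e c u₀ (s m) x - f x‖ ≤
      κ⁻¹ * (1 + Λ) ^ (n + θ) * ((L + 1) * s m) ^ θ * D := by
    filter_upwards [hls.eventually (gt_mem_nhds hR)] with m hm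
    rw [H.tr_eq hΩ hF (frontier_subset_closure' hxF) (hsp m) (hsle m)]
    refine norm_mol_sub_le hum.stronglyMeasurable _ _ fun v hv => ?_
    set w := x + s m • e x + (c * s m) • v
    have hcs : 0 < c * s m := mul_pos hc (hsp m)
    have hwb : w ∈ ball (x + s m • e x) (c * s m / 2) := by
      rw [mem_ball, dist_eq_norm, add_sub_cancel_left, norm_smul, Real.norm_of_nonneg hcs.le]
      nlinarith
    have h1 := H.infDist_ge hΩ hF (frontier_subset_closure' hxF) (hsp m) (hsle m)
      (ball_subset_closedBall hwb)
    have h2 := H.dist_le_of_mem (hsp m) hwb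
    have hwΩ : w ∈ Ω := H.ball_subset (frontier_subset_closure' hxF) (hsp m) (hsle m)
      (ball_subset_ball (by linarith) hwb)
    have hwF := notMem_frontier_of_mem hΩ hwΩ
    have h3 : infDist w (frontier Ω) ≤ dist w x := infDist_le_dist_of_mem hxF
    have h4 : dist w x ≤ Λ * infDist w (frontier Ω) := by
      refine h2.le.trans ?_
      calc (L + 1) * s m = Λ * (c * s m / 2) := by simp only [Λ]; field_simp
        _ ≤ _ := by gcongr
    have h5 := enorm_potExt_sub_le_diffInt hθ₀ hθ₁ hσ hF hxF hwF
      (integrable_powKer_smul hθ₀ hθ₁ hσ hF hf.aestronglyMeasurable hxF hfin hwF) hκ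
      (le_pot_one hσ hσ' hF hwF (by linarith)) hΛ h4
    have h6 : u₀ w = potExt Ω f w := by
      rw [← heq w hwΩ (by linarith)]
      exact indicator_of_mem hwΩ _
    have h8 : 0 ≤ infDist w (frontier Ω) := infDist_nonneg
    rw [h6]
    rw [← ENNReal.ofReal_toReal hfin, ← ofReal_norm, ← ENNReal.ofReal_mul (by positivity),
      ENNReal.ofReal_le_ofReal_iff (by positivity)] at h5
    refine h5.trans ?_
    gcongr
    linarith
  rw [tendsto_iff_norm_sub_tendsto_zero]
  refine squeeze_zero' (Eventually.of_forall fun m => norm_nonneg _) hbound ?_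
  have h7 : Tendsto (fun m => ((L + 1) * s m) ^ θ) atTop (𝓝 0) := by
    have := hls.rpow_const (p := θ) (Or.inr hθ₀.le)
    rwa [Real.zero_rpow hθ₀.ne'] at this
  simpa using (h7.const_mul (κ⁻¹ * (1 + Λ) ^ (n + θ))).mul_const D

/-- The constant of the extension theorem for unbounded boundaries. -/
def extConst (n : ℕ) (θ : ℝ) (C₂ : ℝ≥0) : ℝ≥0∞ :=
  ENNReal.ofReal (n + 1) * (ENNReal.ofReal (gradConst n θ C₂) * maxConst n θ)

lemma extConst_ne_top (n : ℕ) (θ : ℝ) (C₂ : ℝ≥0) : extConst n θ C₂ ≠ ⊤ := by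
  unfold extConst maxConst; finiteness

lemma exists_diffInt_ne_top (hσ : UpperRegular Ω C₁) {R : ℝ} (hσ' : LowerRegular Ω C₂ R)
    (hR : 0 < R) (hC₂ : 0 < C₂) (hF : (frontier Ω).Nonempty) (hf : Measurable f)
    (hS : slobodeckijNorm θ Ω f ≠ ⊤) : ∃ x ∈ frontier Ω, diffInt θ Ω f x ≠ ⊤ := by
  obtain ⟨p, hp⟩ := hF
  have h0 : 0 < (C₂ : ℝ≥0∞) * ENNReal.ofReal (R ^ n) :=
    ENNReal.mul_pos (by exact_mod_cast hC₂.ne') (ENNReal.ofReal_pos.2 (by positivity)).ne'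
  have hne : surfaceMeasure Ω ≠ 0 := fun h => by
    have := h0.trans_le (hσ' p hp R hR le_rfl)
    simp [h] at this
  have : (ae (surfaceMeasure Ω)).NeBot := ae_neBot.2 hne
  exact ((ae_mem_frontier Ω).and (ae_diffInt_ne_top hσ hf hS)).exists

/-- Lower regularity at every radius gives the gradient bound at every distance from the boundary,
so the potential itself is the extension. -/
theorem IsTransversal.exists_extension_of_unbounded {e : Amb n → Amb n} {c L s₀ : ℝ}
    (H : IsTransversal Ω e c L s₀) (hΩ : IsOpen Ω) (hF : (frontier Ω).Nonempty)
    (hθ₀ : 0 < θ) (hθ₁ : θ < 1) (hσ : UpperRegular Ω C₁) (hσ' : ∀ R, LowerRegular Ω C₂ R)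
    (hC₂ : 0 < C₂) (hf : Measurable f) (hS : slobodeckijNorm θ Ω f ≠ ⊤) :
    ∃ u, ContDiffOn ℝ 1 u Ω ∧ HasTrace Ω u f ∧
      avNorm θ ⊤ Ω (gradVec u) ≤ extConst n θ C₂ * slobodeckijNorm θ Ω f := by
  obtain ⟨p, hp, hfin⟩ := exists_diffInt_ne_top hσ (hσ' 1) one_pos hC₂ hF hf hS
  have hfm := hf.aestronglyMeasurable (μ := surfaceMeasure Ω)
  have hi := fun x (hx : x ∉ frontier Ω) =>
    integrable_powKer_smul hθ₀ hθ₁ hσ hF hfm hp hfin hx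
  have hu : ContDiffOn ℝ 1 (potExt Ω f) Ω := (contDiffOn_potExt hσ hF hfm hi
    fun x hx => (hσ' 1).pot_pos one_pos hC₂ hσ hF hx).mono fun x hx => notMem_frontier_of_mem hΩ hx
  have hav : avNorm θ ⊤ Ω (gradVec (potExt Ω f)) ≤ extConst n θ C₂ * slobodeckijNorm θ Ω f := by
    refine (avNorm_top_le (T := fun x => ENNReal.ofReal (n + 1) *
      (ENNReal.ofReal (gradConst n θ C₂) * diffPot θ Ω f x)) hΩ hF fun x hx w hw => ?_).trans ?_
    · refine (enorm_gradVec_le _ w).trans ?_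
      rw [mul_left_comm]
      have h0 : 0 < infDist w (frontier Ω) := infDist_pos_of_notMem hF (notMem_frontier_of_mem_ball hw)
      exact mul_le_mul' le_rfl (enorm_fderiv_potExt_le_of_mem_ball hθ₀ hθ₁ hσ (hσ' _) h0 hC₂ hF hfm hi
        (notMem_frontier_of_mem hΩ hx) hw le_rfl)
    · rw [lintegral_const_mul' _ _ ENNReal.ofReal_ne_top,
        lintegral_const_mul' _ _ ENNReal.ofReal_ne_top, extConst, mul_assoc, mul_assoc]
      exact mul_le_mul' le_rfl (mul_le_mul' le_rfl ((setLIntegral_le_lintegral _ _).trans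
        (lintegral_diffPot_le hθ₀ hσ hf)))
  exact ⟨potExt Ω f, hu, H.hasTrace_of_eq_potExt hΩ hF hθ₀ hθ₁ hσ (hσ' 1) one_pos hC₂ hf hS hu
    (hav.trans_lt (ENNReal.mul_lt_top (extConst_ne_top _ _ _).lt_top hS.lt_top)).ne
    fun _ _ _ => rfl, hav⟩

/-- A bump function at unit scale. -/
def unitBump (n : ℕ) : ContDiffBump (0 : Amb n) := ⟨1, 2, one_pos, one_lt_two⟩

lemma exists_bound_fderiv_unitBump (n : ℕ) :
    ∃ B : ℝ, 0 ≤ B ∧ ∀ y, ‖fderiv ℝ (unitBump n) y‖ ≤ B := by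
  have h := ((unitBump n).contDiff (n := 1)).continuous_fderiv (by simp)
  obtain ⟨B, hB⟩ := ((unitBump n).hasCompactSupport.fderiv ℝ).exists_bound_of_continuous h
  exact ⟨B, (norm_nonneg _).trans (hB 0), hB⟩

lemma enorm_clm_add_le (S T : Amb n →L[ℝ] ℂ) : ‖S + T‖ₑ ≤ ‖S‖ₑ + ‖T‖ₑ := by
  rw [← ofReal_norm, ← ofReal_norm, ← ofReal_norm,
    ← ENNReal.ofReal_add (norm_nonneg _) (norm_nonneg _)]
  exact ENNReal.ofReal_le_ofReal (norm_add_le _ _)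

/-- A good base point for the oscillation of `f`. -/
lemma exists_diffInt_le (hσ : UpperRegular Ω C₁) {ρ R : ℝ} (hρ : 0 < ρ) (hρR : ρ ≤ R)
    (hσ' : LowerRegular Ω C₂ R) (hC₂ : 0 < C₂) (hF : (frontier Ω).Nonempty)
    [IsFiniteMeasure (surfaceMeasure Ω)] (hf : Measurable f) :
    ∃ p ∈ frontier Ω, C₂ * ENNReal.ofReal (ρ ^ n) * diffInt θ Ω f p ≤ slobodeckijNorm θ Ω f := by
  obtain ⟨z, hz⟩ := hF
  have h0 : 0 < (C₂ : ℝ≥0∞) * ENNReal.ofReal (ρ ^ n) :=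
    ENNReal.mul_pos (by exact_mod_cast hC₂.ne') (ENNReal.ofReal_pos.2 (by positivity)).ne'
  have h1 : C₂ * ENNReal.ofReal (ρ ^ n) ≤ surfaceMeasure Ω univ :=
    (hσ' z hz ρ hρ hρR).trans (measure_mono (subset_univ _))
  have hne : surfaceMeasure Ω ≠ 0 := fun h => by
    have := h0.trans_le h1
    simp [h] at this
  obtain ⟨p, hp, hle⟩ := exists_notMem_null_le_laverage hne
    (measurable_diffInt (θ := θ) hσ hf).aemeasurable (ae_mem_frontier Ω)
  refine ⟨p, not_not.1 hp, ?_⟩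
  rw [laverage_eq] at hle
  exact (mul_le_mul' h1 hle).trans ENNReal.mul_div_le

/-- Lower regularity fails far from a bounded boundary, so the potential is blended into the
constant `f p` on an annulus of radius comparable to `ρ`. The base point `p` is chosen with
`diffInt` at most its mean, which pays for the derivative of the cut-off. -/
theorem exists_extension_of_bounded (n : ℕ) {θ : ℝ} (hθ₀ : 0 < θ) (hθ₁ : θ < 1) {C₂ : ℝ≥0}
    (hC₂ : 0 < C₂) : ∃ C : ℝ≥0, ∀ (Ω : Set (Amb n)) (e : Amb n → Amb n) (c L s₀ : ℝ),
    IsTransversal Ω e c L s₀ → IsOpen Ω → (frontier Ω).Nonempty → ∀ C₁, UpperRegular Ω C₁ →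
    ∀ ρ : ℝ, 0 < ρ → LowerRegular Ω C₂ (16 * ρ) →
    (∀ x ∈ frontier Ω, ∀ y ∈ frontier Ω, dist x y ≤ ρ) → ∀ f : Amb n → ℂ, Measurable f →
    slobodeckijNorm θ Ω f ≠ ⊤ → ∃ u, ContDiffOn ℝ 1 u Ω ∧ HasTrace Ω u f ∧
      avNorm θ ⊤ Ω (gradVec u) ≤ C * slobodeckijNorm θ Ω f := by
  obtain ⟨Cb, hCb0, hCb⟩ := exists_bound_fderiv_unitBump n
  have hκ : (0 : ℝ) < C₂ / 4 ^ (n + 1) := div_pos (by exact_mod_cast hC₂) (by positivity)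
  set κ : ℝ := C₂ / 4 ^ (n + 1)
  set Q : ℝ := Cb * κ⁻¹ * 5 ^ (n + θ)
  have hQ : 0 ≤ Q := by positivity
  set K : ℝ≥0∞ := extConst n θ C₂ + ENNReal.ofReal (n + 1) *
    (ENNReal.ofReal (Q * 8 ^ (n + 1)) * (C₂ : ℝ≥0∞)⁻¹ * volBall (n + 1))
  have hC₂' : (C₂ : ℝ≥0∞) ≠ 0 := by exact_mod_cast hC₂.ne'
  have hK : K ≠ ⊤ := by
    have := extConst_ne_top n θ C₂
    have : (C₂ : ℝ≥0∞)⁻¹ ≠ ⊤ := ENNReal.inv_ne_top.2 hC₂'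
    finiteness
  refine ⟨K.toNNReal, fun Ω e c L s₀ H hΩ hF C₁ hσ ρ hρ hσ' hdist f hf hS => ?_⟩
  rw [ENNReal.coe_toNNReal hK]
  have hR : 0 < 16 * ρ := by positivity
  have hfinite : IsFiniteMeasure (surfaceMeasure Ω) := by
    obtain ⟨z, hz⟩ := hF
    have h1 : surfaceMeasure Ω univ = surfaceMeasure Ω (ball z (2 * ρ)) := by
      refine measure_congr ?_
      filter_upwards [ae_mem_frontier Ω] with y hy
      refine propext ⟨fun _ => ?_, fun _ => trivial⟩
      exact (hdist y hy z hz).trans_lt (by linarith)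
    exact ⟨by rw [h1]; exact (hσ z _ (by positivity)).trans_lt (by finiteness)⟩
  obtain ⟨p, hp, hpS⟩ := exists_diffInt_le (θ := θ) hσ hρ (by linarith) hσ' hC₂ hF hf
  have hfin : diffInt θ Ω f p ≠ ⊤ := fun h => by
    rw [h, ENNReal.mul_top (mul_ne_zero hC₂' (ENNReal.ofReal_pos.2 (by positivity)).ne')] at hpS
    exact hS (top_le_iff.1 hpS)
  have hfm := hf.aestronglyMeasurable (μ := surfaceMeasure Ω)
  have hi := fun x (hx : x ∉ frontier Ω) =>
    integrable_powKer_smul hθ₀ hθ₁ hσ hF hfm hp hfin hx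
  have hZ := fun x (hx : x ∉ frontier Ω) => hσ'.pot_pos hR hC₂ hσ hF hx
  have hφ : ContDiffOn ℝ 1 (potExt Ω f) Ω := (contDiffOn_potExt hσ hF hfm hi hZ).mono
    fun x hx => notMem_frontier_of_mem hΩ hx
  set χ : Amb n → ℝ := fun x => unitBump n ((2 * ρ)⁻¹ • (x - p))
  have hχs : ContDiff ℝ 1 χ := (unitBump n).contDiff.comp
    ((contDiff_id.sub contDiff_const).const_smul _)
  have hχd : ∀ x, DifferentiableAt ℝ χ x := fun x => hχs.differentiable (by simp) x
  have hnorm : ∀ x, ‖(2 * ρ)⁻¹ • (x - p)‖ = dist x p / (2 * ρ) := fun x => by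
    rw [norm_smul, norm_inv, Real.norm_of_nonneg (by positivity), dist_eq_norm, inv_mul_eq_div]
  have hχ0 : ∀ x, 0 ≤ χ x := fun x => (unitBump n).nonneg
  have hχ1 : ∀ x, χ x ≤ 1 := fun x => (unitBump n).le_one
  have hχone : ∀ x, dist x p ≤ 2 * ρ → χ x = 1 := fun x hx =>
    (unitBump n).one_of_mem_closedBall (by
      rw [mem_closedBall_zero_iff, hnorm]
      exact (div_le_one (by positivity)).2 hx)
  have hχzero : ∀ x, 4 * ρ ≤ dist x p → χ x = 0 := fun x hx =>
    (unitBump n).zero_of_le_dist (by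
      rw [dist_zero_right, hnorm]
      change 2 ≤ _
      rw [le_div_iff₀ (by positivity)]
      linarith)
  have hχfd : ∀ x, ‖fderiv ℝ χ x‖ ≤ Cb / (2 * ρ) := fun x => by
    have h1 : HasFDerivAt χ ((fderiv ℝ (unitBump n) ((2 * ρ)⁻¹ • (x - p))).comp
        ((2 * ρ)⁻¹ • ContinuousLinearMap.id ℝ (Amb n))) x :=
      (((unitBump n).contDiff (n := 1)).differentiable (by simp) _).hasFDerivAt.comp x
        (((hasFDerivAt_id x).sub_const p).fun_const_smul _)
    rw [h1.fderiv, ContinuousLinearMap.comp_smul, ContinuousLinearMap.comp_id, norm_smul, norm_inv,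
      Real.norm_of_nonneg (by positivity), inv_mul_eq_div]
    gcongr
    exact hCb _
  have hχfd0 : ∀ x, dist x p ≤ 2 * ρ ∨ 4 * ρ ≤ dist x p → fderiv ℝ χ x = 0 := fun x hx => by
    rcases hx with hx | hx
    · refine IsLocalMax.fderiv_eq_zero (Eventually.of_forall fun y => ?_)
      rw [hχone x hx]
      exact hχ1 y
    · refine IsLocalMin.fderiv_eq_zero (Eventually.of_forall fun y => ?_)
      rw [hχzero x hx]
      exact hχ0 y
  set a := f p
  set u : Amb n → ℂ := fun x => χ x • (potExt Ω f x - a) + a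
  have hu : ContDiffOn ℝ 1 u Ω :=
    (hχs.contDiffOn.smul (hφ.sub contDiffOn_const)).add contDiffOn_const
  have hfd : ∀ w ∉ frontier Ω, fderiv ℝ u w = χ w • fderiv ℝ (potExt Ω f) w +
      (fderiv ℝ χ w).smulRight (potExt Ω f w - a) := fun w hw =>
    (((hχd w).hasFDerivAt.fun_smul ((hasFDerivAt_potExt hσ hF hfm hi hZ
      hw).differentiableAt.hasFDerivAt.sub_const a)).add_const a).fderiv
  set V : ℝ≥0∞ := ENNReal.ofReal (Q / ρ) * diffInt θ Ω f p
  set T : Amb n → ℝ≥0∞ := fun x => ENNReal.ofReal (n + 1) *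
    (ENNReal.ofReal (gradConst n θ C₂) * diffPot θ Ω f x + (ball p (8 * ρ)).indicator (fun _ => V) x)
  have hpt : ∀ x ∈ Ω, ∀ w ∈ ball x (infDist x (frontier Ω) / 2),
      ‖gradVec u w‖ₑ ≤ ENNReal.ofReal (infDist x (frontier Ω) ^ θ) * T x := fun x hx w hw => by
    have hxF := notMem_frontier_of_mem hΩ hx
    have hwF := notMem_frontier_of_mem_ball hw
    have hδx := infDist_pos_of_notMem hF hxF
    have hδw := infDist_pos_of_notMem hF hwF
    have hwp : infDist w (frontier Ω) ≤ dist w p := infDist_le_dist_of_mem hp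
    refine (enorm_gradVec_le u w).trans ?_
    simp only [T]
    rw [mul_left_comm, hfd w hwF]
    refine mul_le_mul' le_rfl ((enorm_clm_add_le _ _).trans ?_)
    rw [mul_add]
    refine add_le_add ?_ ?_
    · rw [enorm_smul, Real.enorm_of_nonneg (hχ0 w)]
      by_cases hfar : 4 * ρ ≤ dist w p
      · rw [hχzero w hfar, ENNReal.ofReal_zero, zero_mul]
        exact zero_le
      · refine (mul_le_of_le_one_left' (ENNReal.ofReal_le_one.2 (hχ1 w))).trans ?_
        exact enorm_fderiv_potExt_le_of_mem_ball hθ₀ hθ₁ hσ hσ' hR hC₂ hF hfm hi hxF hw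
          (by linarith)
    · by_cases hfar : dist w p ≤ 2 * ρ ∨ 4 * ρ ≤ dist w p
      · rw [hχfd0 w hfar, ContinuousLinearMap.zero_smulRight, ← ofReal_norm, norm_zero,
          ENNReal.ofReal_zero]
        exact zero_le
      push Not at hfar
      -- On the annulus `2ρ < dist w p < 4ρ` every boundary point is at distance at least `ρ`, so
      -- `w` is nontangential to `p` with `Λ = 4`, whence the base `5` in `Q`.
      have hlow : ρ ≤ infDist w (frontier Ω) := (le_infDist hF).2 fun y hy => by
        have := hdist y hy p hp
        have := dist_triangle w y p
        linarith
      have h1 : infDist x (frontier Ω) ≤ infDist w (frontier Ω) + dist x w :=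
        infDist_le_infDist_add_dist
      have h2 := mem_ball'.1 hw
      have hxp : x ∈ ball p (8 * ρ) := by
        rw [mem_ball]
        linarith [dist_triangle x w p]
      rw [indicator_of_mem hxp]
      have h5 := enorm_potExt_sub_le_diffInt hθ₀ hθ₁ hσ hF hp hwF (hi w hwF) hκ
        (le_pot_one hσ hσ' hF hwF (by linarith)) (Λ := 4) (by norm_num) (by linarith)
      rw [← ofReal_norm, ContinuousLinearMap.norm_smulRight_apply,
        ENNReal.ofReal_mul (norm_nonneg _), ofReal_norm (potExt Ω f w - a)]
      refine (mul_le_mul' (ENNReal.ofReal_le_ofReal (hχfd w)) (h5.trans (mul_le_mul'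
        (ENNReal.ofReal_le_ofReal (mul_le_mul_of_nonneg_left (rpow_infDist_le hθ₀ hθ₁ hw)
          (by positivity))) le_rfl))).trans (le_of_eq ?_)
      simp only [V]
      rw [← mul_assoc, ← mul_assoc (ENNReal.ofReal (infDist x (frontier Ω) ^ θ)),
        ← ENNReal.ofReal_mul (by positivity),
        ← ENNReal.ofReal_mul (p := infDist x (frontier Ω) ^ θ) (by positivity)]
      congr 2
      simp only [Q]
      rw [show (1 + 4 : ℝ) = 5 by norm_num]
      field_simp
  have hav : avNorm θ ⊤ Ω (gradVec u) ≤ K * slobodeckijNorm θ Ω f := by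
    refine (avNorm_top_le hΩ hF hpt).trans ((setLIntegral_le_lintegral _ _).trans ?_)
    simp only [T]
    rw [lintegral_const_mul' _ _ ENNReal.ofReal_ne_top, lintegral_add_right _
      (measurable_const.indicator measurableSet_ball), lintegral_const_mul' _ _
      ENNReal.ofReal_ne_top, lintegral_indicator measurableSet_ball, setLIntegral_const,
      volume_ball_eq p (by positivity : 0 < 8 * ρ)]
    simp only [K]
    rw [extConst, mul_add, add_mul]
    refine add_le_add ?_ ?_
    · rw [mul_assoc, mul_assoc]
      exact mul_le_mul' le_rfl (mul_le_mul' le_rfl (lintegral_diffPot_le hθ₀ hσ hf))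
    · rw [mul_assoc (ENNReal.ofReal ((n : ℝ) + 1))]
      refine mul_le_mul' le_rfl (le_trans (le_of_eq ?_) (mul_le_mul' le_rfl hpS))
      simp only [V]
      -- The cut-off term is constant on a ball of volume comparable to `ρ^(n+1)`; with the factor
      -- `1/ρ` this leaves `ρ^n` times `diffInt` at `p`, which the choice of `p` bounds by the
      -- Slobodeckij norm.
      calc ENNReal.ofReal (Q / ρ) * diffInt θ Ω f p *
            (volBall (n + 1) * ENNReal.ofReal ((8 * ρ) ^ (n + 1)))
          = ENNReal.ofReal (Q / ρ) * ENNReal.ofReal ((8 * ρ) ^ (n + 1)) * volBall (n + 1) *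
            diffInt θ Ω f p := by ring
        _ = ENNReal.ofReal (Q * 8 ^ (n + 1)) * ENNReal.ofReal (ρ ^ n) * volBall (n + 1) *
            diffInt θ Ω f p * ((C₂ : ℝ≥0∞)⁻¹ * C₂) := by
            rw [ENNReal.inv_mul_cancel hC₂' ENNReal.coe_ne_top, mul_one,
              ← ENNReal.ofReal_mul (by positivity), ← ENNReal.ofReal_mul (by positivity)]
            congr 3
            rw [mul_pow, pow_succ ρ]
            field_simp
        _ = _ := by ring
  refine ⟨u, hu, H.hasTrace_of_eq_potExt hΩ hF hθ₀ hθ₁ hσ (R := ρ)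
    (fun x hx s h0 hs => hσ' x hx s h0 (by linarith)) hρ hC₂ hf hS hu
    (hav.trans_lt (ENNReal.mul_lt_top hK.lt_top hS.lt_top)).ne fun w hw hwρ => ?_, hav⟩
  obtain ⟨y, hy, hwy⟩ := isClosed_frontier.exists_infDist_eq_dist hF w
  have h1 := dist_triangle w y p
  have h2 := hdist y hy p hp
  simp only [u]
  rw [hχone w (by linarith), one_smul, sub_add_cancel]

end Trace


/-! ### Assembling the estimates -/

section Assembly

variable {Ω : Set (Amb n)} {θ : ℝ} {C : ℝ≥0} {f : Amb n → ℂ}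

/-- The one-sided estimates between the atomic norm, the Slobodeckij norm and the norm of an
extension, from which the equivalence of the three follows. -/
structure TraceEstimates (θ : ℝ) (Ω : Set (Amb n)) (C : ℝ≥0) : Prop where
  slobodeckij_le : ∀ f, AEStronglyMeasurable f (surfaceMeasure Ω) →
    slobodeckijNorm θ Ω f ≤ C * atomicNorm θ Ω f
  exists_extension : ∀ f, Measurable f → slobodeckijNorm θ Ω f ≠ ⊤ → ∃ u, ContDiffOn ℝ 1 u Ω ∧
    HasTrace Ω u f ∧ avNorm θ ⊤ Ω (gradVec u) ≤ C * slobodeckijNorm θ Ω f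
  exists_trace : ∀ (u : Amb n → ℂ) (G : Amb n → EuclideanSpace ℂ (Fin (n + 1))), Measurable u →
    Measurable G → HasWeakGradient Ω u G → wInt θ Ω G ≠ ⊤ → ∃ f, HasTrace Ω u f
  atomic_le : ∀ (u : Amb n → ℂ) (G : Amb n → EuclideanSpace ℂ (Fin (n + 1))), Measurable u →
    Measurable G → HasWeakGradient Ω u G → wInt θ Ω G ≠ ⊤ → ∀ f, HasTrace Ω u f →
    atomicNorm θ Ω f ≤ C * wInt θ Ω G

lemma TraceEstimates.mono (h : TraceEstimates θ Ω C) {C' : ℝ≥0} (hC : C ≤ C') :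
    TraceEstimates θ Ω C' := by
  have hle : ∀ a : ℝ≥0∞, (C : ℝ≥0∞) * a ≤ C' * a := fun a =>
    mul_le_mul' (ENNReal.coe_le_coe.2 hC) le_rfl
  refine ⟨fun f hf => (h.slobodeckij_le f hf).trans (hle _), fun f hf hS => ?_, h.exists_trace,
    fun u G h1 h2 h3 h4 f hf => (h.atomic_le u G h1 h2 h3 h4 f hf).trans (hle _)⟩
  obtain ⟨u, h1, h2, h3⟩ := h.exists_extension f hf hS
  exact ⟨u, h1, h2, h3.trans (hle _)⟩

lemma slobodeckijNorm_congr {f' : Amb n → ℂ} (h : f =ᵐ[surfaceMeasure Ω] f') :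
    slobodeckijNorm θ Ω f = slobodeckijNorm θ Ω f' := by
  refine lintegral_congr_ae ?_
  filter_upwards [h] with y hy
  refine lintegral_congr_ae ?_
  filter_upwards [h] with x hx
  rw [hx, hy]

/-- Multiplication in the extended nonnegative reals passes through an infimum safely only for a
nonzero finite factor; this is why constants of the form `1 + C` appear below. -/
lemma le_const_mul_iInf {ι : Sort*} {K a : ℝ≥0∞} (hK0 : K ≠ 0) (hK : K ≠ ⊤) {g : ι → ℝ≥0∞}
    (h : ∀ i, a ≤ K * g i) : a ≤ K * ⨅ i, g i := by
  rw [mul_comm, ← ENNReal.div_le_iff_le_mul (Or.inl hK0) (Or.inl hK)]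
  refine le_iInf fun i => ?_
  rw [ENNReal.div_le_iff_le_mul (Or.inl hK0) (Or.inl hK), mul_comm]
  exact h i

/-- A weak gradient with finite averaged norm has measurable representatives, along with the
function itself, and finite weighted integral. -/
lemma HasWeakGradient.exists_measurable (hΩ : IsOpen Ω) (hF : (frontier Ω).Nonempty)
    (hθ₀ : 0 < θ) (hθ₁ : θ < 1) {q : ℝ≥0∞} (hq : 1 ≤ q) {u : Amb n → ℂ}
    {G : Amb n → EuclideanSpace ℂ (Fin (n + 1))} (h : HasWeakGradient Ω u G) :
    ∃ u₀ G₀, Measurable u₀ ∧ Measurable G₀ ∧ u =ᵐ[volume.restrict Ω] u₀ ∧ HasWeakGradient Ω u₀ G₀ ∧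
      wInt θ Ω G₀ ≤ 2 ^ (n + 2) * avNorm θ q Ω G := by
  have hu := h.1.aestronglyMeasurable
  have hG := h.2.1.aestronglyMeasurable
  refine ⟨hu.mk u, hG.mk G, hu.measurable_mk, hG.measurable_mk, hu.ae_eq_mk,
    h.congr hΩ hu.ae_eq_mk hG.ae_eq_mk, ?_⟩
  refine (wInt_le_avNorm_one hΩ hF hθ₀ hθ₁ hG.measurable_mk).trans (mul_le_mul' le_rfl ?_)
  rw [← avNorm_congr hΩ 1 hG.ae_eq_mk]
  exact avNorm_mono_exponent hΩ hF hq hG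

/-- A finite infimum supplies one weak gradient of finite norm; the trace is built for measurable
representatives and carried back along null sets. -/
lemma TraceEstimates.hasTrace (h : TraceEstimates θ Ω C) (hΩ : IsOpen Ω)
    (hF : (frontier Ω).Nonempty) (hθ₀ : 0 < θ) (hθ₁ : θ < 1) {q : ℝ≥0∞} (hq : 1 ≤ q)
    {u : Amb n → ℂ} (hu : sobolevNorm θ q Ω u < ⊤) : ∃ f, HasTrace Ω u f := by
  obtain ⟨G, hG⟩ := iInf_lt_iff.1 hu
  obtain ⟨hw, hG⟩ := iInf_lt_iff.1 hG
  obtain ⟨u₀, G₀, hum, hGm, hu₀, hw₀, hW⟩ := hw.exists_measurable hΩ hF hθ₀ hθ₁ hq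
  obtain ⟨f, hf⟩ := h.exists_trace u₀ G₀ hum hGm hw₀
    (hW.trans_lt (ENNReal.mul_lt_top (by finiteness) hG)).ne
  exact ⟨f, hf.congr hΩ hu₀.symm⟩

lemma TraceEstimates.atomicNorm_le (h : TraceEstimates θ Ω C) (hΩ : IsOpen Ω)
    (hF : (frontier Ω).Nonempty) (hθ₀ : 0 < θ) (hθ₁ : θ < 1) {q : ℝ≥0∞} (hq : 1 ≤ q)
    {u : Amb n → ℂ} (hf : HasTrace Ω u f) :
    atomicNorm θ Ω f ≤ (1 + C) * 2 ^ (n + 2) * sobolevNorm θ q Ω u := by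
  have hK0 : (1 + C : ℝ≥0∞) * 2 ^ (n + 2) ≠ 0 := by positivity
  have hK : (1 + C : ℝ≥0∞) * 2 ^ (n + 2) ≠ ⊤ := by finiteness
  refine le_const_mul_iInf hK0 hK fun G => le_const_mul_iInf hK0 hK fun hw => ?_
  rcases eq_or_ne (avNorm θ q Ω G) ⊤ with htop | htop
  · rw [htop, ENNReal.mul_top hK0]
    exact le_top
  obtain ⟨u₀, G₀, hum, hGm, hu₀, hw₀, hW⟩ := hw.exists_measurable hΩ hF hθ₀ hθ₁ hq
  refine (h.atomic_le u₀ G₀ hum hGm hw₀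
    (hW.trans_lt (ENNReal.mul_lt_top (by finiteness) htop.lt_top)).ne f (hf.congr hΩ hu₀)).trans ?_
  rw [mul_assoc]
  exact mul_le_mul' le_add_self hW

/-- The equivalence of the three norms, and the trace and extension theorems. -/
theorem TraceEstimates.equivalence (h : TraceEstimates θ Ω C) (hΩ : IsOpen Ω)
    (hF : (frontier Ω).Nonempty) (hθ₀ : 0 < θ) (hθ₁ : θ < 1) {K : ℝ≥0}
    (hK : K = (1 + C) * ((1 + C) * 2 ^ (n + 2))) {q : ℝ≥0∞} (hq : 1 ≤ q) :
    (∀ f : Amb n → ℂ, LocallyIntegrable f (surfaceMeasure Ω) →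
      (atomicNorm θ Ω f < ⊤ ∨ slobodeckijNorm θ Ω f < ⊤) →
      ∃ u : Amb n → ℂ, HasTrace Ω u f ∧
        sobolevNorm θ q Ω u ≤ K * slobodeckijNorm θ Ω f ∧
        sobolevNorm θ q Ω u ≤ K * atomicNorm θ Ω f) ∧
    (∀ u : Amb n → ℂ, sobolevNorm θ q Ω u < ⊤ →
      (∃ f : Amb n → ℂ, HasTrace Ω u f) ∧
      ∀ f : Amb n → ℂ, HasTrace Ω u f →
        slobodeckijNorm θ Ω f ≤ K * sobolevNorm θ q Ω u ∧
        atomicNorm θ Ω f ≤ K * sobolevNorm θ q Ω u) ∧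
    (∀ f : Amb n → ℂ, LocallyIntegrable f (surfaceMeasure Ω) →
      (atomicNorm θ Ω f ≤ K * slobodeckijNorm θ Ω f ∧
        slobodeckijNorm θ Ω f ≤ K * atomicNorm θ Ω f) ∧
      (slobodeckijNorm θ Ω f ≤ K * minExtensionNorm θ q Ω f ∧
        minExtensionNorm θ q Ω f ≤ K * slobodeckijNorm θ Ω f) ∧
      (atomicNorm θ Ω f ≤ K * minExtensionNorm θ q Ω f ∧
        minExtensionNorm θ q Ω f ≤ K * atomicNorm θ Ω f)) := by
  -- One factor `1 + C` for each link of the circle that is composed (trace to atoms, then atoms to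
  -- double integral or double integral to extension), and `2^(n+2)` for the passage from the
  -- averaged norm to the weighted integral.
  have hKe : (K : ℝ≥0∞) = (1 + C) * ((1 + C) * 2 ^ (n + 2)) := by rw [hK]; push_cast; rfl
  have h2 : (1 : ℝ≥0∞) ≤ 2 ^ (n + 2) := one_le_pow₀ one_le_two
  have h1C : (1 : ℝ≥0∞) ≤ 1 + C := le_self_add
  have hC1 : (C : ℝ≥0∞) ≤ 1 + C := le_add_self
  have hle1 : (1 + C : ℝ≥0∞) * 2 ^ (n + 2) ≤ K := by
    rw [hKe]; exact le_mul_of_one_le_left' h1C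
  have hle2 : (1 + C : ℝ≥0∞) * (1 + C) ≤ K := by
    rw [hKe]; exact mul_le_mul' le_rfl (le_mul_of_one_le_right' h2)
  have hle3 : (C : ℝ≥0∞) ≤ K :=
    hC1.trans ((le_mul_of_one_le_left' h1C).trans hle2)
  have hK0 : (K : ℝ≥0∞) ≠ 0 := by rw [hKe]; positivity
  have hSA : ∀ f : Amb n → ℂ, LocallyIntegrable f (surfaceMeasure Ω) →
      slobodeckijNorm θ Ω f ≤ C * atomicNorm θ Ω f := fun f hf =>
    h.slobodeckij_le f hf.aestronglyMeasurable
  have hA : ∀ (u f : Amb n → ℂ), HasTrace Ω u f →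
      atomicNorm θ Ω f ≤ K * sobolevNorm θ q Ω u := fun u f hf =>
    (h.atomicNorm_le hΩ hF hθ₀ hθ₁ hq hf).trans (mul_le_mul' hle1 le_rfl)
  have hS : ∀ (u f : Amb n → ℂ), HasTrace Ω u f →
      slobodeckijNorm θ Ω f ≤ K * sobolevNorm θ q Ω u := fun u f hf => by
    refine (hSA f hf.1).trans ((mul_le_mul' hC1
      (h.atomicNorm_le hΩ hF hθ₀ hθ₁ hq hf)).trans (le_of_eq ?_))
    rw [hKe]
    ring
  have hext : ∀ f : Amb n → ℂ, LocallyIntegrable f (surfaceMeasure Ω) →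
      slobodeckijNorm θ Ω f < ⊤ → ∃ u : Amb n → ℂ, HasTrace Ω u f ∧
        sobolevNorm θ q Ω u ≤ C * slobodeckijNorm θ Ω f := fun f hf hfin => by
    have hfm := hf.aestronglyMeasurable
    have hcongr := slobodeckijNorm_congr (θ := θ) hfm.ae_eq_mk
    obtain ⟨u, hu, htr, hav⟩ := h.exists_extension (hfm.mk f) hfm.measurable_mk
      (hcongr ▸ hfin.ne)
    refine ⟨u, htr.congr_right hfm.ae_eq_mk.symm, ?_⟩
    rw [hcongr]
    have hw := hasWeakGradient_of_contDiffOn hΩ hu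
    exact (iInf₂_le (gradVec u) hw).trans
      ((avNorm_mono_exponent hΩ hF le_top hw.2.1.aestronglyMeasurable).trans hav)
  have hmin : ∀ f : Amb n → ℂ, LocallyIntegrable f (surfaceMeasure Ω) →
      minExtensionNorm θ q Ω f ≤ K * slobodeckijNorm θ Ω f := fun f hf => by
    rcases eq_or_ne (slobodeckijNorm θ Ω f) ⊤ with htop | htop
    · rw [htop, ENNReal.mul_top hK0]
      exact le_top
    · obtain ⟨u, hu, hle⟩ := hext f hf htop.lt_top
      exact (iInf₂_le u hu).trans (hle.trans (mul_le_mul' hle3 le_rfl))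
  have hCA : ∀ f : Amb n → ℂ, LocallyIntegrable f (surfaceMeasure Ω) →
      C * slobodeckijNorm θ Ω f ≤ K * atomicNorm θ Ω f := fun f hf => by
    refine (mul_le_mul' le_rfl (hSA f hf)).trans ?_
    rw [← mul_assoc]
    exact mul_le_mul' ((mul_le_mul' hC1 hC1).trans hle2) le_rfl
  have hmin' : ∀ f : Amb n → ℂ, LocallyIntegrable f (surfaceMeasure Ω) →
      minExtensionNorm θ q Ω f ≤ K * atomicNorm θ Ω f := fun f hf => by
    rcases eq_or_ne (atomicNorm θ Ω f) ⊤ with htop | htop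
    · rw [htop, ENNReal.mul_top hK0]
      exact le_top
    · obtain ⟨u, hu, hle⟩ := hext f hf ((hSA f hf).trans_lt
        (ENNReal.mul_lt_top ENNReal.coe_lt_top htop.lt_top))
      exact (iInf₂_le u hu).trans (hle.trans (hCA f hf))
  have hAmin : ∀ f : Amb n → ℂ, atomicNorm θ Ω f ≤ K * minExtensionNorm θ q Ω f := fun f =>
    le_const_mul_iInf hK0 ENNReal.coe_ne_top fun u =>
      le_const_mul_iInf hK0 ENNReal.coe_ne_top fun hu => hA u f hu
  have hSmin : ∀ f : Amb n → ℂ, slobodeckijNorm θ Ω f ≤ K * minExtensionNorm θ q Ω f := fun f =>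
    le_const_mul_iInf hK0 ENNReal.coe_ne_top fun u =>
      le_const_mul_iInf hK0 ENNReal.coe_ne_top fun hu => hS u f hu
  refine ⟨fun f hf hfin => ?_, fun u hu => ⟨h.hasTrace hΩ hF hθ₀ hθ₁ hq hu, fun f hf =>
    ⟨hS u f hf, hA u f hf⟩⟩, fun f hf => ⟨⟨?_, (hSA f hf).trans (mul_le_mul' hle3 le_rfl)⟩,
    ⟨hSmin f, hmin f hf⟩, hAmin f, hmin' f hf⟩⟩
  · have hfin' : slobodeckijNorm θ Ω f < ⊤ := hfin.elim (fun hA => (hSA f hf).trans_lt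
      (ENNReal.mul_lt_top ENNReal.coe_lt_top hA)) id
    obtain ⟨u, hu, hle⟩ := hext f hf hfin'
    exact ⟨u, hu, hle.trans (mul_le_mul' hle3 le_rfl), hle.trans (hCA f hf)⟩
  · rcases eq_or_ne (slobodeckijNorm θ Ω f) ⊤ with htop | htop
    · rw [htop, ENNReal.mul_top hK0]
      exact le_top
    · obtain ⟨u, hu, hle⟩ := hext f hf htop.lt_top
      refine (h.atomicNorm_le hΩ hF hθ₀ hθ₁ hq hu).trans ((mul_le_mul' le_rfl
        (hle.trans (mul_le_mul' hC1 le_rfl))).trans (le_of_eq ?_))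
      rw [hKe]
      ring

/-- The estimates hold on Lipschitz graph domains. -/
theorem exists_traceEstimates_epigraph (n : ℕ) (hn : 1 ≤ n) {θ : ℝ} (hθ₀ : 0 < θ) (hθ₁ : θ < 1)
    (M : ℝ≥0) : ∃ C : ℝ≥0, ∀ (A : Coord n) (ψ : EuclideanSpace ℝ (Fin n) → ℝ), LipschitzWith M ψ →
    (frontier (epigraph A ψ)).Nonempty → TraceEstimates θ (epigraph A ψ) C := by
  have hM : (0 : ℝ) ≤ M := M.2
  obtain ⟨C, hC⟩ := IsTransversal.atomicNorm_le_of_unbounded n hn hθ₀ hθ₁ (c := 1 / (1 + M))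
    (L := 1) (by positivity) ((div_le_one (by positivity)).2 (by linarith)) zero_le_one
  set C₁ : ℝ≥0 := (1 + M) ^ n * volBall n
  set C₂ : ℝ≥0 := volBall n / (1 + M) ^ n
  have hC₂ : 0 < C₂ := div_pos volBall_pos (by positivity)
  have ha : atomConst n θ C₁ (1 + M) + 1 ≠ ⊤ := by rw [atomConst]; finiteness
  have hx := extConst_ne_top n θ C₂
  refine ⟨C + (atomConst n θ C₁ (1 + M) + 1).toNNReal + (extConst n θ C₂).toNNReal,
    fun A ψ hψ hF => ?_⟩
  have hΩ := isOpen_epigraph (A := A) hψ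
  have hσ := upperRegular_epigraph (A := A) hψ
  have hgc := gradControls_epigraph (A := A) hψ
  have H := fun s₀ (hs₀ : 0 < s₀) => isTransversal_epigraph (A := A) hψ hs₀
  refine ⟨fun f hf => ?_, fun f hf hS => ?_, fun u G hu hG hw hW =>
    (H 1 one_pos).exists_hasTrace hΩ hF hσ hθ₀ hw hu hG hW, fun u G hu hG hw hW f hf => ?_⟩
  · refine (slobodeckijNorm_le_atomicNorm hn hθ₀ hθ₁ hσ hgc hf).trans (mul_le_mul' ?_ le_rfl)
    push_cast
    rw [ENNReal.coe_toNNReal ha]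
    exact le_add_self.trans le_self_add
  · obtain ⟨u, h1, h2, h3⟩ := (H 1 one_pos).exists_extension_of_unbounded hΩ hF hθ₀ hθ₁ hσ
      (lowerRegular_epigraph hψ) hC₂ hf hS
    refine ⟨u, h1, h2, h3.trans (mul_le_mul' ?_ le_rfl)⟩
    push_cast
    rw [ENNReal.coe_toNNReal hx]
    exact le_add_self
  · refine (hC _ _ H hΩ hF _ hσ _ hgc u G hu hG hw hW f hf).trans (mul_le_mul' ?_ le_rfl)
    push_cast
    rw [add_assoc]
    exact le_self_add

/-- The estimates hold on domains with bounded geometry. -/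
theorem exists_traceEstimates_bounded (n : ℕ) (hn : 1 ≤ n) {θ : ℝ} (hθ₀ : 0 < θ) (hθ₁ : θ < 1)
    {c L B : ℝ} (hc : 0 < c) (hc1 : c ≤ 1) (hL : 0 ≤ L) (hB : 0 < B) (C₁ : ℝ≥0) {C₂ : ℝ≥0}
    (hC₂ : 0 < C₂) (C₃ : ℝ≥0) : ∃ C : ℝ≥0, ∀ (Ω : Set (Amb n)) (e : Amb n → Amb n) (s₀ : ℝ),
    BoundedGeometry Ω c L B C₁ C₂ C₃ e s₀ → IsOpen Ω → (frontier Ω).Nonempty →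
    TraceEstimates θ Ω C := by
  obtain ⟨C, hC⟩ := IsTransversal.atomicNorm_le_of_bounded n hn hθ₀ hθ₁ hc hc1 hL hB.le C₃
  obtain ⟨C', hC'⟩ := exists_extension_of_bounded n hθ₀ hθ₁ hC₂
  have ha : atomConst n θ C₁ C₃ + 1 ≠ ⊤ := by rw [atomConst]; finiteness
  refine ⟨C + (atomConst n θ C₁ C₃ + 1).toNNReal + C', fun Ω e s₀ H hΩ hF => ?_⟩
  have hs₀ := H.transversal.s_pos
  refine ⟨fun f hf => ?_, fun f hf hS => ?_, fun u G hu hG hw hW =>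
    H.transversal.exists_hasTrace hΩ hF H.upper hθ₀ hw hu hG hW, fun u G hu hG hw hW f hf => ?_⟩
  · refine (slobodeckijNorm_le_atomicNorm hn hθ₀ hθ₁ H.upper H.gradControls hf).trans
      (mul_le_mul' ?_ le_rfl)
    push_cast
    rw [ENNReal.coe_toNNReal ha]
    exact le_add_self.trans le_self_add
  · obtain ⟨u, h1, h2, h3⟩ := hC' Ω e c L s₀ H.transversal hΩ hF C₁ H.upper (B * s₀) (by positivity)
      (by rw [← mul_assoc]; exact H.lower) H.dist_le f hf hS
    refine ⟨u, h1, h2, h3.trans (mul_le_mul' ?_ le_rfl)⟩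
    push_cast
    exact le_add_self
  · refine (hC Ω e s₀ H.transversal hΩ hF C₁ H.upper H.gradControls H.dist_le u G hu hG hw hW f
      hf).trans (mul_le_mul' ?_ le_rfl)
    push_cast
    rw [add_assoc]
    exact le_self_add

/-- The estimates hold on Lipschitz domains with connected boundary, with a constant that depends
only on the Lipschitz character. -/
theorem exists_traceEstimates (n : ℕ) (hn : 1 ≤ n) {θ : ℝ} (hθ₀ : 0 < θ) (hθ₁ : θ < 1)
    (M : ℝ≥0) (N : ℕ) (c₀ : ℝ) : ∃ C : ℝ≥0, ∀ Ω : Set (Amb n), IsLipschitzDomain M N c₀ Ω →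
    IsConnected (frontier Ω) → TraceEstimates θ Ω C := by
  have hM : (0 : ℝ) ≤ M := M.2
  obtain ⟨C, hC⟩ := exists_traceEstimates_epigraph n hn hθ₀ hθ₁ M
  obtain ⟨L, B, C₁, C₂, C₃, hL, hB, hC₂, hgeom⟩ := exists_boundedGeometry n M N c₀
  obtain ⟨C', hC'⟩ := exists_traceEstimates_bounded n hn hθ₀ hθ₁ (c := 1 / (1 + M)) (by positivity)
    ((div_le_one (by positivity)).2 (by linarith)) hL hB C₁ hC₂ C₃
  refine ⟨max C C', fun Ω hΩ hconn => ?_⟩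
  -- The constant was fixed as a maximum before the domain is given, since the character does not
  -- reveal which of the two kinds of domain occurs.
  obtain ⟨hopen, -, ⟨⟨A, ψ, hψ, rfl⟩, -⟩ | ⟨-, hc₀, r, hr, z, ρ, hz, hcov, hcyl⟩⟩ := hΩ
  · exact (hC A ψ hψ hconn.nonempty).mono (le_max_left _ _)
  · obtain ⟨e, s₀, H⟩ := hgeom Ω hopen hconn hc₀ r hr z ρ hz hcov hcyl
    exact (hC' Ω e s₀ H hopen hconn.nonempty).mono (le_max_right _ _)

end Assembly

end AvTrace

end

theorem mainTheorem6 (n : ℕ) (hn : 1 ≤ n) (θ : ℝ) (hθ₀ : 0 < θ) (hθ₁ : θ < 1)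
    (M : ℝ≥0) (N : ℕ) (c₀ : ℝ) :
    ∃ C : ℝ≥0, ∀ Ω : Set (AvTrace.Amb n),
      AvTrace.IsLipschitzDomain M N c₀ Ω → IsConnected (frontier Ω) →
      ∀ q : ℝ≥0∞, 1 ≤ q →
        -- extension
        (∀ f : AvTrace.Amb n → ℂ, LocallyIntegrable f (AvTrace.surfaceMeasure Ω) →
          (AvTrace.atomicNorm θ Ω f < ⊤ ∨ AvTrace.slobodeckijNorm θ Ω f < ⊤) →
          ∃ u : AvTrace.Amb n → ℂ, AvTrace.HasTrace Ω u f ∧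
            AvTrace.sobolevNorm θ q Ω u ≤ C * AvTrace.slobodeckijNorm θ Ω f ∧
            AvTrace.sobolevNorm θ q Ω u ≤ C * AvTrace.atomicNorm θ Ω f) ∧
        -- trace
        (∀ u : AvTrace.Amb n → ℂ, AvTrace.sobolevNorm θ q Ω u < ⊤ →
          (∃ f : AvTrace.Amb n → ℂ, AvTrace.HasTrace Ω u f) ∧
          ∀ f : AvTrace.Amb n → ℂ, AvTrace.HasTrace Ω u f →
            AvTrace.slobodeckijNorm θ Ω f ≤ C * AvTrace.sobolevNorm θ q Ω u ∧
            AvTrace.atomicNorm θ Ω f ≤ C * AvTrace.sobolevNorm θ q Ω u) ∧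
        -- equivalence of the three norms
        (∀ f : AvTrace.Amb n → ℂ, LocallyIntegrable f (AvTrace.surfaceMeasure Ω) →
          (AvTrace.atomicNorm θ Ω f ≤ C * AvTrace.slobodeckijNorm θ Ω f ∧
            AvTrace.slobodeckijNorm θ Ω f ≤ C * AvTrace.atomicNorm θ Ω f) ∧
          (AvTrace.slobodeckijNorm θ Ω f ≤ C * AvTrace.minExtensionNorm θ q Ω f ∧
            AvTrace.minExtensionNorm θ q Ω f ≤ C * AvTrace.slobodeckijNorm θ Ω f) ∧
          (AvTrace.atomicNorm θ Ω f ≤ C * AvTrace.minExtensionNorm θ q Ω f ∧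
            AvTrace.minExtensionNorm θ q Ω f ≤ C * AvTrace.atomicNorm θ Ω f)) := by
  obtain ⟨C, hC⟩ := AvTrace.exists_traceEstimates n hn hθ₀ hθ₁ M N c₀
  -- The witness is the constant `K` of `TraceEstimates.equivalence`, unified through `rfl`; it is
  -- fixed before `Ω` and `q`.
  exact ⟨_, fun Ω hΩ hconn q hq =>
    (hC Ω hΩ hconn).equivalence hΩ.1 hconn.nonempty hθ₀ hθ₁ rfl hq⟩
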